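/- **Setting.** Let $\tau\in\mathbb R$, $\tau\neq 0$, and let $p=(p_0,\boldsymbol p)\in\mathbb R\times\mathbb R^{25}$ with $p_0=0$. Consider the chiral fields $X^\mu=\sum_n x^\mu_n z^{-n}$ and $\Pi_\mu=\sum_n(\pi_\mu)_n z^{-n-1}$ ($\mu=0,\dots,25$), bosonic of weights $0$ and $1$, and the fermionic ghost systems $(b,c)$, $(B,C)$, where $b,B$ have weight $2$ and $c,C$ weight $-1$, with modes defined by $A(z)=\sum_n A_n z^{-n-h}$ for a field $A$ of weight $h$. The only nonzero (anti)commutators are $$[(\pi_\mu)_m,x^\nu_n]=\delta_\mu^\nu\delta_{m+n,0},\qquad [b_m,c_n]=\delta_{m+n,0}=[B_m,C_n].$$ Let $\mathcal F_p$ be the complex Fock space generated from a vacuum $|p\rangle$ with $(\pi_\mu)_0|p\rangle=i p_\mu|p\rangle$, which is annihilated by $x^\mu_n,(\pi_\mu)_n$ for $n\ge1$, by $c_n,C_n$ for $n\ge 2$ and by $b_n,B_n$ for $n\ge -1$; the creation operators are $x^\mu_n,(\pi_\mu)_n$ for $n\le -1$, $c_n,C_n$ for $n\le 1$ and $b_n,B_n$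 for $n\le-2$ (only $\partial X^\mu$ enters below, so $x^\mu_0$ plays no role). Normal-ordered products are $(AB)_n=\sum_{l\le -h_A}A_lB_{n-l}\pm\sum_{l>-h_A}B_{n-l}A_l$, with the sign $-$ exactly if $A$ and $B$ are both fermionic, nested to the right. Put $$T=\partial X^\mu\,\Pi_\mu,\qquad M=\tfrac12\Pi_0\Pi_0-\tfrac12\tau^2\sum_{i=1}^{25}\partial X^i\partial X^i,$$ $$T^{gh}=-2b\,\partial c-\partial b\,c-2B\,\partial C-\partial B\,C,\qquad M^{gh}=-2B\,\partial c-\partial B\,c,$$ $$J=cT+CM+\tfrac12\,cT^{gh}+\tfrac12\,CM^{gh},\qquad d=J_0,\qquad L_0^{tot}=T_0+T^{gh}_0 .$$ Ghost number counts $c,C$ as $+1$ and $b,B$ as $-1$, with $|p\rangle$ of ghost number $0$. For $n\in\mathbb Z$ let $\mathsf C^n(p)$ be the space of states in $\ker L_0^{tot}\subset\mathcal F_p$ of ghost number $n$, and let $\mathsf Z^n(p)=\ker(d|_{\mathsf C^n(p)})$, $\mathsf B^n(p)=d\,\mathsf C^{n-1}(p)$, $\mathsf H^n(p)=\mathsf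 Z^n(p)/\mathsf B^n(p)$ (the absolute BRST cohomology of the critical, $D=25$, carrollian string at momentum $p$). The group $SO(25)$ acts on $\mathbb R\times\mathbb R^{25}$ by $(p_0,\boldsymbol p)\mapsto(p_0,R\boldsymbol p)$. The stabiliser $G_p$ of $p$ acts on $\mathcal F_p$ by rotating the indices $i=1,\dots,25$ of the modes of $X$ and $\Pi$, fixing the modes with index $0$, the ghosts and $|p\rangle$; it commutes with $d$ and $L_0^{tot}$ and so acts on all the spaces above. Let $V=\mathbb C^{25}$ be the complexified vector representation, $V^\perp\subseteq V$ the subspace orthogonal to $\boldsymbol p$, and $\odot^2_0V^\perp$, $\Lambda^2V^\perp$ the traceless symmetric and the skewsymmetric square of $V^\perp$. Write $(a,b,c,e)$ for the representation $a\,\mathbb C\oplus b\,V^\perp\oplus c\odot^2_0V^\perp\oplus e\,\Lambda^2V^\perp$ of $G_p$; for $\boldsymbol p=0$ one has $G_p=SO(25)$ and $V^\perp=V$. **Theorem.** For all $n$, $d$ maps $\mathsf C^n(p)$ to $\mathsf C^{n+1}(p)$, and $d^2=0$ on $\mathsf C^n(p)$. As representations of $G_p$, the spaces are as follows; they all vanish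 for $n\notin\{0,\dots,6\}$. (1) If $\boldsymbol p\neq0$: $$\begin{array}{c|llll} n&\mathsf C^n&\mathsf Z^n&\mathsf B^n&\mathsf H^n\\\hline 0&(1,0,0,0)&0&0&0\\ 1&(12,4,0,0)&(2,1,0,0)&(1,0,0,0)&(1,1,0,0)\\ 2&(42,18,3,1)&(14,7,1,1)&(10,3,0,0)&(4,4,1,1)\\ 3&(62,28,6,2)&(34,17,4,2)&(28,11,2,0)&(6,6,2,2)\\ 4&(42,18,3,1)&(32,15,3,1)&(28,11,2,0)&(4,4,1,1)\\ 5&(12,4,0,0)&(11,4,0,0)&(10,3,0,0)&(1,1,0,0)\\ 6&(1,0,0,0)&(1,0,0,0)&(1,0,0,0)&0\end{array}$$ (2) If $p=0$: $$\begin{array}{c|llll} n&\mathsf C^n&\mathsf Z^n&\mathsf B^n&\mathsf H^n\\\hline 0&(1,0,0,0)&(1,0,0,0)&0&(1,0,0,0)\\ 1&(8,4,0,0)&(2,2,0,0)&0&(2,2,0,0)\\ 2&(25,14,3,1)&(10,6,1,1)&(6,2,0,0)&(4,4,1,1)\\ 3&(36,20,6,2)&(21,12,4,2)&(15,8,2,0)&(6,4,2,2)\\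 4&(25,14,3,1)&(19,12,3,1)&(15,8,2,0)&(4,4,1,1)\\ 5&(8,4,0,0)&(8,4,0,0)&(6,2,0,0)&(2,2,0,0)\\ 6&(1,0,0,0)&(1,0,0,0)&0&(1,0,0,0)\end{array}$$ (3) Every $\mathsf H^n(p)$ is finite-dimensional, and $\mathsf H^n(p)\cong\mathsf H^{6-n}(p)$ as representations of $G_p$ for all $n\in\mathbb Z$ (Poincaré duality). (4) The Euler characteristic vanishes for each isotypical component: $\sum_{n=0}^6(-1)^n\dim\operatorname{Hom}_{G_p}(W,\mathsf H^n(p))=0$ for every finite-dimensional complex representation $W$ of $G_p$ (in particular for every irreducible one). Likewise $\sum_{n=0}^6(-1)^n\dim\mathsf H^n(p)=0$. -/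

import Mathlib

/-!
The BRST complex of the critical carrollian string at fixed momentum, built from the Fock space of
the fields `X^μ, Π_μ` (`μ = 0, …, 25`, weights `0, 1`) and the ghost systems `(b, c)`, `(B, C)`
(weights `(2, -1)`).
-/

open scoped Matrix

namespace CarrollString

noncomputable section

/-! ### The Fock space -/

/-- Bosonic creation modes: `inl (μ, k)` is `x^μ_{-(k+1)}`, `inr (μ, k)` is `(π_μ)_{-(k+1)}`. -/
abbrev MatterMode : Type := (Fin 26 × ℕ) ⊕ (Fin 26 × ℕ)

/-- Fermionic creation modes: `(0, k)`, `(1, k)`, `(2, k)`, `(3, k)` are respectively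
`c_{1-k}`, `C_{1-k}`, `b_{-2-k}`, `B_{-2-k}`. -/
abbrev GhostMode : Type := Fin 4 ×ₗ ℕ

/-- The states obtained from `|p⟩` with the creation operators, for any fixed momentum `p`: finite
sums of `g₁ ⋯ g_r P |p⟩` with fermionic creation modes `g₁ < ⋯ < g_r` and a polynomial `P` in the
bosonic creation modes. -/
def Fock : Type := Finset GhostMode →₀ MvPolynomial MatterMode ℂ

instance : AddCommGroup Fock :=
  inferInstanceAs (AddCommGroup (Finset GhostMode →₀ MvPolynomial MatterMode ℂ))

instance : Module ℂ Fock :=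
  inferInstanceAs (Module ℂ (Finset GhostMode →₀ MvPolynomial MatterMode ℂ))

/-- The state `g₁ ⋯ g_r P |p⟩` with `S = {g₁ < ⋯ < g_r}`. -/
def state (S : Finset GhostMode) : MvPolynomial MatterMode ℂ →ₗ[ℂ] Fock := Finsupp.lsingle S

/-- The coefficient `P` of `g₁ ⋯ g_r P |p⟩`, with `S = {g₁ < ⋯ < g_r}`. -/
def coeff (S : Finset GhostMode) : Fock →ₗ[ℂ] MvPolynomial MatterMode ℂ := Finsupp.lapply S

/-- The linear map with prescribed values on the states `g₁ ⋯ g_r P |p⟩`. -/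
def fockLift (f : Finset GhostMode → MvPolynomial MatterMode ℂ →ₗ[ℂ] Fock) : Module.End ℂ Fock :=
  Finsupp.lsum ℂ f

lemma fockLift_state (f : Finset GhostMode → MvPolynomial MatterMode ℂ →ₗ[ℂ] Fock)
    (S : Finset GhostMode) (P : MvPolynomial MatterMode ℂ) : fockLift f (state S P) = f S P :=
  (Finsupp.lsum_single ℂ f S P :)

lemma fock_ext {f g : Module.End ℂ Fock} (h : ∀ S P, f (state S P) = g (state S P)) : f = g :=
  Finsupp.lhom_ext h

lemma fock_induction {motive : Fock → Prop} (v : Fock) (zero : motive 0)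
    (add : ∀ v w, motive v → motive w → motive (v + w)) (single : ∀ S P, motive (state S P)) :
    motive v :=
  Finsupp.induction_linear (motive := motive) v zero add single

/-- A field, given by its modes `(A_n)`. -/
abbrev Modes : Type := ℤ → Module.End ℂ Fock

/-- A bosonic operator, acting on the Fock space. -/
def bosonic (f : Module.End ℂ (MvPolynomial MatterMode ℂ)) : Module.End ℂ Fock :=
  fockLift fun S => state S ∘ₗ f

/-- The sign from moving the mode `g` past the modes of `S` that stand before it. -/
def fermiSign (g : GhostMode) (S : Finset GhostMode) : ℂ :=
  (-1) ^ (S.filter (· < g)).card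

/-- Left multiplication by the fermionic creation mode `g`. -/
def create (g : GhostMode) : Module.End ℂ Fock :=
  fockLift fun S => if g ∈ S then 0 else fermiSign g S • state (insert g S)

/-- The fermionic annihilation operator with `[annihilate g, create g'] = δ_{g, g'}`. -/
def annihilate (g : GhostMode) : Module.End ℂ Fock :=
  fockLift fun S => if g ∈ S then fermiSign g S • state (S.erase g) else 0

/-! ### The elementary fields -/

/-- The modes `x^μ_n`, `n ≠ 0`. The zero mode `x^μ_0` does not act at fixed momentum; it never
contributes, since `X^μ` enters only through `∂X^μ`, and is set to zero. -/
def xMode (μ : Fin 26) : Modes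
  | Int.negSucc k => bosonic (LinearMap.mulLeft ℂ (MvPolynomial.X (Sum.inl (μ, k))))
  | Int.ofNat 0 => 0
  | Int.ofNat (k + 1) => bosonic (-(MvPolynomial.pderiv (Sum.inr (μ, k))).toLinearMap)

/-- The modes `(π_μ)_n` at momentum `p`, with `(π_μ)_0 = i p_μ` and
`[(π_μ)_m, x^ν_n] = δ_μ^ν δ_{m+n,0}`. -/
def piMode (p : Fin 26 → ℝ) (μ : Fin 26) : Modes
  | Int.negSucc k => bosonic (LinearMap.mulLeft ℂ (MvPolynomial.X (Sum.inr (μ, k))))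
  | Int.ofNat 0 => (Complex.I * (p μ : ℂ)) • 1
  | Int.ofNat (k + 1) => bosonic (MvPolynomial.pderiv (Sum.inl (μ, k))).toLinearMap

/-- The modes of a weight `-1` ghost of species `e`, whose antighost has species `t`. -/
def ghost (e t : Fin 4) : Modes := fun n =>
  if n ≤ 1 then create (toLex (e, (1 - n).toNat)) else annihilate (toLex (t, (n - 2).toNat))

/-- The modes of the weight `2` antighost of species `t`, whose ghost has species `e`. -/
def antighost (e t : Fin 4) : Modes := fun n =>
  if n ≤ -2 then create (toLex (t, (-2 - n).toNat)) else annihilate (toLex (e, (n + 1).toNat))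

/-- The ghost `c`. -/
def cGhost : Modes := ghost 0 2
/-- The antighost `b`. -/
def bGhost : Modes := antighost 0 2
/-- The ghost `C`. -/
def CGhost : Modes := ghost 1 3
/-- The antighost `B`. -/
def BGhost : Modes := antighost 1 3

/-! ### Composite fields -/

/-- A family of operators is locally finite if only finitely many of them act nontrivially on any
given state. -/
def LocallyFinite {ι : Type} (f : ι → Module.End ℂ Fock) : Prop :=
  ∀ v, {i | f i v ≠ 0}.Finite

open Classical in
/-- The sum of a locally finite family of operators. -/
def locSum {ι : Type} (f : ι → Module.End ℂ Fock) : Module.End ℂ Fock :=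
  if h : LocallyFinite f then
    { toFun := fun v => ∑ᶠ i, f i v
      map_add' := fun v w => by
        simp only [map_add]
        exact finsum_add_distrib (h v) (h w)
      map_smul' := fun a v => by
        simp only [map_smul, RingHom.id_apply]
        exact (smul_finsum' a (h v)).symm }
  else 0

/-- The derivative `∂A` of a field `A = ∑ A_n z^{-n-h}` of weight `h`. It has weight `h + 1`. -/
def deriv (h : ℤ) (A : Modes) : Modes := fun n => (-((n : ℂ) + (h : ℂ))) • A n

/-- The normal-ordered product `(AB)`, where `A` has weight `h`:
`(AB)_n = ∑_{l ≤ -h} A_l B_{n-l} + ε ∑_{l > -h} B_{n-l} A_l`, with `ε = -1` if `A` and `B` are both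
fermionic and `ε = 1` otherwise. -/
def nop (h : ℤ) (ε : ℂ) (A B : Modes) : Modes := fun n =>
  locSum fun l : ℤ => if l ≤ -h then A l * B (n - l) else ε • (B (n - l) * A l)

/-- `∂X^μ` -/
def dX (μ : Fin 26) : Modes := deriv 0 (xMode μ)

/-- `T = ∂X^μ Π_μ` -/
def stressT (p : Fin 26 → ℝ) : Modes := ∑ μ, nop 1 1 (dX μ) (piMode p μ)

/-- `M = ½ Π_0 Π_0 - ½ τ² δ_{ij} ∂X^i ∂X^j` -/
def stressM (τ : ℝ) (p : Fin 26 → ℝ) : Modes :=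
  (1 / 2 : ℂ) • nop 1 1 (piMode p 0) (piMode p 0)
    - ((τ : ℂ) ^ 2 / 2) • ∑ i : Fin 25, nop 1 1 (dX i.succ) (dX i.succ)

/-- `T^gh = -2 b ∂c - ∂b c - 2 B ∂C - ∂B C` -/
def ghostT : Modes :=
  (-2 : ℂ) • nop 2 (-1) bGhost (deriv (-1) cGhost) - nop 3 (-1) (deriv 2 bGhost) cGhost
    - (2 : ℂ) • nop 2 (-1) BGhost (deriv (-1) CGhost) - nop 3 (-1) (deriv 2 BGhost) CGhost

/-- `M^gh = -2 B ∂c - ∂B c` -/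
def ghostM : Modes :=
  (-2 : ℂ) • nop 2 (-1) BGhost (deriv (-1) cGhost) - nop 3 (-1) (deriv 2 BGhost) cGhost

/-- The BRST current `J = c T + C M + ½ c T^gh + ½ C M^gh`. -/
def current (τ : ℝ) (p : Fin 26 → ℝ) : Modes :=
  nop (-1) 1 cGhost (stressT p) + nop (-1) 1 CGhost (stressM τ p)
    + (1 / 2 : ℂ) • nop (-1) 1 cGhost ghostT + (1 / 2 : ℂ) • nop (-1) 1 CGhost ghostM

/-- The BRST differential `d = J_0` at momentum `p`. -/
def brst (τ : ℝ) (p : Fin 26 → ℝ) : Module.End ℂ Fock := current τ p 0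

/-- The Virasoro zero mode `L^tot_0 = T_0 + T^gh_0`. -/
def Ltot (p : Fin 26 → ℝ) : Module.End ℂ Fock := stressT p 0 + ghostT 0

/-! ### The complex, its cocycles and coboundaries -/

/-- The ghost number of a set of fermionic creation modes: `c`, `C` count `1`, `b`, `B` count
`-1`. -/
def ghostNumber (S : Finset GhostMode) : ℤ :=
  ∑ g ∈ S, if (ofLex g).1 = 0 ∨ (ofLex g).1 = 1 then 1 else -1

/-- The states of ghost number `n`. -/
def ghostDegree (n : ℤ) : Submodule ℂ Fock :=
  ⨅ (S : Finset GhostMode) (_ : ghostNumber S ≠ n), LinearMap.ker (coeff S)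

/-- The cochains `C^n(p)`: the states of ghost number `n` in the kernel of `L^tot_0`. -/
def cochains (p : Fin 26 → ℝ) (n : ℤ) : Submodule ℂ Fock :=
  LinearMap.ker (Ltot p) ⊓ ghostDegree n

/-- The cocycles `Z^n(p)`. -/
def cocycles (τ : ℝ) (p : Fin 26 → ℝ) (n : ℤ) : Submodule ℂ Fock :=
  cochains p n ⊓ LinearMap.ker (brst τ p)

/-- The coboundaries `B^n(p)`. -/
def coboundaries (τ : ℝ) (p : Fin 26 → ℝ) (n : ℤ) : Submodule ℂ Fock :=
  (cochains p (n - 1)).map (brst τ p)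

/-- The absolute BRST cohomology `H^n(p)`. -/
abbrev Cohomology (τ : ℝ) (p : Fin 26 → ℝ) (n : ℤ) : Type :=
  cocycles τ p n ⧸ (coboundaries τ p n).submoduleOf (cocycles τ p n)

/-! ### Transverse rotations -/

/-- `SO(25)`. -/
abbrev SO25 : Type := Matrix.specialOrthogonalGroup (Fin 25) ℝ

/-- The action of `R ∈ SO(25)` on `ℝ^{26}`: `(p_0, 𝐩) ↦ (p_0, R 𝐩)`. -/
def spacetime (R : Matrix (Fin 25) (Fin 25) ℝ) : Matrix (Fin 26) (Fin 26) ℝ :=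
  Fin.cons (Fin.cons 1 0) fun i => Fin.cons 0 (R i)

section spacetimeLemmas

variable (R S : Matrix (Fin 25) (Fin 25) ℝ)

lemma spacetime_zero_zero : spacetime R 0 0 = 1 := rfl
lemma spacetime_zero_succ (j : Fin 25) : spacetime R 0 j.succ = 0 := rfl
lemma spacetime_succ_zero (i : Fin 25) : spacetime R i.succ 0 = 0 := rfl
lemma spacetime_succ_succ (i j : Fin 25) : spacetime R i.succ j.succ = R i j := rfl

lemma spacetime_one : spacetime 1 = 1 := by
  ext μ ν
  refine Fin.cases ?_ (fun i => ?_) μ <;> refine Fin.cases ?_ (fun j => ?_) ν <;>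
    simp [spacetime_zero_zero, spacetime_zero_succ, spacetime_succ_zero, spacetime_succ_succ,
      Matrix.one_apply, Fin.succ_ne_zero, (Fin.succ_ne_zero _).symm]

lemma spacetime_mul : spacetime (R * S) = spacetime R * spacetime S := by
  ext μ ν
  rw [Matrix.mul_apply, Fin.sum_univ_succ]
  refine Fin.cases ?_ (fun i => ?_) μ <;> refine Fin.cases ?_ (fun j => ?_) ν <;>
    simp [spacetime_zero_zero, spacetime_zero_succ, spacetime_succ_zero, spacetime_succ_succ,
      Matrix.mul_apply]

lemma spacetime_transpose : spacetime Rᵀ = (spacetime R)ᵀ := by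
  ext μ ν
  rw [Matrix.transpose_apply]
  refine Fin.cases ?_ (fun i => ?_) μ <;> refine Fin.cases ?_ (fun j => ?_) ν <;>
    simp [spacetime_zero_zero, spacetime_zero_succ, spacetime_succ_zero, spacetime_succ_succ]

end spacetimeLemmas

lemma mul_transpose_SO25 (R : SO25) : R.1 * R.1ᵀ = 1 :=
  (Matrix.mem_orthogonalGroup_iff (Fin 25) ℝ).1 (Matrix.mem_specialOrthogonalGroup_iff.1 R.2).1

lemma transpose_mul_SO25 (R : SO25) : R.1ᵀ * R.1 = 1 :=
  (Matrix.mem_orthogonalGroup_iff' (Fin 25) ℝ).1 (Matrix.mem_specialOrthogonalGroup_iff.1 R.2).1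

/-- The stabiliser of the momentum `p` in `SO(25)`. -/
def stab (p : Fin 26 → ℝ) : Subgroup SO25 where
  carrier := {R | spacetime R.1 *ᵥ p = p}
  one_mem' := by
    change spacetime 1 *ᵥ p = p
    rw [spacetime_one, Matrix.one_mulVec]
  mul_mem' := by
    intro R S hR hS
    change spacetime R.1 *ᵥ p = p at hR
    change spacetime S.1 *ᵥ p = p at hS
    change spacetime (R.1 * S.1) *ᵥ p = p
    rw [spacetime_mul, ← Matrix.mulVec_mulVec, hS, hR]
  inv_mem' := by
    intro R hR
    change spacetime R.1 *ᵥ p = p at hR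
    change spacetime R.1ᵀ *ᵥ p = p
    conv_lhs => rw [← hR]
    rw [Matrix.mulVec_mulVec, ← spacetime_mul, transpose_mul_SO25, spacetime_one,
      Matrix.one_mulVec]

/-- The matrix elements of a rotation, as complex numbers. -/
def rotCoeff (R : SO25) (ν μ : Fin 26) : ℂ := (spacetime R.1 ν μ : ℂ)

/-- The substitution `x^i_{-n} ↦ R_{ji} x^j_{-n}`, `(π_i)_{-n} ↦ R_{ji} (π_j)_{-n}`. -/
def rotPoly (R : SO25) : MvPolynomial MatterMode ℂ →ₐ[ℂ] MvPolynomial MatterMode ℂ :=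
  MvPolynomial.aeval fun m => match m with
    | Sum.inl (μ, k) => ∑ ν, rotCoeff R ν μ • MvPolynomial.X (Sum.inl (ν, k))
    | Sum.inr (μ, k) => ∑ ν, rotCoeff R ν μ • MvPolynomial.X (Sum.inr (ν, k))

lemma rotCoeff_one (ν μ : Fin 26) : rotCoeff 1 ν μ = if ν = μ then 1 else 0 := by
  change ((spacetime 1 ν μ : ℝ) : ℂ) = _
  rw [spacetime_one, Matrix.one_apply]
  split <;> simp

lemma rotCoeff_mul (R S : SO25) (ν μ : Fin 26) :
    rotCoeff (R * S) ν μ = ∑ ρ, rotCoeff R ν ρ * rotCoeff S ρ μ := by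
  change ((spacetime (R.1 * S.1) ν μ : ℝ) : ℂ) = _
  rw [spacetime_mul, Matrix.mul_apply]
  simp [rotCoeff]

lemma rotCoeff_orth (R : SO25) (ν ρ : Fin 26) :
    ∑ μ, rotCoeff R ν μ * rotCoeff R ρ μ = if ν = ρ then 1 else 0 := by
  have h : (spacetime R.1 * (spacetime R.1)ᵀ) ν ρ = (1 : Matrix _ _ ℝ) ν ρ := by
    rw [← spacetime_transpose, ← spacetime_mul, mul_transpose_SO25, spacetime_one]
  rw [Matrix.mul_apply, Matrix.one_apply] at h
  have h' := congrArg (fun r : ℝ => (r : ℂ)) h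
  simp only [Matrix.transpose_apply, Complex.ofReal_sum, Complex.ofReal_mul] at h'
  simp only [rotCoeff]
  rw [h']
  split <;> simp

lemma rotCoeff_orth' (R : SO25) (ν ρ : Fin 26) :
    ∑ μ, rotCoeff R μ ν * rotCoeff R μ ρ = if ν = ρ then 1 else 0 := by
  have h : ((spacetime R.1)ᵀ * spacetime R.1) ν ρ = (1 : Matrix _ _ ℝ) ν ρ := by
    rw [← spacetime_transpose, ← spacetime_mul, transpose_mul_SO25, spacetime_one]
  rw [Matrix.mul_apply, Matrix.one_apply] at h
  have h' := congrArg (fun r : ℝ => (r : ℂ)) h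
  simp only [Matrix.transpose_apply, Complex.ofReal_sum, Complex.ofReal_mul] at h'
  simp only [rotCoeff]
  rw [h']
  split <;> simp

lemma rotPoly_X (R : SO25) (m : MatterMode) : rotPoly R (MvPolynomial.X m) =
    match m with
    | Sum.inl (μ, k) => ∑ ν, rotCoeff R ν μ • MvPolynomial.X (Sum.inl (ν, k))
    | Sum.inr (μ, k) => ∑ ν, rotCoeff R ν μ • MvPolynomial.X (Sum.inr (ν, k)) := by
  simp only [rotPoly, MvPolynomial.aeval_X]

lemma rotPoly_one : rotPoly 1 = AlgHom.id ℂ _ := by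
  refine MvPolynomial.algHom_ext fun m => ?_
  rw [rotPoly_X]
  rcases m with ⟨μ, k⟩ | ⟨μ, k⟩ <;> simp [rotCoeff_one, ite_smul]

lemma rotPoly_mul (R S : SO25) : rotPoly (R * S) = (rotPoly R).comp (rotPoly S) := by
  refine MvPolynomial.algHom_ext fun m => ?_
  rw [rotPoly_X, AlgHom.comp_apply, rotPoly_X]
  rcases m with ⟨μ, k⟩ | ⟨μ, k⟩ <;>
  · simp only [rotCoeff_mul, map_sum, map_smul, rotPoly_X, Finset.smul_sum, Finset.sum_smul]
    rw [Finset.sum_comm]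
    refine Finset.sum_congr rfl fun ρ _ => Finset.sum_congr rfl fun ν _ => ?_
    rw [smul_smul, mul_comm]

lemma bosonic_state (f : Module.End ℂ (MvPolynomial MatterMode ℂ)) (S : Finset GhostMode)
    (P : MvPolynomial MatterMode ℂ) : bosonic f (state S P) = state S (f P) := by
  rw [bosonic, fockLift_state, LinearMap.comp_apply]

lemma bosonic_one : bosonic 1 = 1 :=
  fock_ext fun S P => by rw [bosonic_state]; rfl

lemma bosonic_mul (f g : Module.End ℂ (MvPolynomial MatterMode ℂ)) :
    bosonic (f * g) = bosonic f * bosonic g :=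
  fock_ext fun S P => by
    rw [Module.End.mul_apply, bosonic_state, bosonic_state, bosonic_state, Module.End.mul_apply]

lemma bosonic_sum {ι : Type} [Fintype ι] (a : ι → ℂ)
    (f : ι → Module.End ℂ (MvPolynomial MatterMode ℂ)) :
    bosonic (∑ i, a i • f i) = ∑ i, a i • bosonic (f i) :=
  fock_ext fun S P => by
    simp only [bosonic_state, LinearMap.sum_apply, LinearMap.smul_apply, map_sum, map_smul]

/-- The representation of `SO(25)` on the Fock space: transverse rotations fix the ghosts, the
modes with index `μ = 0` and (if they fix `p`) the state `|p⟩`. -/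
def rotation : Representation ℂ SO25 Fock where
  toFun R := bosonic (rotPoly R).toLinearMap
  map_one' := by
    rw [rotPoly_one]
    exact bosonic_one
  map_mul' R S := by
    rw [rotPoly_mul]
    exact bosonic_mul (rotPoly R).toLinearMap (rotPoly S).toLinearMap

/-! ### Equivariance -/

/-- `u` carries the field `A` to the field `A'`. -/
def Carries (u : Module.End ℂ Fock) (A A' : Modes) : Prop := ∀ n, u * A n = A' n * u

lemma locSum_apply {ι : Type} {f : ι → Module.End ℂ Fock} (h : LocallyFinite f) (v : Fock) :
    locSum f v = ∑ᶠ i, f i v := by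
  rw [locSum, dif_pos h]
  rfl

lemma locSum_carries {ι : Type} {f f' : ι → Module.End ℂ Fock} {u w : Module.End ℂ Fock}
    (huw : u * w = 1) (hwu : w * u = 1) (h : ∀ i, u * f i = f' i * u) :
    u * locSum f = locSum f' * u := by
  have huw' : ∀ v, u (w v) = v := fun v => by
    rw [← Module.End.mul_apply, huw, Module.End.one_apply]
  have hwu' : ∀ v, w (u v) = v := fun v => by
    rw [← Module.End.mul_apply, hwu, Module.End.one_apply]
  have h' : ∀ i v, u (f i v) = f' i (u v) := fun i v => by
    rw [← Module.End.mul_apply, h, Module.End.mul_apply]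
  by_cases hf : LocallyFinite f
  · have hf' : LocallyFinite f' := by
      intro v
      refine (hf (w v)).subset fun i hi hi' => hi ?_
      rw [← huw' v, ← h', hi', map_zero]
    ext v
    rw [Module.End.mul_apply, Module.End.mul_apply, locSum_apply hf, locSum_apply hf']
    rw [map_finsum u (hf v)]
    exact finsum_congr fun i => h' i v
  · have hf' : ¬ LocallyFinite f' := by
      intro hf'
      refine hf fun v => (hf' (u v)).subset fun i hi hi' => hi ?_
      rw [← h'] at hi'
      rw [← hwu' (f i v), hi', map_zero]
    rw [locSum, locSum, dif_neg hf, dif_neg hf', mul_zero, zero_mul]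

lemma nop_carries {u w : Module.End ℂ Fock} (huw : u * w = 1) (hwu : w * u = 1) (h : ℤ) (ε : ℂ)
    {A A' B B' : Modes} (hA : Carries u A A') (hB : Carries u B B') :
    Carries u (nop h ε A B) (nop h ε A' B') := by
  intro n
  refine locSum_carries huw hwu fun l => ?_
  split
  · rw [← mul_assoc, hA, mul_assoc, hB, mul_assoc]
  · rw [mul_smul_comm, smul_mul_assoc, ← mul_assoc, hB, mul_assoc, hA, mul_assoc]

/-- The modes `A_n` of a field annihilate any given state for all large `n`. -/
def IsField (A : Modes) : Prop := ∀ v, ∃ N : ℤ, ∀ n, N ≤ n → A n v = 0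

lemma nop_locallyFinite {A B : Modes} (hA : IsField A) (hB : IsField B) (h : ℤ) (ε : ℂ) (n : ℤ) :
    LocallyFinite fun l : ℤ => if l ≤ -h then A l * B (n - l) else ε • (B (n - l) * A l) := by
  intro v
  obtain ⟨N, hN⟩ := hA v
  obtain ⟨N', hN'⟩ := hB v
  refine (Set.finite_Icc (min (n - N') (-h)) (max N (-h))).subset fun l hl => ?_
  by_contra hc
  refine hl ?_
  rw [Set.mem_Icc, not_and_or, not_le, not_le] at hc
  dsimp only
  split
  · rw [Module.End.mul_apply, hN' _ (by omega), map_zero]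
  · rw [LinearMap.smul_apply, Module.End.mul_apply, hN _ (by omega), map_zero, smul_zero]

lemma nop_apply {A B : Modes} (hA : IsField A) (hB : IsField B) (h : ℤ) (ε : ℂ) (n : ℤ)
    (v : Fock) : nop h ε A B n v =
      ∑ᶠ l : ℤ, (if l ≤ -h then A l * B (n - l) else ε • (B (n - l) * A l)) v :=
  locSum_apply (nop_locallyFinite hA hB h ε n) v

lemma isField_sum {ι : Type} [Fintype ι] {A : ι → Modes} (hA : ∀ i, IsField (A i)) (a : ι → ℂ) :
    IsField (∑ i, a i • A i) := by
  intro v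
  choose N hN using fun i => hA i v
  refine ⟨∑ i, |N i|, fun n hn => ?_⟩
  simp only [Finset.sum_apply, LinearMap.sum_apply, Pi.smul_apply, LinearMap.smul_apply]
  refine Finset.sum_eq_zero fun i _ => ?_
  rw [hN i n ((le_abs_self _).trans
    ((Finset.single_le_sum (f := fun i => |N i|) (fun j _ => abs_nonneg _)
      (Finset.mem_univ i)).trans hn)), smul_zero]

lemma nop_sum_left {ι : Type} [Fintype ι] {A : ι → Modes} {B : Modes} (hA : ∀ i, IsField (A i))
    (hB : IsField B) (h : ℤ) (ε : ℂ) (a : ι → ℂ) :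
    nop h ε (∑ i, a i • A i) B = ∑ i, a i • nop h ε (A i) B := by
  have hs : IsField (∑ i, a i • A i) := isField_sum hA a
  funext n
  ext v
  simp only [Finset.sum_apply, LinearMap.sum_apply, Pi.smul_apply, LinearMap.smul_apply]
  rw [nop_apply hs hB]
  simp only [nop_apply (hA _) hB]
  simp only [smul_finsum' _ (nop_locallyFinite (hA _) hB h ε n v)]
  rw [← finsum_sum_comm]
  · refine finsum_congr fun l => ?_
    split <;>
    simp only [Finset.sum_apply, LinearMap.sum_apply, Pi.smul_apply, LinearMap.smul_apply,
      Module.End.mul_apply, map_sum, map_smul, Finset.smul_sum]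
    exact Finset.sum_congr rfl fun i _ => smul_comm _ _ _
  · intro i _
    exact (nop_locallyFinite (hA i) hB h ε n v).subset fun l hl hl' => hl (by simp [hl'])

lemma nop_sum_right {ι : Type} [Fintype ι] {A : Modes} {B : ι → Modes} (hA : IsField A)
    (hB : ∀ i, IsField (B i)) (h : ℤ) (ε : ℂ) (b : ι → ℂ) :
    nop h ε A (∑ i, b i • B i) = ∑ i, b i • nop h ε A (B i) := by
  have hs : IsField (∑ i, b i • B i) := isField_sum hB b
  funext n
  ext v
  simp only [Finset.sum_apply, LinearMap.sum_apply, Pi.smul_apply, LinearMap.smul_apply]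
  rw [nop_apply hA hs]
  simp only [nop_apply hA (hB _)]
  simp only [smul_finsum' _ (nop_locallyFinite hA (hB _) h ε n v)]
  rw [← finsum_sum_comm]
  · refine finsum_congr fun l => ?_
    split <;>
    simp only [Finset.sum_apply, LinearMap.sum_apply, Pi.smul_apply, LinearMap.smul_apply,
      Module.End.mul_apply, map_sum, map_smul, Finset.smul_sum]
    exact Finset.sum_congr rfl fun i _ => smul_comm _ _ _
  · intro i _
    exact (nop_locallyFinite hA (hB i) h ε n v).subset fun l hl hl' => hl (by simp [hl'])

lemma isField_of_state {A : Modes} (h : ∀ S P, ∃ N : ℤ, ∀ n, N ≤ n → A n (state S P) = 0) :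
    IsField A := by
  intro v
  induction v using fock_induction with
  | zero => exact ⟨0, fun n _ => map_zero _⟩
  | add v w hv hw =>
    obtain ⟨N, hN⟩ := hv
    obtain ⟨N', hN'⟩ := hw
    exact ⟨max N N', fun n hn => by
      rw [map_add, hN n (by omega), hN' n (by omega), add_zero]⟩
  | single S P => exact h S P

lemma exists_pderiv_eq_zero (P : MvPolynomial MatterMode ℂ) (μ : Fin 26) : ∃ K : ℕ, ∀ k, K ≤ k →
    MvPolynomial.pderiv (Sum.inl (μ, k)) P = 0 ∧ MvPolynomial.pderiv (Sum.inr (μ, k)) P = 0 := by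
  classical
  refine ⟨P.vars.sup (Sum.elim Prod.snd Prod.snd) + 1, fun k hk => ?_⟩
  constructor <;>
  · refine MvPolynomial.pderiv_eq_zero_of_notMem_vars fun hm => ?_
    have : k ≤ P.vars.sup (Sum.elim Prod.snd Prod.snd) :=
      Finset.le_sup (f := (Sum.elim Prod.snd Prod.snd : MatterMode → ℕ)) hm
    omega

lemma isField_xMode (μ : Fin 26) : IsField (xMode μ) := by
  refine isField_of_state fun S P => ?_
  obtain ⟨K, hK⟩ := exists_pderiv_eq_zero P μ
  refine ⟨K + 1, fun n hn => ?_⟩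
  obtain ⟨k, rfl⟩ : ∃ k : ℕ, n = Int.ofNat (k + 1) := ⟨(n - 1).toNat, by simp; omega⟩
  have hk := (hK k (by simp at hn; omega)).2
  simp only [xMode, bosonic_state, LinearMap.neg_apply, Derivation.coeFn_coe, hk, neg_zero,
    map_zero]

lemma isField_piMode (p : Fin 26 → ℝ) (μ : Fin 26) : IsField (piMode p μ) := by
  refine isField_of_state fun S P => ?_
  obtain ⟨K, hK⟩ := exists_pderiv_eq_zero P μ
  refine ⟨K + 1, fun n hn => ?_⟩
  obtain ⟨k, rfl⟩ : ∃ k : ℕ, n = Int.ofNat (k + 1) := ⟨(n - 1).toNat, by simp; omega⟩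
  have hk := (hK k (by simp at hn; omega)).1
  simp only [piMode, bosonic_state, Derivation.coeFn_coe, hk, map_zero]

lemma isField_dX (μ : Fin 26) : IsField (dX μ) := by
  intro v
  obtain ⟨N, hN⟩ := isField_xMode μ v
  exact ⟨N, fun n hn => by rw [dX, deriv, LinearMap.smul_apply, hN n hn, smul_zero]⟩

lemma pderiv_rotPoly (R : SO25) (μ : Fin 26) (k : ℕ) (P : MvPolynomial MatterMode ℂ) :
    (rotPoly R (MvPolynomial.pderiv (Sum.inl (μ, k)) P) =
      ∑ ν, rotCoeff R ν μ • MvPolynomial.pderiv (Sum.inl (ν, k)) (rotPoly R P)) ∧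
    (rotPoly R (MvPolynomial.pderiv (Sum.inr (μ, k)) P) =
      ∑ ν, rotCoeff R ν μ • MvPolynomial.pderiv (Sum.inr (ν, k)) (rotPoly R P)) := by
  classical
  induction P using MvPolynomial.induction_on with
  | C a => simp
  | add P Q hP hQ =>
    simp only [map_add, hP.1, hP.2, hQ.1, hQ.2, smul_add, Finset.sum_add_distrib, and_self]
  | mul_X P m hP =>
    have key : ∀ (s : Fin 26 → MatterMode) (b : MvPolynomial MatterMode ℂ),
        rotPoly R (MvPolynomial.pderiv (s μ) P) =
          ∑ ν, rotCoeff R ν μ • MvPolynomial.pderiv (s ν) (rotPoly R P) →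
        rotPoly R (MvPolynomial.pderiv (s μ) (MvPolynomial.X m)) =
          ∑ ν, rotCoeff R ν μ • MvPolynomial.pderiv (s ν) (rotPoly R (MvPolynomial.X m)) →
        rotPoly R (MvPolynomial.pderiv (s μ) (P * MvPolynomial.X m)) =
          ∑ ν, rotCoeff R ν μ • MvPolynomial.pderiv (s ν) (rotPoly R (P * MvPolynomial.X m)) := by
      intro s _ h1 h2
      simp only [Derivation.leibniz, map_add, smul_eq_mul, map_mul, h1, h2, smul_add,
        Finset.sum_add_distrib, Finset.mul_sum, mul_smul_comm]
    constructor
    · refine key (fun ν => Sum.inl (ν, k)) 0 hP.1 ?_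
      rw [rotPoly_X]
      rcases m with ⟨ρ, l⟩ | ⟨ρ, l⟩
      · by_cases hl : l = k
        · subst hl
          have h1 : ∀ α β : Fin 26, MvPolynomial.pderiv (Sum.inl (α, l))
              (MvPolynomial.X (Sum.inl (β, l)) : MvPolynomial MatterMode ℂ) =
                if β = α then 1 else 0 := fun α β => by
            simp [MvPolynomial.pderiv_X, Pi.single_apply]
          have h2 : ∀ α, MvPolynomial.pderiv (Sum.inl (α, l)) (∑ ν, rotCoeff R ν ρ •
              (MvPolynomial.X (Sum.inl (ν, l)) : MvPolynomial MatterMode ℂ)) =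
                rotCoeff R α ρ • 1 := fun α => by
            rw [map_sum, Finset.sum_eq_single α]
            · rw [Derivation.map_smul, h1, if_pos rfl]
            · intro β _ hβ
              rw [Derivation.map_smul, h1, if_neg hβ, smul_zero]
            · simp
          simp only [h1, h2, smul_smul, ← Finset.sum_smul, rotCoeff_orth']
          by_cases h : μ = ρ
          · simp [h]
          · simp [h, Ne.symm h]
        · simp [MvPolynomial.pderiv_X, hl]
      · simp [MvPolynomial.pderiv_X]
    · refine key (fun ν => Sum.inr (ν, k)) 0 hP.2 ?_
      rw [rotPoly_X]
      rcases m with ⟨ρ, l⟩ | ⟨ρ, l⟩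
      · simp [MvPolynomial.pderiv_X]
      · by_cases hl : l = k
        · subst hl
          have h1 : ∀ α β : Fin 26, MvPolynomial.pderiv (Sum.inr (α, l))
              (MvPolynomial.X (Sum.inr (β, l)) : MvPolynomial MatterMode ℂ) =
                if β = α then 1 else 0 := fun α β => by
            simp [MvPolynomial.pderiv_X, Pi.single_apply]
          have h2 : ∀ α, MvPolynomial.pderiv (Sum.inr (α, l)) (∑ ν, rotCoeff R ν ρ •
              (MvPolynomial.X (Sum.inr (ν, l)) : MvPolynomial MatterMode ℂ)) =
                rotCoeff R α ρ • 1 := fun α => by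
            rw [map_sum, Finset.sum_eq_single α]
            · rw [Derivation.map_smul, h1, if_pos rfl]
            · intro β _ hβ
              rw [Derivation.map_smul, h1, if_neg hβ, smul_zero]
            · simp
          simp only [h1, h2, smul_smul, ← Finset.sum_smul, rotCoeff_orth']
          by_cases h : μ = ρ
          · simp [h]
          · simp [h, Ne.symm h]
        · simp [MvPolynomial.pderiv_X, hl]

lemma rotation_state (R : SO25) (S : Finset GhostMode) (P : MvPolynomial MatterMode ℂ) :
    rotation R (state S P) = state S (rotPoly R P) :=
  bosonic_state _ S P

lemma rotation_xMode (R : SO25) (μ : Fin 26) :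
    Carries (rotation R) (xMode μ) (∑ ν, rotCoeff R ν μ • xMode ν) := by
  intro n
  refine fock_ext fun S P => ?_
  simp only [Module.End.mul_apply, Finset.sum_apply, Pi.smul_apply, LinearMap.sum_apply,
    LinearMap.smul_apply]
  rcases n with (_ | k) | k
  · simp [xMode]
  · simp only [xMode, rotation_state, bosonic_state, LinearMap.neg_apply, Derivation.coeFn_coe,
      map_neg, (pderiv_rotPoly R μ k P).2, map_sum, map_smul, smul_neg, Finset.sum_neg_distrib]
  · simp only [xMode, rotation_state, bosonic_state, LinearMap.mulLeft_apply, map_mul, rotPoly_X,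
      Finset.sum_mul, smul_mul_assoc, map_sum, map_smul]

lemma rotation_dX (R : SO25) (μ : Fin 26) :
    Carries (rotation R) (dX μ) (∑ ν, rotCoeff R ν μ • dX ν) := by
  intro n
  have h := rotation_xMode R μ n
  simp only [Finset.sum_apply, Pi.smul_apply] at h ⊢
  have e : ∀ ν, dX ν n = (-((n : ℂ) + ((0 : ℤ) : ℂ))) • xMode ν n := fun ν => rfl
  simp only [e, mul_smul_comm, h, Finset.smul_sum, Finset.sum_mul, smul_mul_assoc]
  exact Finset.sum_congr rfl fun ν _ => smul_comm _ _ _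

lemma rotCoeff_momentum {p : Fin 26 → ℝ} (R : stab p) (μ : Fin 26) :
    ∑ ν, rotCoeff R.1 ν μ * (p ν : ℂ) = (p μ : ℂ) := by
  have h : spacetime R.1.1ᵀ *ᵥ p = p := (R⁻¹).2
  rw [spacetime_transpose] at h
  have h' := congrArg (fun r : ℝ => (r : ℂ)) (congrFun h μ)
  simp only [Matrix.mulVec, dotProduct, Matrix.transpose_apply, Complex.ofReal_sum,
    Complex.ofReal_mul] at h'
  exact h'

lemma rotation_piMode {p : Fin 26 → ℝ} (R : stab p) (μ : Fin 26) :
    Carries (rotation R.1) (piMode p μ) (∑ ν, rotCoeff R.1 ν μ • piMode p ν) := by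
  intro n
  refine fock_ext fun S P => ?_
  simp only [Module.End.mul_apply, Finset.sum_apply, Pi.smul_apply, LinearMap.sum_apply,
    LinearMap.smul_apply]
  rcases n with (_ | k) | k
  · simp only [piMode, LinearMap.smul_apply, Module.End.one_apply, map_smul, smul_smul,
      ← Finset.sum_smul]
    congr 1
    rw [← rotCoeff_momentum R μ, Finset.mul_sum]
    exact Finset.sum_congr rfl fun ν _ => by ring
  · simp only [piMode, rotation_state, bosonic_state, Derivation.coeFn_coe,
      (pderiv_rotPoly R.1 μ k P).1, map_sum, map_smul]
  · simp only [piMode, rotation_state, bosonic_state, LinearMap.mulLeft_apply, map_mul, rotPoly_X,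
      Finset.sum_mul, smul_mul_assoc, map_sum, map_smul]

lemma rotation_create (R : SO25) (g : GhostMode) :
    rotation R * create g = create g * rotation R := by
  refine fock_ext fun S P => ?_
  simp only [Module.End.mul_apply, rotation_state, create, fockLift_state]
  split <;> simp [rotation_state]

lemma rotation_annihilate (R : SO25) (g : GhostMode) :
    rotation R * annihilate g = annihilate g * rotation R := by
  refine fock_ext fun S P => ?_
  simp only [Module.End.mul_apply, rotation_state, annihilate, fockLift_state]
  split <;> simp [rotation_state]

lemma rotation_ghost (R : SO25) (e t : Fin 4) :
    Carries (rotation R) (ghost e t) (ghost e t) := by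
  intro n
  simp only [ghost]
  split
  · exact rotation_create R _
  · exact rotation_annihilate R _

lemma rotation_antighost (R : SO25) (e t : Fin 4) :
    Carries (rotation R) (antighost e t) (antighost e t) := by
  intro n
  simp only [antighost]
  split
  · exact rotation_create R _
  · exact rotation_annihilate R _

lemma Carries.deriv {u : Module.End ℂ Fock} {A A' : Modes} (h : Carries u A A') (w : ℤ) :
    Carries u (CarrollString.deriv w A) (CarrollString.deriv w A') := fun n => by
  simp only [CarrollString.deriv, mul_smul_comm, smul_mul_assoc, h n]

lemma Carries.smul {u : Module.End ℂ Fock} {A A' : Modes} (h : Carries u A A') (a : ℂ) :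
    Carries u (a • A) (a • A') := fun n => by
  simp only [Pi.smul_apply, mul_smul_comm, smul_mul_assoc, h n]

lemma Carries.add {u : Module.End ℂ Fock} {A A' B B' : Modes} (h : Carries u A A')
    (h' : Carries u B B') : Carries u (A + B) (A' + B') := fun n => by
  simp only [Pi.add_apply, mul_add, add_mul, h n, h' n]

lemma Carries.sub {u : Module.End ℂ Fock} {A A' B B' : Modes} (h : Carries u A A')
    (h' : Carries u B B') : Carries u (A - B) (A' - B') := fun n => by
  simp only [Pi.sub_apply, mul_sub, sub_mul, h n, h' n]

lemma Carries.sum {ι : Type} [Fintype ι] {u : Module.End ℂ Fock} {A A' : ι → Modes}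
    (h : ∀ i, Carries u (A i) (A' i)) : Carries u (∑ i, A i) (∑ i, A' i) := fun n => by
  simp only [Finset.sum_apply, Finset.mul_sum, Finset.sum_mul, fun i => h i n]

lemma rotation_mul_inv (R : SO25) : rotation R * rotation R⁻¹ = 1 := by
  rw [← map_mul, mul_inv_cancel, map_one]

lemma rotation_inv_mul (R : SO25) : rotation R⁻¹ * rotation R = 1 := by
  rw [← map_mul, inv_mul_cancel, map_one]

/-- The contraction of two normal-ordered vector fields over an index set on which the rotation
acts orthogonally. -/
lemma nop_contract {ι : Type} [Fintype ι] [DecidableEq ι] (L : ι → ι → ℂ)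
    (hL : ∀ ν ρ, ∑ μ, L ν μ * L ρ μ = if ν = ρ then 1 else 0) {A B : ι → Modes}
    (hA : ∀ i, IsField (A i)) (hB : ∀ i, IsField (B i)) (h : ℤ) (ε : ℂ) :
    ∑ μ, nop h ε (∑ ν, L ν μ • A ν) (∑ ρ, L ρ μ • B ρ) = ∑ μ, nop h ε (A μ) (B μ) := by
  have hs : ∀ μ, IsField (∑ ρ, L ρ μ • B ρ) := fun μ => isField_sum hB fun ρ => L ρ μ
  simp only [nop_sum_left hA (hs _), nop_sum_right (hA _) hB]
  rw [Finset.sum_comm]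
  refine Finset.sum_congr rfl fun ν _ => ?_
  simp only [Finset.smul_sum, smul_smul]
  rw [Finset.sum_comm]
  simp only [← Finset.sum_smul, hL, ite_smul, one_smul, zero_smul, Finset.sum_ite_eq,
    Finset.mem_univ, if_true]

lemma rotation_stressT {p : Fin 26 → ℝ} (R : stab p) :
    Carries (rotation R.1) (stressT p) (stressT p) := by
  have h := Carries.sum fun μ => nop_carries (rotation_mul_inv R.1) (rotation_inv_mul R.1) 1 1
    (rotation_dX R.1 μ) (rotation_piMode R μ)
  rwa [nop_contract (rotCoeff R.1) (rotCoeff_orth R.1) isField_dX (isField_piMode p) 1 1] at h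

lemma rotCoeff_sum_zero (R : SO25) (A : Fin 26 → Modes) :
    ∑ ν, rotCoeff R ν 0 • A ν = A 0 := by
  rw [Fin.sum_univ_succ]
  simp [rotCoeff, spacetime_zero_zero, spacetime_succ_zero]

lemma rotCoeff_sum_succ (R : SO25) (A : Fin 26 → Modes) (i : Fin 25) :
    ∑ ν, rotCoeff R ν i.succ • A ν = ∑ j : Fin 25, rotCoeff R j.succ i.succ • A j.succ := by
  rw [Fin.sum_univ_succ]
  simp [rotCoeff, spacetime_zero_succ]

lemma rotCoeff_orth_succ (R : SO25) (j l : Fin 25) :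
    ∑ i : Fin 25, rotCoeff R j.succ i.succ * rotCoeff R l.succ i.succ = if j = l then 1 else 0 := by
  have h := rotCoeff_orth R j.succ l.succ
  rw [Fin.sum_univ_succ] at h
  simpa [rotCoeff, spacetime_succ_zero] using h

lemma rotation_stressM (τ : ℝ) {p : Fin 26 → ℝ} (R : stab p) :
    Carries (rotation R.1) (stressM τ p) (stressM τ p) := by
  refine Carries.sub (Carries.smul ?_ _) (Carries.smul ?_ _)
  · have h := rotation_piMode R 0
    rw [rotCoeff_sum_zero] at h
    exact nop_carries (rotation_mul_inv R.1) (rotation_inv_mul R.1) 1 1 h h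
  · have h := Carries.sum fun i : Fin 25 =>
      nop_carries (rotation_mul_inv R.1) (rotation_inv_mul R.1) 1 1
        (rotation_dX R.1 i.succ) (rotation_dX R.1 i.succ)
    simp only [rotCoeff_sum_succ] at h
    rwa [nop_contract (fun j i : Fin 25 => rotCoeff R.1 j.succ i.succ) (rotCoeff_orth_succ R.1)
      (fun i : Fin 25 => isField_dX i.succ) (fun i : Fin 25 => isField_dX i.succ) 1 1] at h

lemma rotation_ghostT (R : SO25) : Carries (rotation R) ghostT ghostT := by
  have hc := rotation_ghost R 0 2
  have hC := rotation_ghost R 1 3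
  have hb := rotation_antighost R 0 2
  have hB := rotation_antighost R 1 3
  have key := fun (h : ℤ) (ε : ℂ) {A A' B B' : Modes} =>
    nop_carries (A := A) (A' := A') (B := B) (B' := B') (rotation_mul_inv R) (rotation_inv_mul R)
      h ε
  exact ((((key _ _ hb (hc.deriv _)).smul _).sub (key _ _ (hb.deriv _) hc)).sub
    ((key _ _ hB (hC.deriv _)).smul _)).sub (key _ _ (hB.deriv _) hC)

lemma rotation_ghostM (R : SO25) : Carries (rotation R) ghostM ghostM := by
  have hc := rotation_ghost R 0 2
  have hB := rotation_antighost R 1 3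
  have key := fun (h : ℤ) (ε : ℂ) {A A' B B' : Modes} =>
    nop_carries (A := A) (A' := A') (B := B) (B' := B') (rotation_mul_inv R) (rotation_inv_mul R)
      h ε
  exact ((key _ _ hB (hc.deriv _)).smul _).sub (key _ _ (hB.deriv _) hc)

lemma rotation_brst (τ : ℝ) {p : Fin 26 → ℝ} (R : stab p) (v : Fock) :
    brst τ p (rotation R.1 v) = rotation R.1 (brst τ p v) := by
  have hc := rotation_ghost R.1 0 2
  have hC := rotation_ghost R.1 1 3
  have key := fun (h : ℤ) (ε : ℂ) {A A' B B' : Modes} =>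
    nop_carries (A := A) (A' := A') (B := B) (B' := B') (rotation_mul_inv R.1)
      (rotation_inv_mul R.1) h ε
  have h : Carries (rotation R.1) (current τ p) (current τ p) :=
    (((key _ _ hc (rotation_stressT R)).add (key _ _ hC (rotation_stressM τ R))).add
      ((key _ _ hc (rotation_ghostT R.1)).smul _)).add ((key _ _ hC (rotation_ghostM R.1)).smul _)
  exact (LinearMap.congr_fun (h 0) v).symm

lemma rotation_Ltot {p : Fin 26 → ℝ} (R : stab p) (v : Fock) :
    Ltot p (rotation R.1 v) = rotation R.1 (Ltot p v) :=
  (LinearMap.congr_fun (((rotation_stressT R).add (rotation_ghostT R.1)) 0) v).symm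

lemma coeff_rotation (R : SO25) (S : Finset GhostMode) (v : Fock) :
    coeff S (rotation R v) = rotPoly R (coeff S v) := by
  classical
  induction v using fock_induction with
  | zero => simp
  | add v w hv hw => simp only [map_add, hv, hw]
  | single S' P =>
    rw [rotation_state]
    change (Finsupp.single S' (rotPoly R P)) S = rotPoly R ((Finsupp.single S' P) S)
    rw [Finsupp.single_apply, Finsupp.single_apply]
    split <;> simp

/-! ### The representations of the stabiliser -/

variable (τ : ℝ) (p : Fin 26 → ℝ) (n : ℤ)

/-- The stabiliser of `p` acting on the states of momentum `p`. -/
def stabRep : Representation ℂ (stab p) Fock := MonoidHom.comp rotation (stab p).subtype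

variable {p n} in
lemma rotation_mem_cochains (R : stab p) {v : Fock} (hv : v ∈ cochains p n) :
    rotation R.1 v ∈ cochains p n := by
  rw [cochains, Submodule.mem_inf, LinearMap.mem_ker] at hv ⊢
  rw [rotation_Ltot, hv.1, map_zero]
  refine ⟨rfl, ?_⟩
  have hg := hv.2
  simp only [ghostDegree, Submodule.mem_iInf, LinearMap.mem_ker] at hg ⊢
  intro S hS
  rw [coeff_rotation, hg S hS, map_zero]

variable {τ p n} in
lemma rotation_mem_cocycles (R : stab p) {v : Fock} (hv : v ∈ cocycles τ p n) :
    rotation R.1 v ∈ cocycles τ p n := by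
  rw [cocycles, Submodule.mem_inf, LinearMap.mem_ker] at hv ⊢
  rw [rotation_brst, hv.2, map_zero]
  exact ⟨rotation_mem_cochains R hv.1, rfl⟩

variable {τ p n} in
lemma rotation_mem_coboundaries (R : stab p) {v : Fock} (hv : v ∈ coboundaries τ p n) :
    rotation R.1 v ∈ coboundaries τ p n := by
  rw [coboundaries, Submodule.mem_map] at hv ⊢
  obtain ⟨w, hw, rfl⟩ := hv
  exact ⟨rotation R.1 w, rotation_mem_cochains R hw, rotation_brst τ R w⟩

/-- `C^n(p)` as a representation of the stabiliser of `p`. -/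
def cochainRep : Representation ℂ (stab p) (cochains p n) :=
  (stabRep p).subrepresentation (cochains p n) fun R => by
    intro v hv
    rw [Submodule.mem_comap]
    exact rotation_mem_cochains R hv

/-- `Z^n(p)` as a representation of the stabiliser of `p`. -/
def cocycleRep : Representation ℂ (stab p) (cocycles τ p n) :=
  (stabRep p).subrepresentation (cocycles τ p n) fun R => by
    intro v hv
    rw [Submodule.mem_comap]
    exact rotation_mem_cocycles R hv

/-- `B^n(p)` as a representation of the stabiliser of `p`. -/
def coboundaryRep : Representation ℂ (stab p) (coboundaries τ p n) :=
  (stabRep p).subrepresentation (coboundaries τ p n) fun R => by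
    intro v hv
    rw [Submodule.mem_comap]
    exact rotation_mem_coboundaries R hv

/-- `H^n(p)` as a representation of the stabiliser of `p`. -/
def cohomologyRep : Representation ℂ (stab p) (Cohomology τ p n) :=
  (cocycleRep τ p n).quotient ((coboundaries τ p n).submoduleOf (cocycles τ p n))
    fun R => by
      intro v hv
      rw [Submodule.mem_comap, Submodule.submoduleOf, Submodule.mem_comap]
      exact rotation_mem_coboundaries R hv

/-- A rotation as a complex matrix. -/
def rotMatrix (R : SO25) : Matrix (Fin 25) (Fin 25) ℂ := R.1.map Complex.ofReal

lemma rotMatrix_one : rotMatrix 1 = 1 := by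
  change (1 : Matrix (Fin 25) (Fin 25) ℝ).map Complex.ofReal = 1
  simp

lemma rotMatrix_mul (R S : SO25) : rotMatrix (R * S) = rotMatrix R * rotMatrix S := by
  change (R.1 * S.1).map Complex.ofReal = _
  exact Matrix.map_mul (f := Complex.ofRealHom)

lemma rotMatrix_transpose_mul (R : SO25) : (rotMatrix R)ᵀ * rotMatrix R = 1 := by
  have h := congrArg (fun A : Matrix (Fin 25) (Fin 25) ℝ => A.map Complex.ofRealHom)
    (transpose_mul_SO25 R)
  simp only [Matrix.map_mul] at h
  rw [Matrix.map_one _ (map_zero _) (map_one _)] at h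
  exact h

/-- The transverse momentum `𝐩`, as a complex vector. -/
def transverse : Fin 25 → ℂ := fun i => (p i.succ : ℂ)

variable {p} in
lemma rotMatrix_transpose_transverse (R : stab p) :
    (rotMatrix R.1)ᵀ *ᵥ transverse p = transverse p := by
  funext i
  have h := rotCoeff_momentum R i.succ
  rw [Fin.sum_univ_succ] at h
  simp only [rotCoeff, spacetime_zero_succ, Complex.ofReal_zero, zero_mul, zero_add,
    spacetime_succ_succ] at h
  exact h

/-- The complex vector representation of `SO(25)`. -/
def vectorRep : Representation ℂ SO25 (Fin 25 → ℂ) where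
  toFun R := (rotMatrix R).mulVecLin
  map_one' := by rw [rotMatrix_one, Matrix.mulVecLin_one]; rfl
  map_mul' R S := by rw [rotMatrix_mul, Matrix.mulVecLin_mul]; rfl

/-- The complex `2`-tensors with components `A i j`, on which `R ∈ SO(25)` acts by
`A ↦ R A Rᵀ`. -/
def tensorRep : Representation ℂ SO25 (Matrix (Fin 25) (Fin 25) ℂ) where
  toFun R := LinearMap.mulLeft ℂ (rotMatrix R) ∘ₗ LinearMap.mulRight ℂ (rotMatrix R)ᵀ
  map_one' := by ext A; simp [rotMatrix_one]
  map_mul' R S := by ext1 A; simp [rotMatrix_mul, Matrix.mul_assoc]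

/-- `V^⊥`: the complex vectors orthogonal to `𝐩`. This is all of `V` if `𝐩 = 0`. -/
def perp : Submodule ℂ (Fin 25 → ℂ) where
  carrier := {v | v ⬝ᵥ transverse p = 0}
  add_mem' := by
    intro v w hv hw
    change v ⬝ᵥ transverse p = 0 at hv
    change w ⬝ᵥ transverse p = 0 at hw
    change (v + w) ⬝ᵥ transverse p = 0
    rw [add_dotProduct, hv, hw, add_zero]
  zero_mem' := zero_dotProduct _
  smul_mem' := by
    intro a v hv
    change v ⬝ᵥ transverse p = 0 at hv
    change (a • v) ⬝ᵥ transverse p = 0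
    rw [smul_dotProduct, hv, smul_zero]

/-- `⊙²₀ V^⊥`: the symmetric traceless tensors in `V^⊥ ⊗ V^⊥`. -/
def symPerp : Submodule ℂ (Matrix (Fin 25) (Fin 25) ℂ) where
  carrier := {A | Aᵀ = A ∧ A.trace = 0 ∧ A *ᵥ transverse p = 0}
  add_mem' := by
    rintro A B ⟨h1, h2, h3⟩ ⟨h1', h2', h3'⟩
    exact ⟨by rw [Matrix.transpose_add, h1, h1'], by rw [Matrix.trace_add, h2, h2', add_zero],
      by rw [Matrix.add_mulVec, h3, h3', add_zero]⟩
  zero_mem' := ⟨Matrix.transpose_zero, Matrix.trace_zero _ _, Matrix.zero_mulVec _⟩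
  smul_mem' := by
    rintro a A ⟨h1, h2, h3⟩
    exact ⟨by rw [Matrix.transpose_smul, h1], by rw [Matrix.trace_smul, h2, smul_zero],
      by rw [Matrix.smul_mulVec, h3, smul_zero]⟩

/-- `Λ² V^⊥`: the skewsymmetric tensors in `V^⊥ ⊗ V^⊥`. -/
def skewPerp : Submodule ℂ (Matrix (Fin 25) (Fin 25) ℂ) where
  carrier := {A | Aᵀ = -A ∧ A *ᵥ transverse p = 0}
  add_mem' := by
    rintro A B ⟨h1, h3⟩ ⟨h1', h3'⟩
    exact ⟨by rw [Matrix.transpose_add, h1, h1', neg_add],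
      by rw [Matrix.add_mulVec, h3, h3', add_zero]⟩
  zero_mem' := ⟨by rw [Matrix.transpose_zero, neg_zero], Matrix.zero_mulVec _⟩
  smul_mem' := by
    rintro a A ⟨h1, h3⟩
    exact ⟨by rw [Matrix.transpose_smul, h1, smul_neg],
      by rw [Matrix.smul_mulVec, h3, smul_zero]⟩

/-- `V^⊥` as a representation of the stabiliser of `p`. -/
def perpRep : Representation ℂ (stab p) (perp p) :=
  Representation.subrepresentation (vectorRep.comp (stab p).subtype) (perp p) fun R v hv => by
    change v ⬝ᵥ transverse p = 0 at hv
    change (rotMatrix R.1 *ᵥ v) ⬝ᵥ transverse p = 0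
    rw [dotProduct_comm, Matrix.dotProduct_mulVec, ← Matrix.mulVec_transpose,
      rotMatrix_transpose_transverse, dotProduct_comm, hv]

/-- `⊙²₀ V^⊥` as a representation of the stabiliser of `p`. -/
def symPerpRep : Representation ℂ (stab p) (symPerp p) :=
  Representation.subrepresentation (tensorRep.comp (stab p).subtype) (symPerp p) fun R A hA => by
    obtain ⟨h1, h2, h3⟩ := hA
    change _ ∧ _ ∧ _
    change (rotMatrix R.1 * (A * (rotMatrix R.1)ᵀ))ᵀ = rotMatrix R.1 * (A * (rotMatrix R.1)ᵀ) ∧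
      (rotMatrix R.1 * (A * (rotMatrix R.1)ᵀ)).trace = 0 ∧
      (rotMatrix R.1 * (A * (rotMatrix R.1)ᵀ)) *ᵥ transverse p = 0
    refine ⟨?_, ?_, ?_⟩
    · rw [Matrix.transpose_mul, Matrix.transpose_mul, Matrix.transpose_transpose, h1,
        Matrix.mul_assoc]
    · rw [Matrix.trace_mul_comm, Matrix.mul_assoc, rotMatrix_transpose_mul, Matrix.mul_one, h2]
    · rw [← Matrix.mulVec_mulVec, ← Matrix.mulVec_mulVec, rotMatrix_transpose_transverse, h3,
        Matrix.mulVec_zero]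

/-- `Λ² V^⊥` as a representation of the stabiliser of `p`. -/
def skewPerpRep : Representation ℂ (stab p) (skewPerp p) :=
  Representation.subrepresentation (tensorRep.comp (stab p).subtype) (skewPerp p) fun R A hA => by
    obtain ⟨h1, h3⟩ := hA
    change (rotMatrix R.1 * (A * (rotMatrix R.1)ᵀ))ᵀ = -(rotMatrix R.1 * (A * (rotMatrix R.1)ᵀ)) ∧
      (rotMatrix R.1 * (A * (rotMatrix R.1)ᵀ)) *ᵥ transverse p = 0
    refine ⟨?_, ?_⟩
    · rw [Matrix.transpose_mul, Matrix.transpose_mul, Matrix.transpose_transpose, h1,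
        Matrix.mul_assoc, Matrix.neg_mul, Matrix.mul_neg]
    · rw [← Matrix.mulVec_mulVec, ← Matrix.mulVec_mulVec, rotMatrix_transpose_transverse, h3,
        Matrix.mulVec_zero]

/-- Multiplicities `a, b, c, e` of a representation `a ℂ ⊕ b V^⊥ ⊕ c ⊙²₀ V^⊥ ⊕ e Λ² V^⊥`. -/
structure Multiplicity where
  scalar : ℕ
  vector : ℕ
  sym : ℕ
  skew : ℕ

/-- The representation `a ℂ ⊕ b V^⊥ ⊕ c ⊙²₀ V^⊥ ⊕ e Λ² V^⊥` of the stabiliser of `p`. -/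
def isotypic (m : Multiplicity) : Representation ℂ (stab p)
    ((Fin m.scalar →₀ ℂ) × (Fin m.vector →₀ perp p) ×
      (Fin m.sym →₀ symPerp p) × (Fin m.skew →₀ skewPerp p)) :=
  ((Representation.trivial ℂ (stab p) ℂ).finsupp (Fin m.scalar)).prod
    (((perpRep p).finsupp (Fin m.vector)).prod
      (((symPerpRep p).finsupp (Fin m.sym)).prod ((skewPerpRep p).finsupp (Fin m.skew))))

/-- A row of the tables: the multiplicities in the cochains, cocycles, coboundaries and
cohomology. -/
structure Row where
  C : Multiplicity
  Z : Multiplicity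
  B : Multiplicity
  H : Multiplicity

/-- The table for `p = (0, 𝐩)` with `𝐩 ≠ 0`. -/
def tableGeneric : ℤ → Row
  | 0 => ⟨⟨1, 0, 0, 0⟩, ⟨0, 0, 0, 0⟩, ⟨0, 0, 0, 0⟩, ⟨0, 0, 0, 0⟩⟩
  | 1 => ⟨⟨12, 4, 0, 0⟩, ⟨2, 1, 0, 0⟩, ⟨1, 0, 0, 0⟩, ⟨1, 1, 0, 0⟩⟩
  | 2 => ⟨⟨42, 18, 3, 1⟩, ⟨14, 7, 1, 1⟩, ⟨10, 3, 0, 0⟩, ⟨4, 4, 1, 1⟩⟩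
  | 3 => ⟨⟨62, 28, 6, 2⟩, ⟨34, 17, 4, 2⟩, ⟨28, 11, 2, 0⟩, ⟨6, 6, 2, 2⟩⟩
  | 4 => ⟨⟨42, 18, 3, 1⟩, ⟨32, 15, 3, 1⟩, ⟨28, 11, 2, 0⟩, ⟨4, 4, 1, 1⟩⟩
  | 5 => ⟨⟨12, 4, 0, 0⟩, ⟨11, 4, 0, 0⟩, ⟨10, 3, 0, 0⟩, ⟨1, 1, 0, 0⟩⟩
  | 6 => ⟨⟨1, 0, 0, 0⟩, ⟨1, 0, 0, 0⟩, ⟨1, 0, 0, 0⟩, ⟨0, 0, 0, 0⟩⟩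
  | _ => ⟨⟨0, 0, 0, 0⟩, ⟨0, 0, 0, 0⟩, ⟨0, 0, 0, 0⟩, ⟨0, 0, 0, 0⟩⟩

/-- The table for `p = 0`, where the stabiliser is all of `SO(25)` and `V^⊥ = V`. -/
def tableZero : ℤ → Row
  | 0 => ⟨⟨1, 0, 0, 0⟩, ⟨1, 0, 0, 0⟩, ⟨0, 0, 0, 0⟩, ⟨1, 0, 0, 0⟩⟩
  | 1 => ⟨⟨8, 4, 0, 0⟩, ⟨2, 2, 0, 0⟩, ⟨0, 0, 0, 0⟩, ⟨2, 2, 0, 0⟩⟩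
  | 2 => ⟨⟨25, 14, 3, 1⟩, ⟨10, 6, 1, 1⟩, ⟨6, 2, 0, 0⟩, ⟨4, 4, 1, 1⟩⟩
  | 3 => ⟨⟨36, 20, 6, 2⟩, ⟨21, 12, 4, 2⟩, ⟨15, 8, 2, 0⟩, ⟨6, 4, 2, 2⟩⟩
  | 4 => ⟨⟨25, 14, 3, 1⟩, ⟨19, 12, 3, 1⟩, ⟨15, 8, 2, 0⟩, ⟨4, 4, 1, 1⟩⟩
  | 5 => ⟨⟨8, 4, 0, 0⟩, ⟨8, 4, 0, 0⟩, ⟨6, 2, 0, 0⟩, ⟨2, 2, 0, 0⟩⟩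
  | 6 => ⟨⟨1, 0, 0, 0⟩, ⟨1, 0, 0, 0⟩, ⟨0, 0, 0, 0⟩, ⟨1, 0, 0, 0⟩⟩
  | _ => ⟨⟨0, 0, 0, 0⟩, ⟨0, 0, 0, 0⟩, ⟨0, 0, 0, 0⟩, ⟨0, 0, 0, 0⟩⟩

/-- The cochains, cocycles, coboundaries and cohomology of ghost number `n` decompose, as
representations of the stabiliser of `p`, with the multiplicities in the given row. -/
def DecomposesAs (r : Row) : Prop :=
  Nonempty ((cochainRep p n).Equiv (isotypic p r.C)) ∧
    Nonempty ((cocycleRep τ p n).Equiv (isotypic p r.Z)) ∧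
    Nonempty ((coboundaryRep τ p n).Equiv (isotypic p r.B)) ∧
    Nonempty ((cohomologyRep τ p n).Equiv (isotypic p r.H))

end

end CarrollString

/-! The zero mode of `T + T^gh` is diagonal on monomial states, with eigenvalue the total weight of
the creation modes (`mem_ker_Ltot`). The momentum does not contribute, because `∂X` has no zero
mode. The only creation modes of negative weight are `c_1` and `C_1`, both fermionic. A state in the
kernel therefore has ghost weight at least `-2` and matter weight at most `2`, and only finitely
many sets of ghost modes occur (`exists_lowMask`). So the complex is finite-dimensional, and on it
the nested infinite sums in `d` have finitely many nonzero terms (`brst_state`).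

The differential can be made independent of `τ` and of the length of `𝐩`. Put `R_0 = κ Π_0`, `R_i =
i τ κ ∂X^i`, `Q_0 = κ⁻¹ ∂X^0`, `Q_i = (i τ κ)⁻¹ Π_i`. Then `T = Q · R` and `κ² M = ½ R · R`: all 26
directions enter alike. For `p_0 = 0` the momentum survives only as the zero mode `p / (τ κ)` of
`Q`. If `𝐩 ≠ 0`, the choice `κ = |𝐩| / τ` makes it a unit vector; if `𝐩 = 0`, it vanishes and `κ =
1` will do. The remaining factor `κ²` in front of `M` is absorbed by scaling each state according to
its number of `C` modes minus its number of `B` modes, a number that only the term `C M` of the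
current changes.

The stabiliser fixes `r` orthonormal axes: the time axis, and that of `𝐩` if `𝐩 ≠ 0`. A matter
polynomial of weight at most two is a sum of explicit equivariant images of `ℂ`, `V^⊥`, `⊙²₀ V^⊥`
and `Λ² V^⊥`. These come from splitting vectors and 2-tensors into components along the axes and
transverse parts, and transverse tensors into trace, traceless symmetric and skew parts
(`matterW_le_covSpan`). The images are independent by explicit projections
(`extract_covariant_self`, `extract_covariant_of_ne`). Combined with the ghost states they give an
equivariant isomorphism `assemble` from a sum of copies of the four representations onto the
cochains. Under it, twice `d` becomes an integer matrix on each multiplicity space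
(`IsFrame.brst_sectorState`, `IsFrame.brst_assemble`). Schur's lemma and complete reducibility are
not used; everything happens on multiplicity indices, on which the group does not act.

What remains is finite. Dimensions, vanishing of the squares and ranks of these matrices are
evaluated (`hasTable_scalar_two` and its companions), the ranks by elimination (`rank_eq_elimRank`).
The dimension 26 enters through the trace `26 - r` of the transverse projection, by which the
central charge of the matter cancels that of the ghosts. A complex of matrices over a field splits
(`exists_splitting`), and the splitting remains one after tensoring with a representation. Hence
cocycles, coboundaries and cohomology are sums of the same four representations, with multiplicities
determined by dimensions and ranks. Duality and the Euler characteristic are then read off the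
cohomology columns, because dimensions and dimensions of `Hom(W, ·)` are additive in the
multiplicities. -/

namespace CarrollString

open scoped Matrix

noncomputable section

/-! ### Matrices acting on vectors with values in a module -/

section act

variable {ι κ l W W' : Type*} [Fintype κ] [Fintype l] [AddCommGroup W] [Module ℂ W]
  [AddCommGroup W'] [Module ℂ W']

/-- The action of a matrix on vectors with entries in a module. -/
def act (A : Matrix ι κ ℂ) : (κ → W) →ₗ[ℂ] (ι → W) where
  toFun f i := ∑ j, A i j • f j
  map_add' f g := by funext i; simp [Finset.sum_add_distrib]
  map_smul' a f := by
    funext i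
    simp only [Pi.smul_apply, RingHom.id_apply, Finset.smul_sum]
    exact Finset.sum_congr rfl fun j _ => smul_comm _ _ _

lemma act_apply (A : Matrix ι κ ℂ) (f : κ → W) (i : ι) : act A f i = ∑ j, A i j • f j := rfl

lemma act_mul (A : Matrix ι κ ℂ) (B : Matrix κ l ℂ) (f : l → W) :
    act (A * B) f = act A (act B f) := by
  funext i
  simp only [act_apply, Matrix.mul_apply, Finset.sum_smul, Finset.smul_sum, smul_smul]
  exact Finset.sum_comm

lemma act_one [DecidableEq κ] (f : κ → W) : act (1 : Matrix κ κ ℂ) f = f := by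
  funext i
  simp [act_apply, Matrix.one_apply]

lemma act_zero (f : κ → W) : act (0 : Matrix ι κ ℂ) f = 0 := by
  funext i
  simp [act_apply]

lemma act_add (A B : Matrix ι κ ℂ) (f : κ → W) : act (A + B) f = act A f + act B f := by
  funext i
  simp [act_apply, add_smul, Finset.sum_add_distrib]

end act

/-! ### Splitting a three-term complex of matrices -/

/-- Over a field `f` has a linear section on its range, and `g` composed with the section extends to
`V₁`. Two preimages of a point differ by an element of `ker f`, which `g` kills, so the section does
not matter. -/
lemma exists_comp_of_ker_le {V V₁ V₂ : Type*} [AddCommGroup V] [Module ℂ V] [AddCommGroup V₁]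
    [Module ℂ V₁] [AddCommGroup V₂] [Module ℂ V₂] (f : V →ₗ[ℂ] V₁) (g : V →ₗ[ℂ] V₂)
    (h : LinearMap.ker f ≤ LinearMap.ker g) : ∃ L : V₁ →ₗ[ℂ] V₂, g = L ∘ₗ f := by
  obtain ⟨s, hs⟩ := f.rangeRestrict.exists_rightInverse_of_surjective (LinearMap.range_rangeRestrict f)
  obtain ⟨t, ht⟩ := LinearMap.exists_extend (g ∘ₗ s)
  refine ⟨t, LinearMap.ext fun v => ?_⟩
  have h1 := LinearMap.congr_fun ht (f.rangeRestrict v)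
  have h2 := LinearMap.congr_fun hs (f.rangeRestrict v)
  have h3 : f (s (f.rangeRestrict v)) = f v := congrArg Subtype.val h2
  have h4 : s (f.rangeRestrict v) - v ∈ LinearMap.ker g :=
    h (by rw [LinearMap.mem_ker, map_sub, h3, sub_self])
  rw [LinearMap.mem_ker, map_sub, sub_eq_zero] at h4
  exact (h1.trans h4).symm

/-- `I` is the image of `D'`, `K` the kernel of `D`, and `H` a complement of `I` in `K`. The pairs
`X`, `X'` and `Y`, `Y'` are coordinates on `I` and on `H`. On `K` the map `X' X + Y' Y` is the
identity, so its defect factors through `D` and gives `L`; `S` lifts the coordinates on `I` to `V₁`.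
Since the splitting is expressed by identities between maps, it can be applied to vectors with
entries in any representation. -/
lemma exists_splitting_linear {V V₁ V₂ : Type*} [AddCommGroup V] [Module ℂ V]
    [FiniteDimensional ℂ V] [AddCommGroup V₁] [Module ℂ V₁] [AddCommGroup V₂] [Module ℂ V₂]
    (D' : V₁ →ₗ[ℂ] V) (D : V →ₗ[ℂ] V₂) (hD : D ∘ₗ D' = 0) (b h : ℕ)
    (hb : Module.finrank ℂ (LinearMap.range D') = b)
    (hh : Module.finrank ℂ (LinearMap.range D) + b + h = Module.finrank ℂ V) :
    ∃ (X : V →ₗ[ℂ] (Fin b → ℂ)) (X' : (Fin b → ℂ) →ₗ[ℂ] V) (Y : V →ₗ[ℂ] (Fin h → ℂ))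
      (Y' : (Fin h → ℂ) →ₗ[ℂ] V) (S : (Fin b → ℂ) →ₗ[ℂ] V₁) (L : V₂ →ₗ[ℂ] V),
      X ∘ₗ X' = LinearMap.id ∧ X ∘ₗ Y' = 0 ∧ Y ∘ₗ X' = 0 ∧ Y ∘ₗ Y' = LinearMap.id ∧
      D' ∘ₗ S = X' ∧ D ∘ₗ Y' = 0 ∧ Y ∘ₗ D' = 0 ∧
      X' ∘ₗ X + Y' ∘ₗ Y + L ∘ₗ D = LinearMap.id := by
  set I := LinearMap.range D'
  set K := LinearMap.ker D
  have hIK : I ≤ K := by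
    rintro _ ⟨v, rfl⟩
    exact LinearMap.congr_fun hD v
  obtain ⟨Cm, hC⟩ := Submodule.exists_isCompl I
  set H := Cm ⊓ K
  -- The modular law, available because `I ≤ K`, turns a complement of `I` in `V` into one in `K`.
  have hsup : I ⊔ H = K := by
    change I ⊔ Cm ⊓ K = K
    rw [← sup_inf_assoc_of_le Cm hIK, hC.sup_eq_top, top_inf_eq]
  have hinf : I ⊓ H = ⊥ := by
    rw [← inf_assoc, hC.inf_eq_bot, bot_inf_eq]
  have hH : Module.finrank ℂ H = h := by
    have h1 := Submodule.finrank_sup_add_finrank_inf_eq I H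
    rw [hsup, hinf, finrank_bot, hb] at h1
    have h2 := LinearMap.finrank_range_add_finrank_ker D
    change _ + Module.finrank ℂ K = _ at h2
    omega
  let eI : (Fin b → ℂ) ≃ₗ[ℂ] I := LinearEquiv.ofFinrankEq _ _ (by rw [hb]; simp)
  let eH : (Fin h → ℂ) ≃ₗ[ℂ] H := LinearEquiv.ofFinrankEq _ _ (by rw [hH]; simp)
  let X : V →ₗ[ℂ] (Fin b → ℂ) := eI.symm.toLinearMap ∘ₗ I.projectionOnto Cm hC
  let X' : (Fin b → ℂ) →ₗ[ℂ] V := I.subtype ∘ₗ eI.toLinearMap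
  let Y' : (Fin h → ℂ) →ₗ[ℂ] V := H.subtype ∘ₗ eH.toLinearMap
  obtain ⟨Y0, hY0⟩ := Y'.exists_leftInverse_of_injective
    (LinearMap.ker_eq_bot.2 (H.injective_subtype.comp eH.injective))
  have hXX : ∀ x, X (X' x) = x := fun x => by
    change eI.symm (I.projectionOnto Cm hC (eI x)) = x
    rw [Submodule.projectionOnto_apply_left, LinearEquiv.symm_apply_apply]
  have hXC : ∀ v ∈ Cm, X v = 0 := fun v hv => by
    change eI.symm (I.projectionOnto Cm hC v) = 0
    rw [(Submodule.projectionOnto_apply_eq_zero_iff hC).2 hv, map_zero]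
  have hXY : ∀ y, X (Y' y) = 0 := fun y => hXC _ (eH y).2.1
  have hX'I : ∀ v ∈ I, X' (X v) = v := fun v hv => by
    obtain ⟨x, hx⟩ := eI.surjective ⟨v, hv⟩
    have : X' x = v := by simp only [X', LinearMap.comp_apply, LinearEquiv.coe_coe, hx]; rfl
    rw [← this, hXX]
  -- Removing the component in `I` first makes `Y` vanish on `I`, which a left inverse of `Y'` alone
  -- need not do.
  let Y := Y0 ∘ₗ (LinearMap.id - X' ∘ₗ X)
  have hY : ∀ v, Y v = Y0 (v - X' (X v)) := fun v => rfl
  have hYY : ∀ y, Y (Y' y) = y := fun y => by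
    rw [hY, hXY, map_zero, sub_zero]
    exact LinearMap.congr_fun hY0 y
  have hYI : ∀ v ∈ I, Y v = 0 := fun v hv => by rw [hY, hX'I v hv, sub_self, map_zero]
  have hker : K ≤ LinearMap.ker (LinearMap.id - X' ∘ₗ X - Y' ∘ₗ Y) := by
    intro v hv
    have hm : v - X' (X v) ∈ H := by
      refine ⟨?_, K.sub_mem hv (hIK (eI _).2)⟩
      refine (Submodule.projectionOnto_apply_eq_zero_iff hC).1 ?_
      apply eI.symm.injective
      rw [map_zero]
      change X (v - X' (X v)) = 0
      rw [map_sub, hXX, sub_self]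
    obtain ⟨y, hy⟩ := eH.surjective ⟨_, hm⟩
    have hy' : Y' y = v - X' (X v) := by
      simp only [Y', LinearMap.comp_apply, LinearEquiv.coe_coe, hy]; rfl
    have hYv : Y v = y := by rw [hY, ← hy']; exact LinearMap.congr_fun hY0 y
    change v - X' (X v) - Y' (Y v) = 0
    rw [hYv, hy', sub_self]
  obtain ⟨L, hL⟩ := exists_comp_of_ker_le D _ hker
  obtain ⟨S, hS⟩ := (X ∘ₗ D').exists_rightInverse_of_surjective (by
    rw [LinearMap.range_eq_top]
    intro x
    obtain ⟨v, hv⟩ := (eI x).2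
    refine ⟨v, ?_⟩
    rw [LinearMap.comp_apply, hv]
    exact hXX x)
  refine ⟨X, X', Y, Y', S, L, LinearMap.ext hXX, LinearMap.ext hXY,
    LinearMap.ext fun x => hYI _ (eI x).2, LinearMap.ext hYY, ?_, ?_, ?_, ?_⟩
  · refine LinearMap.ext fun x => ?_
    rw [LinearMap.comp_apply, ← hX'I (D' (S x)) ⟨_, rfl⟩]
    exact congrArg X' (LinearMap.congr_fun hS x)
  · exact LinearMap.ext fun y => (eH y).2.2
  · exact LinearMap.ext fun v => hYI _ ⟨v, rfl⟩
  · rw [← hL]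
    abel

lemma exists_splitting {I I' J : Type*} [Fintype I] [Fintype I'] [Fintype J] [DecidableEq I]
    [DecidableEq I'] [DecidableEq J] (D' : Matrix I I' ℂ) (D : Matrix J I ℂ) (hD : D * D' = 0)
    (b h : ℕ) (hb : D'.rank = b) (hh : D.rank + b + h = Fintype.card I) :
    ∃ (X : Matrix (Fin b) I ℂ) (X' : Matrix I (Fin b) ℂ) (Y : Matrix (Fin h) I ℂ)
      (Y' : Matrix I (Fin h) ℂ) (S : Matrix I' (Fin b) ℂ) (L : Matrix I J ℂ),
      X * X' = 1 ∧ X * Y' = 0 ∧ Y * X' = 0 ∧ Y * Y' = 1 ∧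
      D' * S = X' ∧ D * Y' = 0 ∧ Y * D' = 0 ∧ X' * X + Y' * Y + L * D = 1 := by
  obtain ⟨X, X', Y, Y', S, L, h1, h2, h3, h4, h5, h6, h7, h8⟩ :=
    exists_splitting_linear (Matrix.toLin' D') (Matrix.toLin' D)
      (by rw [← Matrix.toLin'_mul, hD, map_zero]) b h
      (by rw [← hb, Matrix.rank_eq_finrank_range_toLin D' (Pi.basisFun _ _) (Pi.basisFun _ _),
            Matrix.toLin_eq_toLin'])
      (by rw [← Matrix.toLin_eq_toLin',
            ← Matrix.rank_eq_finrank_range_toLin D (Pi.basisFun _ _) (Pi.basisFun _ _), hh]; simp)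
  refine ⟨X.toMatrix', X'.toMatrix', Y.toMatrix', Y'.toMatrix', S.toMatrix', L.toMatrix', ?_⟩
  refine ⟨?_, ?_, ?_, ?_, ?_, ?_, ?_, ?_⟩
  · simpa [LinearMap.toMatrix'_comp] using congrArg LinearMap.toMatrix' h1
  · simpa [LinearMap.toMatrix'_comp] using congrArg LinearMap.toMatrix' h2
  · simpa [LinearMap.toMatrix'_comp] using congrArg LinearMap.toMatrix' h3
  · simpa [LinearMap.toMatrix'_comp] using congrArg LinearMap.toMatrix' h4
  · simpa [LinearMap.toMatrix'_comp] using congrArg LinearMap.toMatrix' h5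
  · simpa [LinearMap.toMatrix'_comp] using congrArg LinearMap.toMatrix' h6
  · simpa [LinearMap.toMatrix'_comp] using congrArg LinearMap.toMatrix' h7
  · simpa [LinearMap.toMatrix'_comp] using congrArg LinearMap.toMatrix' h8

/-! ### The rank of an integer matrix by elimination -/

/-- The rank of a list of integer vectors with `n` entries, by fraction-free elimination. -/
def elimRank : ℕ → List (List ℤ) → ℕ
  | 0, _ => 0
  | n + 1, rows =>
    match rows.filter (fun r => r.headD 0 != 0) with
    | [] => elimRank n (rows.map List.tail)
    | r :: rs => elimRank n ((rows.filter (fun r => r.headD 0 == 0)).map List.tail ++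
        rs.map fun s => List.zipWith (fun x y => r.headD 0 * y - s.headD 0 * x) r.tail s.tail) + 1

/-- The vector with the entries of a list. -/
def listVec (n : ℕ) (r : List ℤ) : Fin n → ℂ := fun i => ((r.getD i 0 : ℤ) : ℂ)

/-- The span of a list of integer vectors. -/
def listSpan (n : ℕ) (rows : List (List ℤ)) : Submodule ℂ (Fin n → ℂ) :=
  Submodule.span ℂ {v | ∃ r ∈ rows, v = listVec n r}

/-- Inserting a zero as the first coordinate. -/
def consZero (n : ℕ) : (Fin n → ℂ) →ₗ[ℂ] (Fin (n + 1) → ℂ) where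
  toFun v := Fin.cons 0 v
  map_add' v w := by funext i; refine Fin.cases ?_ (fun j => ?_) i <;> simp
  map_smul' a v := by funext i; refine Fin.cases ?_ (fun j => ?_) i <;> simp

lemma consZero_injective (n : ℕ) : Function.Injective (consZero n) := fun v w h => by
  funext i
  simpa [consZero] using congrFun h i.succ

lemma finrank_map_consZero (n : ℕ) (N : Submodule ℂ (Fin n → ℂ)) :
    Module.finrank ℂ (N.map (consZero n)) = Module.finrank ℂ N :=
  (N.equivMapOfInjective (consZero n) (consZero_injective n)).finrank_eq.symm

lemma listVec_zero (n : ℕ) (r : List ℤ) : listVec (n + 1) r 0 = ((r.headD 0 : ℤ) : ℂ) := by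
  cases r <;> simp [listVec]

lemma listVec_succ (n : ℕ) (r : List ℤ) (i : Fin n) :
    listVec (n + 1) r i.succ = listVec n r.tail i := by
  cases r <;> simp [listVec]

lemma listVec_consZero (n : ℕ) (r : List ℤ) (h : r.headD 0 = 0) :
    listVec (n + 1) r = consZero n (listVec n r.tail) := by
  funext i
  refine Fin.cases ?_ (fun j => ?_) i
  · rw [listVec_zero, h]
    simp [consZero]
  · rw [listVec_succ]
    simp [consZero]

lemma map_consZero_listSpan (n : ℕ) (rows : List (List ℤ)) :
    (listSpan n rows).map (consZero n) =
      Submodule.span ℂ {v | ∃ r ∈ rows, v = consZero n (listVec n r)} := by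
  rw [listSpan, Submodule.map_span]
  congr 1
  ext v
  constructor
  · rintro ⟨_, ⟨r, hr, rfl⟩, rfl⟩
    exact ⟨r, hr, rfl⟩
  · rintro ⟨r, hr, rfl⟩
    exact ⟨_, ⟨r, hr, rfl⟩, rfl⟩

/-- Induction on the number of columns. If all leading entries vanish, the first column can be
dropped. Otherwise a row `r` with nonzero leading entry is the pivot, and each further such row `s`
is replaced by `r₀ s - s₀ r`. Together with `r` the new rows span the same space, and the line of
`r` meets the span of the rows with leading entry zero only in zero, so the pivot adds exactly one.
-/
theorem finrank_listSpan (n : ℕ) : ∀ rows : List (List ℤ), (∀ r ∈ rows, r.length = n) →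
    Module.finrank ℂ (listSpan n rows) = elimRank n rows := by
  induction n with
  | zero =>
    intro rows _
    rw [elimRank]
    exact Nat.le_zero.1 ((Submodule.finrank_le _).trans (by simp))
  | succ n ih =>
    intro rows hlen
    rw [elimRank]
    split
    · rename_i hf
      have h0 : ∀ r ∈ rows, r.headD 0 = 0 := by
        intro r hr
        by_contra hne
        have : r ∈ rows.filter (fun r => r.headD 0 != 0) := List.mem_filter.2 ⟨hr, by simpa using hne⟩
        rw [hf] at this
        simp at this
      rw [← ih _ (by
        intro r hr
        obtain ⟨s, hs, rfl⟩ := List.mem_map.1 hr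
        simp [hlen s hs])]
      have : listSpan (n + 1) rows = (listSpan n (rows.map List.tail)).map (consZero n) := by
        rw [map_consZero_listSpan, listSpan]
        congr 1
        ext v
        constructor
        · rintro ⟨r, hr, rfl⟩
          exact ⟨r.tail, List.mem_map_of_mem hr, listVec_consZero n r (h0 r hr)⟩
        · rintro ⟨_, hs, rfl⟩
          obtain ⟨r, hr, rfl⟩ := List.mem_map.1 hs
          exact ⟨r, hr, (listVec_consZero n r (h0 r hr)).symm⟩
      rw [this, finrank_map_consZero]
    · rename_i r rs hf
      set rows' := (rows.filter (fun r => r.headD 0 == 0)).map List.tail ++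
        rs.map fun s => List.zipWith (fun x y => r.headD 0 * y - s.headD 0 * x) r.tail s.tail
        with hrows'
      have hr : r ∈ rows ∧ r.headD 0 ≠ 0 := by
        have : r ∈ rows.filter (fun r => r.headD 0 != 0) := by rw [hf]; simp
        simpa using List.mem_filter.1 this
      have hrs : ∀ s ∈ rs, s ∈ rows := by
        intro s hs
        have : s ∈ rows.filter (fun r => r.headD 0 != 0) := by rw [hf]; simp [hs]
        exact (List.mem_filter.1 this).1
      have hcases : ∀ s ∈ rows, s.headD 0 = 0 ∨ s = r ∨ s ∈ rs := by
        intro s hs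
        by_cases h : s.headD 0 = 0
        · exact Or.inl h
        · have : s ∈ rows.filter (fun r => r.headD 0 != 0) :=
            List.mem_filter.2 ⟨hs, by simpa using h⟩
          rw [hf] at this
          simpa using Or.inr this
      have hz : ∀ s ∈ rs, consZero n (listVec n
          (List.zipWith (fun x y => r.headD 0 * y - s.headD 0 * x) r.tail s.tail)) =
          ((r.headD 0 : ℤ) : ℂ) • listVec (n + 1) s - ((s.headD 0 : ℤ) : ℂ) • listVec (n + 1) r := by
        intro s hs
        funext i
        refine Fin.cases ?_ (fun j => ?_) i
        · simp only [Pi.sub_apply, Pi.smul_apply, listVec_zero, smul_eq_mul]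
          simp [consZero, mul_comm]
        · simp only [Pi.sub_apply, Pi.smul_apply, listVec_succ, smul_eq_mul]
          have h1 : (j : ℕ) < r.tail.length := by simp [hlen r hr.1]
          have h2 : (j : ℕ) < s.tail.length := by simp [hlen s (hrs s hs)]
          simp only [consZero, listVec, LinearMap.coe_mk, AddHom.coe_mk, Fin.cons_succ]
          rw [List.getD_eq_getElem _ _ (by simp [hlen r hr.1, hlen s (hrs s hs)]),
            List.getD_eq_getElem _ _ h1, List.getD_eq_getElem _ _ h2, List.getElem_zipWith]
          push_cast
          ring
      rw [← ih rows' (by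
        intro s hs
        rcases List.mem_append.1 hs with hs | hs <;> obtain ⟨t, ht, rfl⟩ := List.mem_map.1 hs
        · simp [hlen t (List.mem_filter.1 ht).1]
        · simp [hlen t (hrs t ht), hlen r hr.1])]
      have hr0 : ((r.headD 0 : ℤ) : ℂ) ≠ 0 := Int.cast_ne_zero.2 hr.2
      have hmap : listSpan (n + 1) rows =
          (ℂ ∙ listVec (n + 1) r) ⊔ (listSpan n rows').map (consZero n) := by
        rw [map_consZero_listSpan]
        apply le_antisymm
        · rw [listSpan, Submodule.span_le]
          rintro _ ⟨s, hs, rfl⟩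
          rcases hcases s hs with h | rfl | h
          · refine Submodule.mem_sup_right (Submodule.subset_span ⟨s.tail, ?_, listVec_consZero n s h⟩)
            exact List.mem_append_left _ (List.mem_map_of_mem (List.mem_filter.2 ⟨hs, by simpa using h⟩))
          · exact Submodule.mem_sup_left (Submodule.mem_span_singleton_self _)
          · have hm := Submodule.subset_span (R := ℂ)
              (s := {v | ∃ r ∈ rows', v = consZero n (listVec n r)})
              ⟨_, List.mem_append_right _ (List.mem_map_of_mem h), rfl⟩
            rw [hz s h] at hm
            have h1 := Submodule.add_mem _ (Submodule.mem_sup_right (S := ℂ ∙ listVec (n + 1) r) hm)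
              (Submodule.mem_sup_left (Submodule.smul_mem _ ((s.headD 0 : ℤ) : ℂ)
                (Submodule.mem_span_singleton_self (R := ℂ) (listVec (n + 1) r))))
            rw [sub_add_cancel] at h1
            -- The reduced row plus `s₀ r` is `r₀ s`; dividing by the pivot entry recovers `s`.
            exact (Submodule.smul_mem_iff _ hr0).1 h1
        · rw [sup_le_iff, Submodule.span_singleton_le_iff_mem, Submodule.span_le]
          refine ⟨Submodule.subset_span ⟨r, hr.1, rfl⟩, ?_⟩
          rintro _ ⟨s, hs, rfl⟩
          rcases List.mem_append.1 hs with hs | hs <;> obtain ⟨t, ht, rfl⟩ := List.mem_map.1 hs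
          · obtain ⟨ht, ht'⟩ := List.mem_filter.1 ht
            exact Submodule.subset_span ⟨t, ht, (listVec_consZero n t (by simpa using ht')).symm⟩
          · rw [hz t ht]
            exact Submodule.sub_mem _
              (Submodule.smul_mem _ _ (Submodule.subset_span ⟨t, hrs t ht, rfl⟩))
              (Submodule.smul_mem _ _ (Submodule.subset_span ⟨r, hr.1, rfl⟩))
      have hdisj : (ℂ ∙ listVec (n + 1) r) ⊓ (listSpan n rows').map (consZero n) = ⊥ := by
        rw [eq_bot_iff]
        rintro _ ⟨h1, ⟨w, _, rfl⟩⟩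
        obtain ⟨a, ha⟩ := Submodule.mem_span_singleton.1 h1
        have h0 := congrFun ha 0
        rw [Pi.smul_apply, listVec_zero] at h0
        have : a = 0 := (mul_eq_zero.1 h0).resolve_right hr0
        rw [← ha, this, zero_smul]
        exact Submodule.zero_mem _
      have h := Submodule.finrank_sup_add_finrank_inf_eq (ℂ ∙ listVec (n + 1) r)
        ((listSpan n rows').map (consZero n))
      rw [← hmap, hdisj, finrank_bot, finrank_span_singleton (by
        intro h
        have := congrFun h 0
        rw [listVec_zero] at this
        exact hr0 this), finrank_map_consZero] at h
      omega

/-- The rank of an integer matrix is computed by elimination on the list of its rows. -/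
theorem rank_eq_elimRank {m n : ℕ} (A : Matrix (Fin m) (Fin n) ℤ) :
    (A.map (Int.cast : ℤ → ℂ)).rank =
      elimRank n (List.ofFn fun i => List.ofFn fun j => A i j) := by
  rw [← finrank_listSpan n _ (by
    intro r hr
    obtain ⟨i, rfl⟩ := List.mem_ofFn.1 hr
    simp), Matrix.rank_eq_finrank_span_row]
  have : Set.range (A.map (Int.cast : ℤ → ℂ)).row = {v | ∃ r ∈ List.ofFn fun i => List.ofFn fun j => A i j, v = listVec n r} := by
   ext v
   constructor
   · rintro ⟨i, rfl⟩
     refine ⟨_, List.mem_ofFn.2 ⟨i, rfl⟩, ?_⟩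
     funext j
     simp [listVec, Matrix.row]
   · rintro ⟨r, hr, rfl⟩
     obtain ⟨i, rfl⟩ := List.mem_ofFn.1 hr
     refine ⟨i, ?_⟩
     funext j
     simp [listVec, Matrix.row]
  rw [this, listSpan]

/-! ### A combinatorial model of the complex -/

/-- Labels of the basic covariants in the matter polynomials of weight at most two. -/
inductive Label
  | one
  | lin (i : ℕ)
  | der (i : ℕ)
  | quad (i j : ℕ)
  | tr (i : ℕ)
  deriving DecidableEq

/-- The weight of a covariant. -/
def Label.weight : Label → ℕ
  | one => 0
  | lin _ => 1
  | _ => 2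

/-- A multiplicity space of the matter polynomials, with twice the action of the modes of `T` and
`M`. -/
structure MatterModel where
  labels : List Label
  T : ℤ → Label → List (ℤ × Label)
  M : ℤ → Label → List (ℤ × Label)

/-- A product of two covariants, in a normalised order. -/
def mkQuad (i j : ℕ) : Label := if i ≤ j then .quad i j else .quad j i

/-- The invariants under the rotations that fix the first `r` axes. The letters `2 a` and `2 a + 1`
are the components of `Q` and `R` along the axis `a`, and the momentum is along the axis `1`. -/
def scalarModel (r : ℕ) : MatterModel where
  labels := .one :: (List.range (2 * r)).map .lin ++ (List.range (2 * r)).map .der ++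
    (List.range (2 * r)).flatMap (fun j => (List.range (j + 1)).map fun i => .quad i j) ++
    [.tr 0, .tr 1, .tr 2]
  T n m := match n, m with
    | 0, m => [(2 * m.weight, m)]
    -- The contraction `Q · R` is a sum over the axes plus the transverse trace `tr 1`. The letter
    -- `3` is `R` along the momentum axis; its terms are absent for `r = 1`, where the momentum is
    -- zero.
    | -2, .one => (List.range r).map (fun a => (2, .quad (2 * a) (2 * a + 1))) ++ [(2, .tr 1)] ++
        if r = 2 then [(2, .der 3)] else []
    | -1, .one => if r = 2 then [(2, .lin 3)] else []
    | -1, .lin i => (2, .der i) :: if r = 2 then [(2, mkQuad i 3)] else []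
    | 1, .lin i => if i = 2 then [(2, .one)] else []
    | 1, .der i => [(4, .lin i)]
    | 1, .quad i j => (if i = 2 then [(2, .lin j)] else []) ++ if j = 2 then [(2, .lin i)] else []
    | 2, .der i => if i = 2 then [(4, .one)] else []
    | 2, .quad i j => if i % 2 = 0 ∧ j = i + 1 then [(2, .one)] else []
    -- The coefficient is twice the trace `26 - r` of the transverse projection.
    | 2, .tr i => if i = 1 then [(2 * (26 - r), .one)] else []
    | _, _ => []
  M n m := match n, m with
    | -2, .one => (List.range r).map (fun a => (1, .quad (2 * a + 1) (2 * a + 1))) ++ [(1, .tr 2)]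
    | -1, .lin i => if i % 2 = 0 then [(2, .der (i + 1))] else []
    | 0, .lin i => if i % 2 = 0 then [(2, .lin (i + 1))] else []
    | 0, .der i => if i % 2 = 0 then [(4, .der (i + 1))] else []
    | 0, .quad i j => (if i % 2 = 0 then [(2, mkQuad (i + 1) j)] else []) ++
        if j % 2 = 0 then [(2, mkQuad i (j + 1))] else []
    | 0, .tr i => if i = 0 then [(4, .tr 1)] else if i = 1 then [(2, .tr 2)] else []
    | 1, .der i => if i % 2 = 0 then [(4, .lin (i + 1))] else []
    | 2, .quad i j => if i % 2 = 0 ∧ j = i then [(2, .one)] else []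
    | 2, .tr i => if i = 0 then [(2 * (26 - r), .one)] else []
    | _, _ => []

/-- The covariants with values in the transverse vectors: `lin 0`, `lin 1` are `Q`, `R`, and the
first index of `quad` is a letter of the invariants. -/
def vectorModel (r : ℕ) : MatterModel where
  labels := [.lin 0, .lin 1, .der 0, .der 1] ++
    (List.range (2 * r)).flatMap (fun i => [.quad i 0, .quad i 1])
  T n m := match n, m with
    | 0, m => [(2 * m.weight, m)]
    | -1, .lin i => (2, .der i) :: if r = 2 then [(2, .quad 3 i)] else []
    | 1, .der i => [(4, .lin i)]
    | 1, .quad i j => if i = 2 then [(2, .lin j)] else []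
    | _, _ => []
  M n m := match n, m with
    | -1, .lin i => if i = 0 then [(2, .der 1)] else []
    | 0, .lin i => if i = 0 then [(2, .lin 1)] else []
    | 0, .der i => if i = 0 then [(4, .der 1)] else []
    | 0, .quad i j => (if i % 2 = 0 then [(2, .quad (i + 1) j)] else []) ++
        if j = 0 then [(2, .quad i 1)] else []
    | 1, .der i => if i = 0 then [(4, .lin 1)] else []
    | _, _ => []

/-- The covariants with values in the traceless symmetric transverse tensors. -/
def symModel : MatterModel where
  labels := [.tr 0, .tr 1, .tr 2]
  T n m := match n with
    | 0 => [(2 * m.weight, m)]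
    | _ => []
  M n m := match n, m with
    | 0, .tr i => if i = 0 then [(4, .tr 1)] else if i = 1 then [(2, .tr 2)] else []
    | _, _ => []

/-- The covariant with values in the skewsymmetric transverse tensors. -/
def skewModel : MatterModel where
  -- `Q Q` and `R R` are symmetric, so only `Q R` has a skewsymmetric part.
  labels := [.tr 1]
  T n m := match n with
    | 0 => [(2 * m.weight, m)]
    | _ => []
  M _ _ := []

/-- The sign of the mode `i` passing the modes of the mask `s` before it. -/
def maskSign (i s : ℕ) : ℤ := (List.range i).foldr (fun j a => bif s.testBit j then -a else a) 1

/-- Creation (`true`) or annihilation (`false`) of the mode `i` on a mask. -/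
def maskOp (o : Bool × ℕ) (s : ℕ) : Option (ℤ × ℕ) :=
  match o.1, s.testBit o.2 with
  | true, true => none
  | true, false => some (maskSign o.2 s, s ||| 2 ^ o.2)
  | false, true => some (maskSign o.2 s, s ^^^ 2 ^ o.2)
  | false, false => none

/-- The ghost modes on masks: the modes `0, …, 5` and `6, …, 11` of a mask are `c₁, …, c₋₄` and
`C₁, …, C₋₄`; the modes `12, 13, 14` and `15, 16, 17` are `b₋₂, b₋₃, b₋₄` and `B₋₂, B₋₃, B₋₄`. -/
def ghostOp (e : ℕ) (n : ℤ) : Bool × ℕ :=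
  if n ≤ 1 then (true, 6 * e + (1 - n).toNat) else (false, 12 + 3 * e + (n - 2).toNat)

/-- The antighost modes on masks. -/
def antighostOp (e : ℕ) (n : ℤ) : Bool × ℕ :=
  if n ≤ -2 then (true, 12 + 3 * e + (-2 - n).toNat) else (false, 6 * e + (n + 1).toNat)

/-- Successive operations on a mask, the first one first. -/
def maskOps : List (Bool × ℕ) → ℕ → Option (ℤ × ℕ)
  | [], s => some (1, s)
  | o :: l, s =>
    match maskOp o s with
    | none => none
    | some (a, t) =>
      match maskOps l t with
      | none => none
      | some (b, u) => some (a * b, u)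

/-- The mode numbers that occur on states of weight zero. -/
def window : List ℤ := [-4, -3, -2, -1, 0, 1, 2]

/-- The factors of the normal-ordered product of an antighost mode and a ghost mode. -/
def pairOps (b e : ℕ) (j k : ℤ) : List (Bool × ℕ) :=
  if j ≤ -2 then [ghostOp e k, antighostOp b j] else [antighostOp b j, ghostOp e k]

/-- The factors of a cubic ghost term of the differential. -/
def cubicOps (a b e : ℕ) (l j : ℤ) : List (Bool × ℕ) :=
  if l ≤ 1 then pairOps b e j (-l - j) ++ [ghostOp a l] else ghostOp a l :: pairOps b e j (-l - j)

/-- The terms of twice the ghost part of the differential. -/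
def ghostTerms : List (ℤ × List (Bool × ℕ)) :=
  window.flatMap fun l => (window.filter fun j => -l - j ≤ 2).flatMap fun j =>
    -- The coefficient `2 n - j` of a pair at `n = -l`, with the sign that normal ordering gives to
    -- the pair when `j > -2`.
    [(if j ≤ -2 then -2 * l - j else 2 * l + j, cubicOps 0 0 0 l j),
      (if j ≤ -2 then -2 * l - j else 2 * l + j, cubicOps 0 1 1 l j),
      (if j ≤ -2 then -2 * l - j else 2 * l + j, cubicOps 1 1 0 l j)]

/-- The image of a mask under a term, as a linear combination. -/
def maskTerm (a : ℤ) (l : List (Bool × ℕ)) (s : ℕ) : List (ℤ × ℕ) :=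
  match maskOps l s with
  | none => []
  | some (b, t) => [(a * b, t)]

/-- Twice the ghost part of the differential. -/
def ghostDiff (s : ℕ) : List (ℤ × ℕ) := ghostTerms.flatMap fun x => maskTerm x.1 x.2 s

/-- Twice the differential. -/
def modelDiff (m : MatterModel) (x : ℕ × Label) : List (ℤ × ℕ × Label) :=
  ([-2, -1, 0, 1, 2].flatMap fun n =>
    ((maskTerm 1 [ghostOp 0 (-n)] x.1).flatMap fun z => (m.T n x.2).map fun y =>
      (y.1 * z.1, z.2, y.2)) ++
    ((maskTerm 1 [ghostOp 1 (-n)] x.1).flatMap fun z => (m.M n x.2).map fun y =>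
      (y.1 * z.1, z.2, y.2))) ++
  (ghostDiff x.1).map fun y => (y.1, y.2, x.2)

/-- All masks with modes in a list. -/
def masks : List ℕ → List ℕ
  | [] => [0]
  | i :: l => masks l ++ (masks l).map (· ||| 2 ^ i)

/-- The weight of a mode of a mask. -/
def bitWeight (i : ℕ) : ℤ :=
  if i < 6 then i - 1 else if i < 12 then i - 7 else if i < 15 then i - 10 else i - 13

/-- The sum of a function over the modes of a mask. -/
def maskSum (f : ℕ → ℤ) (s : ℕ) : ℤ :=
  ((List.range 18).map fun i => if s.testBit i then f i else 0).sum

/-- The masks of nonpositive weight. -/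
def lowMasks : List ℕ :=
  [0, 128, 64, 320, 192, 448, 68, 196, 2, 130, 66, 322, 194, 450, 70, 198, 1, 257, 129, 385, 65,
    32833, 4161, 577, 321, 193, 32961, 4289, 705, 449, 73, 201, 5, 133, 69, 325, 197, 453, 3, 259,
    131, 387, 67, 32835, 4163, 579, 323, 195, 32963, 4291, 707, 451, 75, 203, 7, 135, 71, 327,
    199, 455]

/-- The basis of the multiplicity space of cochains of ghost number `n`. -/
def basis (m : MatterModel) (n : ℤ) : List (ℕ × Label) :=
  (lowMasks.filter fun s => maskSum (fun i => if i < 12 then 1 else -1) s = n).flatMap fun s =>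
    (m.labels.filter fun x => maskSum bitWeight s + x.weight = 0).map fun x => (s, x)

/-- The position of a label in an enumeration of the labels that occur. -/
def Label.code : Label → ℕ
  | one => 0
  | lin i => 8 * i + 1
  | der i => 8 * i + 2
  | tr i => 8 * i + 3
  | quad i j => 8 * (4 * i + j) + 4

/-- A number that determines a basis element. -/
def key (x : ℕ × Label) : ℕ := x.1 + 262144 * x.2.code

/-- The coefficient of a basis element in a linear combination. -/
def listCoeff (k : ℕ) (v : List (ℤ × ℕ)) : ℤ :=
  v.foldr (fun x a => bif k.beq x.2 then x.1 + a else a) 0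

/-- The rows of the transposed matrix of twice the differential. -/
def diffRows (m : MatterModel) (n : ℤ) : List (List ℤ) :=
  (basis m n).map fun x => (basis m (n + 1)).map fun y =>
    listCoeff (key y) ((modelDiff m x).map fun z => (z.1, key z.2))

/-- The product of a row vector and a matrix with `n` columns. -/
def rowMul (n : ℕ) (r : List ℤ) (rows : List (List ℤ)) : List ℤ :=
  (r.zip rows).foldr (fun x a => if x.1 = 0 then a else List.zipWith (fun y z => x.1 * y + z) x.2 a)
    (List.replicate n 0)

/-! ### The modes as fields -/

lemma create_state (g : GhostMode) (S : Finset GhostMode) (P : MvPolynomial MatterMode ℂ) :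
    create g (state S P) = if g ∈ S then 0 else fermiSign g S • state (insert g S) P := by
  rw [create, fockLift_state]
  split <;> rfl

lemma annihilate_state (g : GhostMode) (S : Finset GhostMode) (P : MvPolynomial MatterMode ℂ) :
    annihilate g (state S P) = if g ∈ S then fermiSign g S • state (S.erase g) P else 0 := by
  rw [annihilate, fockLift_state]
  split <;> rfl

lemma exists_notMem (S : Finset GhostMode) (e : Fin 4) : ∃ K : ℕ, ∀ k, K ≤ k → toLex (e, k) ∉ S := by
  refine ⟨S.sup (fun g => (ofLex g).2) + 1, fun k hk hm => ?_⟩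
  have := Finset.le_sup (f := fun g : GhostMode => (ofLex g).2) hm
  simp at this
  omega

lemma isField_ghost (e t : Fin 4) : IsField (ghost e t) := by
  refine isField_of_state fun S P => ?_
  obtain ⟨K, hK⟩ := exists_notMem S t
  refine ⟨K + 2, fun n hn => ?_⟩
  rw [ghost, if_neg (by omega), annihilate_state, if_neg (hK _ (by omega))]

lemma isField_antighost (e t : Fin 4) : IsField (antighost e t) := by
  refine isField_of_state fun S P => ?_
  obtain ⟨K, hK⟩ := exists_notMem S e
  refine ⟨K, fun n hn => ?_⟩
  rw [antighost, if_neg (by omega), annihilate_state, if_neg (hK _ (by omega))]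

lemma IsField.deriv {A : Modes} (hA : IsField A) (h : ℤ) : IsField (CarrollString.deriv h A) := by
  intro v
  obtain ⟨N, hN⟩ := hA v
  exact ⟨N, fun n hn => by rw [CarrollString.deriv, LinearMap.smul_apply, hN n hn, smul_zero]⟩

lemma IsField.add {A B : Modes} (hA : IsField A) (hB : IsField B) : IsField (A + B) := by
  intro v
  obtain ⟨N, hN⟩ := hA v
  obtain ⟨N', hN'⟩ := hB v
  exact ⟨max N N', fun n hn => by
    rw [Pi.add_apply, LinearMap.add_apply, hN n (by omega), hN' n (by omega), add_zero]⟩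

lemma IsField.smul {A : Modes} (hA : IsField A) (a : ℂ) : IsField (a • A) := by
  intro v
  obtain ⟨N, hN⟩ := hA v
  exact ⟨N, fun n hn => by rw [Pi.smul_apply, LinearMap.smul_apply, hN n hn, smul_zero]⟩

lemma IsField.sub {A B : Modes} (hA : IsField A) (hB : IsField B) : IsField (A - B) := by
  have h := hA.add (hB.smul (-1))
  rwa [neg_one_smul, ← sub_eq_add_neg] at h

lemma IsField.sum {ι : Type} [Fintype ι] {A : ι → Modes} (hA : ∀ i, IsField (A i)) :
    IsField (∑ i, A i) := by
  have h := isField_sum hA fun _ => 1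
  simpa using h

/-- Needed because the products in the current are nested. For `l ≤ -h` the index `n - l` grows with
`n`, so `B` annihilates; for `l ≥ N` already `A_l` annihilates; for the finitely many `l` in
between, `B_{n-l}` annihilates `A_l v` once `n` is large. -/
lemma IsField.nop {A B : Modes} (hA : IsField A) (hB : IsField B) (h : ℤ) (ε : ℂ) :
    IsField (CarrollString.nop h ε A B) := by
  intro v
  obtain ⟨N, hN⟩ := hA v
  obtain ⟨N', hN'⟩ := hB v
  choose K hK using fun l => hB (A l v)
  -- The sum dominates `K l + l` for each intermediate `l`.
  refine ⟨max (N' - h) (∑ l ∈ Finset.Icc (-h) N, (|K l| + |N|)), fun n hn => ?_⟩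
  rw [nop_apply hA hB]
  refine finsum_eq_zero_of_forall_eq_zero fun l => ?_
  split
  · rw [Module.End.mul_apply, hN' _ (by omega), map_zero]
  · by_cases hl : N ≤ l
    · rw [LinearMap.smul_apply, Module.End.mul_apply, hN _ hl, map_zero, smul_zero]
    · have h1 : |K l| + |N| ≤ ∑ l ∈ Finset.Icc (-h) N, (|K l| + |N|) :=
        Finset.single_le_sum (f := fun l => |K l| + |N|) (fun _ _ => by positivity)
          (Finset.mem_Icc.2 ⟨by omega, by omega⟩)
      rw [LinearMap.smul_apply, Module.End.mul_apply, hK l, smul_zero]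
      have := le_abs_self (K l)
      have := le_abs_self N
      omega

lemma isField_stressT (p : Fin 26 → ℝ) : IsField (stressT p) :=
  IsField.sum fun μ => (isField_dX μ).nop (isField_piMode p μ) _ _

lemma isField_stressM (τ : ℝ) (p : Fin 26 → ℝ) : IsField (stressM τ p) :=
  (((isField_piMode p 0).nop (isField_piMode p 0) _ _).smul _).sub
    ((IsField.sum fun i : Fin 25 => (isField_dX i.succ).nop (isField_dX i.succ) _ _).smul _)

lemma isField_ghostT : IsField ghostT :=
  (((((isField_antighost 0 2).nop ((isField_ghost 0 2).deriv _) _ _).smul _).sub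
    (((isField_antighost 0 2).deriv _).nop (isField_ghost 0 2) _ _)).sub
    (((isField_antighost 1 3).nop ((isField_ghost 1 3).deriv _) _ _).smul _)).sub
    (((isField_antighost 1 3).deriv _).nop (isField_ghost 1 3) _ _)

lemma isField_ghostM : IsField ghostM :=
  (((isField_antighost 1 3).nop ((isField_ghost 0 2).deriv _) _ _).smul _).sub
    (((isField_antighost 1 3).deriv _).nop (isField_ghost 0 2) _ _)

/-! ### Ghost bilinears -/

/-- The normal-ordered product of an antighost mode and a ghost mode. -/
def ghostPair (B E : Modes) (j k : ℤ) : Module.End ℂ Fock :=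
  if j ≤ -2 then B j * E k else -(E k * B j)

/-- The modes of `-2 B ∂E - ∂B E` for an antighost `B` and a ghost `E`. -/
lemma ghostBilinear_apply {B E : Modes} (hB : IsField B) (hE : IsField E) (n : ℤ) (v : Fock) :
    ((-2 : ℂ) • nop 2 (-1) B (deriv (-1) E) n - nop 3 (-1) (deriv 2 B) E n) v =
      ∑ᶠ j : ℤ, ((2 * n - j : ℤ) : ℂ) • ghostPair B E j (n - j) v := by
  rw [LinearMap.sub_apply, LinearMap.smul_apply, nop_apply hB (hE.deriv _),
    nop_apply (hB.deriv _) hE]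
  rw [smul_finsum' _ (nop_locallyFinite hB (hE.deriv _) 2 (-1) n v),
    ← finsum_sub_distrib ?_ (nop_locallyFinite (hB.deriv _) hE 3 (-1) n v)]
  · refine finsum_congr fun j => ?_
    dsimp only
    rw [ghostPair]
    by_cases h1 : j ≤ -2
    · rw [if_pos h1, if_pos h1]
      by_cases h2 : j ≤ -3
      · rw [if_pos h2]
        simp only [deriv, Module.End.mul_apply, LinearMap.smul_apply, map_smul, smul_smul,
          ← sub_smul]
        congr 1
        push_cast
        ring
      -- The two products order their factors at different thresholds, `-2` and `-3`. At the one
      -- index in between the coefficient `-(j + 2)` of `∂B` vanishes, so the discrepancy is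
      -- harmless.
      · obtain rfl : j = -2 := by omega
        rw [if_neg h2]
        simp only [deriv, Module.End.mul_apply, LinearMap.smul_apply, map_smul, smul_smul]
        norm_num
        rw [← neg_smul]
        congr 1
        ring
    · rw [if_neg h1, if_neg h1, if_neg (by omega)]
      simp only [deriv, Module.End.mul_apply, LinearMap.smul_apply, LinearMap.neg_apply, map_smul,
        smul_smul, smul_neg, ← neg_smul, ← sub_smul]
      congr 1
      push_cast
      ring
  · refine (nop_locallyFinite hB (hE.deriv (-1)) 2 (-1) n v).subset fun l hl hl' => hl ?_
    dsimp only at hl' ⊢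
    rw [hl', smul_zero]

lemma ghostT_eq (n : ℤ) : ghostT n =
    ((-2 : ℂ) • nop 2 (-1) bGhost (deriv (-1) cGhost) n - nop 3 (-1) (deriv 2 bGhost) cGhost n) +
    ((-2 : ℂ) • nop 2 (-1) BGhost (deriv (-1) CGhost) n - nop 3 (-1) (deriv 2 BGhost) CGhost n) := by
  have h : ∀ a b c d : Module.End ℂ Fock, (-2 : ℂ) • a - b - (2 : ℂ) • c - d =
      ((-2 : ℂ) • a - b) + ((-2 : ℂ) • c - d) := fun a b c d => by
    rw [neg_smul, neg_smul]
    abel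
  exact h _ _ _ _

/-! ### The spectrum of the Virasoro zero mode -/

/-- The weight of a bosonic creation mode. -/
def modeWeight : MatterMode → ℕ := Sum.elim (fun m => m.2 + 1) (fun m => m.2 + 1)

/-- The weight of a fermionic creation mode. -/
def ghostWeight (g : GhostMode) : ℤ :=
  if (ofLex g).1 = 0 ∨ (ofLex g).1 = 1 then (ofLex g).2 - 1 else (ofLex g).2 + 2

/-- This is the number operator of `g`: erasing `g` does not change the modes before it, so the two
signs agree and multiply to one. -/
lemma create_annihilate (g : GhostMode) (S : Finset GhostMode) (P : MvPolynomial MatterMode ℂ) :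
    create g (annihilate g (state S P)) = if g ∈ S then state S P else 0 := by
  rw [annihilate_state]
  split
  · rename_i h
    rw [map_smul, create_state, if_neg (Finset.notMem_erase g S), Finset.insert_erase h, smul_smul]
    have : fermiSign g (S.erase g) = fermiSign g S := by
      rw [fermiSign, fermiSign]
      congr 2
      ext x
      simp only [Finset.mem_filter, Finset.mem_erase]
      exact ⟨fun h => ⟨h.1.2, h.2⟩, fun h => ⟨⟨h.2.ne, h.1⟩, h.2⟩⟩
    rw [this, fermiSign, ← mul_pow]
    norm_num
  · exact map_zero _

lemma natCast_toNat {j : ℤ} (h : 0 ≤ j) : ((j.toNat : ℕ) : ℂ) = (j : ℂ) := by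
  exact_mod_cast congrArg (Int.cast : ℤ → ℂ) (Int.toNat_of_nonneg h)

/-- In the zero mode each normal-ordered pair counts a single creation mode: the antighost mode with
label `-2 - j` if `j ≤ -2`, and the ghost mode with label `j + 1` otherwise. The coefficient, with
the sign of the ordering, is the weight of that mode. -/
lemma ghostPair_zero (e t : Fin 4) (S : Finset GhostMode) (P : MvPolynomial MatterMode ℂ) (j : ℤ) :
    ((2 * 0 - j : ℤ) : ℂ) • ghostPair (antighost e t) (ghost e t) j (0 - j) (state S P) =
      ∑ g ∈ S, (if j = -2 - (ofLex g).2 ∧ (ofLex g).1 = t then ((ofLex g).2 + 2 : ℂ) else 0) •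
          state S P +
        ∑ g ∈ S, (if j = (ofLex g).2 - 1 ∧ (ofLex g).1 = e then ((ofLex g).2 - 1 : ℂ) else 0) •
          state S P := by
  have hg : ∀ (g : GhostMode) (i : Fin 4) (k : ℕ), (ofLex g).1 = i → (ofLex g).2 = k →
      g = toLex (i, k) := by
    rintro g i k rfl rfl
    rfl
  by_cases hj : j ≤ -2
  · have h2 : ∑ g ∈ S, (if j = (ofLex g).2 - 1 ∧ (ofLex g).1 = e then ((ofLex g).2 - 1 : ℂ) else 0) •
        state S P = 0 := by
      refine Finset.sum_eq_zero fun g _ => ?_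
      rw [if_neg (by omega), zero_smul]
    rw [h2, add_zero, ghostPair, if_pos hj, Module.End.mul_apply, antighost, if_pos hj, ghost,
      if_neg (by omega), show (0 - j - 2).toNat = (-2 - j).toNat by omega, create_annihilate]
    split
    · rename_i hm
      rw [Finset.sum_eq_single_of_mem _ hm]
      · rw [if_pos ⟨by simp; omega, by simp⟩]
        congr 1
        simp only [ofLex_toLex, natCast_toNat (show 0 ≤ -2 - j by omega)]
        push_cast
        ring
      · intro g _ hne
        rw [if_neg, zero_smul]
        rintro ⟨h3, h4⟩
        exact hne (hg _ _ _ h4 (by omega))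
    · rename_i hm
      rw [smul_zero]
      refine (Finset.sum_eq_zero fun g hgS => ?_).symm
      rw [if_neg, zero_smul]
      rintro ⟨h3, h4⟩
      exact hm (by rwa [← hg g t (-2 - j).toNat h4 (by omega)])
  · have h2 : ∑ g ∈ S, (if j = -2 - (ofLex g).2 ∧ (ofLex g).1 = t then ((ofLex g).2 + 2 : ℂ) else 0) •
        state S P = 0 := by
      refine Finset.sum_eq_zero fun g _ => ?_
      rw [if_neg (by omega), zero_smul]
    rw [h2, zero_add, ghostPair, if_neg hj, LinearMap.neg_apply, Module.End.mul_apply, antighost,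
      if_neg hj, ghost, if_pos (by omega), show (1 - (0 - j)).toNat = (j + 1).toNat by omega,
      create_annihilate]
    split
    · rename_i hm
      rw [Finset.sum_eq_single_of_mem _ hm]
      · rw [if_pos ⟨by simp; omega, by simp⟩, smul_neg, ← neg_smul]
        congr 1
        simp only [ofLex_toLex, natCast_toNat (show 0 ≤ j + 1 by omega)]
        push_cast
        ring
      · intro g _ hne
        rw [if_neg, zero_smul]
        rintro ⟨h3, h4⟩
        exact hne (hg _ _ _ h4 (by omega))
    · rename_i hm
      rw [neg_zero, smul_zero]
      refine (Finset.sum_eq_zero fun g hgS => ?_).symm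
      rw [if_neg, zero_smul]
      rintro ⟨h3, h4⟩
      exact hm (by rwa [← hg g e (j + 1).toNat h4 (by omega)])

lemma finsum_ite_eq_smul (a : ℤ) (q : Prop) [Decidable q] (c : ℂ) (v : Fock) :
    ∑ᶠ j : ℤ, (if j = a ∧ q then c else 0) • v = (if q then c else 0) • v := by
  rw [finsum_eq_single _ a]
  · simp
  · intro j hj
    simp [hj]

lemma finite_support_ite_smul (a : ℤ) (q : Prop) [Decidable q] (c : ℂ) (v : Fock) :
    (Function.support fun j : ℤ => (if j = a ∧ q then c else 0) • v).Finite := by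
  refine (Set.finite_singleton a).subset fun j hj => ?_
  by_contra hne
  refine hj ?_
  simp only [Set.mem_singleton_iff] at hne
  simp [hne]

lemma finite_support_sum {α : Type} {s : Finset α} {f : ℤ → α → Fock}
    (h : ∀ a ∈ s, (Function.support fun j => f j a).Finite) :
    (Function.support fun j => ∑ a ∈ s, f j a).Finite := by
  refine (Set.Finite.biUnion s.finite_toSet h).subset fun j hj => ?_
  by_contra hne
  refine hj (Finset.sum_eq_zero fun a ha => ?_)
  simp only [Set.mem_iUnion, not_exists] at hne
  exact Function.notMem_support.1 (hne a ha)

lemma ghostBilinear_zero_state (e t : Fin 4) (S : Finset GhostMode)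
    (P : MvPolynomial MatterMode ℂ) :
    ((-2 : ℂ) • nop 2 (-1) (antighost e t) (deriv (-1) (ghost e t)) 0 -
      nop 3 (-1) (deriv 2 (antighost e t)) (ghost e t) 0) (state S P) =
      ∑ g ∈ S, ((if (ofLex g).1 = t then ((ofLex g).2 + 2 : ℂ) else 0) +
        (if (ofLex g).1 = e then ((ofLex g).2 - 1 : ℂ) else 0)) • state S P := by
  rw [ghostBilinear_apply (isField_antighost e t) (isField_ghost e t)]
  simp only [ghostPair_zero]
  rw [finsum_add_distrib, finsum_sum_comm, finsum_sum_comm]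
  · simp only [finsum_ite_eq_smul, add_smul, Finset.sum_add_distrib]
  · exact fun g _ => finite_support_ite_smul _ _ _ _
  · exact fun g _ => finite_support_ite_smul _ _ _ _
  · exact finite_support_sum fun g _ => finite_support_ite_smul _ _ _ _
  · exact finite_support_sum fun g _ => finite_support_ite_smul _ _ _ _

lemma ghostT_zero_state (S : Finset GhostMode) (P : MvPolynomial MatterMode ℂ) :
    ghostT 0 (state S P) = ((∑ g ∈ S, ghostWeight g : ℤ) : ℂ) • state S P := by
  rw [ghostT_eq, LinearMap.add_apply, bGhost, cGhost, BGhost, CGhost, ghostBilinear_zero_state,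
    ghostBilinear_zero_state, ← Finset.sum_add_distrib, Int.cast_sum, Finset.sum_smul]
  refine Finset.sum_congr rfl fun g _ => ?_
  rw [← add_smul]
  congr 1
  rw [ghostWeight]
  rcases g with ⟨i, k⟩
  change (if i = 2 then (k + 2 : ℂ) else 0) + (if i = 0 then (k - 1 : ℂ) else 0) +
    ((if i = 3 then (k + 2 : ℂ) else 0) + (if i = 1 then (k - 1 : ℂ) else 0)) =
    ((if i = 0 ∨ i = 1 then (k : ℤ) - 1 else k + 2 : ℤ) : ℂ)
  fin_cases i <;> simp

/-! ### The matter fields on polynomials -/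

/-- The modes `x^μ_n` on polynomials. -/
def xPoly (μ : Fin 26) : ℤ → Module.End ℂ (MvPolynomial MatterMode ℂ)
  | Int.negSucc k => LinearMap.mulLeft ℂ (MvPolynomial.X (Sum.inl (μ, k)))
  | Int.ofNat 0 => 0
  | Int.ofNat (k + 1) => -(MvPolynomial.pderiv (Sum.inr (μ, k))).toLinearMap

/-- The modes `(π_μ)_n` on polynomials. -/
def piPoly (p : Fin 26 → ℝ) (μ : Fin 26) : ℤ → Module.End ℂ (MvPolynomial MatterMode ℂ)
  | Int.negSucc k => LinearMap.mulLeft ℂ (MvPolynomial.X (Sum.inr (μ, k)))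
  | Int.ofNat 0 => (Complex.I * (p μ : ℂ)) • 1
  | Int.ofNat (k + 1) => (MvPolynomial.pderiv (Sum.inl (μ, k))).toLinearMap

lemma xMode_state (μ : Fin 26) (n : ℤ) (S : Finset GhostMode) (P : MvPolynomial MatterMode ℂ) :
    xMode μ n (state S P) = state S (xPoly μ n P) := by
  rcases n with (_ | k) | k
  · exact (map_zero _).symm
  · exact bosonic_state _ _ _
  · exact bosonic_state _ _ _

lemma piMode_state (p : Fin 26 → ℝ) (μ : Fin 26) (n : ℤ) (S : Finset GhostMode)
    (P : MvPolynomial MatterMode ℂ) :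
    piMode p μ n (state S P) = state S (piPoly p μ n P) := by
  rcases n with (_ | k) | k
  · exact ((state S).map_smul _ _).symm
  · exact bosonic_state _ _ _
  · exact bosonic_state _ _ _

/-- The modes of `∂X^μ` on polynomials. -/
def dXPoly (μ : Fin 26) : ℤ → Module.End ℂ (MvPolynomial MatterMode ℂ) :=
  fun n => (-(n : ℂ)) • xPoly μ n

lemma dX_state (μ : Fin 26) (n : ℤ) (S : Finset GhostMode) (P : MvPolynomial MatterMode ℂ) :
    dX μ n (state S P) = state S (dXPoly μ n P) := by
  rw [dX, deriv, LinearMap.smul_apply, xMode_state, dXPoly, LinearMap.smul_apply, map_smul]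
  simp

/-- A normal-ordered product of two modes on polynomials. -/
def polyPair (A B : ℤ → Module.End ℂ (MvPolynomial MatterMode ℂ)) (n l : ℤ) :
    Module.End ℂ (MvPolynomial MatterMode ℂ) :=
  if l ≤ -1 then A l * B (n - l) else B (n - l) * A l

lemma nop_state {A B : Modes} {a b : ℤ → Module.End ℂ (MvPolynomial MatterMode ℂ)}
    (hA : IsField A) (hB : IsField B) (ha : ∀ n S P, A n (state S P) = state S (a n P))
    (hb : ∀ n S P, B n (state S P) = state S (b n P)) (n : ℤ) (S : Finset GhostMode)
    (P : MvPolynomial MatterMode ℂ) :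
    nop 1 1 A B n (state S P) = ∑ᶠ l, state S (polyPair a b n l P) := by
  rw [nop_apply hA hB]
  refine finsum_congr fun l => ?_
  rw [polyPair]
  split
  · rw [Module.End.mul_apply, hb, ha, Module.End.mul_apply]
  · rw [LinearMap.smul_apply, one_smul, Module.End.mul_apply, ha, hb, Module.End.mul_apply]

lemma X_mul_pderiv_monomial (m : MatterMode) (d : MatterMode →₀ ℕ) (a : ℂ) :
    MvPolynomial.X m * MvPolynomial.pderiv m (MvPolynomial.monomial d a) =
      (d m : ℂ) • MvPolynomial.monomial d a := by
  classical
  rw [MvPolynomial.pderiv_monomial, MvPolynomial.X, MvPolynomial.monomial_mul, one_mul,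
    MvPolynomial.smul_monomial, smul_eq_mul, mul_comm a]
  by_cases h : d m = 0
  · simp [h]
  · rw [add_comm, tsub_add_cancel_of_le (by
      rw [Finsupp.single_le_iff]; omega)]

/-- The mode number of the annihilation operator `∂X` or `Π` conjugate to a creation mode, with a
minus sign in the first case. -/
def modeIndex : MatterMode → ℤ := Sum.elim (fun m => -(m.2 + 1)) (fun m => m.2 + 1)

/-- The spacetime index of a creation mode. -/
def modeAxis : MatterMode → Fin 26 := Sum.elim Prod.fst Prod.fst

/-- The mode that is counted by the term `l` of the zero mode of `∂X^μ Π_μ`. -/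
lemma polyPair_zero_monomial (p : Fin 26 → ℝ) (μ : Fin 26) (l : ℤ) (d : MatterMode →₀ ℕ) (a : ℂ) :
    polyPair (dXPoly μ) (piPoly p μ) 0 l (MvPolynomial.monomial d a) =
      ∑ m ∈ d.support, (if l = modeIndex m ∧
        modeAxis m = μ then (d m * modeWeight m : ℂ) else 0) •
          MvPolynomial.monomial d a := by
  classical
  have key : ∀ m : MatterMode, modeAxis m = μ →
      l = modeIndex m →
      ∑ m ∈ d.support, (if l = modeIndex m ∧
        modeAxis m = μ then (d m * modeWeight m : ℂ) else 0) •
          MvPolynomial.monomial d a = (d m * modeWeight m : ℂ) • MvPolynomial.monomial d a := by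
    intro m h1 h2
    -- `modeIndex` is negative for the modes of `x` and positive for those of `π`, so together with
    -- the axis it determines the mode.
    have huniq : ∀ m', modeAxis m' = μ →
        l = modeIndex m' → m' = m := by
      rcases m with ⟨ν, k⟩ | ⟨ν, k⟩ <;> rintro (⟨ν', k'⟩ | ⟨ν', k'⟩) h3 h4 <;>
        simp only [modeIndex, modeAxis, Sum.elim_inl, Sum.elim_inr] at h1 h2 h3 h4
      · rw [h1, h3, show k' = k by omega]
      · omega
      · omega
      · rw [h1, h3, show k' = k by omega]
    rw [Finset.sum_eq_single m]
    · rw [if_pos ⟨h2, h1⟩]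
    · intro m' _ hne
      rw [if_neg fun h => hne (huniq m' h.2 h.1), zero_smul]
    · intro hm
      rw [Finsupp.notMem_support_iff.1 hm]
      simp
  rcases l with (_ | k) | k
  · rw [polyPair, if_neg (by simp)]
    rw [Finset.sum_eq_zero]
    · simp [dXPoly, xPoly]
    · intro m _
      rw [if_neg, zero_smul]
      rcases m with m | m <;> simp [modeIndex] <;> omega
  · rw [key (Sum.inr (μ, k)) rfl rfl, polyPair, if_neg (by simp)]
    rw [show (0 : ℤ) - Int.ofNat (k + 1) = Int.negSucc k by rw [Int.negSucc_eq]; simp]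
    simp only [Module.End.mul_apply, dXPoly, piPoly, xPoly, LinearMap.smul_apply,
      Derivation.coeFn_coe, LinearMap.mulLeft_apply, mul_smul_comm,
      smul_neg, X_mul_pderiv_monomial, smul_smul, ← neg_smul, modeWeight, Sum.elim_inr]
    congr 1
    push_cast [Int.ofNat_eq_natCast]
    ring
  · rw [key (Sum.inl (μ, k)) rfl (by simp [modeIndex, Int.negSucc_eq]), polyPair,
      if_pos (by rw [Int.negSucc_eq]; omega)]
    rw [show (0 : ℤ) - Int.negSucc k = Int.ofNat (k + 1) by rw [Int.negSucc_eq]; simp]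
    simp only [Module.End.mul_apply, dXPoly, piPoly, xPoly, LinearMap.smul_apply,
      Derivation.coeFn_coe, LinearMap.mulLeft_apply,
      X_mul_pderiv_monomial, smul_smul, modeWeight, Sum.elim_inl]
    congr 1
    push_cast [Int.negSucc_eq]
    ring

/-- Again a sum of number operators. The momentum sits in the zero mode of `Π`, which is paired with
the zero mode of `∂X`, and the latter vanishes; so the spectrum is the same for every `p`. -/
lemma stressT_zero_monomial (p : Fin 26 → ℝ) (S : Finset GhostMode) (d : MatterMode →₀ ℕ)
    (a : ℂ) : stressT p 0 (state S (MvPolynomial.monomial d a)) =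
      ((Finsupp.weight modeWeight d : ℕ) : ℂ) • state S (MvPolynomial.monomial d a) := by
  rw [stressT, Finset.sum_apply, LinearMap.sum_apply]
  have h : ∀ μ, nop 1 1 (dX μ) (piMode p μ) 0 (state S (MvPolynomial.monomial d a)) =
      ∑ m ∈ d.support, (if modeAxis m = μ then (d m * modeWeight m : ℂ) else 0) •
        state S (MvPolynomial.monomial d a) := by
    intro μ
    rw [nop_state (a := dXPoly μ) (b := piPoly p μ) (isField_dX μ) (isField_piMode p μ) (dX_state μ)
      (piMode_state p μ)]
    simp only [polyPair_zero_monomial, map_sum, map_smul]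
    rw [finsum_sum_comm]
    · simp only [finsum_ite_eq_smul]
    · exact fun m _ => finite_support_ite_smul _ _ _ _
  simp only [h]
  rw [Finset.sum_comm, Finsupp.weight_apply, Finsupp.sum, Nat.cast_sum, Finset.sum_smul]
  refine Finset.sum_congr rfl fun m _ => ?_
  rw [← Finset.sum_smul, Finset.sum_ite_eq, if_pos (Finset.mem_univ _), smul_eq_mul, Nat.cast_mul]

/-- The polynomials of weight `w`. -/
abbrev matterW (w : ℕ) : Submodule ℂ (MvPolynomial MatterMode ℂ) :=
  MvPolynomial.weightedHomogeneousSubmodule ℂ modeWeight w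

lemma coeff_state (S S' : Finset GhostMode) (P : MvPolynomial MatterMode ℂ) :
    coeff S (state S' P) = if S' = S then P else 0 := by
  classical
  change (Finsupp.single S' P) S = _
  rw [Finsupp.single_apply]

lemma fock_eq_of_coeff {v w : Fock} (h : ∀ S, coeff S v = coeff S w) : v = w := Finsupp.ext h

/-- Both summands are number operators on monomial states, so the operator is diagonal with the
total weight as eigenvalue. -/
lemma coeff_Ltot (p : Fin 26 → ℝ) (S : Finset GhostMode) (d : MatterMode →₀ ℕ) (v : Fock) :
    MvPolynomial.coeff d (coeff S (Ltot p v)) =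
      ((∑ g ∈ S, ghostWeight g + (Finsupp.weight modeWeight d : ℕ) : ℤ) : ℂ) *
        MvPolynomial.coeff d (coeff S v) := by
  classical
  induction v using fock_induction with
  | zero => simp
  | add v w hv hw => simp only [map_add, MvPolynomial.coeff_add, hv, hw, mul_add]
  | single S' P =>
    induction P using MvPolynomial.induction_on' with
    | add P Q hP hQ => simp only [map_add, MvPolynomial.coeff_add, hP, hQ, mul_add]
    | monomial d' a =>
      rw [Ltot, LinearMap.add_apply, stressT_zero_monomial, ghostT_zero_state, ← add_smul,
        map_smul, MvPolynomial.coeff_smul, coeff_state, smul_eq_mul]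
      by_cases hS : S' = S
      · subst hS
        rw [if_pos rfl, MvPolynomial.coeff_monomial]
        by_cases hd : d' = d
        · subst hd
          push_cast
          ring
        · simp [hd]
      · simp [hS]

lemma mem_ker_Ltot (p : Fin 26 → ℝ) (v : Fock) : v ∈ LinearMap.ker (Ltot p) ↔
    ∀ S d, MvPolynomial.coeff d (coeff S v) ≠ 0 →
      ∑ g ∈ S, ghostWeight g + (Finsupp.weight modeWeight d : ℕ) = 0 := by
  rw [LinearMap.mem_ker]
  constructor
  · intro h S d hne
    have h1 := coeff_Ltot p S d v
    rw [h, map_zero, MvPolynomial.coeff_zero] at h1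
    exact_mod_cast (mul_eq_zero.1 h1.symm).resolve_right hne
  · intro h
    refine fock_eq_of_coeff fun S => MvPolynomial.ext _ _ fun d => ?_
    rw [coeff_Ltot, map_zero, MvPolynomial.coeff_zero, mul_eq_zero]
    by_cases hne : MvPolynomial.coeff d (coeff S v) = 0
    · exact Or.inr hne
    · exact Or.inl (by exact_mod_cast h S d hne)

lemma state_mem_cochains (p : Fin 26 → ℝ) {S : Finset GhostMode} {w : ℕ} {n : ℤ}
    {P : MvPolynomial MatterMode ℂ} (hS : ∑ g ∈ S, ghostWeight g + w = 0) (hn : ghostNumber S = n)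
    (hP : P ∈ matterW w) : state S P ∈ cochains p n := by
  refine ⟨(mem_ker_Ltot p _).2 fun S' d hne => ?_, ?_⟩
  · rw [coeff_state] at hne
    split at hne
    · rename_i h
      rw [← h, hP hne, hS]
    · simp at hne
  · change _ ∈ ghostDegree n
    simp only [ghostDegree, Submodule.mem_iInf, LinearMap.mem_ker]
    intro S' hS'
    rw [coeff_state, if_neg]
    rintro rfl
    exact hS' hn

/-- The cochains are the sums of the states of weight zero. -/
lemma cochains_le_span (p : Fin 26 → ℝ) (n : ℤ) : cochains p n ≤ Submodule.span ℂ
    {v | ∃ S w P, ∑ g ∈ S, ghostWeight g + (w : ℕ) = 0 ∧ ghostNumber S = n ∧ P ∈ matterW w ∧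
      v = state S P} := by
  intro v hv
  have h1 := (mem_ker_Ltot p v).1 hv.1
  have h2 : v ∈ ghostDegree n := hv.2
  simp only [ghostDegree, Submodule.mem_iInf, LinearMap.mem_ker] at h2
  have hv' : v = ∑ S ∈ Finsupp.support v, state S (coeff S v) :=
    (Finsupp.sum_single v).symm
  rw [hv']
  refine Submodule.sum_mem _ fun S hS => ?_
  rw [(coeff S v).as_sum, map_sum]
  refine Submodule.sum_mem _ fun d hd => Submodule.subset_span ?_
  refine ⟨S, _, _, h1 S d (MvPolynomial.mem_support_iff.1 hd), ?_,
    MvPolynomial.isWeightedHomogeneous_monomial _ _ _ rfl, rfl⟩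
  by_contra hne
  exact (Finsupp.mem_support_iff.1 hS) (h2 S hne)

/-! ### States of low weight: the matter modes -/

lemma pderiv_eq_zero_of_weight {w : ℕ} {P : MvPolynomial MatterMode ℂ} (hP : P ∈ matterW w)
    {m : MatterMode} (hm : w < modeWeight m) : MvPolynomial.pderiv m P = 0 := by
  classical
  refine MvPolynomial.pderiv_eq_zero_of_notMem_vars fun hv => ?_
  obtain ⟨d, hd, hmd⟩ := (MvPolynomial.mem_vars_iff_mem_support m).1 hv
  have h1 : Finsupp.weight modeWeight d = w := hP (MvPolynomial.mem_support_iff.1 hd)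
  have h2 := Finsupp.le_weight_of_ne_zero' modeWeight (Finsupp.mem_support_iff.1 hmd)
  omega

lemma pderiv_mem_matterW {w : ℕ} {P : MvPolynomial MatterMode ℂ} (hP : P ∈ matterW w)
    {m : MatterMode} (hm : modeWeight m ≤ w) :
    MvPolynomial.pderiv m P ∈ matterW (w - modeWeight m) :=
  MvPolynomial.IsWeightedHomogeneous.pderiv hP (by omega)

/-- The modes of a current of weight one, acting on polynomials. -/
structure IsCurrent (a : ℤ → Module.End ℂ (MvPolynomial MatterMode ℂ)) : Prop where
  zero : ∃ c : ℂ, a 0 = c • 1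
  pos : ∀ n : ℤ, 0 < n → ∃ (c : ℂ) (m : MatterMode), (modeWeight m : ℤ) = n ∧
    a n = c • (MvPolynomial.pderiv m).toLinearMap

lemma isCurrent_dXPoly (μ : Fin 26) : IsCurrent (dXPoly μ) where
  zero := ⟨0, by simp [dXPoly]⟩
  pos n hn := by
    obtain ⟨k, rfl⟩ : ∃ k : ℕ, n = Int.ofNat (k + 1) := ⟨(n - 1).toNat, by simp; omega⟩
    refine ⟨((k + 1 : ℕ) : ℂ), Sum.inr (μ, k), rfl, ?_⟩
    rw [dXPoly, xPoly, smul_neg, neg_smul, neg_neg]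
    rfl

lemma isCurrent_piPoly (p : Fin 26 → ℝ) (μ : Fin 26) : IsCurrent (piPoly p μ) where
  zero := ⟨_, rfl⟩
  pos n hn := by
    obtain ⟨k, rfl⟩ : ∃ k : ℕ, n = Int.ofNat (k + 1) := ⟨(n - 1).toNat, by simp; omega⟩
    exact ⟨1, Sum.inl (μ, k), rfl, by rw [one_smul]; rfl⟩

section current

variable {a b : ℤ → Module.End ℂ (MvPolynomial MatterMode ℂ)} {w : ℕ}
  {P : MvPolynomial MatterMode ℂ}

lemma IsCurrent.apply_eq_zero (ha : IsCurrent a) (hP : P ∈ matterW w) {n : ℤ} (hn : w < n) :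
    a n P = 0 := by
  obtain ⟨c, m, hm, h⟩ := ha.pos n (by omega)
  rw [h, LinearMap.smul_apply, Derivation.coeFn_coe, pderiv_eq_zero_of_weight hP (by omega),
    smul_zero]

lemma IsCurrent.apply_mem (ha : IsCurrent a) (hP : P ∈ matterW w) {n : ℤ} (h0 : 0 ≤ n)
    (hn : n ≤ w) : a n P ∈ matterW (w - n.toNat) := by
  rcases h0.eq_or_lt with rfl | h0
  · obtain ⟨c, h⟩ := ha.zero
    rw [h]
    exact Submodule.smul_mem _ _ hP
  · obtain ⟨c, m, hm, h⟩ := ha.pos n h0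
    rw [h, ← hm, Int.toNat_natCast]
    exact Submodule.smul_mem _ _ (pderiv_mem_matterW hP (by omega))

lemma IsCurrent.apply_apply_eq_zero (ha : IsCurrent a) (hb : IsCurrent b) (hP : P ∈ matterW w)
    {m n : ℤ} (hn : 0 ≤ n) (hmn : w < m + n) (hm : 0 < m) : b m (a n P) = 0 := by
  by_cases h : n ≤ w
  · exact hb.apply_eq_zero (ha.apply_mem hP hn h) (by omega)
  · rw [ha.apply_eq_zero hP (by omega), map_zero]

/-- A mode of positive number lowers the weight by that number and kills whatever has smaller
weight. `polyPair` lets a lowering factor act first; if both factors lower the weight, they do so by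
`n` in total. -/
lemma polyPair_eq_zero (ha : IsCurrent a) (hb : IsCurrent b) (hP : P ∈ matterW w) {n l : ℤ}
    (h : w < l ∨ w < n - l ∨ w < n) : polyPair a b n l P = 0 := by
  rw [polyPair]
  split
  · rw [Module.End.mul_apply, hb.apply_eq_zero hP (by omega), map_zero]
  · rw [Module.End.mul_apply]
    by_cases hl : w < l
    · rw [ha.apply_eq_zero hP hl, map_zero]
    · exact ha.apply_apply_eq_zero hb hP (by omega) (by omega) (by omega)

end current

/-- Turns the infinite sums of the normal-ordered products into sums over explicit lists, which can
be matched with the combinatorial model. -/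
lemma finsum_eq_list_sum {M : Type} [AddCommMonoid M] {f : ℤ → M} {L : List ℤ} (hL : L.Nodup)
    (h : ∀ j, j ∉ L → f j = 0) : ∑ᶠ j, f j = (L.map f).sum := by
  rw [finsum_eq_sum_of_support_subset f (s := L.toFinset), List.sum_toFinset f hL]
  intro j hj
  by_contra hn
  exact hj (h j (by simpa using hn))

/-- The modes that contribute to the mode `n` of a bilinear field, on states of weight at most
two. -/
def pairWindow (n : ℤ) : List ℤ := window.filter fun j => n - j ≤ 2

lemma nodup_window : window.Nodup := by decide

lemma nodup_pairWindow (n : ℤ) : (pairWindow n).Nodup := nodup_window.filter _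

lemma mem_window {j : ℤ} : j ∈ window ↔ -4 ≤ j ∧ j ≤ 2 := by
  simp only [window, List.mem_cons, List.not_mem_nil, or_false]
  omega

lemma mem_pairWindow {n j : ℤ} : j ∈ pairWindow n ↔ (-4 ≤ j ∧ j ≤ 2) ∧ n - j ≤ 2 := by
  rw [pairWindow, List.mem_filter, mem_window, decide_eq_true_iff]

/-- The modes of a normal-ordered product of currents, on polynomials of weight at most two. -/
def lowPair (a b : ℤ → Module.End ℂ (MvPolynomial MatterMode ℂ)) (n : ℤ) :
    Module.End ℂ (MvPolynomial MatterMode ℂ) :=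
  ((pairWindow n).map fun l => polyPair a b n l).sum

lemma lowPair_apply (a b : ℤ → Module.End ℂ (MvPolynomial MatterMode ℂ)) (n : ℤ)
    (P : MvPolynomial MatterMode ℂ) :
    lowPair a b n P = ((pairWindow n).map fun l => polyPair a b n l P).sum := by
  rw [lowPair]
  induction pairWindow n with
  | nil => rfl
  | cons x l ih => rw [List.map_cons, List.sum_cons, LinearMap.add_apply, ih, List.map_cons,
      List.sum_cons]

lemma state_list_sum (S : Finset GhostMode) (L : List (MvPolynomial MatterMode ℂ)) :
    state S L.sum = (L.map (state S)).sum := map_list_sum (state S) L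

lemma nop_state_low {A B : Modes} {a b : ℤ → Module.End ℂ (MvPolynomial MatterMode ℂ)}
    (hA : IsField A) (hB : IsField B) (hAa : ∀ n S P, A n (state S P) = state S (a n P))
    (hBb : ∀ n S P, B n (state S P) = state S (b n P)) (ha : IsCurrent a) (hb : IsCurrent b)
    {w : ℕ} (hw : w ≤ 2) {P : MvPolynomial MatterMode ℂ} (hP : P ∈ matterW w) {n : ℤ}
    (hn : -2 ≤ n) (S : Finset GhostMode) :
    nop 1 1 A B n (state S P) = state S (lowPair a b n P) := by
  rw [nop_state hA hB hAa hBb, finsum_eq_list_sum (nodup_pairWindow n), lowPair_apply,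
    state_list_sum, List.map_map]
  · rfl
  · intro j hj
    rw [mem_pairWindow] at hj
    rw [polyPair_eq_zero ha hb hP (by omega), map_zero]

lemma lowPair_eq_zero {a b : ℤ → Module.End ℂ (MvPolynomial MatterMode ℂ)} (ha : IsCurrent a)
    (hb : IsCurrent b) {w : ℕ} {P : MvPolynomial MatterMode ℂ} (hP : P ∈ matterW w) {n : ℤ}
    (hn : w < n) : lowPair a b n P = 0 := by
  rw [lowPair_apply]
  refine List.sum_eq_zero fun x hx => ?_
  obtain ⟨l, _, rfl⟩ := List.mem_map.1 hx
  exact polyPair_eq_zero ha hb hP (by omega)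

/-- The modes of `T`, on polynomials of weight at most two. -/
def polyT (p : Fin 26 → ℝ) (n : ℤ) : Module.End ℂ (MvPolynomial MatterMode ℂ) :=
  ∑ μ, lowPair (dXPoly μ) (piPoly p μ) n

/-- The modes of `M`, on polynomials of weight at most two. -/
def polyM (τ : ℝ) (p : Fin 26 → ℝ) (n : ℤ) : Module.End ℂ (MvPolynomial MatterMode ℂ) :=
  (1 / 2 : ℂ) • lowPair (piPoly p 0) (piPoly p 0) n -
    ((τ : ℂ) ^ 2 / 2) • ∑ i : Fin 25, lowPair (dXPoly i.succ) (dXPoly i.succ) n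

section low

variable {τ : ℝ} {p : Fin 26 → ℝ} {w : ℕ} {P : MvPolynomial MatterMode ℂ}

/-- Only the modes `n ≥ -2` are of interest: in `d` the mode `n` comes with the ghost mode `-n`, and
ghost modes of number above `2` annihilate the states in question. -/
lemma stressT_state (hw : w ≤ 2) (hP : P ∈ matterW w) {n : ℤ} (hn : -2 ≤ n)
    (S : Finset GhostMode) : stressT p n (state S P) = state S (polyT p n P) := by
  rw [stressT, polyT, Finset.sum_apply, LinearMap.sum_apply, LinearMap.sum_apply, map_sum]
  exact Finset.sum_congr rfl fun μ _ => nop_state_low (isField_dX μ) (isField_piMode p μ)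
    (dX_state μ) (piMode_state p μ) (isCurrent_dXPoly μ) (isCurrent_piPoly p μ) hw hP hn S

lemma stressM_state (hw : w ≤ 2) (hP : P ∈ matterW w) {n : ℤ} (hn : -2 ≤ n)
    (S : Finset GhostMode) : stressM τ p n (state S P) = state S (polyM τ p n P) := by
  have h1 := nop_state_low (isField_piMode p 0) (isField_piMode p 0) (piMode_state p 0)
    (piMode_state p 0) (isCurrent_piPoly p 0) (isCurrent_piPoly p 0) hw hP hn S
  have h2 := fun i : Fin 25 => nop_state_low (isField_dX i.succ) (isField_dX i.succ)
    (dX_state _) (dX_state _) (isCurrent_dXPoly _) (isCurrent_dXPoly _) hw hP hn S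
  have h3 : stressM τ p n (state S P) = (1 / 2 : ℂ) • nop 1 1 (piMode p 0) (piMode p 0) n (state S P)
      - ((τ : ℂ) ^ 2 / 2) • ∑ i : Fin 25, nop 1 1 (dX i.succ) (dX i.succ) n (state S P) := by
    rw [← LinearMap.sum_apply, ← Finset.sum_apply]
    rfl
  have h4 : polyM τ p n P = (1 / 2 : ℂ) • lowPair (piPoly p 0) (piPoly p 0) n P
      - ((τ : ℂ) ^ 2 / 2) • ∑ i : Fin 25, lowPair (dXPoly i.succ) (dXPoly i.succ) n P := by
    rw [← LinearMap.sum_apply]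
    rfl
  rw [h3, h4, h1]
  simp only [h2, map_sub, map_smul, map_sum]

lemma polyT_eq_zero (hP : P ∈ matterW w) {n : ℤ} (hn : w < n) : polyT p n P = 0 := by
  rw [polyT, LinearMap.sum_apply]
  exact Finset.sum_eq_zero fun μ _ =>
    lowPair_eq_zero (isCurrent_dXPoly μ) (isCurrent_piPoly p μ) hP hn

lemma polyM_eq_zero (hP : P ∈ matterW w) {n : ℤ} (hn : w < n) : polyM τ p n P = 0 := by
  rw [polyM, LinearMap.sub_apply, LinearMap.smul_apply, LinearMap.smul_apply, LinearMap.sum_apply,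
    lowPair_eq_zero (isCurrent_piPoly p 0) (isCurrent_piPoly p 0) hP hn, Finset.sum_eq_zero]
  · simp
  · exact fun i _ => lowPair_eq_zero (isCurrent_dXPoly _) (isCurrent_dXPoly _) hP hn

end low

/-! ### States of low weight: the ghost modes -/

/-- The fermionic creation modes that occur in states of weight zero. -/
def IsLow (g : GhostMode) : Prop := (ofLex g).2 ≤ if (ofLex g).1 < 2 then 3 else 0

/-- The states whose ghost modes are low. -/
def ghostLow : Submodule ℂ Fock :=
  Submodule.span ℂ {v | ∃ S P, (∀ g ∈ S, IsLow g) ∧ v = state S P}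

/-- For `n > 2` this operator removes the antighost mode of number `-n`, while the only low
antighost mode of each species has number `-2`. -/
lemma ghost_low {v : Fock} (hv : v ∈ ghostLow) (e : Fin 4) {t : Fin 4} (ht : 2 ≤ t) {n : ℤ}
    (hn : 2 < n) : ghost e t n v = 0 := by
  induction hv using Submodule.span_induction with
  | zero => exact map_zero _
  | add v w _ _ hv hw => rw [map_add, hv, hw, add_zero]
  | smul a v _ hv => rw [map_smul, hv, smul_zero]
  | mem v hv =>
    obtain ⟨S, P, hS, rfl⟩ := hv
    rw [ghost, if_neg (by omega), annihilate_state, if_neg]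
    intro hm
    have h := hS _ hm
    change (n - 2).toNat ≤ (if t < 2 then 3 else 0) at h
    rw [if_neg (not_lt.2 ht)] at h
    omega

lemma antighost_low {v : Fock} (hv : v ∈ ghostLow) {e : Fin 4} (t : Fin 4) (he : e < 2) {n : ℤ}
    (hn : 2 < n) : antighost e t n v = 0 := by
  induction hv using Submodule.span_induction with
  | zero => exact map_zero _
  | add v w _ _ hv hw => rw [map_add, hv, hw, add_zero]
  | smul a v _ hv => rw [map_smul, hv, smul_zero]
  | mem v hv =>
    obtain ⟨S, P, hS, rfl⟩ := hv
    rw [antighost, if_neg (by omega), annihilate_state, if_neg]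
    intro hm
    have h := hS _ hm
    change (n + 1).toNat ≤ (if e < 2 then 3 else 0) at h
    rw [if_pos he] at h
    omega

/-- Annihilation keeps a state low, creation need not. This suffices, because a normal-ordered
product lets the annihilating factor act first. -/
lemma annihilate_mem_ghostLow {v : Fock} (hv : v ∈ ghostLow) (g : GhostMode) :
    annihilate g v ∈ ghostLow := by
  induction hv using Submodule.span_induction with
  | zero => rw [map_zero]; exact Submodule.zero_mem _
  | add v w _ _ hv hw => rw [map_add]; exact Submodule.add_mem _ hv hw
  | smul a v _ hv => rw [map_smul]; exact Submodule.smul_mem _ _ hv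
  | mem v hv =>
    obtain ⟨S, P, hS, rfl⟩ := hv
    rw [annihilate_state]
    split
    · exact Submodule.smul_mem _ _ (Submodule.subset_span
        ⟨_, _, fun g hg => hS g (Finset.mem_of_mem_erase hg), rfl⟩)
    · exact Submodule.zero_mem _

lemma ghostBilinear_low {e t e' t' : Fin 4} (he : e < 2) (ht : 2 ≤ t') {v : Fock}
    (hv : v ∈ ghostLow) {n : ℤ} (hn : -2 ≤ n) :
    ((-2 : ℂ) • nop 2 (-1) (antighost e t) (deriv (-1) (ghost e' t')) n -
      nop 3 (-1) (deriv 2 (antighost e t)) (ghost e' t') n) v =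
      ((pairWindow n).map fun j => ((2 * n - j : ℤ) : ℂ) •
        ghostPair (antighost e t) (ghost e' t') j (n - j) v).sum := by
  rw [ghostBilinear_apply (isField_antighost e t) (isField_ghost e' t'),
    finsum_eq_list_sum (nodup_pairWindow n)]
  intro j hj
  rw [mem_pairWindow] at hj
  rw [ghostPair]
  split
  · rw [Module.End.mul_apply, ghost_low hv e' ht (by omega), map_zero, smul_zero]
  · rw [LinearMap.neg_apply, Module.End.mul_apply]
    by_cases h : 2 < j
    · rw [antighost_low hv t he h, map_zero, neg_zero, smul_zero]
    · rw [ghost_low _ e' ht (by omega), neg_zero, smul_zero]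
      rw [antighost, if_neg (by omega)]
      exact annihilate_mem_ghostLow hv _

lemma pairWindow_eq_nil {n : ℤ} (hn : 4 < n) : pairWindow n = [] := by
  refine List.eq_nil_iff_forall_not_mem.2 fun j hj => ?_
  rw [mem_pairWindow] at hj
  omega

lemma ghostT_low {v : Fock} (hv : v ∈ ghostLow) {n : ℤ} (hn : -2 ≤ n) :
    ghostT n v = ((pairWindow n).map fun j => ((2 * n - j : ℤ) : ℂ) •
        ghostPair (antighost 0 2) (ghost 0 2) j (n - j) v).sum +
      ((pairWindow n).map fun j => ((2 * n - j : ℤ) : ℂ) •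
        ghostPair (antighost 1 3) (ghost 1 3) j (n - j) v).sum := by
  rw [ghostT_eq, LinearMap.add_apply, bGhost, cGhost, BGhost, CGhost,
    ghostBilinear_low (by decide) (by decide) hv hn,
    ghostBilinear_low (by decide) (by decide) hv hn]

lemma ghostM_low {v : Fock} (hv : v ∈ ghostLow) {n : ℤ} (hn : -2 ≤ n) :
    ghostM n v = ((pairWindow n).map fun j => ((2 * n - j : ℤ) : ℂ) •
        ghostPair (antighost 1 3) (ghost 0 2) j (n - j) v).sum :=
  ghostBilinear_low (by decide) (by decide) hv hn

/-- Modes `l > 2` drop out because the ghost annihilates, so `L` has to contain only those `l ≤ 2`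
that can contribute. It is left free because the matter terms need five modes and the ghost terms
seven. -/
lemma nop_ghost_low {A : Modes} (hA : IsField A) {L : List ℤ} (hL : L.Nodup) (e : Fin 4)
    {t : Fin 4} (ht : 2 ≤ t) {v : Fock} (hv : v ∈ ghostLow)
    (hLA : ∀ l, l ∉ L → l ≤ 2 → A (-l) v = 0 ∧ l ≤ 1) :
    nop (-1) 1 (ghost e t) A 0 v =
      (L.map fun l => if l ≤ 1 then ghost e t l (A (-l) v) else A (-l) (ghost e t l v)).sum := by
  rw [nop_apply (isField_ghost e t) hA, finsum_eq_list_sum hL]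
  · congr 2
    funext l
    rw [neg_neg, zero_sub]
    split
    · rfl
    · rw [one_smul]; rfl
  · intro l hl
    rw [neg_neg, zero_sub]
    by_cases h : l ≤ 2
    · obtain ⟨h1, h2⟩ := hLA l hl h
      rw [if_pos h2, Module.End.mul_apply, h1, map_zero]
    · rw [if_neg (by omega), one_smul, Module.End.mul_apply, ghost_low hv e ht (by omega), map_zero]

/-! ### Masks and sets of ghost modes -/

/-- The mode with a given number in a mask. -/
def modeOf (i : ℕ) : GhostMode :=
  if i < 6 then toLex (0, i) else if i < 12 then toLex (1, i - 6)
  else if i < 15 then toLex (2, i - 12) else toLex (3, i - 15)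

/-- The bits are numbered in the order of the fermionic modes, so the sign of an operation is
determined by the lower bits of the mask. -/
lemma modeOf_strictMono : StrictMono modeOf := by
  intro i j hij
  rw [modeOf, modeOf, Prod.Lex.lt_iff]
  split_ifs <;> simp <;> omega

/-- The set of modes of a mask. -/
def maskSet (s : ℕ) : Finset GhostMode :=
  ((Finset.range 18).filter fun i => s.testBit i).map ⟨modeOf, modeOf_strictMono.injective⟩

lemma mem_maskSet {s : ℕ} {g : GhostMode} :
    g ∈ maskSet s ↔ ∃ i < 18, s.testBit i = true ∧ modeOf i = g := by
  simp [maskSet, and_assoc]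

lemma modeOf_mem_maskSet {s i : ℕ} (hi : i < 18) : modeOf i ∈ maskSet s ↔ s.testBit i = true := by
  rw [mem_maskSet]
  constructor
  · rintro ⟨j, _, hj, h⟩
    rwa [← modeOf_strictMono.injective h]
  · exact fun h => ⟨i, hi, h, rfl⟩

lemma maskSign_eq (i s : ℕ) (hi : i ≤ 18) : ((maskSign i s : ℤ) : ℂ) =
    (-1) ^ ((maskSet s).filter (· < modeOf i)).card := by
  have h1 : ((maskSet s).filter (· < modeOf i)).card =
      ((Finset.range i).filter fun j => s.testBit j).card := by
    rw [maskSet, Finset.filter_map, Finset.card_map]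
    congr 1
    ext j
    simp only [Finset.mem_filter, Finset.mem_range, Function.comp_apply,
      Function.Embedding.coeFn_mk, modeOf_strictMono.lt_iff_lt]
    constructor
    · exact fun h => ⟨h.2, h.1.2⟩
    · exact fun h => ⟨⟨by omega, h.2⟩, h.1⟩
  rw [h1]
  have h2 : ∀ (i : ℕ) (a : ℤ), (List.range i).foldr (fun j a => bif s.testBit j then -a else a) a =
      (-1) ^ ((Finset.range i).filter fun j => s.testBit j).card * a := by
    intro i
    induction i with
    | zero => simp
    | succ i ih =>
      intro a
      rw [List.range_succ, List.foldr_append, ih, Finset.range_add_one, Finset.filter_insert]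
      cases h : s.testBit i
      · simp [h]
      · simp [h, pow_succ]
  rw [maskSign, h2]
  push_cast
  ring

/-- The operator of an operation on masks. -/
def opOf (o : Bool × ℕ) : Module.End ℂ Fock :=
  if o.1 then create (modeOf o.2) else annihilate (modeOf o.2)

/-- A linear combination of the states of given masks. -/
def combState (L : List (ℤ × ℕ)) (P : MvPolynomial MatterMode ℂ) : Fock :=
  (L.map fun z => (z.1 : ℂ) • state (maskSet z.2) P).sum

lemma opOf_state (o : Bool × ℕ) (ho : o.2 < 18) (s : ℕ) (P : MvPolynomial MatterMode ℂ) :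
    opOf o (state (maskSet s) P) = match maskOp o s with
      | none => 0
      | some (a, t) => (a : ℂ) • state (maskSet t) P := by
  rcases o with ⟨b, i⟩
  have hsign := maskSign_eq i s (le_of_lt ho)
  change i < 18 at ho
  cases b
  · simp only [opOf, Bool.false_eq_true, if_false, annihilate_state, modeOf_mem_maskSet ho, maskOp]
    cases h : s.testBit i
    · simp
    · suffices hset : (maskSet s).erase (modeOf i) = maskSet (s ^^^ 2 ^ i) by
        simp [hsign, fermiSign, hset]
      ext g
      simp only [Finset.mem_erase, mem_maskSet, Nat.testBit_xor, Nat.testBit_two_pow]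
      constructor
      · rintro ⟨h1, j, h2, h3, rfl⟩
        refine ⟨j, h2, ?_, rfl⟩
        have : i ≠ j := fun h => h1 (h ▸ rfl)
        simp [this, h3]
      · rintro ⟨j, h2, h3, rfl⟩
        by_cases hij : i = j
        · subst hij
          simp [h] at h3
        · refine ⟨fun h => hij (modeOf_strictMono.injective h).symm, j, h2, ?_, rfl⟩
          simpa [hij] using h3
  · simp only [opOf, if_true, create_state, modeOf_mem_maskSet ho, maskOp]
    cases h : s.testBit i
    · suffices hset : insert (modeOf i) (maskSet s) = maskSet (s ||| 2 ^ i) by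
        simp [hsign, fermiSign, hset]
      ext g
      simp only [Finset.mem_insert, mem_maskSet, Nat.testBit_or, Nat.testBit_two_pow]
      constructor
      · rintro (rfl | ⟨j, h2, h3, rfl⟩)
        · exact ⟨i, ho, by simp, rfl⟩
        · exact ⟨j, h2, by simp [h3], rfl⟩
      · rintro ⟨j, h2, h3, rfl⟩
        by_cases hij : i = j
        · exact Or.inl (hij ▸ rfl)
        · exact Or.inr ⟨j, h2, by simpa [hij] using h3, rfl⟩
    · simp

/-- The product of the operators of successive operations, the first one first. -/
def opsOf : List (Bool × ℕ) → Module.End ℂ Fock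
  | [] => 1
  | o :: l => opsOf l * opOf o

lemma opsOf_state (l : List (Bool × ℕ)) (hl : ∀ o ∈ l, o.2 < 18) (a : ℤ) (s : ℕ)
    (P : MvPolynomial MatterMode ℂ) :
    (a : ℂ) • opsOf l (state (maskSet s) P) = combState (maskTerm a l s) P := by
  have key : opsOf l (state (maskSet s) P) = match maskOps l s with
      | none => 0
      | some (a, t) => (a : ℂ) • state (maskSet t) P := by
    induction l generalizing s with
    | nil => simp [opsOf, maskOps]
    | cons o l ih =>
      rw [opsOf, Module.End.mul_apply, opOf_state o (hl o (by simp)), maskOps]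
      cases h : maskOp o s with
      | none => simp
      | some z =>
        rcases z with ⟨a, t⟩
        simp only [map_smul, ih (fun o ho => hl o (by simp [ho])) t]
        cases h' : maskOps l t with
        | none => simp
        | some z =>
          rcases z with ⟨b, u⟩
          simp [smul_smul]
  rw [key, maskTerm]
  cases maskOps l s with
  | none => simp [combState]
  | some z => simp [combState, smul_smul]

lemma modeOf_ghost (e : Fin 2) (k : ℕ) (hk : k < 6) :
    modeOf (6 * e + k) = toLex ((e.castLE (by decide) : Fin 4), k) := by
  fin_cases e
  · simp [modeOf, hk]
  · rw [modeOf, if_neg (by simp), if_pos (by simp; omega)]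
    simp

lemma modeOf_antighost (e : Fin 2) (k : ℕ) (hk : k < 3) :
    modeOf (12 + 3 * e + k) = toLex ((Fin.natAdd 2 e : Fin 4), k) := by
  fin_cases e
  · rw [modeOf, if_neg (by simp; omega), if_neg (by simp), if_pos (by simp; omega)]
    simp
  · rw [modeOf, if_neg (by simp; omega), if_neg (by simp; omega), if_neg (by simp)]
    simp

/-- The bits of a mask are those for `c_1, …, c_{-4}` and `b_{-2}, …, b_{-4}` and the same for `C`,
`B`. These are exactly the modes that a ghost mode of number between `-4` and `4` creates or
removes. Low states need fewer bits, but individual factors of the terms of `d` use more. -/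
lemma opOf_ghostOp (e : Fin 2) {n : ℤ} (h : -4 ≤ n) (h' : n ≤ 4) :
    opOf (ghostOp e n) = ghost (e.castLE (by decide)) (Fin.natAdd 2 e) n ∧
      (ghostOp e n).2 < 18 := by
  have := e.2
  rw [ghostOp, ghost]
  split
  · refine ⟨?_, by simp only; omega⟩
    simp only [opOf, if_true]
    rw [modeOf_ghost e _ (by omega)]
  · refine ⟨?_, by simp only; omega⟩
    simp only [opOf, Bool.false_eq_true, if_false]
    rw [modeOf_antighost e _ (by omega)]

lemma opOf_antighostOp (e : Fin 2) {n : ℤ} (h : -4 ≤ n) (h' : n ≤ 4) :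
    opOf (antighostOp e n) = antighost (e.castLE (by decide)) (Fin.natAdd 2 e) n ∧
      (antighostOp e n).2 < 18 := by
  have := e.2
  rw [antighostOp, antighost]
  split
  · refine ⟨?_, by simp only; omega⟩
    simp only [opOf, if_true]
    rw [modeOf_antighost e _ (by omega)]
  · refine ⟨?_, by simp only; omega⟩
    simp only [opOf, Bool.false_eq_true, if_false]
    rw [modeOf_ghost e _ (by omega)]

/-! ### The differential on states of low weight -/

section

variable {s : ℕ} {P : MvPolynomial MatterMode ℂ}

lemma combState_append (L L' : List (ℤ × ℕ)) (P : MvPolynomial MatterMode ℂ) :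
    combState (L ++ L') P = combState L P + combState L' P := by
  simp [combState]

lemma combState_flatMap {α : Type} (l : List α) (f : α → List (ℤ × ℕ))
    (P : MvPolynomial MatterMode ℂ) :
    combState (l.flatMap f) P = (l.map fun x => combState (f x) P).sum := by
  induction l with
  | nil => rfl
  | cons x l ih => rw [List.flatMap_cons, combState_append, ih, List.map_cons, List.sum_cons]

lemma combState_smul (L : List (ℤ × ℕ)) (a : ℂ) (P : MvPolynomial MatterMode ℂ) :
    combState L (a • P) = a • combState L P := by
  rw [combState, combState, List.smul_sum, List.map_map]
  congr 2
  funext z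
  rw [map_smul, smul_comm]
  rfl

lemma ghost_combState (e : Fin 2) {n : ℤ} (h : -4 ≤ n) (h' : n ≤ 4) :
    ghost (e.castLE (by decide)) (Fin.natAdd 2 e) n (state (maskSet s) P) =
      combState (maskTerm 1 [ghostOp e n] s) P := by
  obtain ⟨h1, h2⟩ := opOf_ghostOp e h h'
  rw [← opsOf_state _ (by simpa using h2), ← h1, Int.cast_one, one_smul]
  rfl

lemma map_combState {f : Module.End ℂ Fock} {Q : MvPolynomial MatterMode ℂ}
    (h : ∀ S, f (state S P) = state S Q) (L : List (ℤ × ℕ)) :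
    f (combState L P) = combState L Q := by
  rw [combState, combState, map_list_sum, List.map_map]
  congr 2
  funext z
  simp [h]

lemma ghostPair_eq_opsOf (b e : Fin 2) {j k : ℤ} (hj : -4 ≤ j) (hj' : j ≤ 4) (hk : -4 ≤ k)
    (hk' : k ≤ 4) :
    ghostPair (antighost (b.castLE (by decide)) (Fin.natAdd 2 b))
      (ghost (e.castLE (by decide)) (Fin.natAdd 2 e)) j k =
      (if j ≤ -2 then 1 else -1 : ℂ) • opsOf (pairOps b e j k) ∧
    ∀ o ∈ pairOps b e j k, o.2 < 18 := by
  obtain ⟨h1, h2⟩ := opOf_ghostOp e hk hk'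
  obtain ⟨h3, h4⟩ := opOf_antighostOp b hj hj'
  rw [ghostPair, pairOps, ← h1, ← h3]
  split
  · refine ⟨?_, by simp [h2, h4]⟩
    rw [one_smul]
    rfl
  · refine ⟨?_, by simp [h2, h4]⟩
    rw [neg_smul, one_smul]
    rfl

lemma opsOf_append (l l' : List (Bool × ℕ)) : opsOf (l ++ l') = opsOf l' * opsOf l := by
  induction l with
  | nil => exact (mul_one _).symm
  | cons o l ih => rw [List.cons_append, opsOf, ih, opsOf, mul_assoc]

lemma cubic_combState (a b e : Fin 2) {l j : ℤ} (hl : l ∈ window) (hj : j ∈ pairWindow (-l)) :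
    (if l ≤ 1 then
      ghost (a.castLE (by decide)) (Fin.natAdd 2 a) l (((2 * (-l) - j : ℤ) : ℂ) •
        ghostPair (antighost (b.castLE (by decide)) (Fin.natAdd 2 b))
          (ghost (e.castLE (by decide)) (Fin.natAdd 2 e)) j (-l - j) (state (maskSet s) P))
     else ((2 * (-l) - j : ℤ) : ℂ) •
        ghostPair (antighost (b.castLE (by decide)) (Fin.natAdd 2 b))
          (ghost (e.castLE (by decide)) (Fin.natAdd 2 e)) j (-l - j)
          (ghost (a.castLE (by decide)) (Fin.natAdd 2 a) l (state (maskSet s) P))) =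
    combState (maskTerm (if j ≤ -2 then -2 * l - j else 2 * l + j) (cubicOps a b e l j) s) P := by
  rw [mem_window] at hl
  rw [mem_pairWindow] at hj
  obtain ⟨h1, h2⟩ := opOf_ghostOp a (n := l) (by omega) (by omega)
  obtain ⟨h3, h4⟩ := ghostPair_eq_opsOf b e (j := j) (k := -l - j) (by omega) (by omega) (by omega)
    (by omega)
  have hops : ∀ o ∈ cubicOps a b e l j, o.2 < 18 := by
    intro o ho
    rw [cubicOps] at ho
    split at ho
    · rcases List.mem_append.1 ho with h | h
      · exact h4 o h
      · rw [List.mem_singleton.1 h]; exact h2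
    · rcases List.mem_cons.1 ho with h | h
      · rw [h]; exact h2
      · exact h4 o h
  have hcoef : (((if j ≤ -2 then -2 * l - j else 2 * l + j : ℤ)) : ℂ) =
      ((2 * (-l) - j : ℤ) : ℂ) * (if j ≤ -2 then 1 else -1 : ℂ) := by
    split <;> push_cast <;> ring
  rw [← opsOf_state _ hops, h3, ← h1, hcoef, cubicOps, mul_smul]
  split
  · rw [opsOf_append, LinearMap.smul_apply, map_smul, map_smul]
    rfl
  · rw [LinearMap.smul_apply]
    rfl

lemma nop_ghost_bilinear (hv : state (maskSet s) P ∈ ghostLow) (a : Fin 2)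
    (L : List (Fin 2 × Fin 2)) {A : Modes} (hA : IsField A)
    (h : ∀ n : ℤ, -2 ≤ n → ∀ v ∈ ghostLow, A n v = (L.map fun x => ((pairWindow n).map fun j =>
      ((2 * n - j : ℤ) : ℂ) • ghostPair (antighost (x.1.castLE (by decide)) (Fin.natAdd 2 x.1))
          (ghost (x.2.castLE (by decide)) (Fin.natAdd 2 x.2)) j (n - j) v).sum).sum) :
    nop (-1) 1 (ghost (a.castLE (by decide)) (Fin.natAdd 2 a)) A 0 (state (maskSet s) P) =
      (window.map fun l => (L.map fun x => ((pairWindow (-l)).map fun j =>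
        combState (maskTerm (if j ≤ -2 then -2 * l - j else 2 * l + j)
          (cubicOps a x.1 x.2 l j) s) P).sum).sum).sum := by
  rw [nop_ghost_low hA nodup_window _ (by fin_cases a <;> decide) hv]
  · refine congrArg List.sum (List.map_congr_left fun l hl => ?_)
    have hl' := mem_window.1 hl
    have key : ∀ x : Fin 2 × Fin 2, ∀ j ∈ pairWindow (-l), _ := fun x j hj =>
      cubic_combState (s := s) (P := P) a x.1 x.2 hl hj
    by_cases h1 : l ≤ 1
    · simp only [if_pos h1] at key ⊢
      rw [h _ (by omega) _ hv, map_list_sum, List.map_map]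
      refine congrArg List.sum (List.map_congr_left fun x _ => ?_)
      rw [Function.comp_apply, map_list_sum, List.map_map]
      exact congrArg List.sum (List.map_congr_left fun j hj => key x j hj)
    · simp only [if_neg h1] at key ⊢
      rw [h _ (by omega)]
      · refine congrArg List.sum (List.map_congr_left fun x _ => ?_)
        exact congrArg List.sum (List.map_congr_left fun j hj => key x j hj)
      -- Here `l = 2`, so the ghost mode removes an antighost and the state stays low.
      · rw [ghost, if_neg h1]
        exact annihilate_mem_ghostLow hv _
  · intro l hl hl2
    rw [mem_window] at hl
    refine ⟨?_, by omega⟩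
    -- Below the window one has `-l > 4`, where no pair contributes.
    rw [h _ (by omega) _ hv, pairWindow_eq_nil (by omega)]
    simp

lemma nop_ghost_matter (hv : state (maskSet s) P ∈ ghostLow) (a : Fin 2) {A : Modes}
    (hA : IsField A) (f : ℤ → MvPolynomial MatterMode ℂ)
    (h : ∀ n : ℤ, -2 ≤ n → ∀ S, A n (state S P) = state S (f n)) (h0 : ∀ n : ℤ, 2 < n → f n = 0) :
    nop (-1) 1 (ghost (a.castLE (by decide)) (Fin.natAdd 2 a)) A 0 (state (maskSet s) P) =
      ([-2, -1, 0, 1, 2].map fun n => combState (maskTerm 1 [ghostOp a (-n)] s) (f n)).sum := by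
  rw [nop_ghost_low hA (L := [2, 1, 0, -1, -2]) (by decide) _ (by fin_cases a <;> decide) hv]
  · have h1 : ∀ n ∈ [(-2 : ℤ), -1, 0, 1, 2],
        combState (maskTerm 1 [ghostOp a (-n)] s) (f n) = if -n ≤ 1 then
          ghost (a.castLE (by decide)) (Fin.natAdd 2 a) (-n) (A n (state (maskSet s) P)) else
          A n (ghost (a.castLE (by decide)) (Fin.natAdd 2 a) (-n) (state (maskSet s) P)) := by
      intro n hn
      simp only [List.mem_cons, List.not_mem_nil, or_false] at hn
      split
      · rw [h n (by omega), ghost_combState a (by omega) (by omega)]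
      · rw [ghost_combState a (by omega) (by omega), map_combState (h n (by omega))]
    rw [List.map_congr_left h1]
    rfl
  · intro l hl hl2
    simp only [List.mem_cons, List.not_mem_nil, or_false] at hl
    refine ⟨?_, by omega⟩
    rw [h _ (by omega), h0 _ (by omega), map_zero]

lemma state_mem_ghostLow (hs : ∀ g ∈ maskSet s, IsLow g) : state (maskSet s) P ∈ ghostLow :=
  Submodule.subset_span ⟨_, _, hs, rfl⟩

lemma list_sum_map_add {α : Type} (l : List α) (f g : α → Fock) :
    (l.map fun x => f x + g x).sum = (l.map f).sum + (l.map g).sum := List.sum_map_add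

/-- On a low state the nested sums in `d` reduce to these finitely many terms. The factor two clears
the halves in front of the ghost part of the current and inside `M`. -/
lemma brst_state {τ : ℝ} {p : Fin 26 → ℝ} (hs : ∀ g ∈ maskSet s, IsLow g) {w : ℕ} (hw : w ≤ 2)
    (hP : P ∈ matterW w) :
    (2 : ℂ) • brst τ p (state (maskSet s) P) = ([-2, -1, 0, 1, 2].map fun n =>
      combState (maskTerm 1 [ghostOp 0 (-n)] s) ((2 : ℂ) • polyT p n P) +
      combState (maskTerm 1 [ghostOp 1 (-n)] s) ((2 : ℂ) • polyM τ p n P)).sum +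
      combState (ghostDiff s) P := by
  have hv := state_mem_ghostLow (P := P) hs
  have h1 := nop_ghost_matter hv 0 (isField_stressT p) (fun n => polyT p n P)
    (fun n hn S => stressT_state hw hP hn S) fun n hn => polyT_eq_zero hP (by omega)
  have h2 := nop_ghost_matter hv 1 (isField_stressM τ p) (fun n => polyM τ p n P)
    (fun n hn S => stressM_state hw hP hn S) fun n hn => polyM_eq_zero hP (by omega)
  have h3 := nop_ghost_bilinear hv 0 [(0, 0), (1, 1)] isField_ghostT fun n hn v hv => by
    rw [ghostT_low hv hn]
    simp
  have h4 := nop_ghost_bilinear hv 1 [(1, 0)] isField_ghostM fun n hn v hv => by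
    rw [ghostM_low hv hn]
    simp
  have hd : brst τ p (state (maskSet s) P) =
      nop (-1) 1 (ghost 0 2) (stressT p) 0 (state (maskSet s) P) +
      nop (-1) 1 (ghost 1 3) (stressM τ p) 0 (state (maskSet s) P) +
      (1 / 2 : ℂ) • nop (-1) 1 (ghost 0 2) ghostT 0 (state (maskSet s) P) +
      (1 / 2 : ℂ) • nop (-1) 1 (ghost 1 3) ghostM 0 (state (maskSet s) P) := rfl
  have hg : combState (ghostDiff s) P =
      nop (-1) 1 (ghost 0 2) ghostT 0 (state (maskSet s) P) +
      nop (-1) 1 (ghost 1 3) ghostM 0 (state (maskSet s) P) := by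
    refine Eq.trans ?_ (congrArg₂ (· + ·) h3 h4).symm
    rw [ghostDiff, ghostTerms, List.flatMap_assoc, combState_flatMap, ← list_sum_map_add]
    refine congrArg List.sum (List.map_congr_left fun l _ => ?_)
    rw [List.flatMap_assoc, combState_flatMap]
    simp only [List.map_cons, List.map_nil, List.sum_cons, List.sum_nil, add_zero]
    rw [← list_sum_map_add, ← list_sum_map_add]
    refine congrArg List.sum (List.map_congr_left fun j _ => ?_)
    simp [add_assoc, combState_append]
  rw [hd, hg, list_sum_map_add]
  simp only [combState_smul]
  have hsm : ∀ f : ℤ → Fock, ([-2, -1, 0, 1, 2].map fun n => (2 : ℂ) • f n).sum =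
      (2 : ℂ) • ([-2, -1, 0, 1, 2].map f).sum := fun f => by
    rw [List.smul_sum, List.map_map]; rfl
  rw [hsm, hsm]
  have h1' : nop (-1) 1 (ghost 0 2) (stressT p) 0 (state (maskSet s) P) = _ := h1
  have h2' : nop (-1) 1 (ghost 1 3) (stressM τ p) 0 (state (maskSet s) P) = _ := h2
  rw [h1', h2']
  simp only [Fin.val_zero, Fin.val_one, smul_add, smul_smul]
  norm_num
  abel

end

open MvPolynomial (X C pderiv pderiv_X)

/-! ### The matter modes in adapted variables -/

/-- The adapted variables: `ξ = 0` for `Q`, `ξ = 1` for `R`. -/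
def letter (τ κ : ℂ) (ξ : ℕ) (μ : Fin 26) (k : ℕ) : MvPolynomial MatterMode ℂ :=
  if ξ = 0 then
    if μ = 0 then ((k + 1) / κ) • X (Sum.inl (μ, k)) else (Complex.I * τ * κ)⁻¹ • X (Sum.inr (μ, k))
  else
    if μ = 0 then κ • X (Sum.inr (μ, k)) else ((k + 1) * (Complex.I * τ * κ)) • X (Sum.inl (μ, k))

/-- The derivations dual to the adapted variables. -/
def dual (τ κ : ℂ) (ξ : ℕ) (μ : Fin 26) (k : ℕ) :
    Derivation ℂ (MvPolynomial MatterMode ℂ) (MvPolynomial MatterMode ℂ) :=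
  if ξ = 0 then
    if μ = 0 then (κ / (k + 1)) • pderiv (Sum.inl (μ, k))
    else (Complex.I * τ * κ) • pderiv (Sum.inr (μ, k))
  else
    if μ = 0 then κ⁻¹ • pderiv (Sum.inr (μ, k))
    else ((k + 1) * (Complex.I * τ * κ))⁻¹ • pderiv (Sum.inl (μ, k))

/-- The rescaled momentum. -/
def momentum (τ κ : ℂ) (p : Fin 26 → ℝ) (μ : Fin 26) : ℂ := p μ / (τ * κ)

section

variable {τ κ : ℂ}

/-- The letters are the creation modes of two fields `Q` and `R`, where `R` is `κ Π_0` in the time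
direction and `i τ κ ∂X^i` in the others, and `Q` is its partner with `T = Q · R`. Then `κ² M = ½ R
· R`, and all directions are on the same footing. Up to constants the dual derivations are the
annihilation modes. -/
lemma dual_letter (hτ : τ ≠ 0) (hκ : κ ≠ 0) {ξ η : ℕ} (hξ : ξ < 2) (hη : η < 2) (μ ν : Fin 26)
    (k l : ℕ) : dual τ κ ξ μ k (letter τ κ η ν l) =
      if ξ = η ∧ μ = ν ∧ k = l then 1 else 0 := by
  have h0 : Complex.I * τ * κ ≠ 0 := by simp [hτ, hκ]
  have hk : (k : ℂ) + 1 ≠ 0 := Nat.cast_add_one_ne_zero k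
  by_cases h : μ = ν ∧ k = l
  · obtain ⟨rfl, rfl⟩ := h
    interval_cases ξ <;> interval_cases η <;> simp only [dual, letter] <;>
      by_cases hμ : μ = 0 <;>
      simp [hμ, pderiv_X, smul_smul, hκ, hk] <;> field_simp <;> simp
  · rw [if_neg (fun h' => h h'.2)]
    have h' : ¬ (ν = μ ∧ l = k) := fun h' => h ⟨h'.1.symm, h'.2.symm⟩
    interval_cases ξ <;> interval_cases η <;> simp only [dual, letter] <;>
      by_cases hμ : μ = 0 <;> by_cases hν : ν = 0 <;>
      simp [hμ, hν, pderiv_X, Pi.single_apply] <;> simp_all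

end

section modes

variable (P : MvPolynomial MatterMode ℂ) (μ : Fin 26) (p : Fin 26 → ℝ)

lemma dXPoly_zero : dXPoly μ 0 P = 0 := by simp [dXPoly]
lemma dXPoly_one : dXPoly μ 1 P = pderiv (Sum.inr (μ, 0)) P := by
  simp [dXPoly, xPoly]
lemma dXPoly_two : dXPoly μ 2 P = (2 : ℂ) • pderiv (Sum.inr (μ, 1)) P := by
  simp [dXPoly, xPoly]
lemma dXPoly_neg_one : dXPoly μ (-1) P = X (Sum.inl (μ, 0)) * P := by
  rw [dXPoly, LinearMap.smul_apply]
  exact (congrArg (· • xPoly μ (-1) P) (by simp : -((-1 : ℤ) : ℂ) = 1)).trans (one_smul _ _)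
lemma dXPoly_neg_two : dXPoly μ (-2) P = (2 : ℂ) • (X (Sum.inl (μ, 1)) * P) := by
  rw [dXPoly, LinearMap.smul_apply]
  exact congrArg (· • xPoly μ (-2) P) (by simp : -((-2 : ℤ) : ℂ) = 2)
lemma piPoly_zero : piPoly p μ 0 P = (Complex.I * p μ) • P := rfl
lemma piPoly_one : piPoly p μ 1 P = pderiv (Sum.inl (μ, 0)) P := rfl
lemma piPoly_two : piPoly p μ 2 P = pderiv (Sum.inl (μ, 1)) P := rfl
lemma piPoly_neg_one : piPoly p μ (-1) P = X (Sum.inr (μ, 0)) * P := rfl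
lemma piPoly_neg_two : piPoly p μ (-2) P = X (Sum.inr (μ, 1)) * P := rfl

end modes

section formulas

variable {τ : ℝ} {κ : ℂ} {p : Fin 26 → ℝ} (P : MvPolynomial MatterMode ℂ)

lemma letter_coeff_ne_zero (hτ : τ ≠ 0) (hκ : κ ≠ 0) : Complex.I * τ * κ ≠ 0 := by simp [hτ, hκ]

lemma momentum_eq (hτ : τ ≠ 0) (hκ : κ ≠ 0) (μ : Fin 26) :
    momentum τ κ p μ = Complex.I * p μ / (Complex.I * τ * κ) := by
  have hτ' : (τ : ℂ) ≠ 0 := by exact_mod_cast hτ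
  rw [momentum]
  field_simp

/-- `momentum` is the zero mode of `Q`. With `p 0 = 0` the field `R` has no zero mode, since its
other components are multiples of `∂X^i`; so this is the only way in which `p` enters. -/
lemma polyT_one (hτ : τ ≠ 0) (hκ : κ ≠ 0) (hp : p 0 = 0) :
    polyT p 1 P = ∑ μ, ((2 : ℂ) • (letter τ κ 0 μ 0 * dual τ κ 0 μ 1 P) +
      momentum τ κ p μ • dual τ κ 0 μ 0 P + (2 : ℂ) • (letter τ κ 1 μ 0 * dual τ κ 1 μ 1 P)) := by
  have hc := letter_coeff_ne_zero hτ hκ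
  rw [polyT, LinearMap.sum_apply]
  refine Finset.sum_congr rfl fun μ _ => ?_
  rw [lowPair_apply, show pairWindow 1 = [-1, 0, 1, 2] by decide, momentum_eq hτ hκ]
  simp only [polyPair, List.map_cons, List.map_nil, List.sum_cons, List.sum_nil]
  norm_num [dXPoly_zero, dXPoly_one, dXPoly_two, dXPoly_neg_one, piPoly_zero, piPoly_one,
    piPoly_two, piPoly_neg_one, letter, dual, -mul_eq_zero, -mul_inv_rev]
  -- The imaginary unit and `τ` occur only in this nonzero product.
  generalize Complex.I * τ * κ = c at *
  by_cases hμ : μ = 0 <;> simp [hμ, hp] <;> match_scalars <;> field_simp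

lemma pderiv_comm_apply (m m' : MatterMode) :
    pderiv m (pderiv m' P) = pderiv m' (pderiv m P) := by
  have h : ⁅pderiv (R := ℂ) m, pderiv (R := ℂ) m'⁆ = 0 := by
    refine MvPolynomial.derivation_ext fun i => ?_
    classical
    rw [Derivation.commutator_apply, pderiv_X, pderiv_X]
    simp only [Pi.single_apply]
    split_ifs <;> simp
  have h1 := congrArg (fun D => D P) h
  simpa [Derivation.commutator_apply, sub_eq_zero] using h1

lemma polyT_two (hτ : τ ≠ 0) (hκ : κ ≠ 0) (hp : p 0 = 0) :
    polyT p 2 P = ∑ μ, ((2 * momentum τ κ p μ) • dual τ κ 0 μ 1 P +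
      dual τ κ 0 μ 0 (dual τ κ 1 μ 0 P)) := by
  have hc := letter_coeff_ne_zero hτ hκ
  rw [polyT, LinearMap.sum_apply]
  refine Finset.sum_congr rfl fun μ _ => ?_
  have hcomm := pderiv_comm_apply P (Sum.inr (μ, 0)) (Sum.inl (μ, 0))
  rw [lowPair_apply, show pairWindow 2 = [0, 1, 2] by decide, momentum_eq hτ hκ]
  simp only [polyPair, List.map_cons, List.map_nil, List.sum_cons, List.sum_nil]
  norm_num [dXPoly_zero, dXPoly_one, dXPoly_two, dXPoly_neg_one, dXPoly_neg_two, piPoly_zero,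
    piPoly_one, piPoly_two, piPoly_neg_one, piPoly_neg_two, letter, dual, -mul_eq_zero,
    -mul_inv_rev, hcomm]
  generalize Complex.I * τ * κ = c at *
  by_cases hμ : μ = 0 <;> simp [hμ, hp, hcomm] <;> match_scalars <;> field_simp

/-- `T_{-1}` raises the weight by one, so it is needed only on weight at most one. There the
derivations of depth two vanish and the corresponding terms drop out. -/
lemma polyT_neg_one (hτ : τ ≠ 0) (hκ : κ ≠ 0) (hp : p 0 = 0) {w : ℕ} (hP : P ∈ matterW w)
    (hw : w ≤ 1) : polyT p (-1) P = ∑ μ, (letter τ κ 0 μ 1 * dual τ κ 0 μ 0 P +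
      momentum τ κ p μ • (letter τ κ 1 μ 0 * P) + letter τ κ 1 μ 1 * dual τ κ 1 μ 0 P) := by
  have hc := letter_coeff_ne_zero hτ hκ
  rw [polyT, LinearMap.sum_apply]
  refine Finset.sum_congr rfl fun μ _ => ?_
  have h1 : pderiv (Sum.inl (μ, 1)) P = 0 :=
    pderiv_eq_zero_of_weight hP (by simp [modeWeight]; omega)
  have h2 : pderiv (Sum.inr (μ, 1)) P = 0 :=
    pderiv_eq_zero_of_weight hP (by simp [modeWeight]; omega)
  rw [lowPair_apply, show pairWindow (-1) = [-3, -2, -1, 0, 1, 2] by decide, momentum_eq hτ hκ]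
  simp only [polyPair, List.map_cons, List.map_nil, List.sum_cons, List.sum_nil]
  norm_num [dXPoly_zero, dXPoly_one, dXPoly_two, dXPoly_neg_one, dXPoly_neg_two, piPoly_zero,
    piPoly_one, piPoly_two, piPoly_neg_one, piPoly_neg_two, letter, dual, -mul_eq_zero,
    -mul_inv_rev, h1, h2]
  generalize Complex.I * τ * κ = c at *
  by_cases hμ : μ = 0 <;> simp [hμ, hp] <;> match_scalars <;> field_simp

lemma polyT_neg_two (hτ : τ ≠ 0) (hκ : κ ≠ 0) (hp : p 0 = 0) :
    polyT p (-2) 1 = ∑ μ, (letter τ κ 0 μ 0 * letter τ κ 1 μ 0 +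
      momentum τ κ p μ • letter τ κ 1 μ 1) := by
  have hc := letter_coeff_ne_zero hτ hκ
  rw [polyT, LinearMap.sum_apply]
  refine Finset.sum_congr rfl fun μ _ => ?_
  have hcomm : (X (Sum.inr (μ, 0)) * X (Sum.inl (μ, 0)) : MvPolynomial MatterMode ℂ) = _ :=
    mul_comm _ _
  rw [lowPair_apply, show pairWindow (-2) = [-4, -3, -2, -1, 0, 1, 2] by decide,
    momentum_eq hτ hκ]
  simp only [polyPair, List.map_cons, List.map_nil, List.sum_cons, List.sum_nil]
  norm_num [dXPoly_zero, dXPoly_one, dXPoly_two, dXPoly_neg_one, dXPoly_neg_two, piPoly_zero,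
    piPoly_one, piPoly_two, piPoly_neg_one, piPoly_neg_two, letter, dual, -mul_eq_zero,
    -mul_inv_rev]
  generalize Complex.I * τ * κ = c at *
  by_cases hμ : μ = 0 <;> simp [hμ, hp, hcomm] <;> match_scalars <;> field_simp

/-- Both kinds of summands become squares of `R`: the factor `κ²` belongs to `Π_0`, and `-τ² κ² = (i
τ κ)²` to `∂X^i`. -/
lemma polyM_eq_sum (n : ℤ) : κ ^ 2 • polyM τ p n P = ∑ μ, if μ = 0 then
      (κ ^ 2 / 2) • lowPair (piPoly p 0) (piPoly p 0) n P
    else (-(κ ^ 2 * (τ : ℂ) ^ 2) / 2) • lowPair (dXPoly μ) (dXPoly μ) n P := by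
  rw [Fin.sum_univ_succ, if_pos rfl]
  simp only [Fin.succ_ne_zero, if_false]
  rw [polyM, LinearMap.sub_apply, LinearMap.smul_apply, LinearMap.smul_apply, LinearMap.sum_apply,
    smul_sub, smul_smul, smul_smul, ← Finset.smul_sum, mul_one_div, sub_eq_add_neg, ← neg_smul]
  congr 2
  ring

lemma polyM_two (hτ : τ ≠ 0) (hκ : κ ≠ 0) (hp : p 0 = 0) :
    κ ^ 2 • polyM τ p (2) P = ∑ μ, (1 / 2 : ℂ) • dual τ κ 0 μ 0 (dual τ κ 0 μ 0 P) := by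
  have hc := letter_coeff_ne_zero hτ hκ
  rw [polyM_eq_sum]
  refine Finset.sum_congr rfl fun μ _ => ?_
  have hsq : -(κ ^ 2 * (τ : ℂ) ^ 2) = (Complex.I * τ * κ) ^ 2 := by
    simp only [mul_pow, Complex.I_sq]
    ring
  rw [lowPair_apply, lowPair_apply, show pairWindow (2) = [0, 1, 2] by decide, hsq]
  simp only [polyPair, List.map_cons, List.map_nil, List.sum_cons, List.sum_nil]
  norm_num [dXPoly_zero, dXPoly_one, dXPoly_two, dXPoly_neg_one, dXPoly_neg_two, piPoly_zero,
    piPoly_one, piPoly_two, piPoly_neg_one, piPoly_neg_two, letter, dual, -mul_eq_zero,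
    -mul_inv_rev, hp]
  generalize Complex.I * τ * κ = c at *
  by_cases hμ : μ = 0 <;> simp [hμ] <;> match_scalars <;> field_simp

lemma polyM_one (hτ : τ ≠ 0) (hκ : κ ≠ 0) (hp : p 0 = 0) :
    κ ^ 2 • polyM τ p (1) P = ∑ μ, (2 : ℂ) • (letter τ κ 1 μ 0 * dual τ κ 0 μ 1 P) := by
  have hc := letter_coeff_ne_zero hτ hκ
  rw [polyM_eq_sum]
  refine Finset.sum_congr rfl fun μ _ => ?_
  have hsq : -(κ ^ 2 * (τ : ℂ) ^ 2) = (Complex.I * τ * κ) ^ 2 := by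
    simp only [mul_pow, Complex.I_sq]
    ring
  rw [lowPair_apply, lowPair_apply, show pairWindow (1) = [-1, 0, 1, 2] by decide, hsq]
  simp only [polyPair, List.map_cons, List.map_nil, List.sum_cons, List.sum_nil]
  norm_num [dXPoly_zero, dXPoly_one, dXPoly_two, dXPoly_neg_one, dXPoly_neg_two, piPoly_zero,
    piPoly_one, piPoly_two, piPoly_neg_one, piPoly_neg_two, letter, dual, -mul_eq_zero,
    -mul_inv_rev, hp]
  generalize Complex.I * τ * κ = c at *
  by_cases hμ : μ = 0 <;> simp [hμ] <;> match_scalars <;> field_simp <;> norm_num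

lemma polyM_zero (hτ : τ ≠ 0) (hκ : κ ≠ 0) (hp : p 0 = 0) :
    κ ^ 2 • polyM τ p (0) P = ∑ μ, (letter τ κ 1 μ 0 * dual τ κ 0 μ 0 P +
      (2 : ℂ) • (letter τ κ 1 μ 1 * dual τ κ 0 μ 1 P)) := by
  have hc := letter_coeff_ne_zero hτ hκ
  rw [polyM_eq_sum]
  refine Finset.sum_congr rfl fun μ _ => ?_
  have hsq : -(κ ^ 2 * (τ : ℂ) ^ 2) = (Complex.I * τ * κ) ^ 2 := by
    simp only [mul_pow, Complex.I_sq]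
    ring
  rw [lowPair_apply, lowPair_apply, show pairWindow (0) = [-2, -1, 0, 1, 2] by decide, hsq]
  simp only [polyPair, List.map_cons, List.map_nil, List.sum_cons, List.sum_nil]
  norm_num [dXPoly_zero, dXPoly_one, dXPoly_two, dXPoly_neg_one, dXPoly_neg_two, piPoly_zero,
    piPoly_one, piPoly_two, piPoly_neg_one, piPoly_neg_two, letter, dual, -mul_eq_zero,
    -mul_inv_rev, hp]
  generalize Complex.I * τ * κ = c at *
  by_cases hμ : μ = 0 <;> simp [hμ] <;> match_scalars <;> field_simp <;> norm_num

lemma polyM_neg_one (hτ : τ ≠ 0) (hκ : κ ≠ 0) (hp : p 0 = 0) {w : ℕ} (hP : P ∈ matterW w)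
    (hw : w ≤ 1) :
    κ ^ 2 • polyM τ p (-1) P = ∑ μ, letter τ κ 1 μ 1 * dual τ κ 0 μ 0 P := by
  have hc := letter_coeff_ne_zero hτ hκ
  rw [polyM_eq_sum]
  refine Finset.sum_congr rfl fun μ _ => ?_
  have h1 : pderiv (Sum.inl (μ, 1)) P = 0 :=
    pderiv_eq_zero_of_weight hP (by simp [modeWeight]; omega)
  have h2 : pderiv (Sum.inr (μ, 1)) P = 0 :=
    pderiv_eq_zero_of_weight hP (by simp [modeWeight]; omega)
  have h3 : pderiv (Sum.inr (0, 1)) P = 0 :=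
    pderiv_eq_zero_of_weight hP (by simp [modeWeight]; omega)
  have h4 : pderiv (Sum.inl (0, 1)) P = 0 :=
    pderiv_eq_zero_of_weight hP (by simp [modeWeight]; omega)
  have hsq : -(κ ^ 2 * (τ : ℂ) ^ 2) = (Complex.I * τ * κ) ^ 2 := by
    simp only [mul_pow, Complex.I_sq]
    ring
  rw [lowPair_apply, lowPair_apply, show pairWindow (-1) = [-3, -2, -1, 0, 1, 2] by decide, hsq]
  simp only [polyPair, List.map_cons, List.map_nil, List.sum_cons, List.sum_nil]
  norm_num [dXPoly_zero, dXPoly_one, dXPoly_two, dXPoly_neg_one, dXPoly_neg_two, piPoly_zero,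
    piPoly_one, piPoly_two, piPoly_neg_one, piPoly_neg_two, letter, dual, -mul_eq_zero,
    -mul_inv_rev, hp, h1, h2, h3, h4]
  generalize Complex.I * τ * κ = c at *
  by_cases hμ : μ = 0 <;> simp [hμ] <;> match_scalars <;> field_simp <;> norm_num

lemma polyM_neg_two (hτ : τ ≠ 0) (hκ : κ ≠ 0) (hp : p 0 = 0) :
    κ ^ 2 • polyM τ p (-2) 1 = ∑ μ, (1 / 2 : ℂ) • (letter τ κ 1 μ 0 * letter τ κ 1 μ 0) := by
  have hc := letter_coeff_ne_zero hτ hκ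
  rw [polyM_eq_sum]
  refine Finset.sum_congr rfl fun μ _ => ?_
  have hsq : -(κ ^ 2 * (τ : ℂ) ^ 2) = (Complex.I * τ * κ) ^ 2 := by
    simp only [mul_pow, Complex.I_sq]
    ring
  rw [lowPair_apply, lowPair_apply, show pairWindow (-2) = [-4, -3, -2, -1, 0, 1, 2] by decide, hsq]
  simp only [polyPair, List.map_cons, List.map_nil, List.sum_cons, List.sum_nil]
  norm_num [dXPoly_zero, dXPoly_one, dXPoly_two, dXPoly_neg_one, dXPoly_neg_two, piPoly_zero,
    piPoly_one, piPoly_two, piPoly_neg_one, piPoly_neg_two, letter, dual, -mul_eq_zero,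
    -mul_inv_rev, hp]
  generalize Complex.I * τ * κ = c at *
  by_cases hμ : μ = 0 <;> simp [hμ] <;> match_scalars <;> field_simp

end formulas

/-! ### Covariants of the matter modes -/

/-- The linear combination of adapted variables with coefficients `u`. -/
def lin (τ κ : ℂ) (ξ k : ℕ) : (Fin 26 → ℂ) →ₗ[ℂ] MvPolynomial MatterMode ℂ :=
  ∑ μ, (LinearMap.proj μ).smulRight (letter τ κ ξ μ k)

/-- The quadratic polynomial in the adapted variables of depth one with coefficients `A`. -/
def quad (τ κ : ℂ) (ξ η : ℕ) : Matrix (Fin 26) (Fin 26) ℂ →ₗ[ℂ] MvPolynomial MatterMode ℂ :=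
  ∑ μ, ∑ ν, (LinearMap.proj ν ∘ₗ (LinearMap.proj μ : _ →ₗ[ℂ] (Fin 26 → ℂ))).smulRight
    (letter τ κ ξ μ 0 * letter τ κ η ν 0)

section

variable {τ κ : ℂ}

lemma lin_apply (ξ k : ℕ) (u : Fin 26 → ℂ) : lin τ κ ξ k u = ∑ μ, u μ • letter τ κ ξ μ k := by
  simp [lin]

lemma quad_apply (ξ η : ℕ) (A : Matrix (Fin 26) (Fin 26) ℂ) :
    quad τ κ ξ η A = ∑ μ, ∑ ν, A μ ν • (letter τ κ ξ μ 0 * letter τ κ η ν 0) := by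
  simp [quad]
  rfl

lemma quad_eq_sum_lin (ξ η : ℕ) (A : Matrix (Fin 26) (Fin 26) ℂ) :
    quad τ κ ξ η A = ∑ μ, letter τ κ ξ μ 0 * lin τ κ η 0 (A μ) := by
  rw [quad_apply]
  refine Finset.sum_congr rfl fun μ _ => ?_
  rw [lin_apply, Finset.mul_sum]
  exact Finset.sum_congr rfl fun ν _ => (mul_smul_comm _ _ _).symm

lemma quad_comm (ξ η : ℕ) (A : Matrix (Fin 26) (Fin 26) ℂ) :
    quad τ κ ξ η A = quad τ κ η ξ Aᵀ := by
  rw [quad_apply, quad_apply, Finset.sum_comm]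
  refine Finset.sum_congr rfl fun μ _ => Finset.sum_congr rfl fun ν _ => ?_
  rw [mul_comm, Matrix.transpose_apply]

lemma quad_eq_sum_lin' (ξ η : ℕ) (A : Matrix (Fin 26) (Fin 26) ℂ) :
    quad τ κ ξ η A = ∑ μ, letter τ κ η μ 0 * lin τ κ ξ 0 (fun ν => A ν μ) := by
  rw [quad_comm, quad_eq_sum_lin]
  rfl

lemma quad_vecMulVec (ξ η : ℕ) (u v : Fin 26 → ℂ) :
    quad τ κ ξ η (Matrix.vecMulVec u v) = lin τ κ ξ 0 u * lin τ κ η 0 v := by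
  rw [quad_eq_sum_lin, lin_apply ξ, Finset.sum_mul]
  refine Finset.sum_congr rfl fun μ _ => ?_
  rw [show Matrix.vecMulVec u v μ = u μ • v from rfl, map_smul, mul_smul_comm, smul_mul_assoc]

lemma quad_one (ξ η : ℕ) : quad τ κ ξ η 1 = ∑ μ, letter τ κ ξ μ 0 * letter τ κ η μ 0 := by
  rw [quad_apply]
  refine Finset.sum_congr rfl fun μ _ => ?_
  simp [Matrix.one_apply]

lemma letter_mem_matterW (ξ : ℕ) (μ : Fin 26) (k : ℕ) : letter τ κ ξ μ k ∈ matterW (k + 1) := by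
  have h := fun m : MatterMode => MvPolynomial.isWeightedHomogeneous_X ℂ modeWeight m
  rw [letter]
  split_ifs <;> exact Submodule.smul_mem _ _ (h _)

lemma lin_mem_matterW (ξ k : ℕ) (u : Fin 26 → ℂ) : lin τ κ ξ k u ∈ matterW (k + 1) := by
  rw [lin_apply]
  exact Submodule.sum_mem _ fun μ _ => Submodule.smul_mem _ _ (letter_mem_matterW ξ μ k)

lemma quad_mem_matterW (ξ η : ℕ) (A : Matrix (Fin 26) (Fin 26) ℂ) :
    quad τ κ ξ η A ∈ matterW 2 := by
  rw [quad_apply]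
  exact Submodule.sum_mem _ fun μ _ => Submodule.sum_mem _ fun ν _ => Submodule.smul_mem _ _
    (MvPolynomial.IsWeightedHomogeneous.mul (letter_mem_matterW ξ μ 0) (letter_mem_matterW η ν 0))

variable {ξ η θ : ℕ}

lemma dual_lin (hτ : τ ≠ 0) (hκ : κ ≠ 0) (hξ : ξ < 2) (hη : η < 2) (μ : Fin 26) (k l : ℕ)
    (u : Fin 26 → ℂ) : dual τ κ ξ μ k (lin τ κ η l u) =
      if ξ = η ∧ k = l then u μ • 1 else 0 := by
  rw [lin_apply, map_sum]
  simp only [Derivation.map_smul, dual_letter hτ hκ hξ hη]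
  split_ifs with h
  · simp [h.1, h.2]
  · refine Finset.sum_eq_zero fun ν _ => ?_
    rw [if_neg (fun h' => h ⟨h'.1, h'.2.2⟩), smul_zero]

lemma dual_quad_zero (hτ : τ ≠ 0) (hκ : κ ≠ 0) (hξ : ξ < 2) (hη : η < 2) (hθ : θ < 2) (μ : Fin 26)
    (A : Matrix (Fin 26) (Fin 26) ℂ) : dual τ κ ξ μ 0 (quad τ κ η θ A) =
      (if ξ = η then lin τ κ θ 0 (A μ) else 0) +
        if ξ = θ then lin τ κ η 0 (fun ν => A ν μ) else 0 := by
  rw [quad_eq_sum_lin, map_sum]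
  simp only [Derivation.leibniz, dual_lin hτ hκ hξ hθ, dual_letter hτ hκ hξ hη]
  rw [Finset.sum_add_distrib, add_comm]
  congr 1
  · split_ifs with h <;> simp [h]
  · rcases eq_or_ne ξ θ with h | h <;> simp [h, lin_apply]

lemma dual_quad_one (hτ : τ ≠ 0) (hκ : κ ≠ 0) (hξ : ξ < 2) (hη : η < 2) (hθ : θ < 2) (μ : Fin 26)
    (A : Matrix (Fin 26) (Fin 26) ℂ) : dual τ κ ξ μ 1 (quad τ κ η θ A) = 0 := by
  rw [quad_eq_sum_lin, map_sum]
  simp [Derivation.leibniz, dual_lin hτ hκ hξ hθ, dual_letter hτ hκ hξ hη]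

lemma sum_smul_lin (k : ℕ) (a : Fin 26 → ℂ) (A : Matrix (Fin 26) (Fin 26) ℂ) :
    ∑ μ, a μ • lin τ κ ξ k (A μ) = lin τ κ ξ k (a ᵥ* A) := by
  simp only [← map_smul, ← map_sum]
  congr 1

lemma sum_smul_lin' (k : ℕ) (a : Fin 26 → ℂ) (A : Matrix (Fin 26) (Fin 26) ℂ) :
    ∑ μ, a μ • lin τ κ ξ k (fun ν => A ν μ) = lin τ κ ξ k (A *ᵥ a) := by
  rw [← Matrix.vecMul_transpose, ← sum_smul_lin]
  rfl

end

section action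

variable {τ : ℝ} {κ : ℂ} {p : Fin 26 → ℝ} {ξ η : ℕ}

/-- Read off from the spectrum of `T_0` on the Fock space, taken without ghosts, rather than from
the mode sum. -/
lemma polyT_zero {w : ℕ} (hw : w ≤ 2) {P : MvPolynomial MatterMode ℂ} (hP : P ∈ matterW w) :
    polyT p 0 P = (w : ℂ) • P := by
  have h := stressT_state (p := p) hw hP (n := 0) (by norm_num) ∅
  have h2 : stressT p 0 (state ∅ P) = state ∅ ((w : ℂ) • P) := by
    conv_lhs => rw [P.as_sum]
    conv_rhs => rw [P.as_sum]
    rw [map_sum, map_sum, Finset.smul_sum, map_sum]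
    refine Finset.sum_congr rfl fun d hd => ?_
    rw [stressT_zero_monomial, hP (MvPolynomial.mem_support_iff.1 hd), map_smul]
  have h3 := congrArg (coeff ∅) (h.symm.trans h2)
  simpa [coeff_state] using h3

lemma polyT_one_lin (hτ : τ ≠ 0) (hκ : κ ≠ 0) (hp : p 0 = 0) (hξ : ξ < 2) (u : Fin 26 → ℂ) :
    polyT p 1 (lin τ κ ξ 0 u) = if ξ = 0 then (momentum τ κ p ⬝ᵥ u) • 1 else 0 := by
  have hτ' : (τ : ℂ) ≠ 0 := by exact_mod_cast hτ
  rw [polyT_one _ hτ hκ hp]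
  interval_cases ξ <;> simp [dual_lin hτ' hκ, dotProduct, Finset.sum_smul, smul_smul]

lemma polyT_one_der (hτ : τ ≠ 0) (hκ : κ ≠ 0) (hp : p 0 = 0) (hξ : ξ < 2) (u : Fin 26 → ℂ) :
    polyT p 1 (lin τ κ ξ 1 u) = (2 : ℂ) • lin τ κ ξ 0 u := by
  have hτ' : (τ : ℂ) ≠ 0 := by exact_mod_cast hτ
  rw [polyT_one _ hτ hκ hp, lin_apply ξ 0, Finset.smul_sum]
  interval_cases ξ <;> simp [dual_lin hτ' hκ]

lemma polyT_one_quad (hτ : τ ≠ 0) (hκ : κ ≠ 0) (hp : p 0 = 0) (hξ : ξ < 2) (hη : η < 2)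
    (A : Matrix (Fin 26) (Fin 26) ℂ) :
    polyT p 1 (quad τ κ ξ η A) = (if ξ = 0 then lin τ κ η 0 (momentum τ κ p ᵥ* A) else 0) +
      if η = 0 then lin τ κ ξ 0 (A *ᵥ momentum τ κ p) else 0 := by
  have hτ' : (τ : ℂ) ≠ 0 := by exact_mod_cast hτ
  rw [polyT_one _ hτ hκ hp]
  interval_cases ξ <;> interval_cases η <;>
    simp [dual_quad_one hτ' hκ, dual_quad_zero hτ' hκ, sum_smul_lin, sum_smul_lin',
      Finset.sum_add_distrib]

lemma polyT_two_lin (hτ : τ ≠ 0) (hκ : κ ≠ 0) (hp : p 0 = 0) (hξ : ξ < 2) (u : Fin 26 → ℂ) :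
    polyT p 2 (lin τ κ ξ 1 u) = if ξ = 0 then (2 * (momentum τ κ p ⬝ᵥ u)) • 1 else 0 := by
  have hτ' : (τ : ℂ) ≠ 0 := by exact_mod_cast hτ
  rw [polyT_two _ hτ hκ hp]
  interval_cases ξ <;>
    simp [dual_lin hτ' hκ, dotProduct, Finset.sum_smul, smul_smul, Finset.mul_sum, mul_assoc]

/-- The second-order term contracts a `Q` with an `R`; the momentum term sees only letters of depth
two. -/
lemma polyT_two_quad (hτ : τ ≠ 0) (hκ : κ ≠ 0) (hp : p 0 = 0) (hξ : ξ < 2) (hη : η < 2)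
    (A : Matrix (Fin 26) (Fin 26) ℂ) :
    polyT p 2 (quad τ κ ξ η A) = if ξ = η then 0 else A.trace • 1 := by
  have hτ' : (τ : ℂ) ≠ 0 := by exact_mod_cast hτ
  rw [polyT_two _ hτ hκ hp]
  interval_cases ξ <;> interval_cases η <;>
    simp [dual_quad_one hτ' hκ, dual_quad_zero hτ' hκ, dual_lin hτ' hκ, Matrix.trace,
      Finset.sum_smul]

lemma polyT_neg_one_lin (hτ : τ ≠ 0) (hκ : κ ≠ 0) (hp : p 0 = 0) (hξ : ξ < 2)
    (u : Fin 26 → ℂ) : polyT p (-1) (lin τ κ ξ 0 u) =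
      lin τ κ ξ 1 u + quad τ κ 1 ξ (Matrix.vecMulVec (momentum τ κ p) u) := by
  have hτ' : (τ : ℂ) ≠ 0 := by exact_mod_cast hτ
  rw [polyT_neg_one _ hτ hκ hp (lin_mem_matterW ξ 0 u) le_rfl, quad_vecMulVec, lin_apply 1 0,
    lin_apply ξ 1, Finset.sum_mul, ← Finset.sum_add_distrib]
  interval_cases ξ <;> refine Finset.sum_congr rfl fun μ _ => ?_ <;>
    simp [dual_lin hτ' hκ, add_comm]

lemma polyT_neg_one_one (hτ : τ ≠ 0) (hκ : κ ≠ 0) (hp : p 0 = 0) :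
    polyT p (-1) 1 = lin τ κ 1 0 (momentum τ κ p) := by
  rw [polyT_neg_one (w := 0) _ hτ hκ hp (MvPolynomial.isWeightedHomogeneous_one ℂ _) (by norm_num),
    lin_apply]
  simp

lemma polyT_neg_two_one (hτ : τ ≠ 0) (hκ : κ ≠ 0) (hp : p 0 = 0) :
    polyT p (-2) 1 = quad τ κ 0 1 1 + lin τ κ 1 1 (momentum τ κ p) := by
  rw [polyT_neg_two hτ hκ hp, Finset.sum_add_distrib, quad_one, lin_apply]

lemma polyM_two_lin (hτ : τ ≠ 0) (hκ : κ ≠ 0) (hp : p 0 = 0) (hξ : ξ < 2) (u : Fin 26 → ℂ) :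
    κ ^ 2 • polyM τ p 2 (lin τ κ ξ 1 u) = 0 := by
  have hτ' : (τ : ℂ) ≠ 0 := by exact_mod_cast hτ
  rw [polyM_two _ hτ hκ hp]
  interval_cases ξ <;> simp [dual_lin hτ' hκ]

lemma polyM_two_quad (hτ : τ ≠ 0) (hκ : κ ≠ 0) (hp : p 0 = 0) (hξ : ξ < 2) (hη : η < 2)
    (A : Matrix (Fin 26) (Fin 26) ℂ) :
    κ ^ 2 • polyM τ p 2 (quad τ κ ξ η A) = if ξ = 0 ∧ η = 0 then A.trace • 1 else 0 := by
  have hτ' : (τ : ℂ) ≠ 0 := by exact_mod_cast hτ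
  rw [polyM_two _ hτ hκ hp]
  interval_cases ξ <;> interval_cases η <;>
    simp [dual_quad_zero hτ' hκ, dual_lin hτ' hκ, Matrix.trace, Finset.sum_smul, ← two_smul ℂ, smul_smul]

lemma polyM_one_lin (hτ : τ ≠ 0) (hκ : κ ≠ 0) (hp : p 0 = 0) (hξ : ξ < 2) (u : Fin 26 → ℂ) :
    κ ^ 2 • polyM τ p 1 (lin τ κ ξ 0 u) = 0 := by
  have hτ' : (τ : ℂ) ≠ 0 := by exact_mod_cast hτ
  rw [polyM_one _ hτ hκ hp]
  interval_cases ξ <;> simp [dual_lin hτ' hκ]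

lemma polyM_one_der (hτ : τ ≠ 0) (hκ : κ ≠ 0) (hp : p 0 = 0) (hξ : ξ < 2) (u : Fin 26 → ℂ) :
    κ ^ 2 • polyM τ p 1 (lin τ κ ξ 1 u) = if ξ = 0 then (2 : ℂ) • lin τ κ 1 0 u else 0 := by
  have hτ' : (τ : ℂ) ≠ 0 := by exact_mod_cast hτ
  rw [polyM_one _ hτ hκ hp, lin_apply 1, Finset.smul_sum]
  interval_cases ξ <;> simp [dual_lin hτ' hκ]

lemma polyM_one_quad (hτ : τ ≠ 0) (hκ : κ ≠ 0) (hp : p 0 = 0) (hξ : ξ < 2) (hη : η < 2)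
    (A : Matrix (Fin 26) (Fin 26) ℂ) : κ ^ 2 • polyM τ p 1 (quad τ κ ξ η A) = 0 := by
  have hτ' : (τ : ℂ) ≠ 0 := by exact_mod_cast hτ
  rw [polyM_one _ hτ hκ hp]
  interval_cases ξ <;> interval_cases η <;> simp [dual_quad_one hτ' hκ]

lemma polyM_zero_one (hτ : τ ≠ 0) (hκ : κ ≠ 0) (hp : p 0 = 0) :
    κ ^ 2 • polyM τ p 0 1 = 0 := by
  rw [polyM_zero _ hτ hκ hp]
  simp

lemma polyM_zero_lin (hτ : τ ≠ 0) (hκ : κ ≠ 0) (hp : p 0 = 0) (hξ : ξ < 2) (u : Fin 26 → ℂ) :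
    κ ^ 2 • polyM τ p 0 (lin τ κ ξ 0 u) = if ξ = 0 then lin τ κ 1 0 u else 0 := by
  have hτ' : (τ : ℂ) ≠ 0 := by exact_mod_cast hτ
  rw [polyM_zero _ hτ hκ hp, lin_apply 1]
  interval_cases ξ <;> simp [dual_lin hτ' hκ]

lemma polyM_zero_der (hτ : τ ≠ 0) (hκ : κ ≠ 0) (hp : p 0 = 0) (hξ : ξ < 2) (u : Fin 26 → ℂ) :
    κ ^ 2 • polyM τ p 0 (lin τ κ ξ 1 u) = if ξ = 0 then (2 : ℂ) • lin τ κ 1 1 u else 0 := by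
  have hτ' : (τ : ℂ) ≠ 0 := by exact_mod_cast hτ
  rw [polyM_zero _ hτ hκ hp, lin_apply 1, Finset.smul_sum]
  interval_cases ξ <;> simp [dual_lin hτ' hκ]

lemma polyM_zero_quad (hτ : τ ≠ 0) (hκ : κ ≠ 0) (hp : p 0 = 0) (hξ : ξ < 2) (hη : η < 2)
    (A : Matrix (Fin 26) (Fin 26) ℂ) :
    κ ^ 2 • polyM τ p 0 (quad τ κ ξ η A) = (if ξ = 0 then quad τ κ 1 η A else 0) +
      if η = 0 then quad τ κ ξ 1 A else 0 := by
  have hτ' : (τ : ℂ) ≠ 0 := by exact_mod_cast hτ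
  rw [polyM_zero _ hτ hκ hp, quad_eq_sum_lin 1, quad_eq_sum_lin' _ 1]
  interval_cases ξ <;> interval_cases η <;>
    simp [dual_quad_one hτ' hκ, dual_quad_zero hτ' hκ, mul_add, Finset.sum_add_distrib]

lemma polyM_neg_one_one (hτ : τ ≠ 0) (hκ : κ ≠ 0) (hp : p 0 = 0) :
    κ ^ 2 • polyM τ p (-1) 1 = 0 := by
  rw [polyM_neg_one (w := 0) _ hτ hκ hp (MvPolynomial.isWeightedHomogeneous_one ℂ _) (by norm_num)]
  simp

lemma polyM_neg_one_lin (hτ : τ ≠ 0) (hκ : κ ≠ 0) (hp : p 0 = 0) (hξ : ξ < 2)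
    (u : Fin 26 → ℂ) : κ ^ 2 • polyM τ p (-1) (lin τ κ ξ 0 u) =
      if ξ = 0 then lin τ κ 1 1 u else 0 := by
  have hτ' : (τ : ℂ) ≠ 0 := by exact_mod_cast hτ
  rw [polyM_neg_one _ hτ hκ hp (lin_mem_matterW ξ 0 u) le_rfl, lin_apply 1]
  interval_cases ξ <;> simp [dual_lin hτ' hκ]

lemma polyM_neg_two_one (hτ : τ ≠ 0) (hκ : κ ≠ 0) (hp : p 0 = 0) :
    κ ^ 2 • polyM τ p (-2) 1 = (1 / 2 : ℂ) • quad τ κ 1 1 1 := by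
  rw [polyM_neg_two hτ hκ hp, ← Finset.smul_sum, quad_one]

end action

/-! ### Invariant axes and transverse tensors -/

/-- A transverse vector as a vector with components `μ = 0, …, 25`. -/
def hat : (Fin 25 → ℂ) →ₗ[ℂ] (Fin 26 → ℂ) where
  toFun v := Fin.cons 0 v
  map_add' v w := by ext μ; refine Fin.cases ?_ (fun i => ?_) μ <;> simp
  map_smul' a v := by ext μ; refine Fin.cases ?_ (fun i => ?_) μ <;> simp

/-- The transverse components of a vector. -/
def unhat : (Fin 26 → ℂ) →ₗ[ℂ] (Fin 25 → ℂ) := LinearMap.funLeft ℂ ℂ Fin.succ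

/-- A transverse tensor as a tensor with components `μ, ν = 0, …, 25`. -/
def hatMat : Matrix (Fin 25) (Fin 25) ℂ →ₗ[ℂ] Matrix (Fin 26) (Fin 26) ℂ where
  toFun A := Fin.cons 0 fun i => Fin.cons 0 (A i)
  map_add' A B := by
    ext μ ν
    refine Fin.cases ?_ (fun i => ?_) μ <;> refine Fin.cases ?_ (fun j => ?_) ν <;>
      first | rfl | exact (add_zero 0).symm
  map_smul' a A := by
    ext μ ν
    refine Fin.cases ?_ (fun i => ?_) μ <;> refine Fin.cases ?_ (fun j => ?_) ν <;>
      first | rfl | exact (smul_zero a).symm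

/-- The transverse components of a tensor. -/
def unhatMat : Matrix (Fin 26) (Fin 26) ℂ →ₗ[ℂ] Matrix (Fin 25) (Fin 25) ℂ where
  toFun A := A.submatrix Fin.succ Fin.succ
  map_add' _ _ := rfl
  map_smul' _ _ := rfl

lemma hat_zero (v : Fin 25 → ℂ) : hat v 0 = 0 := rfl
lemma hat_succ (v : Fin 25 → ℂ) (i : Fin 25) : hat v i.succ = v i := rfl
lemma unhat_apply (u : Fin 26 → ℂ) (i : Fin 25) : unhat u i = u i.succ := rfl
lemma unhat_hat (v : Fin 25 → ℂ) : unhat (hat v) = v := rfl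

lemma hat_unhat {u : Fin 26 → ℂ} (h : u 0 = 0) : hat (unhat u) = u := by
  ext μ
  refine Fin.cases ?_ (fun i => ?_) μ
  · rw [hat_zero, h]
  · rw [hat_succ, unhat_apply]

lemma hat_dotProduct_hat (v w : Fin 25 → ℂ) : hat v ⬝ᵥ hat w = v ⬝ᵥ w := by
  simp [dotProduct, Fin.sum_univ_succ, hat_zero, hat_succ]

lemma hatMat_zero_left (A : Matrix (Fin 25) (Fin 25) ℂ) (ν : Fin 26) : hatMat A 0 ν = 0 := rfl
lemma hatMat_zero_right (A : Matrix (Fin 25) (Fin 25) ℂ) (μ : Fin 26) : hatMat A μ 0 = 0 := by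
  refine Fin.cases ?_ (fun i => ?_) μ <;> rfl
lemma hatMat_succ (A : Matrix (Fin 25) (Fin 25) ℂ) (i j : Fin 25) :
    hatMat A i.succ j.succ = A i j := rfl
lemma unhatMat_hatMat (A : Matrix (Fin 25) (Fin 25) ℂ) : unhatMat (hatMat A) = A := rfl

lemma hatMat_unhatMat {A : Matrix (Fin 26) (Fin 26) ℂ} (h : ∀ μ, A 0 μ = 0) (h' : ∀ μ, A μ 0 = 0) :
    hatMat (unhatMat A) = A := by
  ext μ ν
  refine Fin.cases ?_ (fun i => ?_) μ
  · rw [hatMat_zero_left, h]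
  · refine Fin.cases ?_ (fun j => ?_) ν
    · rw [hatMat_zero_right, h']
    · rfl

lemma hatMat_transpose (A : Matrix (Fin 25) (Fin 25) ℂ) : hatMat Aᵀ = (hatMat A)ᵀ := by
  ext μ ν
  refine Fin.cases ?_ (fun i => ?_) μ <;> refine Fin.cases ?_ (fun j => ?_) ν <;> rfl

lemma hatMat_trace (A : Matrix (Fin 25) (Fin 25) ℂ) : (hatMat A).trace = A.trace := by
  simp [Matrix.trace, Fin.sum_univ_succ, hatMat_zero_left, hatMat_succ]

lemma hatMat_mulVec_hat (A : Matrix (Fin 25) (Fin 25) ℂ) (v : Fin 25 → ℂ) :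
    hatMat A *ᵥ hat v = hat (A *ᵥ v) := by
  ext μ
  refine Fin.cases ?_ (fun i => ?_) μ <;>
    simp [Matrix.mulVec, dotProduct, Fin.sum_univ_succ, hat_zero, hat_succ, hatMat_zero_left,
      hatMat_succ]

/-- The orthogonal projection to the complement of the first `r` axes. -/
def transProj (r : ℕ) (e : ℕ → Fin 26 → ℂ) : Matrix (Fin 26) (Fin 26) ℂ :=
  1 - ∑ a ∈ Finset.range r, Matrix.vecMulVec (e a) (e a)

/-- Orthonormal axes, fixed by the stabiliser of `p`, whose complement is `V^⊥`. -/
structure IsFrame (τ : ℝ) (κ : ℂ) (p : Fin 26 → ℝ) (r : ℕ) (e : ℕ → Fin 26 → ℂ) : Prop where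
  tension : τ ≠ 0
  scale : κ ≠ 0
  energy : p 0 = 0
  rank : r = 1 ∨ r = 2
  orth : ∀ a < r, ∀ b < r, e a ⬝ᵥ e b = if a = b then 1 else 0
  zero : e 0 = Pi.single 0 1
  mem_perp : ∀ v : Fin 25 → ℂ, v ∈ perp p ↔ ∀ a < r, e a ⬝ᵥ hat v = 0
  transverse : ∃ c : ℂ, c ≠ 0 ∧ hat (transverse p) = if r = 2 then c • e 1 else 0
  momentum : momentum τ κ p = if r = 2 then e 1 else 0
  fixed : ∀ R : stab p, ∀ a < r, ∀ ν, ∑ μ, rotCoeff R ν μ * e a μ = e a ν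

section frame

variable {τ : ℝ} {κ : ℂ} {p : Fin 26 → ℝ} {r : ℕ} {e : ℕ → Fin 26 → ℂ}

lemma transProj_transpose : (transProj r e)ᵀ = transProj r e := by
  simp [transProj, Matrix.transpose_sub, Matrix.transpose_sum, Matrix.transpose_vecMulVec]

lemma transProj_mulVec (u : Fin 26 → ℂ) :
    transProj r e *ᵥ u = u - ∑ a ∈ Finset.range r, (e a ⬝ᵥ u) • e a := by
  rw [transProj, Matrix.sub_mulVec, Matrix.one_mulVec, Matrix.sum_mulVec]
  simp only [Matrix.vecMulVec_mulVec]
  simp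

namespace IsFrame

variable (F : IsFrame τ κ p r e)
include F

lemma pos : 0 < r := by rcases F.rank with h | h <;> omega

lemma transProj_mulVec_axis {a : ℕ} (ha : a < r) : transProj r e *ᵥ e a = 0 := by
  rw [transProj_mulVec, sub_eq_zero, Finset.sum_eq_single a]
  · rw [F.orth a ha a ha, if_pos rfl, one_smul]
  · intro b hb hba
    rw [F.orth b (Finset.mem_range.1 hb) a ha, if_neg hba, zero_smul]
  · exact fun h => absurd (Finset.mem_range.2 ha) h

lemma transProj_mulVec_hat {v : Fin 25 → ℂ} (hv : v ∈ perp p) :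
    transProj r e *ᵥ hat v = hat v := by
  rw [transProj_mulVec, Finset.sum_eq_zero, sub_zero]
  intro a ha
  rw [(F.mem_perp v).1 hv a (Finset.mem_range.1 ha), zero_smul]

lemma axis_dotProduct_transProj {a : ℕ} (ha : a < r) (u : Fin 26 → ℂ) :
    e a ⬝ᵥ (transProj r e *ᵥ u) = 0 := by
  rw [Matrix.dotProduct_mulVec, ← Matrix.mulVec_transpose, transProj_transpose,
    F.transProj_mulVec_axis ha, zero_dotProduct]

lemma transProj_mulVec_zero (u : Fin 26 → ℂ) : (transProj r e *ᵥ u) 0 = 0 := by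
  have h := F.axis_dotProduct_transProj F.pos u
  rwa [F.zero, single_dotProduct, one_mul] at h

lemma hat_unhat_transProj (u : Fin 26 → ℂ) :
    hat (unhat (transProj r e *ᵥ u)) = transProj r e *ᵥ u :=
  hat_unhat (F.transProj_mulVec_zero u)

lemma unhat_transProj_mem (u : Fin 26 → ℂ) : unhat (transProj r e *ᵥ u) ∈ perp p := by
  rw [F.mem_perp]
  intro a ha
  rw [F.hat_unhat_transProj, F.axis_dotProduct_transProj ha]

lemma transProj_mul_self : transProj r e * transProj r e = transProj r e := by
  refine Matrix.ext_of_mulVec_single fun i => ?_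
  rw [← Matrix.mulVec_mulVec, ← F.hat_unhat_transProj (Pi.single i 1),
    F.transProj_mulVec_hat (F.unhat_transProj_mem _)]

lemma transProj_trace : (transProj r e).trace = 26 - r := by
  have h : ∑ a ∈ Finset.range r, (Matrix.vecMulVec (e a) (e a)).trace = ∑ a ∈ Finset.range r, 1 :=
    Finset.sum_congr rfl fun a ha => by
      rw [Matrix.trace_vecMulVec, F.orth a (Finset.mem_range.1 ha) a (Finset.mem_range.1 ha),
        if_pos rfl]
  rw [transProj, Matrix.trace_sub, Matrix.trace_one, Matrix.trace_sum, h]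
  simp

lemma momentum_dotProduct {a : ℕ} (ha : a < r) :
    CarrollString.momentum τ κ p ⬝ᵥ e a = if a = 1 then 1 else 0 := by
  rw [F.momentum]
  rcases F.rank with h | h
  · rw [if_neg (by omega), zero_dotProduct, if_neg (by omega)]
  · rw [if_pos h, F.orth 1 (by omega) a ha]
    simp [eq_comm]

lemma momentum_dotProduct_hat {v : Fin 25 → ℂ} (hv : v ∈ perp p) :
    CarrollString.momentum τ κ p ⬝ᵥ hat v = 0 := by
  rw [F.momentum]
  split
  · exact (F.mem_perp v).1 hv 1 (by omega)
  · exact zero_dotProduct _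

lemma transProj_mulVec_momentum : transProj r e *ᵥ CarrollString.momentum τ κ p = 0 := by
  rw [F.momentum]
  split
  · exact F.transProj_mulVec_axis (by omega)
  · exact Matrix.mulVec_zero _

/-- `hat (transverse p)` spans the second axis, or vanishes if there is none. The time axis is
killed by every `hatMat A`, so including it costs nothing. -/
lemma mulVec_transverse (A : Matrix (Fin 25) (Fin 25) ℂ) :
    A *ᵥ CarrollString.transverse p = 0 ↔ ∀ a < r, hatMat A *ᵥ e a = 0 := by
  have h0 : hatMat A *ᵥ e 0 = 0 := by
    rw [F.zero, Matrix.mulVec_single_one]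
    funext μ
    exact hatMat_zero_right A μ
  obtain ⟨c, hc, h⟩ := F.transverse
  have hinj : A *ᵥ CarrollString.transverse p = 0 ↔
      hatMat A *ᵥ hat (CarrollString.transverse p) = 0 := by
    rw [hatMat_mulVec_hat]
    exact ⟨fun h => by rw [h, map_zero], fun h => by rw [← unhat_hat (A *ᵥ _), h, map_zero]⟩
  rw [hinj, h]
  rcases F.rank with hr | hr
  · rw [if_neg (by omega), Matrix.mulVec_zero]
    refine ⟨fun _ a ha => ?_, fun _ => rfl⟩
    obtain rfl : a = 0 := by omega
    exact h0
  · rw [if_pos hr, Matrix.mulVec_smul, smul_eq_zero_iff_right hc]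
    refine ⟨fun h1 a ha => ?_, fun h => h 1 (by omega)⟩
    obtain rfl | rfl : a = 0 ∨ a = 1 := by omega
    · exact h0
    · exact h1

lemma hatMat_mul_transProj {A : Matrix (Fin 25) (Fin 25) ℂ}
    (hA : A *ᵥ CarrollString.transverse p = 0) : hatMat A * transProj r e = hatMat A := by
  rw [transProj, Matrix.mul_sub, Matrix.mul_one, Matrix.mul_sum, Finset.sum_eq_zero, sub_zero]
  intro a ha
  rw [Matrix.mul_vecMulVec, (F.mulVec_transverse A).1 hA a (Finset.mem_range.1 ha),
    Matrix.zero_vecMulVec]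

lemma transProj_mul_hatMat {A : Matrix (Fin 25) (Fin 25) ℂ}
    (hA : Aᵀ *ᵥ CarrollString.transverse p = 0) : transProj r e * hatMat A = hatMat A := by
  have h := F.hatMat_mul_transProj hA
  rwa [hatMat_transpose, ← Matrix.transpose_inj, Matrix.transpose_mul, transProj_transpose,
    Matrix.transpose_transpose] at h

lemma hatMat_unhatMat_transProj (B : Matrix (Fin 26) (Fin 26) ℂ) :
    hatMat (unhatMat (transProj r e * B * transProj r e)) =
      transProj r e * B * transProj r e := by
  refine hatMat_unhatMat (fun μ => ?_) fun μ => ?_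
  · have h := F.transProj_mulVec_zero ((B * transProj r e) *ᵥ Pi.single μ 1)
    rw [Matrix.mulVec_mulVec, ← Matrix.mul_assoc, Matrix.mulVec_single_one] at h
    exact h
  · have h := F.transProj_mulVec_zero ((Bᵀ * transProj r e) *ᵥ Pi.single μ 1)
    rw [Matrix.mulVec_mulVec, Matrix.mulVec_single_one] at h
    change (transProj r e * (Bᵀ * transProj r e)) 0 μ = 0 at h
    rw [← Matrix.transpose_apply (transProj r e * B * transProj r e), Matrix.transpose_mul,
      Matrix.transpose_mul, transProj_transpose]
    exact h

lemma unhatMat_transProj_mulVec (B : Matrix (Fin 26) (Fin 26) ℂ) :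
    unhatMat (transProj r e * B * transProj r e) *ᵥ CarrollString.transverse p = 0 := by
  rw [F.mulVec_transverse]
  intro a ha
  rw [F.hatMat_unhatMat_transProj, ← Matrix.mulVec_mulVec, F.transProj_mulVec_axis ha,
    Matrix.mulVec_zero]

end IsFrame

end frame

/-! ### The isotypic sectors -/

/-- The representations that occur in the cochains. -/
inductive Sector
  | scalar
  | vector
  | sym
  | skew
  deriving DecidableEq

instance : Fintype Sector where
  elems := {.scalar, .vector, .sym, .skew}
  complete x := by cases x <;> decide

/-- The space of a representation that occurs in the cochains. -/
def Sector.Space (p : Fin 26 → ℝ) : Sector → Type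
  | scalar => ℂ
  | vector => perp p
  | sym => symPerp p
  | skew => skewPerp p

instance (p : Fin 26 → ℝ) : (s : Sector) → AddCommGroup (s.Space p)
  | .scalar => inferInstanceAs (AddCommGroup ℂ)
  | .vector => inferInstanceAs (AddCommGroup (perp p))
  | .sym => inferInstanceAs (AddCommGroup (symPerp p))
  | .skew => inferInstanceAs (AddCommGroup (skewPerp p))

instance (p : Fin 26 → ℝ) : (s : Sector) → Module ℂ (s.Space p)
  | .scalar => inferInstanceAs (Module ℂ ℂ)
  | .vector => inferInstanceAs (Module ℂ (perp p))
  | .sym => inferInstanceAs (Module ℂ (symPerp p))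
  | .skew => inferInstanceAs (Module ℂ (skewPerp p))

/-- The representations that occur in the cochains. -/
def Sector.rep (p : Fin 26 → ℝ) : (s : Sector) → Representation ℂ (stab p) (s.Space p)
  | scalar => Representation.trivial ℂ (stab p) ℂ
  | vector => perpRep p
  | sym => symPerpRep p
  | skew => skewPerpRep p

/-- The combinatorial model of a sector. -/
def Sector.model (r : ℕ) : Sector → MatterModel
  | scalar => scalarModel r
  | vector => vectorModel r
  | sym => symModel
  | skew => skewModel

/-- The tensor product with a fixed vector. -/
def outer (u : Fin 26 → ℂ) : (Fin 26 → ℂ) →ₗ[ℂ] Matrix (Fin 26) (Fin 26) ℂ where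
  toFun v := Matrix.vecMulVec u v
  map_add' v w := Matrix.vecMulVec_add u v w
  map_smul' a v := by
    ext μ ν
    exact mul_left_comm _ _ _

lemma outer_apply (u v : Fin 26 → ℂ) : outer u v = Matrix.vecMulVec u v := rfl

/-- The invariant polynomials. -/
def scalarCov (τ κ : ℂ) (r : ℕ) (e : ℕ → Fin 26 → ℂ) : Label → MvPolynomial MatterMode ℂ
  | .one => 1
  | .lin i => lin τ κ (i % 2) 0 (e (i / 2))
  | .der i => lin τ κ (i % 2) 1 (e (i / 2))
  | .quad i j => quad τ κ (i % 2) (j % 2) (Matrix.vecMulVec (e (i / 2)) (e (j / 2)))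
  | .tr i => quad τ κ (i / 2) ((i + 1) / 2) (transProj r e)

/-- The polynomials that depend linearly on a transverse vector. -/
def vectorCov (τ κ : ℂ) (e : ℕ → Fin 26 → ℂ) : Label → (Fin 26 → ℂ) →ₗ[ℂ] MvPolynomial MatterMode ℂ
  | .lin i => lin τ κ i 0
  | .der i => lin τ κ i 1
  | .quad i j => quad τ κ (i % 2) j ∘ₗ outer (e (i / 2))
  | _ => 0

/-- The polynomials that depend linearly on a transverse tensor. -/
def tensorCov (τ κ : ℂ) : Label → Matrix (Fin 26) (Fin 26) ℂ →ₗ[ℂ] MvPolynomial MatterMode ℂ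
  | .tr i => quad τ κ (i / 2) ((i + 1) / 2)
  | _ => 0

/-- The polynomials of a sector. -/
def covariant (τ κ : ℂ) (p : Fin 26 → ℝ) (r : ℕ) (e : ℕ → Fin 26 → ℂ) :
    (s : Sector) → Label → s.Space p →ₗ[ℂ] MvPolynomial MatterMode ℂ
  | .scalar, x => LinearMap.toSpanSingleton ℂ _ (scalarCov τ κ r e x)
  | .vector, x => vectorCov τ κ e x ∘ₗ hat ∘ₗ (perp p).subtype
  | .sym, x => tensorCov τ κ x ∘ₗ hatMat ∘ₗ (symPerp p).subtype
  | .skew, x => tensorCov τ κ x ∘ₗ hatMat ∘ₗ (skewPerp p).subtype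

/-- A linear combination of polynomials. -/
def labelSum (f : Label → MvPolynomial MatterMode ℂ) (L : List (ℤ × Label)) :
    MvPolynomial MatterMode ℂ := (L.map fun y => (y.1 : ℂ) • f y.2).sum

lemma labelSum_nil (f : Label → MvPolynomial MatterMode ℂ) : labelSum f [] = 0 := rfl

lemma labelSum_cons (f : Label → MvPolynomial MatterMode ℂ) (y : ℤ × Label)
    (L : List (ℤ × Label)) : labelSum f (y :: L) = (y.1 : ℂ) • f y.2 + labelSum f L := rfl

lemma labelSum_append (f : Label → MvPolynomial MatterMode ℂ) (L L' : List (ℤ × Label)) :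
    labelSum f (L ++ L') = labelSum f L + labelSum f L' := by simp [labelSum]

lemma labelSum_ite (f : Label → MvPolynomial MatterMode ℂ) (c : Prop) [Decidable c]
    (L L' : List (ℤ × Label)) :
    labelSum f (if c then L else L') = if c then labelSum f L else labelSum f L' := by
  split <;> rfl

/-! ### The modes of `T` on the invariants -/

section

variable {τ : ℝ} {κ : ℂ} {p : Fin 26 → ℝ} {r : ℕ} {e : ℕ → Fin 26 → ℂ}

lemma mem_scalarModel_lin {i : ℕ} : Label.lin i ∈ (scalarModel r).labels ↔ i < 2 * r := by
  simp [scalarModel]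

lemma mem_scalarModel_der {i : ℕ} : Label.der i ∈ (scalarModel r).labels ↔ i < 2 * r := by
  simp [scalarModel]

lemma mem_scalarModel_quad {i j : ℕ} :
    Label.quad i j ∈ (scalarModel r).labels ↔ j < 2 * r ∧ i ≤ j := by
  simp [scalarModel]

lemma mem_scalarModel_tr {i : ℕ} : Label.tr i ∈ (scalarModel r).labels ↔ i < 3 := by
  simp [scalarModel]
  omega

lemma scalarCov_mem {x : Label} : scalarCov τ κ r e x ∈ matterW x.weight := by
  cases x with
  | one => exact MvPolynomial.isWeightedHomogeneous_one ℂ _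
  | lin i => exact lin_mem_matterW _ _ _
  | der i => exact lin_mem_matterW _ _ _
  | quad i j => exact quad_mem_matterW _ _ _
  | tr i => exact quad_mem_matterW _ _ _

lemma vectorCov_mem {x : Label} (u : Fin 26 → ℂ) : vectorCov τ κ e x u ∈ matterW x.weight := by
  cases x with
  | one => exact Submodule.zero_mem _
  | lin i => exact lin_mem_matterW _ _ _
  | der i => exact lin_mem_matterW _ _ _
  | quad i j => exact quad_mem_matterW _ _ _
  | tr i => exact Submodule.zero_mem _

lemma tensorCov_mem {x : Label} (A : Matrix (Fin 26) (Fin 26) ℂ) :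
    tensorCov τ κ x A ∈ matterW x.weight := by
  cases x with
  | tr i => exact quad_mem_matterW _ _ _
  | _ => exact Submodule.zero_mem _

lemma covariant_mem (s : Sector) (x : Label) (w : s.Space p) :
    covariant τ κ p r e s x w ∈ matterW x.weight := by
  cases s with
  | scalar => exact Submodule.smul_mem _ _ scalarCov_mem
  | vector => exact vectorCov_mem _
  | sym => exact tensorCov_mem _
  | skew => exact tensorCov_mem _

lemma scalarCov_mkQuad (i j : ℕ) : scalarCov τ κ r e (mkQuad i j) =
    quad τ κ (i % 2) (j % 2) (Matrix.vecMulVec (e (i / 2)) (e (j / 2))) := by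
  rw [mkQuad]
  split
  · rw [scalarCov]
  · rw [quad_comm, Matrix.transpose_vecMulVec, scalarCov]

lemma Label.weight_le (x : Label) : x.weight ≤ 2 := by cases x <;> simp [weight]

/-- Splits the contractions over all directions in `T_{-2}` and `M_{-2}` into products of axis
letters and a transverse trace. -/
lemma one_eq_transProj_add (hr : r = 1 ∨ r = 2) : (1 : Matrix (Fin 26) (Fin 26) ℂ) =
    transProj r e + if r = 2 then Matrix.vecMulVec (e 0) (e 0) + Matrix.vecMulVec (e 1) (e 1)
      else Matrix.vecMulVec (e 0) (e 0) := by
  rcases hr with rfl | rfl <;> simp [transProj, Finset.sum_range_succ]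

lemma scalar_T_zero (x : Label) : (2 : ℂ) • polyT p 0 (scalarCov τ κ r e x) =
    labelSum (scalarCov τ κ r e) ((scalarModel r).T 0 x) := by
  rw [polyT_zero x.weight_le scalarCov_mem]
  rw [show (scalarModel r).T 0 x = [((2 * x.weight : ℤ), x)] by cases x <;> rfl]
  simp [labelSum, smul_smul]

namespace IsFrame

variable (F : IsFrame τ κ p r e)
include F

lemma scalar_T_neg_two : (2 : ℂ) • polyT p (-2) (scalarCov τ κ r e .one) =
    labelSum (scalarCov τ κ r e) ((scalarModel r).T (-2) .one) := by
  rw [scalarCov, polyT_neg_two_one F.tension F.scale F.energy, F.momentum,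
    one_eq_transProj_add (e := e) F.rank]
  rcases F.rank with rfl | rfl
  · simp [labelSum, scalarModel, scalarCov]
    abel
  · simp [labelSum, scalarModel, scalarCov, List.range_succ]
    abel

lemma scalar_T_neg_one {x : Label} (hx : x ∈ (scalarModel r).labels) (hw : x.weight ≤ 1) :
    (2 : ℂ) • polyT p (-1) (scalarCov τ κ r e x) =
    labelSum (scalarCov τ κ r e) ((scalarModel r).T (-1) x) := by
  cases x with
  | one =>
    rw [scalarCov, polyT_neg_one_one F.tension F.scale F.energy, F.momentum]
    rcases F.rank with rfl | rfl <;> simp [labelSum, scalarModel, scalarCov]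
  | lin i =>
    rw [mem_scalarModel_lin] at hx
    rw [scalarCov, polyT_neg_one_lin F.tension F.scale F.energy (by omega), F.momentum]
    rw [show (scalarModel r).T (-1) (.lin i) =
      (2, .der i) :: if r = 2 then [(2, mkQuad i 3)] else [] from rfl]
    rcases F.rank with rfl | rfl
    · simp [labelSum, scalarCov]
    · rw [if_pos rfl, if_pos rfl, labelSum_cons, labelSum_cons, labelSum_nil, scalarCov_mkQuad,
        quad_comm, Matrix.transpose_vecMulVec]
      simp [scalarCov]
  | der i => simp [Label.weight] at hw
  | quad i j => simp [Label.weight] at hw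
  | tr i => simp [Label.weight] at hw

lemma scalar_T_one {x : Label} (hx : x ∈ (scalarModel r).labels) :
    (2 : ℂ) • polyT p 1 (scalarCov τ κ r e x) =
    labelSum (scalarCov τ κ r e) ((scalarModel r).T 1 x) := by
  cases x with
  | one =>
    rw [polyT_eq_zero scalarCov_mem (by simp [Label.weight]), smul_zero]
    rfl
  | lin i =>
    rw [mem_scalarModel_lin] at hx
    rw [scalarCov, polyT_one_lin F.tension F.scale F.energy (by omega),
      F.momentum_dotProduct (by omega)]
    rw [show (scalarModel r).T 1 (.lin i) = if i = 2 then [(2, .one)] else [] from rfl]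
    -- The letter `2` is `Q` along the momentum axis, the only letter that `T_1` contracts with the
    -- momentum.
    have h : (i % 2 = 0 ∧ i / 2 = 1) ↔ i = 2 := by omega
    by_cases h2 : i = 2
    · subst h2
      simp [labelSum, scalarCov]
    · rw [if_neg h2]
      rw [← h, not_and] at h2
      by_cases h3 : i % 2 = 0
      · simp [h2 h3, labelSum]
      · simp [h3, labelSum]
  | der i =>
    rw [mem_scalarModel_der] at hx
    rw [scalarCov, polyT_one_der F.tension F.scale F.energy (by omega)]
    rw [show (scalarModel r).T 1 (.der i) = [(4, .lin i)] from rfl]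
    simp [labelSum, scalarCov, smul_smul]
    norm_num
  | quad i j =>
    rw [mem_scalarModel_quad] at hx
    rw [scalarCov, polyT_one_quad F.tension F.scale F.energy (by omega) (by omega),
      Matrix.vecMul_vecMulVec, Matrix.vecMulVec_mulVec, F.momentum_dotProduct (by omega),
      dotProduct_comm, F.momentum_dotProduct (by omega)]
    rw [show (scalarModel r).T 1 (.quad i j) = (if i = 2 then [(2, .lin j)] else []) ++
      if j = 2 then [(2, .lin i)] else [] from rfl, labelSum_append, labelSum_ite, labelSum_ite]
    have h : ∀ i, (i % 2 = 0 ∧ i / 2 = 1) ↔ i = 2 := by omega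
    simp only [← h, labelSum_cons, labelSum_nil, scalarCov, smul_add]
    congr 1
    · by_cases h1 : i % 2 = 0 <;> by_cases h2 : i / 2 = 1 <;> simp [h1, h2]
    · by_cases h1 : j % 2 = 0 <;> by_cases h2 : j / 2 = 1 <;> simp [h1, h2]
  | tr i =>
    rw [mem_scalarModel_tr] at hx
    rw [scalarCov, polyT_one_quad F.tension F.scale F.energy (by omega) (by omega),
      ← Matrix.mulVec_transpose, transProj_transpose, F.transProj_mulVec_momentum]
    simp [labelSum, show (scalarModel r).T 1 (.tr i) = [] from rfl]

lemma scalar_T_two {x : Label} (hx : x ∈ (scalarModel r).labels) :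
    (2 : ℂ) • polyT p 2 (scalarCov τ κ r e x) =
    labelSum (scalarCov τ κ r e) ((scalarModel r).T 2 x) := by
  cases x with
  | one =>
    rw [polyT_eq_zero scalarCov_mem (by simp [Label.weight]), smul_zero]
    rfl
  | lin i =>
    rw [polyT_eq_zero scalarCov_mem (by simp [Label.weight]), smul_zero]
    rfl
  | der i =>
    rw [mem_scalarModel_der] at hx
    rw [scalarCov, polyT_two_lin F.tension F.scale F.energy (by omega),
      F.momentum_dotProduct (by omega)]
    rw [show (scalarModel r).T 2 (.der i) = if i = 2 then [(4, .one)] else [] from rfl]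
    have h : (i % 2 = 0 ∧ i / 2 = 1) ↔ i = 2 := by omega
    by_cases h2 : i = 2
    · subst h2
      simp [labelSum, scalarCov, smul_smul]
      norm_num
    · rw [if_neg h2]
      rw [← h, not_and] at h2
      by_cases h3 : i % 2 = 0
      · simp [h2 h3, labelSum]
      · simp [h3, labelSum]
  | quad i j =>
    rw [mem_scalarModel_quad] at hx
    rw [scalarCov, polyT_two_quad F.tension F.scale F.energy (by omega) (by omega),
      Matrix.trace_vecMulVec, F.orth _ (by omega) _ (by omega)]
    rw [show (scalarModel r).T 2 (.quad i j) =
      if i % 2 = 0 ∧ j = i + 1 then [(2, .one)] else [] from rfl]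
    -- Since `i ≤ j`, two letters of different kinds on the same axis are consecutive, with `Q`
    -- first.
    have h : (i % 2 = 0 ∧ j = i + 1) ↔ (i % 2 ≠ j % 2 ∧ i / 2 = j / 2) := by omega
    simp only [h]
    by_cases h1 : i % 2 = j % 2 <;> by_cases h2 : i / 2 = j / 2 <;>
      simp [h1, h2, labelSum, scalarCov]
  | tr i =>
    rw [mem_scalarModel_tr] at hx
    rw [scalarCov, polyT_two_quad F.tension F.scale F.energy (by omega) (by omega),
      F.transProj_trace]
    rw [show (scalarModel r).T 2 (.tr i) = if i = 1 then
      [((2 * (26 - r) : ℤ), Label.one)] else [] from rfl]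
    interval_cases i <;> simp [labelSum, scalarCov, smul_smul]

end IsFrame

end

/-! ### The modes of `M` on the invariants -/

section

variable {τ : ℝ} {κ : ℂ} {p : Fin 26 → ℝ} {r : ℕ} {e : ℕ → Fin 26 → ℂ}

namespace IsFrame

variable (F : IsFrame τ κ p r e)
include F

lemma scalar_M_neg_two : (2 : ℂ) • κ ^ 2 • polyM τ p (-2) (scalarCov τ κ r e .one) =
    labelSum (scalarCov τ κ r e) ((scalarModel r).M (-2) .one) := by
  rw [scalarCov, polyM_neg_two_one F.tension F.scale F.energy, one_eq_transProj_add (e := e) F.rank]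
  rcases F.rank with rfl | rfl
  · simp [labelSum, scalarModel, scalarCov, add_comm]
  · simp [labelSum, scalarModel, scalarCov, List.range_succ]
    abel

lemma scalar_M_neg_one {x : Label} (hx : x ∈ (scalarModel r).labels) (hw : x.weight ≤ 1) :
    (2 : ℂ) • κ ^ 2 • polyM τ p (-1) (scalarCov τ κ r e x) =
    labelSum (scalarCov τ κ r e) ((scalarModel r).M (-1) x) := by
  cases x with
  | one =>
    rw [scalarCov, polyM_neg_one_one F.tension F.scale F.energy, smul_zero]
    rfl
  | lin i =>
    rw [mem_scalarModel_lin] at hx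
    rw [scalarCov, polyM_neg_one_lin F.tension F.scale F.energy (by omega)]
    rw [show (scalarModel r).M (-1) (.lin i) =
      if i % 2 = 0 then [(2, .der (i + 1))] else [] from rfl]
    by_cases h : i % 2 = 0
    · simp [h, labelSum, scalarCov, show (i + 1) % 2 = 1 by omega, show (i + 1) / 2 = i / 2 by omega]
    · simp [h, labelSum]
  | der i => simp [Label.weight] at hw
  | quad i j => simp [Label.weight] at hw
  | tr i => simp [Label.weight] at hw

lemma scalar_M_zero {x : Label} (hx : x ∈ (scalarModel r).labels) :
    (2 : ℂ) • κ ^ 2 • polyM τ p 0 (scalarCov τ κ r e x) =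
    labelSum (scalarCov τ κ r e) ((scalarModel r).M 0 x) := by
  have hsucc : ∀ i : ℕ, i % 2 = 0 → (i + 1) % 2 = 1 ∧ (i + 1) / 2 = i / 2 := by omega
  cases x with
  | one =>
    rw [scalarCov, polyM_zero_one F.tension F.scale F.energy, smul_zero]
    rfl
  | lin i =>
    rw [mem_scalarModel_lin] at hx
    rw [scalarCov, polyM_zero_lin F.tension F.scale F.energy (by omega)]
    rw [show (scalarModel r).M 0 (.lin i) =
      if i % 2 = 0 then [(2, .lin (i + 1))] else [] from rfl]
    by_cases h : i % 2 = 0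
    · simp [h, labelSum, scalarCov, hsucc]
    · simp [h, labelSum]
  | der i =>
    rw [mem_scalarModel_der] at hx
    rw [scalarCov, polyM_zero_der F.tension F.scale F.energy (by omega)]
    rw [show (scalarModel r).M 0 (.der i) =
      if i % 2 = 0 then [(4, .der (i + 1))] else [] from rfl]
    by_cases h : i % 2 = 0
    · simp [h, labelSum, scalarCov, hsucc, smul_smul]
      norm_num
    · simp [h, labelSum]
  | quad i j =>
    rw [mem_scalarModel_quad] at hx
    rw [scalarCov, polyM_zero_quad F.tension F.scale F.energy (by omega) (by omega)]
    rw [show (scalarModel r).M 0 (.quad i j) = (if i % 2 = 0 then [(2, mkQuad (i + 1) j)] else []) ++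
      if j % 2 = 0 then [(2, mkQuad i (j + 1))] else [] from rfl, labelSum_append, labelSum_ite,
      labelSum_ite, smul_add]
    simp only [labelSum_cons, labelSum_nil, scalarCov_mkQuad]
    congr 1
    · by_cases h : i % 2 = 0 <;> simp [h, hsucc]
    · by_cases h : j % 2 = 0 <;> simp [h, hsucc]
  | tr i =>
    rw [mem_scalarModel_tr] at hx
    rw [scalarCov, polyM_zero_quad F.tension F.scale F.energy (by omega) (by omega)]
    rw [show (scalarModel r).M 0 (.tr i) =
      if i = 0 then [(4, .tr 1)] else if i = 1 then [(2, .tr 2)] else [] from rfl]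
    interval_cases i
    · simp [labelSum, scalarCov]
      rw [quad_comm 1 0, transProj_transpose, ← two_smul ℂ, smul_smul]
      norm_num
    · simp [labelSum, scalarCov]
    · simp [labelSum]

lemma scalar_M_one {x : Label} (hx : x ∈ (scalarModel r).labels) :
    (2 : ℂ) • κ ^ 2 • polyM τ p 1 (scalarCov τ κ r e x) =
    labelSum (scalarCov τ κ r e) ((scalarModel r).M 1 x) := by
  cases x with
  | one =>
    rw [polyM_eq_zero scalarCov_mem (by simp [Label.weight]), smul_zero, smul_zero]
    rfl
  | lin i =>
    rw [mem_scalarModel_lin] at hx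
    rw [scalarCov, polyM_one_lin F.tension F.scale F.energy (by omega), smul_zero]
    rfl
  | der i =>
    rw [mem_scalarModel_der] at hx
    rw [scalarCov, polyM_one_der F.tension F.scale F.energy (by omega)]
    rw [show (scalarModel r).M 1 (.der i) =
      if i % 2 = 0 then [(4, .lin (i + 1))] else [] from rfl]
    by_cases h : i % 2 = 0
    · simp [h, labelSum, scalarCov, show (i + 1) % 2 = 1 by omega,
        show (i + 1) / 2 = i / 2 by omega, smul_smul]
      norm_num
    · simp [h, labelSum]
  | quad i j =>
    rw [mem_scalarModel_quad] at hx
    rw [scalarCov, polyM_one_quad F.tension F.scale F.energy (by omega) (by omega), smul_zero]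
    rfl
  | tr i =>
    rw [mem_scalarModel_tr] at hx
    rw [scalarCov, polyM_one_quad F.tension F.scale F.energy (by omega) (by omega), smul_zero]
    rfl

lemma scalar_M_two {x : Label} (hx : x ∈ (scalarModel r).labels) :
    (2 : ℂ) • κ ^ 2 • polyM τ p 2 (scalarCov τ κ r e x) =
    labelSum (scalarCov τ κ r e) ((scalarModel r).M 2 x) := by
  cases x with
  | one =>
    rw [polyM_eq_zero scalarCov_mem (by simp [Label.weight]), smul_zero, smul_zero]
    rfl
  | lin i =>
    rw [polyM_eq_zero scalarCov_mem (by simp [Label.weight]), smul_zero, smul_zero]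
    rfl
  | der i =>
    rw [mem_scalarModel_der] at hx
    rw [scalarCov, polyM_two_lin F.tension F.scale F.energy (by omega), smul_zero]
    rfl
  | quad i j =>
    rw [mem_scalarModel_quad] at hx
    rw [scalarCov, polyM_two_quad F.tension F.scale F.energy (by omega) (by omega),
      Matrix.trace_vecMulVec, F.orth _ (by omega) _ (by omega)]
    rw [show (scalarModel r).M 2 (.quad i j) =
      if i % 2 = 0 ∧ j = i then [(2, .one)] else [] from rfl]
    have h : (i % 2 = 0 ∧ j = i) ↔ ((i % 2 = 0 ∧ j % 2 = 0) ∧ i / 2 = j / 2) := by omega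
    simp only [h]
    by_cases h1 : i % 2 = 0 ∧ j % 2 = 0 <;> by_cases h2 : i / 2 = j / 2 <;>
      simp [h1, h2, labelSum, scalarCov]
  | tr i =>
    rw [mem_scalarModel_tr] at hx
    rw [scalarCov, polyM_two_quad F.tension F.scale F.energy (by omega) (by omega),
      F.transProj_trace]
    rw [show (scalarModel r).M 2 (.tr i) = if i = 0 then
      [((2 * (26 - r) : ℤ), Label.one)] else [] from rfl]
    interval_cases i <;> simp [labelSum, scalarCov, smul_smul]

end IsFrame

end

/-! ### The modes of `T` and `M` on transverse vectors and tensors -/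

section

variable {τ : ℝ} {κ : ℂ} {p : Fin 26 → ℝ} {r : ℕ} {e : ℕ → Fin 26 → ℂ}

lemma mem_vectorModel {x : Label} : x ∈ (vectorModel r).labels ↔
    (∃ i < 2, x = .lin i) ∨ (∃ i < 2, x = .der i) ∨
      ∃ i < 2 * r, ∃ j < 2, x = .quad i j := by
  have h : ∀ P : ℕ → Prop, (∃ i < 2, P i) ↔ P 0 ∨ P 1 := fun P =>
    ⟨fun ⟨i, hi, h⟩ => by interval_cases i <;> simp_all, fun h =>
      h.elim (fun h => ⟨0, by norm_num, h⟩) fun h => ⟨1, by norm_num, h⟩⟩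
  simp only [h]
  simp [vectorModel, or_assoc]

lemma covariant_vector (x : Label) (w : perp p) :
    covariant τ κ p r e .vector x w = vectorCov τ κ e x (hat w.1) := rfl

lemma covariant_sym (x : Label) (w : symPerp p) :
    covariant τ κ p r e .sym x w = tensorCov τ κ x (hatMat w.1) := rfl

lemma covariant_skew (x : Label) (w : skewPerp p) :
    covariant τ κ p r e .skew x w = tensorCov τ κ x (hatMat w.1) := rfl

lemma smul_labelSum (a : ℂ) (f : Label → MvPolynomial MatterMode ℂ) (L : List (ℤ × Label)) :
    a • labelSum f L = labelSum (fun y => a • f y) L := by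
  rw [labelSum, List.smul_sum, List.map_map]
  refine congrArg List.sum (List.map_congr_left fun y _ => ?_)
  exact smul_comm _ _ _

lemma mem_symModel {x : Label} : x ∈ symModel.labels ↔ ∃ i < 3, x = .tr i := by
  have h : ∀ P : ℕ → Prop, (∃ i < 3, P i) ↔ P 0 ∨ P 1 ∨ P 2 := fun P =>
    ⟨fun ⟨i, hi, h⟩ => by interval_cases i <;> simp_all, fun h =>
      h.elim (fun h => ⟨0, by norm_num, h⟩) fun h =>
        h.elim (fun h => ⟨1, by norm_num, h⟩) fun h => ⟨2, by norm_num, h⟩⟩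
  rw [h]
  simp [symModel]

lemma hatMat_neg (A : Matrix (Fin 25) (Fin 25) ℂ) : hatMat (-A) = -hatMat A := by
  rw [← neg_one_smul ℂ A, map_smul, neg_one_smul]

/-- The letters commute, so with two letters of the same kind only the symmetric part of the
coefficients counts. -/
lemma quad_self_eq_zero {τ : ℂ} (ξ : ℕ) {A B : Matrix (Fin 26) (Fin 26) ℂ} (h : Aᵀ = B)
    (hB : B = (-1 : ℂ) • A) : quad τ κ ξ ξ A = 0 := by
  have h' := quad_comm (τ := τ) (κ := κ) ξ ξ A
  rw [h, hB] at h'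
  rw [map_smul] at h'
  have h2 : (2 : ℂ) • quad τ κ ξ ξ A = 0 := by
    rw [two_smul]
    nth_rewrite 1 [h']
    nth_rewrite 2 [← one_smul ℂ (quad τ κ ξ ξ A)]
    rw [← add_smul, neg_add_cancel, zero_smul]
  rw [← one_smul ℂ (quad τ κ ξ ξ A), ← inv_mul_cancel₀ (two_ne_zero (α := ℂ)), mul_smul, h2,
    smul_zero]

lemma mem_skewModel {x : Label} : x ∈ skewModel.labels ↔ x = .tr 1 := by simp [skewModel]

lemma trace_skewPerp (w : skewPerp p) : w.1.trace = 0 := by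
  have := congrArg Matrix.trace w.2.1
  rw [Matrix.trace_transpose, Matrix.trace_neg] at this
  exact self_eq_neg.1 this

namespace IsFrame

variable (F : IsFrame τ κ p r e)
include F

/-- A transverse vector is orthogonal to the axes and to the momentum, so every contraction
involving `v` vanishes. What remains is again linear in `v` through one of the listed covariants. -/
lemma vector_T {x : Label} (hx : x ∈ (vectorModel r).labels) {n : ℤ} (hn : n ≤ 2)
    (hw : (x.weight : ℤ) - n ≤ 2) {v : Fin 25 → ℂ} (hv : v ∈ perp p) :
    (2 : ℂ) • polyT p n (vectorCov τ κ e x (hat v)) =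
      labelSum (fun y => vectorCov τ κ e y (hat v)) ((vectorModel r).T n x) := by
  have hk := F.momentum_dotProduct_hat hv
  have hk' := hk
  rw [dotProduct_comm] at hk'
  have hx0 : 1 ≤ x.weight := by
    obtain ⟨i, hi, rfl⟩ | ⟨i, hi, rfl⟩ | ⟨i, hi, j, hj, rfl⟩ := mem_vectorModel.1 hx <;>
      simp [Label.weight]
  -- No covariant of this sector has weight zero, so `n = -2` would lead above weight two.
  obtain rfl | rfl | rfl | rfl : n = -1 ∨ n = 0 ∨ n = 1 ∨ n = 2 := by omega
  · obtain ⟨i, hi, rfl⟩ | ⟨i, hi, rfl⟩ | ⟨i, hi, j, hj, rfl⟩ := mem_vectorModel.1 hx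
    · rw [vectorCov, polyT_neg_one_lin F.tension F.scale F.energy hi, F.momentum]
      rw [show (vectorModel r).T (-1) (.lin i) =
        (2, .der i) :: if r = 2 then [(2, .quad 3 i)] else [] from rfl]
      rcases F.rank with rfl | rfl <;> simp [labelSum, vectorCov, outer_apply]
    · norm_num [Label.weight] at hw
    · norm_num [Label.weight] at hw
  · rw [polyT_zero x.weight_le (vectorCov_mem _)]
    rw [show (vectorModel r).T 0 x = [((2 * x.weight : ℤ), x)] by cases x <;> rfl]
    simp [labelSum, smul_smul]
  · obtain ⟨i, hi, rfl⟩ | ⟨i, hi, rfl⟩ | ⟨i, hi, j, hj, rfl⟩ := mem_vectorModel.1 hx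
    · rw [vectorCov, polyT_one_lin F.tension F.scale F.energy hi, hk]
      simp [labelSum, show (vectorModel r).T 1 (.lin i) = [] from rfl]
    · rw [vectorCov, polyT_one_der F.tension F.scale F.energy hi]
      simp [labelSum, show (vectorModel r).T 1 (.der i) = [(4, .lin i)] from rfl, vectorCov,
        smul_smul]
      norm_num
    · rw [vectorCov, LinearMap.comp_apply, outer_apply,
        polyT_one_quad F.tension F.scale F.energy (by omega) hj,
        Matrix.vecMul_vecMulVec, Matrix.vecMulVec_mulVec, F.momentum_dotProduct (by omega), hk']
      rw [show (vectorModel r).T 1 (.quad i j) = if i = 2 then [(2, .lin j)] else [] from rfl]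
      have h : (i % 2 = 0 ∧ i / 2 = 1) ↔ i = 2 := by omega
      simp only [← h]
      by_cases h1 : i % 2 = 0 <;> by_cases h2 : i / 2 = 1 <;> simp [h1, h2, labelSum, vectorCov]
  · obtain ⟨i, hi, rfl⟩ | ⟨i, hi, rfl⟩ | ⟨i, hi, j, hj, rfl⟩ := mem_vectorModel.1 hx
    · rw [polyT_eq_zero (vectorCov_mem _) (by simp [Label.weight]), smul_zero]
      rfl
    · rw [vectorCov, polyT_two_lin F.tension F.scale F.energy hi, hk]
      simp [labelSum, show (vectorModel r).T 2 (.der i) = [] from rfl]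
    · rw [vectorCov, LinearMap.comp_apply, outer_apply,
        polyT_two_quad F.tension F.scale F.energy (by omega) hj, Matrix.trace_vecMulVec,
        (F.mem_perp v).1 hv _ (by omega)]
      simp [labelSum, show (vectorModel r).T 2 (.quad i j) = [] from rfl]

lemma vector_M {x : Label} (hx : x ∈ (vectorModel r).labels) {n : ℤ} (hn : n ≤ 2)
    (hw : (x.weight : ℤ) - n ≤ 2) {v : Fin 25 → ℂ} (hv : v ∈ perp p) :
    (2 : ℂ) • κ ^ 2 • polyM τ p n (vectorCov τ κ e x (hat v)) =
      labelSum (fun y => vectorCov τ κ e y (hat v)) ((vectorModel r).M n x) := by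
  have hx0 : 1 ≤ x.weight := by
    obtain ⟨i, hi, rfl⟩ | ⟨i, hi, rfl⟩ | ⟨i, hi, j, hj, rfl⟩ := mem_vectorModel.1 hx <;>
      simp [Label.weight]
  have hsucc : ∀ i : ℕ, i % 2 = 0 → (i + 1) % 2 = 1 ∧ (i + 1) / 2 = i / 2 := by omega
  obtain rfl | rfl | rfl | rfl : n = -1 ∨ n = 0 ∨ n = 1 ∨ n = 2 := by omega
  · obtain ⟨i, hi, rfl⟩ | ⟨i, hi, rfl⟩ | ⟨i, hi, j, hj, rfl⟩ := mem_vectorModel.1 hx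
    · rw [vectorCov, polyM_neg_one_lin F.tension F.scale F.energy hi]
      rw [show (vectorModel r).M (-1) (.lin i) = if i = 0 then [(2, .der 1)] else [] from rfl]
      split <;> simp [labelSum, vectorCov]
    · norm_num [Label.weight] at hw
    · norm_num [Label.weight] at hw
  · obtain ⟨i, hi, rfl⟩ | ⟨i, hi, rfl⟩ | ⟨i, hi, j, hj, rfl⟩ := mem_vectorModel.1 hx
    · rw [vectorCov, polyM_zero_lin F.tension F.scale F.energy hi]
      rw [show (vectorModel r).M 0 (.lin i) = if i = 0 then [(2, .lin 1)] else [] from rfl]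
      split <;> simp [labelSum, vectorCov]
    · rw [vectorCov, polyM_zero_der F.tension F.scale F.energy hi]
      rw [show (vectorModel r).M 0 (.der i) = if i = 0 then [(4, .der 1)] else [] from rfl]
      split <;> simp [labelSum, vectorCov, smul_smul]
      norm_num
    · rw [vectorCov, LinearMap.comp_apply, polyM_zero_quad F.tension F.scale F.energy (by omega) hj]
      rw [show (vectorModel r).M 0 (.quad i j) = (if i % 2 = 0 then [(2, .quad (i + 1) j)] else []) ++
        if j = 0 then [(2, .quad i 1)] else [] from rfl, labelSum_append, labelSum_ite,
        labelSum_ite, smul_add]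
      congr 1
      · by_cases h : i % 2 = 0 <;> simp [h, hsucc, labelSum, vectorCov]
      · by_cases h : j = 0 <;> simp [h, labelSum, vectorCov]
  · obtain ⟨i, hi, rfl⟩ | ⟨i, hi, rfl⟩ | ⟨i, hi, j, hj, rfl⟩ := mem_vectorModel.1 hx
    · rw [vectorCov, polyM_one_lin F.tension F.scale F.energy hi, smul_zero]
      rfl
    · rw [vectorCov, polyM_one_der F.tension F.scale F.energy hi]
      rw [show (vectorModel r).M 1 (.der i) = if i = 0 then [(4, .lin 1)] else [] from rfl]
      split <;> simp [labelSum, vectorCov, smul_smul]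
      norm_num
    · rw [vectorCov, LinearMap.comp_apply, polyM_one_quad F.tension F.scale F.energy (by omega) hj,
        smul_zero]
      rfl
  · obtain ⟨i, hi, rfl⟩ | ⟨i, hi, rfl⟩ | ⟨i, hi, j, hj, rfl⟩ := mem_vectorModel.1 hx
    · rw [polyM_eq_zero (vectorCov_mem _) (by simp [Label.weight]), smul_zero, smul_zero]
      rfl
    · rw [vectorCov, polyM_two_lin F.tension F.scale F.energy hi, smul_zero]
      rfl
    · rw [vectorCov, LinearMap.comp_apply, outer_apply,
        polyM_two_quad F.tension F.scale F.energy (by omega) hj, Matrix.trace_vecMulVec,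
        (F.mem_perp v).1 hv _ (by omega)]
      simp [labelSum, show (vectorModel r).M 2 (.quad i j) = [] from rfl]

lemma hatMat_mulVec_momentum {A : Matrix (Fin 25) (Fin 25) ℂ}
    (hA : A *ᵥ CarrollString.transverse p = 0) :
    hatMat A *ᵥ CarrollString.momentum τ κ p = 0 := by
  rw [F.momentum]
  split
  · exact (F.mulVec_transverse A).1 hA 1 (by omega)
  · exact Matrix.mulVec_zero _

/-- The weight is two, so only `n = 0, 1, 2` occur. `T_1` contracts an index with the momentum and
`T_2` takes the trace; both vanish on a transverse traceless tensor. -/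
lemma tensor_T {i : ℕ} (hi : i < 3) {n : ℤ} (hn : n ≤ 2) (hw : 0 ≤ n)
    {A : Matrix (Fin 25) (Fin 25) ℂ} (hA : A *ᵥ CarrollString.transverse p = 0)
    (hA' : Aᵀ *ᵥ CarrollString.transverse p = 0) (ht : A.trace = 0) :
    (2 : ℂ) • polyT p n (tensorCov τ κ (.tr i) (hatMat A)) =
      if n = 0 then (4 : ℂ) • tensorCov τ κ (.tr i) (hatMat A) else 0 := by
  obtain rfl | rfl | rfl : n = 0 ∨ n = 1 ∨ n = 2 := by omega
  · rw [polyT_zero (w := 2) le_rfl (tensorCov_mem (x := .tr i) _), smul_smul]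
    norm_num
  · rw [tensorCov, polyT_one_quad F.tension F.scale F.energy (by omega) (by omega),
      F.hatMat_mulVec_momentum hA, ← Matrix.mulVec_transpose, ← hatMat_transpose,
      F.hatMat_mulVec_momentum hA']
    simp
  · rw [tensorCov, polyT_two_quad F.tension F.scale F.energy (by omega) (by omega), hatMat_trace, ht]
    simp

/-- `M_0` replaces one letter `Q` by `R`, `M_1` acts only on letters of depth two, and `M_2` takes a
trace. -/
lemma tensor_M {i : ℕ} (hi : i < 3) {n : ℤ} (hn : n ≤ 2) (hw : 0 ≤ n)
    {A : Matrix (Fin 25) (Fin 25) ℂ} (ht : A.trace = 0) :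
    κ ^ 2 • polyM τ p n (tensorCov τ κ (.tr i) (hatMat A)) =
      if n = 0 then if i = 0 then quad τ κ 0 1 (hatMat A) + quad τ κ 0 1 (hatMat Aᵀ)
        else if i = 1 then quad τ κ 1 1 (hatMat A) else 0 else 0 := by
  obtain rfl | rfl | rfl : n = 0 ∨ n = 1 ∨ n = 2 := by omega
  · rw [tensorCov, polyM_zero_quad F.tension F.scale F.energy (by omega) (by omega), hatMat_transpose,
      ← quad_comm 1 0, add_comm (quad τ κ 0 1 _)]
    interval_cases i <;> simp
  · rw [tensorCov, polyM_one_quad F.tension F.scale F.energy (by omega) (by omega)]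
    simp
  · rw [tensorCov, polyM_two_quad F.tension F.scale F.energy (by omega) (by omega), hatMat_trace, ht]
    simp

lemma scalar_T {x : Label} (hx : x ∈ (scalarModel r).labels) {n : ℤ} (hn : n ≤ 2)
    (hn' : -2 ≤ n) (hw : (x.weight : ℤ) - n ≤ 2) :
    (2 : ℂ) • polyT p n (scalarCov τ κ r e x) =
      labelSum (scalarCov τ κ r e) ((scalarModel r).T n x) := by
  obtain rfl | rfl | rfl | rfl | rfl : n = -2 ∨ n = -1 ∨ n = 0 ∨ n = 1 ∨ n = 2 := by omega
  · obtain rfl : x = .one := by cases x <;> (simp [Label.weight] at hw; try rfl)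
    exact F.scalar_T_neg_two
  · exact F.scalar_T_neg_one hx (by omega)
  · exact scalar_T_zero x
  · exact F.scalar_T_one hx
  · exact F.scalar_T_two hx

lemma scalar_M {x : Label} (hx : x ∈ (scalarModel r).labels) {n : ℤ} (hn : n ≤ 2)
    (hn' : -2 ≤ n) (hw : (x.weight : ℤ) - n ≤ 2) :
    (2 : ℂ) • κ ^ 2 • polyM τ p n (scalarCov τ κ r e x) =
      labelSum (scalarCov τ κ r e) ((scalarModel r).M n x) := by
  obtain rfl | rfl | rfl | rfl | rfl : n = -2 ∨ n = -1 ∨ n = 0 ∨ n = 1 ∨ n = 2 := by omega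
  · obtain rfl : x = .one := by cases x <;> (simp [Label.weight] at hw; try rfl)
    exact F.scalar_M_neg_two
  · exact F.scalar_M_neg_one hx (by omega)
  · exact F.scalar_M_zero hx
  · exact F.scalar_M_one hx
  · exact F.scalar_M_two hx

lemma sym_T {x : Label} (hx : x ∈ (symModel).labels) {n : ℤ} (hn : n ≤ 2)
    (hn' : -2 ≤ n) (hw : (x.weight : ℤ) - n ≤ 2) (w : symPerp p) :
    (2 : ℂ) • polyT p n (tensorCov τ κ x (hatMat w.1)) =
      labelSum (fun y => tensorCov τ κ y (hatMat w.1)) (symModel.T n x) := by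
  have hA := w.2
  generalize w.1 = A at hA ⊢
  obtain ⟨h1, h2, h3⟩ := hA
  obtain ⟨i, hi, rfl⟩ := mem_symModel.1 hx
  have hw : 0 ≤ n := by simp [Label.weight] at hw; omega
  rw [F.tensor_T hi hn hw h3 (by rwa [h1]) h2]
  obtain rfl | rfl | rfl : n = 0 ∨ n = 1 ∨ n = 2 := by omega
  · simp [labelSum, show symModel.T 0 (.tr i) = [(4, .tr i)] from rfl]
  · simp [labelSum, show symModel.T 1 (.tr i) = [] from rfl]
  · simp [labelSum, show symModel.T 2 (.tr i) = [] from rfl]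

lemma skew_T {x : Label} (hx : x ∈ (skewModel).labels) {n : ℤ} (hn : n ≤ 2)
    (hn' : -2 ≤ n) (hw : (x.weight : ℤ) - n ≤ 2) (w : skewPerp p) :
    (2 : ℂ) • polyT p n (tensorCov τ κ x (hatMat w.1)) =
      labelSum (fun y => tensorCov τ κ y (hatMat w.1)) (skewModel.T n x) := by
  have ht := trace_skewPerp w
  have hA := w.2
  generalize w.1 = A at hA ht ⊢
  obtain ⟨h1, h3⟩ := hA
  obtain rfl := mem_skewModel.1 hx
  have hw : 0 ≤ n := by simp [Label.weight] at hw; omega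
  rw [F.tensor_T (by norm_num) hn hw h3 (by rw [h1, Matrix.neg_mulVec, h3, neg_zero]) ht]
  obtain rfl | rfl | rfl : n = 0 ∨ n = 1 ∨ n = 2 := by omega
  · simp [labelSum, show skewModel.T 0 (.tr 1) = [(4, .tr 1)] from rfl]
  · simp [labelSum, show skewModel.T 1 (.tr 1) = [] from rfl]
  · simp [labelSum, show skewModel.T 2 (.tr 1) = [] from rfl]

lemma sym_M {x : Label} (hx : x ∈ (symModel).labels) {n : ℤ} (hn : n ≤ 2)
    (hn' : -2 ≤ n) (hw : (x.weight : ℤ) - n ≤ 2) (w : symPerp p) :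
    (2 : ℂ) • κ ^ 2 • polyM τ p n (tensorCov τ κ x (hatMat w.1)) =
      labelSum (fun y => tensorCov τ κ y (hatMat w.1)) (symModel.M n x) := by
  have hA := w.2
  generalize w.1 = A at hA ⊢
  obtain ⟨h1, h2, h3⟩ := hA
  obtain ⟨i, hi, rfl⟩ := mem_symModel.1 hx
  have hw : 0 ≤ n := by simp [Label.weight] at hw; omega
  rw [F.tensor_M hi hn hw h2]
  obtain rfl | rfl | rfl : n = 0 ∨ n = 1 ∨ n = 2 := by omega
  · rw [show symModel.M 0 (.tr i) =
      if i = 0 then [(4, .tr 1)] else if i = 1 then [(2, .tr 2)] else [] from rfl, h1]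
    interval_cases i
    · simp only [if_true, ← two_smul ℂ (quad τ κ 0 1 _), smul_smul]
      norm_num [labelSum, tensorCov]
    · simp [labelSum, tensorCov]
    · simp [labelSum]
  · simp [labelSum, show symModel.M 1 (.tr i) = [] from rfl]
  · simp [labelSum, show symModel.M 2 (.tr i) = [] from rfl]

lemma skew_M {x : Label} (hx : x ∈ (skewModel).labels) {n : ℤ} (hn : n ≤ 2)
    (hw : (x.weight : ℤ) - n ≤ 2) (w : skewPerp p) :
    (2 : ℂ) • κ ^ 2 • polyM τ p n (tensorCov τ κ x (hatMat w.1)) =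
      labelSum (fun y => tensorCov τ κ y (hatMat w.1)) (skewModel.M n x) := by
  have ht := trace_skewPerp w
  have hA := w.2
  generalize w.1 = A at hA ht ⊢
  obtain ⟨h1, h3⟩ := hA
  obtain rfl := mem_skewModel.1 hx
  have hw : 0 ≤ n := by simp [Label.weight] at hw; omega
  -- `M_0` turns `Q R` into `R R`, which has no skewsymmetric part; hence the empty entries for `M`
  -- in `skewModel`.
  have h0 : quad τ κ 1 1 (hatMat A) = 0 := quad_self_eq_zero 1 rfl (by
    rw [← hatMat_transpose, h1, hatMat_neg, neg_one_smul])
  rw [F.tensor_M (i := 1) (A := A) (by norm_num) hn hw ht, h0]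
  simp [labelSum, show skewModel.M n (.tr 1) = [] from rfl]

/-- The modes of `T` act on the polynomials of a sector as in its model. -/
lemma covariant_T (s : Sector) {x : Label} (hx : x ∈ (s.model r).labels) {n : ℤ} (hn : n ≤ 2)
    (hn' : -2 ≤ n) (hw : (x.weight : ℤ) - n ≤ 2) (w : s.Space p) :
    (2 : ℂ) • polyT p n (covariant τ κ p r e s x w) =
      labelSum (fun y => covariant τ κ p r e s y w) ((s.model r).T n x) := by
  cases s with
  | scalar =>
    have h (w : ℂ) : (2 : ℂ) • polyT p n (w • scalarCov τ κ r e x) =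
        labelSum (fun y => w • scalarCov τ κ r e y) ((scalarModel r).T n x) := by
      rw [map_smul, smul_comm (2 : ℂ) w, F.scalar_T hx hn hn' hw, smul_labelSum]
    exact h w
  | vector => exact F.vector_T hx hn hw w.2
  | sym => exact F.sym_T hx hn hn' hw w
  | skew => exact F.skew_T hx hn hn' hw w

/-- The modes of `M` act on the polynomials of a sector as in its model. -/
lemma covariant_M (s : Sector) {x : Label} (hx : x ∈ (s.model r).labels) {n : ℤ} (hn : n ≤ 2)
    (hn' : -2 ≤ n) (hw : (x.weight : ℤ) - n ≤ 2) (w : s.Space p) :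
    (2 : ℂ) • κ ^ 2 • polyM τ p n (covariant τ κ p r e s x w) =
      labelSum (fun y => covariant τ κ p r e s y w) ((s.model r).M n x) := by
  cases s with
  | scalar =>
    have h (w : ℂ) : (2 : ℂ) • κ ^ 2 • polyM τ p n (w • scalarCov τ κ r e x) =
        labelSum (fun y => w • scalarCov τ κ r e y) ((scalarModel r).M n x) := by
      rw [map_smul, smul_comm (κ ^ 2) w, smul_comm (2 : ℂ) w, F.scalar_M hx hn hn' hw, smul_labelSum]
    exact h w
  | vector => exact F.vector_M hx hn hw w.2
  | sym => exact F.sym_M hx hn hn' hw w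
  | skew => exact F.skew_M hx hn hw w

end IsFrame

end

/-! ### The differential in terms of the model -/

/-- The number of `C` modes minus the number of `B` modes. -/
def maskScale (s : ℕ) : ℤ :=
  maskSum (fun i => if i < 6 then 0 else if i < 12 then 1 else if i < 15 then 0 else -1) s

/-- The ghost number of a mask. -/
def maskNumber (s : ℕ) : ℤ := maskSum (fun i => if i < 12 then 1 else -1) s

lemma mem_basis {m : MatterModel} {n : ℤ} {x : ℕ × Label} : x ∈ basis m n ↔
    (x.1 ∈ lowMasks ∧ maskNumber x.1 = n) ∧ x.2 ∈ m.labels ∧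
      maskSum bitWeight x.1 + x.2.weight = 0 := by
  simp only [basis, List.mem_flatMap, List.mem_filter, List.mem_map, decide_eq_true_iff, maskNumber]
  constructor
  · rintro ⟨s, h1, y, h2, rfl⟩
    exact ⟨h1, h2⟩
  · exact fun h => ⟨x.1, h.1, x.2, h.2, rfl⟩

/-- The ten modes are `c_1, …, c_{-2}`, `C_1, …, C_{-2}`, `b_{-2}` and `B_{-2}`. -/
lemma lowMasks_low : ∀ s ∈ lowMasks, ∀ i < 18, s.testBit i = true →
    i ∈ [0, 1, 2, 3, 6, 7, 8, 9, 12, 15] := by decide +kernel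

lemma lowMasks_weight : ∀ s ∈ lowMasks, -2 ≤ maskSum bitWeight s := by decide +kernel

/-- The bound on the weight plus `n` keeps the new mask at nonpositive weight. Only the terms that
come with `M` change `maskScale`, and they raise it by one; this is what allows a scaling of the
states to absorb `κ²`. -/
lemma lowMasks_matter : ∀ s ∈ lowMasks, ∀ n ∈ [(-2 : ℤ), -1, 0, 1, 2],
    maskSum bitWeight s + n ≤ 0 →
    (∀ z ∈ maskTerm 1 [ghostOp 0 (-n)] s, z.2 ∈ lowMasks ∧ maskNumber z.2 = maskNumber s + 1 ∧
      maskSum bitWeight z.2 = maskSum bitWeight s + n ∧ maskScale z.2 = maskScale s) ∧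
    (∀ z ∈ maskTerm 1 [ghostOp 1 (-n)] s, z.2 ∈ lowMasks ∧ maskNumber z.2 = maskNumber s + 1 ∧
      maskSum bitWeight z.2 = maskSum bitWeight s + n ∧ maskScale z.2 = maskScale s + 1) := by
  decide +kernel

/-- The cubic terms have the form `c b c`, `c B C` and `C B c`, and each conserves the number of `C`
modes minus the number of `B` modes. -/
lemma lowMasks_ghost : ∀ s ∈ lowMasks, ∀ z ∈ ghostDiff s, z.2 ∈ lowMasks ∧
    maskNumber z.2 = maskNumber s + 1 ∧ maskSum bitWeight z.2 = maskSum bitWeight s ∧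
      maskScale z.2 = maskScale s := by
  decide +kernel

/-- The table entries of a model change the weight of a label as the modes do. -/
def MatterModel.Graded (m : MatterModel) : Prop :=
  ∀ x ∈ m.labels, ∀ n ∈ [(-2 : ℤ), -1, 0, 1, 2],
    (∀ y ∈ m.T n x, y.2 ∈ m.labels ∧ (y.2.weight : ℤ) = x.weight - n) ∧
      ∀ y ∈ m.M n x, y.2 ∈ m.labels ∧ (y.2.weight : ℤ) = x.weight - n

instance (m : MatterModel) : Decidable m.Graded := by
  unfold MatterModel.Graded
  infer_instance

lemma graded_scalar_one : (scalarModel 1).Graded := by decide +kernel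
lemma graded_scalar_two : (scalarModel 2).Graded := by decide +kernel
lemma graded_vector_one : (vectorModel 1).Graded := by decide +kernel
lemma graded_vector_two : (vectorModel 2).Graded := by decide +kernel
lemma graded_sym : symModel.Graded := by decide +kernel
lemma graded_skew : skewModel.Graded := by decide +kernel

lemma Sector.graded {r : ℕ} (hr : r = 1 ∨ r = 2) (σ : Sector) : (σ.model r).Graded := by
  rcases hr with rfl | rfl <;> cases σ
  exacts [graded_scalar_one, graded_vector_one, graded_sym, graded_skew, graded_scalar_two,
    graded_vector_two, graded_sym, graded_skew]

/-- Guarantees that no term is lost when the differential is recorded as a matrix between the two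
bases. -/
lemma modelDiff_mem_basis {m : MatterModel} (hm : m.Graded) {n : ℤ} {x : ℕ × Label}
    (hx : x ∈ basis m n) {z : ℤ × ℕ × Label} (hz : z ∈ modelDiff m x) : z.2 ∈ basis m (n + 1) := by
  obtain ⟨⟨h1, h2⟩, h3, h4⟩ := mem_basis.1 hx
  rw [mem_basis]
  simp only [modelDiff, List.mem_append, List.mem_flatMap, List.mem_map] at hz
  obtain ⟨k, hk, ⟨a, ha, b, hb, rfl⟩ | ⟨a, ha, b, hb, rfl⟩⟩ | ⟨a, ha, rfl⟩ := hz
  · obtain ⟨h5, h6⟩ := (hm _ h3 k hk).1 b hb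
    obtain ⟨h7, h8, h9, -⟩ := (lowMasks_matter _ h1 k hk (by omega)).1 a ha
    exact ⟨⟨h7, by rw [h8, h2]⟩, h5, by rw [h9, h6]; omega⟩
  · obtain ⟨h5, h6⟩ := (hm _ h3 k hk).2 b hb
    obtain ⟨h7, h8, h9, -⟩ := (lowMasks_matter _ h1 k hk (by omega)).2 a ha
    exact ⟨⟨h7, by rw [h8, h2]⟩, h5, by rw [h9, h6]; omega⟩
  · obtain ⟨h7, h8, h9, -⟩ := lowMasks_ghost _ h1 a ha
    exact ⟨⟨h7, by rw [h8, h2]⟩, h3, by rw [h9, h4]⟩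

lemma isLow_of_mem_lowMasks {s : ℕ} (hs : s ∈ lowMasks) : ∀ g ∈ maskSet s, IsLow g := by
  intro g hg
  obtain ⟨i, hi, h, rfl⟩ := mem_maskSet.1 hg
  have h' : ∀ i ∈ [0, 1, 2, 3, 6, 7, 8, 9, 12, 15],
      (ofLex (modeOf i)).2 ≤ if (ofLex (modeOf i)).1 < 2 then 3 else 0 := by decide
  exact h' i (lowMasks_low s hs i hi h)

section

variable {τ : ℝ} {κ : ℂ} {p : Fin 26 → ℝ} {r : ℕ} {e : ℕ → Fin 26 → ℂ}

/-- The states of a sector. -/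
def sectorState (τ κ : ℂ) (p : Fin 26 → ℝ) (r : ℕ) (e : ℕ → Fin 26 → ℂ) (σ : Sector)
    (x : ℕ × Label) : σ.Space p →ₗ[ℂ] Fock :=
  ((κ ^ 2) ^ (-maskScale x.1)) • state (maskSet x.1) ∘ₗ covariant τ κ p r e σ x.2

/-- A linear combination of states of a sector. -/
def sectorSum (τ κ : ℂ) (p : Fin 26 → ℝ) (r : ℕ) (e : ℕ → Fin 26 → ℂ) (σ : Sector)
    (L : List (ℤ × ℕ × Label)) (w : σ.Space p) : Fock :=
  (L.map fun z => (z.1 : ℂ) • sectorState τ κ p r e σ z.2 w).sum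

lemma sectorState_apply {τ : ℂ} (σ : Sector) (x : ℕ × Label) (w : σ.Space p) :
    sectorState τ κ p r e σ x w =
      ((κ ^ 2) ^ (-maskScale x.1)) • state (maskSet x.1) (covariant τ κ p r e σ x.2 w) := rfl

lemma sectorSum_append {τ : ℂ} (σ : Sector) (L L' : List (ℤ × ℕ × Label)) (w : σ.Space p) :
    sectorSum τ κ p r e σ (L ++ L') w =
      sectorSum τ κ p r e σ L w + sectorSum τ κ p r e σ L' w := by
  simp [sectorSum]

lemma sectorSum_flatMap {τ : ℂ} (σ : Sector) {α : Type} (l : List α)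
    (f : α → List (ℤ × ℕ × Label)) (w : σ.Space p) :
    sectorSum τ κ p r e σ (l.flatMap f) w =
      (l.map fun x => sectorSum τ κ p r e σ (f x) w).sum := by
  induction l with
  | nil => rfl
  | cons x l ih => rw [List.flatMap_cons, sectorSum_append, ih, List.map_cons, List.sum_cons]

lemma smul_combState {τ : ℂ} (σ : Sector) (c : ℂ) (L : List (ℤ × ℕ)) (K : List (ℤ × Label))
    (w : σ.Space p) (h : ∀ z ∈ L, c = (κ ^ 2) ^ (-maskScale z.2)) :
    c • combState L (labelSum (fun y => covariant τ κ p r e σ y w) K) =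
      sectorSum τ κ p r e σ (L.flatMap fun z => K.map fun y => (y.1 * z.1, z.2, y.2)) w := by
  rw [sectorSum_flatMap, combState, List.smul_sum, List.map_map]
  refine congrArg List.sum (List.map_congr_left fun z hz => ?_)
  rw [Function.comp_apply, labelSum, map_list_sum, List.smul_sum, List.smul_sum, List.map_map,
    List.map_map, List.map_map, sectorSum, List.map_map]
  refine congrArg List.sum (List.map_congr_left fun y _ => ?_)
  simp only [Function.comp_apply, sectorState_apply, map_smul, smul_smul, h z hz]
  congr 1
  push_cast
  ring

/-- A state with `maskScale` equal to `s` carries the factor `κ^(-2 s)`, which turns the term `C M`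
into `C` times `κ² M`. All coefficients are then integers, and `τ` and `p` enter only through the
number `r` of axes. -/
lemma IsFrame.brst_sectorState (F : IsFrame τ κ p r e) (σ : Sector) {n : ℤ} {x : ℕ × Label}
    (hx : x ∈ basis (σ.model r) n) (w : σ.Space p) :
    (2 : ℂ) • brst τ p (sectorState τ κ p r e σ x w) =
      sectorSum τ κ p r e σ (modelDiff (σ.model r) x) w := by
  obtain ⟨⟨h1, h2⟩, h3, h4⟩ := mem_basis.1 hx
  have hκ : κ ^ 2 ≠ 0 := pow_ne_zero 2 F.scale
  have hP := covariant_mem (τ := τ) (κ := κ) (r := r) (e := e) σ x.2 w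
  rw [sectorState_apply, map_smul, smul_comm, brst_state (isLow_of_mem_lowMasks h1) x.2.weight_le hP,
    modelDiff, sectorSum_append, sectorSum_flatMap, smul_add, List.smul_sum, List.map_map]
  refine congrArg₂ (· + ·) ?_ ?_
  · refine congrArg List.sum (List.map_congr_left fun k hk => ?_)
    have hk2 : -2 ≤ k ∧ k ≤ 2 := by
      simp only [List.mem_cons, List.not_mem_nil, or_false] at hk
      omega
    rw [Function.comp_apply, sectorSum_append, smul_add]
    -- The weights of mask and label cancel, so in the negative case `k` exceeds the weight of the
    -- label, and both sides vanish.
    by_cases hkw : maskSum bitWeight x.1 + k ≤ 0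
    · have hm := lowMasks_matter _ h1 k hk hkw
      refine congrArg₂ (· + ·) ?_ ?_
      · by_cases hw : (x.2.weight : ℤ) - k ≤ 2
        · rw [F.covariant_T σ h3 hk2.2 hk2.1 hw, smul_combState]
          intro z hz
          rw [(hm.1 z hz).2.2.2]
        -- The label would get a weight above two, so the new mask would have weight below `-2`, and
        -- no such mask exists.
        · have : maskTerm 1 [ghostOp 0 (-k)] x.1 = [] := by
            refine List.eq_nil_iff_forall_not_mem.2 fun z hz => ?_
            have h5 := hm.1 z hz
            have h6 := lowMasks_weight _ h5.1
            omega
          rw [this]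
          simp [combState, sectorSum]
      · by_cases hw : (x.2.weight : ℤ) - k ≤ 2
        · rw [← smul_combState σ ((κ ^ 2) ^ (-maskScale x.1) * (κ ^ 2)⁻¹) _ _ _ ?_,
            ← F.covariant_M σ h3 hk2.2 hk2.1 hw, smul_comm (2 : ℂ) (κ ^ 2), combState_smul _ (κ ^ 2),
            smul_smul, inv_mul_cancel_right₀ hκ]
          intro z hz
          rw [(hm.2 z hz).2.2.2, neg_add, zpow_add₀ hκ, zpow_neg_one]
        · have : maskTerm 1 [ghostOp 1 (-k)] x.1 = [] := by
            refine List.eq_nil_iff_forall_not_mem.2 fun z hz => ?_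
            have h5 := hm.2 z hz
            have h6 := lowMasks_weight _ h5.1
            omega
          rw [this]
          simp [combState, sectorSum]
    · have hg := Sector.graded F.rank σ x.2 h3 k hk
      have hT : (σ.model r).T k x.2 = [] := List.eq_nil_iff_forall_not_mem.2 fun y hy => by
        have := (hg.1 y hy).2
        omega
      have hM : (σ.model r).M k x.2 = [] := List.eq_nil_iff_forall_not_mem.2 fun y hy => by
        have := (hg.2 y hy).2
        omega
      rw [hT, hM, polyT_eq_zero hP (by omega), polyM_eq_zero hP (by omega)]
      have hnil (l : List (ℤ × ℕ)) : l.flatMap (fun _ => ([] : List (ℤ × ℕ × Label))) = [] := by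
        simp [List.flatMap_eq_nil_iff]
      simp [combState, sectorSum, hnil]
  · rw [combState, sectorSum, List.smul_sum, List.map_map, List.map_map]
    refine congrArg List.sum (List.map_congr_left fun z hz => ?_)
    simp only [Function.comp_apply, sectorState_apply, (lowMasks_ghost _ h1 z hz).2.2.2]
    exact smul_comm _ _ _

end

/-! ### Coefficients of the matter polynomials -/

/-- The constant term. -/
def constPart : MvPolynomial MatterMode ℂ →ₗ[ℂ] ℂ := MvPolynomial.lcoeff ℂ 0

/-- The coefficients of the terms linear in the adapted variables. -/
def vecPart (τ κ : ℂ) (ξ k : ℕ) : MvPolynomial MatterMode ℂ →ₗ[ℂ] (Fin 26 → ℂ) :=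
  LinearMap.pi fun μ => constPart ∘ₗ (dual τ κ ξ μ k).toLinearMap

/-- The second derivatives in the adapted variables of depth one. -/
def matPart (τ κ : ℂ) (ξ η : ℕ) : MvPolynomial MatterMode ℂ →ₗ[ℂ] Matrix (Fin 26) (Fin 26) ℂ :=
  LinearMap.pi fun μ => LinearMap.pi fun ν =>
    constPart ∘ₗ (dual τ κ ξ μ 0).toLinearMap ∘ₗ (dual τ κ η ν 0).toLinearMap

section

variable {τ κ : ℂ} {ξ η ξ' η' : ℕ}

lemma vecPart_apply (ξ k : ℕ) (P : MvPolynomial MatterMode ℂ) (μ : Fin 26) :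
    vecPart τ κ ξ k P μ = constPart (dual τ κ ξ μ k P) := rfl

lemma matPart_apply (ξ η : ℕ) (P : MvPolynomial MatterMode ℂ) (μ ν : Fin 26) :
    matPart τ κ ξ η P μ ν = constPart (dual τ κ ξ μ 0 (dual τ κ η ν 0 P)) := rfl

lemma constPart_one : constPart 1 = 1 := by
  simp [constPart, MvPolynomial.lcoeff]

lemma constPart_of_mem {w : ℕ} (hw : w ≠ 0) {P : MvPolynomial MatterMode ℂ} (hP : P ∈ matterW w) :
    constPart P = 0 := by
  by_contra h
  have := hP h
  simp at this
  exact hw this.symm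

lemma constPart_lin (ξ k : ℕ) (u : Fin 26 → ℂ) : constPart (lin τ κ ξ k u) = 0 :=
  constPart_of_mem (Nat.succ_ne_zero k) (lin_mem_matterW ξ k u)

lemma constPart_quad (ξ η : ℕ) (A : Matrix (Fin 26) (Fin 26) ℂ) :
    constPart (quad τ κ ξ η A) = 0 :=
  constPart_of_mem two_ne_zero (quad_mem_matterW ξ η A)

lemma vecPart_one (ξ k : ℕ) : vecPart τ κ ξ k 1 = 0 := by
  funext μ
  simp [vecPart_apply]

lemma vecPart_lin (hτ : τ ≠ 0) (hκ : κ ≠ 0) (hξ : ξ < 2) (hη : η < 2) (k l : ℕ)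
    (u : Fin 26 → ℂ) : vecPart τ κ ξ k (lin τ κ η l u) = if ξ = η ∧ k = l then u else 0 := by
  funext μ
  rw [vecPart_apply, dual_lin hτ hκ hξ hη]
  split <;> simp [constPart_one]

lemma vecPart_quad (hτ : τ ≠ 0) (hκ : κ ≠ 0) (hξ : ξ < 2) (hξ' : ξ' < 2) (hη' : η' < 2) {k : ℕ}
    (hk : k < 2) (A : Matrix (Fin 26) (Fin 26) ℂ) : vecPart τ κ ξ k (quad τ κ ξ' η' A) = 0 := by
  funext μ
  rw [vecPart_apply]
  interval_cases k
  · rw [dual_quad_zero hτ hκ hξ hξ' hη', map_add]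
    split_ifs <;> simp [constPart_lin]
  · rw [dual_quad_one hτ hκ hξ hξ' hη', map_zero]
    rfl

lemma matPart_one (ξ η : ℕ) : matPart τ κ ξ η 1 = 0 := by
  ext μ ν
  simp [matPart_apply]

lemma matPart_lin (hτ : τ ≠ 0) (hκ : κ ≠ 0) (hη : η < 2) (hξ' : ξ' < 2) (k : ℕ) (u : Fin 26 → ℂ) :
    matPart τ κ ξ η (lin τ κ ξ' k u) = 0 := by
  ext μ ν
  rw [matPart_apply, dual_lin hτ hκ hη hξ']
  split <;> simp

/-- A second derivative meets the two factors in either order. For letters of the same kind both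
orders contribute, whence the halves in the formulas that invert this one. -/
lemma matPart_quad (hτ : τ ≠ 0) (hκ : κ ≠ 0) (hξ : ξ < 2) (hη : η < 2) (hξ' : ξ' < 2) (hη' : η' < 2)
    (A : Matrix (Fin 26) (Fin 26) ℂ) : matPart τ κ ξ η (quad τ κ ξ' η' A) =
      (if ξ = ξ' ∧ η = η' then A else 0) + if ξ = η' ∧ η = ξ' then Aᵀ else 0 := by
  ext μ ν
  rw [matPart_apply, dual_quad_zero hτ hκ hη hξ' hη', map_add, map_add, add_comm, Matrix.add_apply]
  congr 1
  · by_cases h1 : ξ = ξ' <;> by_cases h2 : η = η' <;>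
      simp [h1, h2, dual_lin hτ hκ hξ' hξ', constPart_one, dual_lin hτ hκ hξ hξ']
  · by_cases h1 : ξ = η' <;> by_cases h2 : η = ξ' <;>
      simp [h1, h2, dual_lin hτ hκ hη' hη', constPart_one, dual_lin hτ hκ hξ hη']

/-! ### Reconstruction from the coefficients -/

lemma weight_eq_zero {d : MatterMode →₀ ℕ} (h : Finsupp.weight modeWeight d = 0) : d = 0 := by
  by_contra hd
  obtain ⟨m, hm⟩ := Finsupp.ne_iff.1 hd
  have hle := Finsupp.le_weight_of_ne_zero' modeWeight hm
  have hpos : 0 < modeWeight m := by rcases m with m | m <;> simp [modeWeight]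
  omega

lemma exists_single_add {d : MatterMode →₀ ℕ} {w : ℕ} (h : Finsupp.weight modeWeight d = w + 1) :
    ∃ m d', d = Finsupp.single m 1 + d' ∧ modeWeight m + Finsupp.weight modeWeight d' = w + 1 := by
  have hd : d ≠ 0 := by
    rintro rfl
    simp at h
  obtain ⟨m, hm⟩ := Finsupp.ne_iff.1 hd
  have hle : Finsupp.single m 1 ≤ d := by
    rw [Finsupp.single_le_iff]
    exact Nat.one_le_iff_ne_zero.2 hm
  refine ⟨m, d - Finsupp.single m 1, (add_tsub_cancel_of_le hle).symm, ?_⟩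
  rw [← h]
  conv_rhs => rw [← add_tsub_cancel_of_le hle, map_add, Finsupp.weight_single, one_smul]

/-- The change of variables to the letters is invertible: each of the original variables is a
multiple of a single letter of the same depth. -/
lemma X_eq_smul_lin (hτ : τ ≠ 0) (hκ : κ ≠ 0) (m : MatterMode) : ∃ ξ < 2, ∃ u,
    (X m : MvPolynomial MatterMode ℂ) = lin τ κ ξ (modeWeight m - 1) u := by
  have h0 : Complex.I * τ * κ ≠ 0 := by simp [hτ, hκ]
  have key : ∀ (ξ : ℕ) (μ : Fin 26) (k : ℕ) (c : ℂ),
      c • letter τ κ ξ μ k = lin τ κ ξ k (Pi.single μ c) := by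
    intro ξ μ k c
    rw [lin_apply, Finset.sum_eq_single μ] <;> simp +contextual
  rcases m with ⟨μ, k⟩ | ⟨μ, k⟩
  · have hk : (k : ℂ) + 1 ≠ 0 := Nat.cast_add_one_ne_zero k
    by_cases hμ : μ = 0
    · refine ⟨0, by norm_num, Pi.single μ (((k : ℂ) + 1) / κ)⁻¹, ?_⟩
      change _ = lin τ κ 0 k _
      rw [← key 0 μ k]
      simp only [letter, hμ, if_true, smul_smul]
      rw [inv_mul_cancel₀ (div_ne_zero hk hκ), one_smul]
    · refine ⟨1, by norm_num, Pi.single μ (((k : ℂ) + 1) * (Complex.I * τ * κ))⁻¹, ?_⟩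
      change _ = lin τ κ 1 k _
      rw [← key 1 μ k]
      simp only [letter, hμ, one_ne_zero, if_false, smul_smul]
      rw [inv_mul_cancel₀ (mul_ne_zero hk h0), one_smul]
  · by_cases hμ : μ = 0
    · refine ⟨1, by norm_num, Pi.single μ κ⁻¹, ?_⟩
      change _ = lin τ κ 1 k _
      rw [← key 1 μ k]
      simp only [letter, hμ, one_ne_zero, if_true, if_false, smul_smul]
      rw [inv_mul_cancel₀ hκ, one_smul]
    · refine ⟨0, by norm_num, Pi.single μ (Complex.I * τ * κ), ?_⟩
      change _ = lin τ κ 0 k _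
      rw [← key 0 μ k]
      simp only [letter, hμ, if_true, if_false, smul_smul]
      rw [mul_inv_cancel₀ h0, one_smul]

lemma matterW_zero_le : matterW 0 ≤ Submodule.span ℂ {(1 : MvPolynomial MatterMode ℂ)} := by
  intro P hP
  rw [P.as_sum]
  refine Submodule.sum_mem _ fun d hd => ?_
  obtain rfl := weight_eq_zero (hP (MvPolynomial.mem_support_iff.1 hd))
  rw [Submodule.mem_span_singleton]
  exact ⟨MvPolynomial.coeff 0 P, by rw [MvPolynomial.smul_eq_C_mul, mul_one]; rfl⟩

lemma monomial_single_add (m : MatterMode) (d : MatterMode →₀ ℕ) (a : ℂ) :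
    MvPolynomial.monomial (Finsupp.single m 1 + d) a = X m * MvPolynomial.monomial d a := by
  rw [X, MvPolynomial.monomial_mul, one_mul]

lemma matterW_one_le (hτ : τ ≠ 0) (hκ : κ ≠ 0) : matterW 1 ≤ Submodule.span ℂ
    {P : MvPolynomial MatterMode ℂ | ∃ ξ < 2, ∃ u, P = lin τ κ ξ 0 u} := by
  intro P hP
  rw [P.as_sum]
  refine Submodule.sum_mem _ fun d hd => ?_
  obtain ⟨m, d', rfl, h⟩ := exists_single_add (hP (MvPolynomial.mem_support_iff.1 hd))
  have hm : 0 < modeWeight m := by rcases m with m | m <;> simp [modeWeight]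
  obtain rfl := weight_eq_zero (d := d') (by omega)
  obtain ⟨ξ, hξ, u, hu⟩ := X_eq_smul_lin hτ hκ m
  rw [show modeWeight m - 1 = 0 by omega] at hu
  rw [monomial_single_add, hu, mul_comm, ← MvPolynomial.C_apply, ← MvPolynomial.smul_eq_C_mul]
  exact Submodule.smul_mem _ _ (Submodule.subset_span ⟨ξ, hξ, u, rfl⟩)

lemma matterW_two_le (hτ : τ ≠ 0) (hκ : κ ≠ 0) : matterW 2 ≤ Submodule.span ℂ
    {P : MvPolynomial MatterMode ℂ | (∃ ξ < 2, ∃ u, P = lin τ κ ξ 1 u) ∨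
      ∃ ξ < 2, ∃ η < 2, ∃ A, P = quad τ κ ξ η A} := by
  intro P hP
  rw [P.as_sum]
  refine Submodule.sum_mem _ fun d hd => ?_
  obtain ⟨m, d', rfl, h⟩ := exists_single_add (hP (MvPolynomial.mem_support_iff.1 hd))
  have hpos : ∀ m, 0 < modeWeight m := by rintro (m | m) <;> simp [modeWeight]
  have hm := hpos m
  obtain ⟨ξ, hξ, u, hu⟩ := X_eq_smul_lin hτ hκ m
  rw [monomial_single_add, hu]
  by_cases h2 : modeWeight m = 2
  · obtain rfl := weight_eq_zero (d := d') (by omega)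
    rw [mul_comm, ← MvPolynomial.C_apply, ← MvPolynomial.smul_eq_C_mul, h2]
    exact Submodule.smul_mem _ _ (Submodule.subset_span (Or.inl ⟨ξ, hξ, u, rfl⟩))
  · obtain ⟨m', d'', rfl, h'⟩ := exists_single_add (d := d') (w := 0) (by omega)
    have hm' := hpos m'
    obtain rfl := weight_eq_zero (d := d'') (by omega)
    obtain ⟨η, hη, v, hv⟩ := X_eq_smul_lin hτ hκ m'
    rw [monomial_single_add, hv, mul_comm (lin τ κ η _ v), ← MvPolynomial.C_apply, mul_left_comm,
      ← MvPolynomial.smul_eq_C_mul, show modeWeight m - 1 = 0 by omega,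
      show modeWeight m' - 1 = 0 by omega, ← quad_vecMulVec]
    exact Submodule.smul_mem _ _ (Submodule.subset_span (Or.inr ⟨ξ, hξ, η, hη, _, rfl⟩))

lemma reconstruct_zero {P : MvPolynomial MatterMode ℂ} (hP : P ∈ matterW 0) :
    P = constPart P • 1 := by
  obtain ⟨a, rfl⟩ := Submodule.mem_span_singleton.1 (matterW_zero_le hP)
  rw [map_smul, constPart_one, smul_eq_mul, mul_one]

lemma reconstruct_one (hτ : τ ≠ 0) (hκ : κ ≠ 0) {P : MvPolynomial MatterMode ℂ}
    (hP : P ∈ matterW 1) :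
    P = lin τ κ 0 0 (vecPart τ κ 0 0 P) + lin τ κ 1 0 (vecPart τ κ 1 0 P) := by
  refine LinearMap.eqOn_span (f := LinearMap.id)
    (g := lin τ κ 0 0 ∘ₗ vecPart τ κ 0 0 + lin τ κ 1 0 ∘ₗ vecPart τ κ 1 0) ?_
    (matterW_one_le hτ hκ hP)
  rintro _ ⟨ξ, hξ, u, rfl⟩
  interval_cases ξ <;> simp [vecPart_lin hτ hκ]

/-- Taylor's formula in the letters, checked on the spanning polynomials `lin` and `quad`. The
halves compensate the symmetric second derivatives of `Q Q` and `R R`; the mixed derivative is taken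
in one order only. -/
lemma reconstruct_two (hτ : τ ≠ 0) (hκ : κ ≠ 0) {P : MvPolynomial MatterMode ℂ}
    (hP : P ∈ matterW 2) :
    P = lin τ κ 0 1 (vecPart τ κ 0 1 P) + lin τ κ 1 1 (vecPart τ κ 1 1 P) +
      ((1 / 2 : ℂ) • quad τ κ 0 0 (matPart τ κ 0 0 P) + quad τ κ 0 1 (matPart τ κ 0 1 P) +
        (1 / 2 : ℂ) • quad τ κ 1 1 (matPart τ κ 1 1 P)) := by
  refine LinearMap.eqOn_span (f := LinearMap.id)
    (g := lin τ κ 0 1 ∘ₗ vecPart τ κ 0 1 + lin τ κ 1 1 ∘ₗ vecPart τ κ 1 1 +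
      ((1 / 2 : ℂ) • quad τ κ 0 0 ∘ₗ matPart τ κ 0 0 + quad τ κ 0 1 ∘ₗ matPart τ κ 0 1 +
        (1 / 2 : ℂ) • quad τ κ 1 1 ∘ₗ matPart τ κ 1 1)) ?_ (matterW_two_le hτ hκ hP)
  have half : ∀ Q : MvPolynomial MatterMode ℂ, (1 / 2 : ℂ) • (Q + Q) = Q := by
    intro Q
    rw [← two_smul ℂ Q, smul_smul]
    norm_num
  rintro _ (⟨ξ, hξ, u, rfl⟩ | ⟨ξ, hξ, η, hη, A, rfl⟩)
  · interval_cases ξ <;> simp [vecPart_lin hτ hκ, matPart_lin hτ hκ]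
  · have h1 := quad_comm (τ := τ) (κ := κ) 0 0 A
    have h2 := quad_comm (τ := τ) (κ := κ) 1 1 A
    have h3 := quad_comm (τ := τ) (κ := κ) 1 0 A
    simp only [LinearMap.id_apply, LinearMap.add_apply, LinearMap.comp_apply, LinearMap.smul_apply]
    interval_cases ξ <;> interval_cases η <;>
      simp only [vecPart_quad hτ hκ, matPart_quad hτ hκ, Nat.ofNat_pos, Nat.one_lt_ofNat, map_zero,
        add_zero, zero_add, and_self, if_true, if_false, one_ne_zero, zero_ne_one, and_false,
        false_and, smul_zero, map_add, ← h1, ← h2, ← h3, half]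

end

/-! ### Extraction of the covariants -/

section

variable {τ : ℝ} {κ : ℂ} {p : Fin 26 → ℝ} {r : ℕ} {e : ℕ → Fin 26 → ℂ}

/-- The matrix coefficient between two vectors. -/
def sandwich (u v : Fin 26 → ℂ) : Matrix (Fin 26) (Fin 26) ℂ →ₗ[ℂ] ℂ where
  toFun A := u ⬝ᵥ A *ᵥ v
  map_add' A B := by rw [Matrix.add_mulVec, dotProduct_add]
  map_smul' a A := by rw [Matrix.smul_mulVec, dotProduct_smul, RingHom.id_apply]

lemma sandwich_apply (u v : Fin 26 → ℂ) (A : Matrix (Fin 26) (Fin 26) ℂ) :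
    sandwich u v A = u ⬝ᵥ A *ᵥ v := rfl

/-- The trace with a fixed matrix. -/
def traceMul (B : Matrix (Fin 26) (Fin 26) ℂ) : Matrix (Fin 26) (Fin 26) ℂ →ₗ[ℂ] ℂ :=
  Matrix.traceLinearMap _ ℂ ℂ ∘ₗ LinearMap.mulLeft ℂ B

lemma traceMul_apply (B A : Matrix (Fin 26) (Fin 26) ℂ) : traceMul B A = (B * A).trace := rfl

/-- The pairing with a fixed vector. -/
def pairing (u : Fin 26 → ℂ) : (Fin 26 → ℂ) →ₗ[ℂ] ℂ where
  toFun v := u ⬝ᵥ v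
  map_add' := dotProduct_add u
  map_smul' a v := dotProduct_smul a u v

lemma pairing_apply (u v : Fin 26 → ℂ) : pairing u v = u ⬝ᵥ v := rfl

/-- The multiplication by a fixed vector from the left. -/
def vecMulMap (u : Fin 26 → ℂ) : Matrix (Fin 26) (Fin 26) ℂ →ₗ[ℂ] (Fin 26 → ℂ) where
  toFun A := u ᵥ* A
  map_add' A B := Matrix.vecMul_add A B u
  map_smul' a A := Matrix.vecMul_smul u a A

lemma vecMulMap_apply (u : Fin 26 → ℂ) (A : Matrix (Fin 26) (Fin 26) ℂ) :
    vecMulMap u A = u ᵥ* A := rfl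

/-- The coefficient of an invariant. -/
def scalarExt (τ κ : ℂ) (r : ℕ) (e : ℕ → Fin 26 → ℂ) : Label → MvPolynomial MatterMode ℂ →ₗ[ℂ] ℂ
  | .one => constPart
  | .lin i => pairing (e (i / 2)) ∘ₗ vecPart τ κ (i % 2) 0
  | .der i => pairing (e (i / 2)) ∘ₗ vecPart τ κ (i % 2) 1
  | .quad i j => (if i = j then (1 / 2 : ℂ) else 1) •
      sandwich (e (i / 2)) (e (j / 2)) ∘ₗ matPart τ κ (i % 2) (j % 2)
  | .tr i => ((if i = 1 then (1 : ℂ) else 1 / 2) * (26 - r : ℂ)⁻¹) •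
      traceMul (transProj r e) ∘ₗ matPart τ κ (i / 2) ((i + 1) / 2)

/-- The coefficient of a covariant with values in the transverse vectors. -/
def vectorExt (τ κ : ℂ) (e : ℕ → Fin 26 → ℂ) :
    Label → MvPolynomial MatterMode ℂ →ₗ[ℂ] (Fin 26 → ℂ)
  | .lin i => vecPart τ κ i 0
  | .der i => vecPart τ κ i 1
  | .quad i j => vecMulMap (e (i / 2)) ∘ₗ matPart τ κ (i % 2) j
  | _ => 0

/-- The coefficient of a covariant with values in the transverse tensors. -/
def tensorExt (τ κ : ℂ) : Label → MvPolynomial MatterMode ℂ →ₗ[ℂ] Matrix (Fin 26) (Fin 26) ℂ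
  | .tr i => (if i = 1 then (1 : ℂ) else 1 / 2) • matPart τ κ (i / 2) ((i + 1) / 2)
  | _ => 0

lemma mem_scalarModel {x : Label} : x ∈ (scalarModel r).labels ↔
    x = .one ∨ (∃ i < 2 * r, x = .lin i) ∨ (∃ i < 2 * r, x = .der i) ∨
      (∃ j < 2 * r, ∃ i ≤ j, x = .quad i j) ∨ ∃ i < 3, x = .tr i := by
  cases x with
  | one => simp [scalarModel]
  | lin i => simp [mem_scalarModel_lin]
  | der i => simp [mem_scalarModel_der]
  | quad i j => simp [mem_scalarModel_quad]
  | tr i => simp [mem_scalarModel_tr]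

namespace IsFrame

variable (F : IsFrame τ κ p r e)
include F

lemma trace_ne_zero : (26 - r : ℂ) ≠ 0 := by
  rcases F.rank with rfl | rfl <;> norm_num

/-- `scalarExt` is the dual basis of the invariants. The square of a letter has second derivative
two, and the trace labels are normalised by the trace `26 - r`; this fixes the constants in its
definition. -/
lemma scalarExt_scalar {x y : Label} (hx : x ∈ (scalarModel r).labels)
    (hy : y ∈ (scalarModel r).labels) :
    scalarExt τ κ r e x (scalarCov τ κ r e y) = if x = y then 1 else 0 := by
  have ht := F.tension
  have hκ := F.scale
  have ht' : (τ : ℂ) ≠ 0 := Complex.ofReal_ne_zero.2 ht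
  obtain rfl | ⟨i, hi, rfl⟩ | ⟨i, hi, rfl⟩ | ⟨j, hj, i, hi, rfl⟩ | ⟨i, hi, rfl⟩ :=
    mem_scalarModel.1 hx <;>
  obtain rfl | ⟨i', hi', rfl⟩ | ⟨i', hi', rfl⟩ | ⟨j', hj', i', hi', rfl⟩ | ⟨i', hi', rfl⟩ :=
    mem_scalarModel.1 hy <;>
  simp (disch := omega) only [scalarExt, scalarCov, LinearMap.comp_apply, LinearMap.smul_apply, constPart_one,
    constPart_lin, constPart_quad, vecPart_one, matPart_one, map_zero, if_true,
    reduceCtorEq, if_false, vecPart_lin ht' hκ, vecPart_quad ht' hκ, matPart_lin ht' hκ, matPart_quad ht' hκ, and_false, and_true,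
    zero_ne_one, one_ne_zero, map_add, sandwich_apply, traceMul_apply, pairing_apply, apply_ite (pairing _), apply_ite (sandwich _ _), apply_ite (traceMul _),
    F.orth, F.transProj_mulVec_axis, F.transProj_trace, F.transProj_mul_self, Matrix.transpose_vecMulVec, transProj_transpose,
    Matrix.vecMulVec_mulVec, op_smul_eq_smul, dotProduct_smul, smul_eq_mul, mul_zero, Matrix.mul_vecMulVec, Matrix.zero_vecMulVec, Matrix.trace_zero, dotProduct_zero, ite_self, add_zero, Label.lin.injEq, Label.der.injEq, Label.quad.injEq, Label.tr.injEq]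
  · split_ifs <;> first | rfl | omega
  · split_ifs <;> first | rfl | omega
  -- A letter is determined by its kind and its axis. As both pairs of letters are ordered, the term
  -- with the letters exchanged is nonzero only if all four indices agree.
  · have key : ∀ k l : ℕ, (if i % 2 = k % 2 ∧ j % 2 = l % 2 then
        (if l / 2 = j / 2 then (1 : ℂ) else 0) * (if i / 2 = k / 2 then 1 else 0) else 0) =
        if i = k ∧ j = l then 1 else 0 := by
      intro k l
      by_cases h : i = k ∧ j = l
      · simp [h.1, h.2]
      · rw [if_neg h]
        split_ifs <;> first | omega | simp
    rw [key, key]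
    by_cases h : i = i' ∧ j = j'
    · rw [if_pos h]
      obtain ⟨rfl, rfl⟩ := h
      by_cases hij : i = j
      · simp [hij]
        norm_num
      · simp [hij]
    · rw [if_neg h, if_neg (c := i = j' ∧ j = i') (by omega), add_zero, mul_zero]
  · have hr := F.trace_ne_zero
    interval_cases i <;> interval_cases i' <;> simp [← two_mul, hr]
    all_goals field_simp

/-- The projection to the transverse vectors. -/
def vecProj : (Fin 26 → ℂ) →ₗ[ℂ] perp p :=
  LinearMap.codRestrict (perp p) (unhat ∘ₗ (transProj r e).mulVecLin) F.unhat_transProj_mem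

lemma vecProj_hat (v : perp p) : F.vecProj (hat v.1) = v :=
  Subtype.ext (by
    change unhat (transProj r e *ᵥ hat v.1) = v.1
    rw [F.transProj_mulVec_hat v.2, unhat_hat])

lemma vecProj_axis {a : ℕ} (ha : a < r) : F.vecProj (e a) = 0 :=
  Subtype.ext (by
    change unhat (transProj r e *ᵥ e a) = 0
    rw [F.transProj_mulVec_axis ha, map_zero])

lemma trace_unhatMat_transProj (B : Matrix (Fin 26) (Fin 26) ℂ) :
    (unhatMat (transProj r e * B * transProj r e)).trace = (transProj r e * B).trace := by
  rw [← hatMat_trace, F.hatMat_unhatMat_transProj, Matrix.trace_mul_comm, ← Matrix.mul_assoc,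
    F.transProj_mul_self]

omit F in
lemma unhatMat_transProj_transpose (B : Matrix (Fin 26) (Fin 26) ℂ) :
    (unhatMat (transProj r e * B * transProj r e))ᵀ =
      unhatMat (transProj r e * Bᵀ * transProj r e) := by
  change unhatMat (transProj r e * B * transProj r e)ᵀ = _
  rw [Matrix.transpose_mul, Matrix.transpose_mul, transProj_transpose, ← Matrix.mul_assoc]

/-- The projection to the traceless symmetric transverse tensors. -/
def symProj : Matrix (Fin 26) (Fin 26) ℂ →ₗ[ℂ] symPerp p where
  toFun B := ⟨unhatMat (transProj r e * ((1 / 2 : ℂ) • (B + Bᵀ) -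
      ((26 - r : ℂ)⁻¹ * traceMul (transProj r e) B) • 1) * transProj r e), by
    refine ⟨?_, ?_, F.unhatMat_transProj_mulVec _⟩
    · rw [unhatMat_transProj_transpose]
      simp [add_comm]
    · have h : (transProj r e * Bᵀ).trace = (transProj r e * B).trace := by
        rw [← Matrix.trace_transpose, Matrix.transpose_mul, Matrix.transpose_transpose,
          transProj_transpose, Matrix.trace_mul_comm]
      rw [F.trace_unhatMat_transProj]
      simp only [Matrix.mul_sub, Matrix.mul_add, Matrix.mul_smul, Matrix.trace_sub,
        Matrix.trace_smul, Matrix.trace_add, h, Matrix.mul_one, F.transProj_trace, smul_eq_mul,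
        traceMul_apply]
      field_simp [F.trace_ne_zero]
      ring⟩
  map_add' A B := Subtype.ext (by
    change unhatMat _ = unhatMat _ + unhatMat _
    rw [← map_add, ← Matrix.add_mul, ← Matrix.mul_add, map_add, Matrix.transpose_add]
    congr 3
    module)
  map_smul' a B := Subtype.ext (by
    change unhatMat _ = a • unhatMat _
    rw [← map_smul, ← Matrix.smul_mul, ← Matrix.mul_smul, map_smul, Matrix.transpose_smul, smul_eq_mul]
    congr 3
    module)

/-- The projection to the skewsymmetric transverse tensors. -/
def skewProj : Matrix (Fin 26) (Fin 26) ℂ →ₗ[ℂ] skewPerp p where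
  toFun B := ⟨unhatMat (transProj r e * ((1 / 2 : ℂ) • (B - Bᵀ)) * transProj r e), by
    refine ⟨?_, F.unhatMat_transProj_mulVec _⟩
    rw [unhatMat_transProj_transpose, ← neg_one_smul ℂ, ← map_smul, ← Matrix.smul_mul,
      ← Matrix.mul_smul]
    congr 3
    rw [Matrix.transpose_smul, Matrix.transpose_sub, Matrix.transpose_transpose]
    module⟩
  map_add' A B := Subtype.ext (by
    change unhatMat _ = unhatMat _ + unhatMat _
    rw [← map_add, ← Matrix.add_mul, ← Matrix.mul_add, Matrix.transpose_add]
    congr 3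
    module)
  map_smul' a B := Subtype.ext (by
    change unhatMat _ = a • unhatMat _
    rw [← map_smul, ← Matrix.smul_mul, ← Matrix.mul_smul, Matrix.transpose_smul]
    congr 3
    module)

lemma symProj_hatMat (A : symPerp p) : F.symProj (hatMat A.1) = A :=
  Subtype.ext (by
    change unhatMat _ = A.1
    have h1 : transProj r e * hatMat A.1 = hatMat A.1 := F.transProj_mul_hatMat (by rw [A.2.1, A.2.2.2])
    rw [← hatMat_transpose, A.2.1, traceMul_apply, h1, hatMat_trace, A.2.2.1, mul_zero, zero_smul, sub_zero,
      ← two_smul ℂ, smul_smul, Matrix.mul_smul, Matrix.smul_mul, h1, F.hatMat_mul_transProj A.2.2.2, map_smul, unhatMat_hatMat]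
    norm_num)

lemma skewProj_hatMat (A : skewPerp p) : F.skewProj (hatMat A.1) = A :=
  Subtype.ext (by
    change unhatMat _ = A.1
    have h1 : transProj r e * hatMat A.1 = hatMat A.1 := F.transProj_mul_hatMat (by rw [A.2.1, Matrix.neg_mulVec, A.2.2, neg_zero])
    rw [← hatMat_transpose, A.2.1, hatMat_neg, sub_neg_eq_add,
      ← two_smul ℂ, smul_smul, Matrix.mul_smul, Matrix.smul_mul, h1, F.hatMat_mul_transProj A.2.2, map_smul, unhatMat_hatMat]
    norm_num)

lemma symProj_of_skew {B : Matrix (Fin 26) (Fin 26) ℂ} (h : Bᵀ = -B) : F.symProj B = 0 :=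
  Subtype.ext (by
    change unhatMat _ = 0
    have h' : (transProj r e * B).trace = 0 := by
      rw [← CharZero.eq_neg_self_iff, ← Matrix.trace_neg, ← Matrix.mul_neg, ← h,
        ← Matrix.trace_transpose, Matrix.transpose_mul, transProj_transpose, Matrix.trace_mul_comm]
    rw [h, add_neg_cancel, traceMul_apply, h']
    simp)

lemma skewProj_of_symm {B : Matrix (Fin 26) (Fin 26) ℂ} (h : Bᵀ = B) : F.skewProj B = 0 :=
  Subtype.ext (by
    change unhatMat _ = 0
    rw [h, sub_self]
    simp)

lemma symProj_transpose (B : Matrix (Fin 26) (Fin 26) ℂ) : F.symProj Bᵀ = F.symProj B := by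
  have h : (transProj r e * Bᵀ).trace = (transProj r e * B).trace := by
    rw [← Matrix.trace_transpose, Matrix.transpose_mul, Matrix.transpose_transpose,
      transProj_transpose, Matrix.trace_mul_comm]
  refine Subtype.ext ?_
  change unhatMat _ = unhatMat _
  rw [traceMul_apply, traceMul_apply, h, Matrix.transpose_transpose, add_comm]

lemma skewProj_transpose (B : Matrix (Fin 26) (Fin 26) ℂ) : F.skewProj Bᵀ = -F.skewProj B := by
  refine Subtype.ext ?_
  change unhatMat _ = -unhatMat _
  rw [Matrix.transpose_transpose, ← neg_sub, smul_neg, Matrix.mul_neg, Matrix.neg_mul]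
  rfl

lemma symProj_transProj : F.symProj (transProj r e) = 0 :=
  Subtype.ext (by
    change unhatMat _ = 0
    rw [transProj_transpose, traceMul_apply, F.transProj_mul_self, F.transProj_trace, inv_mul_cancel₀ F.trace_ne_zero, ← two_smul ℂ, smul_smul,
      Matrix.mul_sub, Matrix.sub_mul, Matrix.mul_smul, F.transProj_mul_self, Matrix.smul_mul, F.transProj_mul_self, one_smul, Matrix.mul_one, F.transProj_mul_self]
    norm_num)

/-- If `B` has no transverse part in its first slot, neither has `Bᵀ` in its second, and the trace
term vanishes as well. It is used for products of an axis with a vector. -/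
lemma symProj_of_mul {B : Matrix (Fin 26) (Fin 26) ℂ} (h : transProj r e * B = 0)
    : F.symProj B = 0 :=
  Subtype.ext (by
    have h' : Bᵀ * transProj r e = 0 := by
      rw [← Matrix.transpose_transpose (transProj r e), ← Matrix.transpose_mul, transProj_transpose, h, Matrix.transpose_zero]
    change unhatMat _ = 0
    rw [traceMul_apply, h, Matrix.mul_sub, Matrix.sub_mul, Matrix.mul_smul, Matrix.mul_add, h, zero_add, Matrix.smul_mul, Matrix.mul_assoc, h']
    simp)

lemma skewProj_of_mul {B : Matrix (Fin 26) (Fin 26) ℂ} (h : transProj r e * B = 0)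
    : F.skewProj B = 0 :=
  Subtype.ext (by
    have h' : Bᵀ * transProj r e = 0 := by
      rw [← Matrix.transpose_transpose (transProj r e), ← Matrix.transpose_mul, transProj_transpose, h, Matrix.transpose_zero]
    change unhatMat _ = 0
    rw [Matrix.mul_smul, Matrix.mul_sub, h, zero_sub, Matrix.smul_mul, Matrix.neg_mul, Matrix.mul_assoc, h']
    simp)

/-- The coefficient of a covariant. -/
def extract : (σ : Sector) → Label → MvPolynomial MatterMode ℂ →ₗ[ℂ] σ.Space p
  | .scalar, x => scalarExt τ κ r e x
  | .vector, x => F.vecProj ∘ₗ vectorExt τ κ e x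
  | .sym, x => F.symProj ∘ₗ tensorExt τ κ x
  | .skew, x => F.skewProj ∘ₗ tensorExt τ κ x

lemma scalarExt_vector {x y : Label} (hx : x ∈ (scalarModel r).labels)
    (hy : y ∈ (vectorModel r).labels) (v : perp p) :
    scalarExt τ κ r e x (vectorCov τ κ e y (hat v.1)) = 0 := by
  have hκ := F.scale
  have ht : (τ : ℂ) ≠ 0 := Complex.ofReal_ne_zero.2 F.tension
  have h1 : ∀ a < r, e a ⬝ᵥ hat v.1 = 0 := (F.mem_perp v.1).1 v.2
  have h2 : ∀ a < r, hat v.1 ⬝ᵥ e a = 0 := fun a ha => by rw [dotProduct_comm, h1 a ha]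
  obtain rfl | ⟨i, hi, rfl⟩ | ⟨i, hi, rfl⟩ | ⟨j, hj, i, hi, rfl⟩ | ⟨i, hi, rfl⟩ :=
    mem_scalarModel.1 hx <;>
  obtain ⟨i', hi', rfl⟩ | ⟨i', hi', rfl⟩ | ⟨i', hi', j', hj', rfl⟩ := mem_vectorModel.1 hy <;>
  simp (disch := omega) only [scalarExt, vectorCov, outer_apply, LinearMap.comp_apply,
    LinearMap.smul_apply, constPart_lin, constPart_quad, map_zero, vecPart_lin ht hκ,
    vecPart_quad ht hκ, matPart_lin ht hκ, matPart_quad ht hκ, map_add, sandwich_apply,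
    traceMul_apply, pairing_apply, apply_ite (pairing _), apply_ite (sandwich _ _),
    apply_ite (traceMul _), h1, h2, F.transProj_mulVec_axis, Matrix.transpose_vecMulVec,
    Matrix.vecMulVec_mulVec, op_smul_eq_smul, dotProduct_smul, smul_zero, Matrix.mul_vecMulVec,
    Matrix.zero_vecMulVec, Matrix.trace_zero, ite_self, add_zero, zero_smul, dotProduct_zero, Matrix.trace_vecMulVec,
    F.transProj_mulVec_hat v.2]

lemma scalarExt_tensor {x y : Label} (hx : x ∈ (scalarModel r).labels)
    {A : Matrix (Fin 25) (Fin 25) ℂ} (h : A *ᵥ CarrollString.transverse p = 0)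
    (h' : Aᵀ *ᵥ CarrollString.transverse p = 0) (hA : A.trace = 0) (hy : ∃ i < 3, y = .tr i) :
    scalarExt τ κ r e x (tensorCov τ κ y (hatMat A)) = 0 := by
  have hκ := F.scale
  have ht : (τ : ℂ) ≠ 0 := Complex.ofReal_ne_zero.2 F.tension
  have h1 := (F.mulVec_transverse A).1 h
  have h2 := (F.mulVec_transverse Aᵀ).1 h'
  have h3 : transProj r e * hatMat Aᵀ = hatMat Aᵀ :=
    F.transProj_mul_hatMat (by rwa [Matrix.transpose_transpose])
  obtain ⟨i', hi', rfl⟩ := hy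
  obtain rfl | ⟨i, hi, rfl⟩ | ⟨i, hi, rfl⟩ | ⟨j, hj, i, hi, rfl⟩ | ⟨i, hi, rfl⟩ :=
    mem_scalarModel.1 hx <;>
  simp (disch := omega) only [scalarExt, tensorCov, LinearMap.comp_apply,
    LinearMap.smul_apply, constPart_quad, map_zero, ← hatMat_transpose, 
    vecPart_quad ht hκ, matPart_quad ht hκ, map_add, sandwich_apply,
    traceMul_apply, apply_ite (sandwich _ _),
    apply_ite (traceMul _), h1, h2, h3, F.transProj_mul_hatMat h', hatMat_trace, hA, Matrix.trace_transpose,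
    smul_zero, ite_self, add_zero, dotProduct_zero]

lemma vecProj_scalar {x y : Label} (hx : x ∈ (vectorModel r).labels)
    (hy : y ∈ (scalarModel r).labels) :
    F.vecProj (vectorExt τ κ e x (scalarCov τ κ r e y)) = 0 := by
  have hκ := F.scale
  have ht : (τ : ℂ) ≠ 0 := Complex.ofReal_ne_zero.2 F.tension
  have h1 : ∀ a < r, e a ᵥ* transProj r e = 0 := fun a ha => by
    rw [← Matrix.mulVec_transpose, transProj_transpose, F.transProj_mulVec_axis ha]
  obtain ⟨i', hi', rfl⟩ | ⟨i', hi', rfl⟩ | ⟨i', hi', j', hj', rfl⟩ := mem_vectorModel.1 hx <;>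
  obtain rfl | ⟨i, hi, rfl⟩ | ⟨i, hi, rfl⟩ | ⟨j, hj, i, hi, rfl⟩ | ⟨i, hi, rfl⟩ :=
    mem_scalarModel.1 hy <;>
  simp (disch := omega) only [scalarCov, vectorExt, vecMulMap_apply, LinearMap.comp_apply,
    map_zero, vecPart_one, matPart_one, vecPart_lin ht hκ,
    vecPart_quad ht hκ, matPart_lin ht hκ, matPart_quad ht hκ, map_add, 
    apply_ite (vecMulMap _), apply_ite F.vecProj, h1, F.vecProj_axis, Matrix.transpose_vecMulVec, Matrix.vecMul_vecMulVec,
    map_smul, smul_zero, transProj_transpose, ite_self, add_zero]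

lemma vecProj_tensor {x y : Label} (hx : x ∈ (vectorModel r).labels)
    {A : Matrix (Fin 25) (Fin 25) ℂ} (h : A *ᵥ CarrollString.transverse p = 0)
    (h' : Aᵀ *ᵥ CarrollString.transverse p = 0) (hy : ∃ i < 3, y = .tr i) :
    F.vecProj (vectorExt τ κ e x (tensorCov τ κ y (hatMat A))) = 0 := by
  have hκ := F.scale
  have ht : (τ : ℂ) ≠ 0 := Complex.ofReal_ne_zero.2 F.tension
  have h1 : ∀ a < r, e a ᵥ* hatMat Aᵀ = 0 := fun a ha => by
    rw [← Matrix.mulVec_transpose, ← hatMat_transpose, Matrix.transpose_transpose,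
      (F.mulVec_transverse A).1 h a ha]
  have h2 : ∀ a < r, e a ᵥ* hatMat A = 0 := fun a ha => by
    rw [← Matrix.mulVec_transpose, ← hatMat_transpose, (F.mulVec_transverse Aᵀ).1 h' a ha]
  obtain ⟨i, hi, rfl⟩ := hy
  obtain ⟨i', hi', rfl⟩ | ⟨i', hi', rfl⟩ | ⟨i', hi', j', hj', rfl⟩ := mem_vectorModel.1 hx <;>
  simp (disch := omega) only [tensorCov, vectorExt, vecMulMap_apply, LinearMap.comp_apply,
    map_zero, vecPart_quad ht hκ, matPart_quad ht hκ, map_add, 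
    apply_ite (vecMulMap _), h1, h2, ← hatMat_transpose, ite_self, add_zero]

lemma vecProj_vector {x y : Label} (hx : x ∈ (vectorModel r).labels)
    (hy : y ∈ (vectorModel r).labels) (v : perp p) :
    F.vecProj (vectorExt τ κ e x (vectorCov τ κ e y (hat v.1))) = if x = y then v else 0 := by
  have hκ := F.scale
  have ht : (τ : ℂ) ≠ 0 := Complex.ofReal_ne_zero.2 F.tension
  have h1 : ∀ a < r, e a ⬝ᵥ hat v.1 = 0 := (F.mem_perp v.1).1 v.2
  obtain ⟨i, hi, rfl⟩ | ⟨i, hi, rfl⟩ | ⟨i, hi, j, hj, rfl⟩ := mem_vectorModel.1 hx <;>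
  obtain ⟨i', hi', rfl⟩ | ⟨i', hi', rfl⟩ | ⟨i', hi', j', hj', rfl⟩ := mem_vectorModel.1 hy <;>
  simp (disch := omega) only [vectorCov, vectorExt, vecMulMap_apply, LinearMap.comp_apply, outer_apply,
    map_zero, vecPart_lin ht hκ, vecPart_quad ht hκ, matPart_lin ht hκ, matPart_quad ht hκ, map_add, 
    apply_ite (vecMulMap _), apply_ite F.vecProj, F.vecProj_hat, F.orth, h1, Matrix.transpose_vecMulVec, Matrix.vecMul_vecMulVec,
    map_smul, zero_smul, ite_self, add_zero, and_true, and_false, one_ne_zero, zero_ne_one, if_false, reduceCtorEq,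
    Label.lin.injEq, Label.der.injEq, Label.quad.injEq]
  by_cases h : i = i' ∧ j = j'
  · simp [h.1, h.2]
  · rw [if_neg h]
    split_ifs <;> first | omega | simp

lemma tensorExt_scalar {x y : Label} (hx : ∃ i < 3, x = .tr i) (hy : y ∈ (scalarModel r).labels) :
    F.symProj (tensorExt τ κ x (scalarCov τ κ r e y)) = 0 ∧
      F.skewProj (tensorExt τ κ x (scalarCov τ κ r e y)) = 0 := by
  have hκ := F.scale
  have ht : (τ : ℂ) ≠ 0 := Complex.ofReal_ne_zero.2 F.tension
  have h1 : ∀ a < r, ∀ u, F.symProj (Matrix.vecMulVec (e a) u) = 0 := fun a ha u =>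
    F.symProj_of_mul (by rw [Matrix.mul_vecMulVec, F.transProj_mulVec_axis ha, Matrix.zero_vecMulVec])
  have h2 : ∀ a < r, ∀ u, F.skewProj (Matrix.vecMulVec (e a) u) = 0 := fun a ha u =>
    F.skewProj_of_mul (by rw [Matrix.mul_vecMulVec, F.transProj_mulVec_axis ha, Matrix.zero_vecMulVec])
  obtain ⟨i', hi', rfl⟩ := hx
  obtain rfl | ⟨i, hi, rfl⟩ | ⟨i, hi, rfl⟩ | ⟨j, hj, i, hi, rfl⟩ | ⟨i, hi, rfl⟩ :=
    mem_scalarModel.1 hy <;>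
  simp (disch := omega) only [scalarCov, tensorExt, LinearMap.smul_apply,
    map_zero, matPart_one, matPart_lin ht hκ, matPart_quad ht hκ, map_add,
    apply_ite F.symProj, apply_ite F.skewProj, h1, h2, Matrix.transpose_vecMulVec,
    map_smul, smul_zero, transProj_transpose, F.symProj_transProj, F.skewProj_of_symm transProj_transpose, ite_self, add_zero, and_self]

lemma tensorExt_vector {x y : Label} (hx : ∃ i < 3, x = .tr i) (hy : y ∈ (vectorModel r).labels)
    (v : perp p) : F.symProj (tensorExt τ κ x (vectorCov τ κ e y (hat v.1))) = 0 ∧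
      F.skewProj (tensorExt τ κ x (vectorCov τ κ e y (hat v.1))) = 0 := by
  have hκ := F.scale
  have ht : (τ : ℂ) ≠ 0 := Complex.ofReal_ne_zero.2 F.tension
  have h1 : ∀ a < r, ∀ u, F.symProj (Matrix.vecMulVec (e a) u) = 0 := fun a ha u =>
    F.symProj_of_mul (by rw [Matrix.mul_vecMulVec, F.transProj_mulVec_axis ha, Matrix.zero_vecMulVec])
  have h2 : ∀ a < r, ∀ u, F.skewProj (Matrix.vecMulVec (e a) u) = 0 := fun a ha u =>
    F.skewProj_of_mul (by rw [Matrix.mul_vecMulVec, F.transProj_mulVec_axis ha, Matrix.zero_vecMulVec])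
  have h3 : ∀ a < r, ∀ u, F.symProj (Matrix.vecMulVec u (e a)) = 0 := fun a ha u => by
    rw [← F.symProj_transpose, Matrix.transpose_vecMulVec, h1 a ha]
  have h4 : ∀ a < r, ∀ u, F.skewProj (Matrix.vecMulVec u (e a)) = 0 := fun a ha u => by
    rw [← Matrix.transpose_vecMulVec, F.skewProj_transpose, h2 a ha, neg_zero]
  obtain ⟨i, hi, rfl⟩ := hx
  obtain ⟨i', hi', rfl⟩ | ⟨i', hi', rfl⟩ | ⟨i', hi', j', hj', rfl⟩ := mem_vectorModel.1 hy <;>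
  simp (disch := omega) only [vectorCov, tensorExt, LinearMap.comp_apply, LinearMap.smul_apply, outer_apply,
    map_zero, matPart_lin ht hκ, matPart_quad ht hκ, map_add,
    apply_ite F.symProj, apply_ite F.skewProj, h1, h2, h3, h4, Matrix.transpose_vecMulVec,
    map_smul, smul_zero, ite_self, add_zero, and_self]

lemma tensorExt_sym {x y : Label} (hx : ∃ i < 3, x = .tr i) (hy : ∃ i < 3, y = .tr i)
    (A : symPerp p) :
    tensorExt τ κ x (tensorCov τ κ y (hatMat A.1)) = if x = y then hatMat A.1 else 0 := by
  have hκ := F.scale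
  have ht : (τ : ℂ) ≠ 0 := Complex.ofReal_ne_zero.2 F.tension
  obtain ⟨i, hi, rfl⟩ := hx
  obtain ⟨j, hj, rfl⟩ := hy
  rw [tensorExt, tensorCov, LinearMap.smul_apply,
    matPart_quad ht hκ (by omega) (by omega) (by omega) (by omega), ← hatMat_transpose, A.2.1]
  interval_cases i <;> interval_cases j <;> simp [← two_smul ℂ (hatMat A.1), smul_smul]

lemma tensorExt_skew {x y : Label} (hx : ∃ i < 3, x = .tr i) (hy : y = .tr 1)
    (A : skewPerp p) :
    tensorExt τ κ x (tensorCov τ κ y (hatMat A.1)) = if x = y then hatMat A.1 else 0 := by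
  have hκ := F.scale
  have ht : (τ : ℂ) ≠ 0 := Complex.ofReal_ne_zero.2 F.tension
  obtain ⟨i, hi, rfl⟩ := hx
  subst hy
  rw [tensorExt, tensorCov, LinearMap.smul_apply,
    matPart_quad ht hκ (by omega) (by omega) (by omega) (by omega)]
  interval_cases i <;> simp

omit F in
lemma map_covariant_scalar {W : Type} [AddCommGroup W] [Module ℂ W]
    (f : MvPolynomial MatterMode ℂ →ₗ[ℂ] W) (y : Label) (w : ℂ) :
    f (covariant τ κ p r e .scalar y w) = w • f (scalarCov τ κ r e y) :=
  f.map_smul w _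

omit F in
lemma map_covariant_scalar_eq_zero {W : Type} [AddCommGroup W] [Module ℂ W]
    (f : MvPolynomial MatterMode ℂ →ₗ[ℂ] W) {y : Label} (w : ℂ)
    (h : f (scalarCov τ κ r e y) = 0) : f (covariant τ κ p r e .scalar y w) = 0 := by
  rw [map_covariant_scalar, h, smul_zero]

lemma scalarExt_covariant_scalar {x y : Label} (hx : x ∈ (scalarModel r).labels)
    (hy : y ∈ (scalarModel r).labels) (w : ℂ) :
    scalarExt τ κ r e x (covariant τ κ p r e .scalar y w) = if x = y then w else 0 := by
  rw [map_covariant_scalar, F.scalarExt_scalar hx hy, smul_ite, smul_zero, smul_eq_mul, mul_one]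

lemma extract_covariant_self {σ : Sector} {x y : Label} (hx : x ∈ (σ.model r).labels)
    (hy : y ∈ (σ.model r).labels) (w : σ.Space p) :
    F.extract σ x (covariant τ κ p r e σ y w) = if x = y then w else 0 := by
  cases σ with
  | scalar => exact F.scalarExt_covariant_scalar hx hy w
  | vector => exact F.vecProj_vector hx hy w
  | sym =>
    refine (congrArg F.symProj (F.tensorExt_sym (mem_symModel.1 hx) (mem_symModel.1 hy) w)).trans ?_
    split
    · exact F.symProj_hatMat w
    · exact map_zero _
  | skew =>
    refine (congrArg F.skewProj
      (F.tensorExt_skew ⟨1, by norm_num, mem_skewModel.1 hx⟩ (mem_skewModel.1 hy) w)).trans ?_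
    split
    · exact F.skewProj_hatMat w
    · exact map_zero _

/-- The sectors are separated by explicit means: contraction with the axes, orthogonality of
transverse vectors and axes, the transverse trace, and symmetrisation. Independence therefore does
not rest on the four representations being irreducible or inequivalent. -/
lemma extract_covariant_of_ne {σ σ' : Sector} (hσ : σ ≠ σ') {x y : Label}
    (hx : x ∈ (σ.model r).labels) (hy : y ∈ (σ'.model r).labels) (w : σ'.Space p) :
    F.extract σ x (covariant τ κ p r e σ' y w) = 0 := by
  have skew_mulVec (A : skewPerp p) : A.1ᵀ *ᵥ CarrollString.transverse p = 0 := by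
    rw [A.2.1, Matrix.neg_mulVec, A.2.2, neg_zero]
  have sym_mulVec (A : symPerp p) : A.1ᵀ *ᵥ CarrollString.transverse p = 0 := by
    rw [A.2.1, A.2.2.2]
  have hskew : ∀ {x}, x ∈ skewModel.labels → ∃ i < 3, x = .tr i :=
    fun hx => ⟨1, by norm_num, mem_skewModel.1 hx⟩
  cases σ <;> cases σ' <;> first | exact absurd rfl hσ | skip
  · exact F.scalarExt_vector hx hy w
  · exact F.scalarExt_tensor hx (Subtype.property (p := (· ∈ symPerp p)) w).2.2 (sym_mulVec w)
      (Subtype.property (p := (· ∈ symPerp p)) w).2.1 (mem_symModel.1 hy)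
  · exact F.scalarExt_tensor hx (Subtype.property (p := (· ∈ skewPerp p)) w).2 (skew_mulVec w)
      (trace_skewPerp w) (hskew hy)
  · exact map_covariant_scalar_eq_zero (F.extract .vector x) w (F.vecProj_scalar hx hy)
  · exact F.vecProj_tensor hx (Subtype.property (p := (· ∈ symPerp p)) w).2.2 (sym_mulVec w)
      (mem_symModel.1 hy)
  · exact F.vecProj_tensor hx (Subtype.property (p := (· ∈ skewPerp p)) w).2 (skew_mulVec w)
      (hskew hy)
  · exact map_covariant_scalar_eq_zero (F.extract .sym x) w ((F.tensorExt_scalar (mem_symModel.1 hx) hy).1)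
  · exact (F.tensorExt_vector (mem_symModel.1 hx) hy w).1
  · refine (congrArg F.symProj (F.tensorExt_skew (mem_symModel.1 hx) (mem_skewModel.1 hy) w)).trans ?_
    split
    · exact F.symProj_of_skew (by
        rw [← hatMat_transpose, ← hatMat_neg]
        exact congrArg hatMat (Subtype.property (p := (· ∈ skewPerp p)) w).1)
    · exact map_zero _
  · exact map_covariant_scalar_eq_zero (F.extract .skew x) w ((F.tensorExt_scalar (hskew hx) hy).2)
  · exact (F.tensorExt_vector (hskew hx) hy w).2
  · refine (congrArg F.skewProj (F.tensorExt_sym (hskew hx) (mem_symModel.1 hy) w)).trans ?_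
    split
    · exact F.skewProj_of_symm (by
        rw [← hatMat_transpose]
        exact congrArg hatMat (Subtype.property (p := (· ∈ symPerp p)) w).1)
    · exact map_zero _

end IsFrame

end

/-! ### The covariants span the matter polynomials -/

section

variable {τ : ℝ} {κ : ℂ} {p : Fin 26 → ℝ} {r : ℕ} {e : ℕ → Fin 26 → ℂ}

/-- The span of the covariants of a given weight. -/
def covSpan (τ κ : ℂ) (p : Fin 26 → ℝ) (r : ℕ) (e : ℕ → Fin 26 → ℂ) (w : ℕ) :
    Submodule ℂ (MvPolynomial MatterMode ℂ) :=
  Submodule.span ℂ {Q | ∃ σ : Sector, ∃ x ∈ (σ.model r).labels, x.weight = w ∧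
    ∃ v : σ.Space p, Q = covariant τ κ p r e σ x v}

lemma scalarCov_mem_covSpan {τ : ℂ} {x : Label} (hx : x ∈ (scalarModel r).labels) :
    scalarCov τ κ r e x ∈ covSpan τ κ p r e x.weight :=
  Submodule.subset_span ⟨.scalar, x, hx, rfl, (1 : ℂ), (one_smul ℂ _).symm⟩

lemma one_eq_transProj_add_sum :
    (1 : Matrix (Fin 26) (Fin 26) ℂ) =
      transProj r e + ∑ a ∈ Finset.range r, Matrix.vecMulVec (e a) (e a) := by
  rw [transProj, sub_add_cancel]

lemma eq_transProj_add (u : Fin 26 → ℂ) :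
    u = transProj r e *ᵥ u + ∑ a ∈ Finset.range r, (e a ⬝ᵥ u) • e a := by
  rw [transProj_mulVec, sub_add_cancel]

namespace IsFrame

variable (F : IsFrame τ κ p r e)
include F

lemma vectorCov_mem_covSpan {x : Label} (hx : x ∈ (vectorModel r).labels) (u : Fin 26 → ℂ) :
    vectorCov τ κ e x (transProj r e *ᵥ u) ∈ covSpan τ κ p r e x.weight :=
  Submodule.subset_span ⟨.vector, x, hx, rfl, F.vecProj u, by
    rw [covariant_vector]
    exact congrArg _ (F.hat_unhat_transProj u).symm⟩

/-- The transverse part of `u` gives a covariant of the vector sector, and its components along the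
axes give invariants. -/
lemma lin_mem_covSpan {ξ k : ℕ} (hξ : ξ < 2) (hk : k < 2) (u : Fin 26 → ℂ) :
    lin τ κ ξ k u ∈ covSpan τ κ p r e (k + 1) := by
  rw [eq_transProj_add (r := r) (e := e) u, map_add, map_sum]
  refine Submodule.add_mem _ ?_ (Submodule.sum_mem _ fun a ha => ?_)
  · interval_cases k
    · exact F.vectorCov_mem_covSpan (mem_vectorModel.2 (Or.inl ⟨ξ, hξ, rfl⟩)) u
    · exact F.vectorCov_mem_covSpan (mem_vectorModel.2 (Or.inr (Or.inl ⟨ξ, hξ, rfl⟩))) u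
  · rw [map_smul]
    refine Submodule.smul_mem _ _ ?_
    rw [Finset.mem_range] at ha
    have h1 : (2 * a + ξ) % 2 = ξ := by omega
    have h2 : (2 * a + ξ) / 2 = a := by omega
    interval_cases k
    · have h := scalarCov_mem_covSpan (τ := τ) (κ := κ) (p := p) (e := e)
        (mem_scalarModel_lin.2 (show 2 * a + ξ < 2 * r by omega))
      rwa [scalarCov, h1, h2] at h
    · have h := scalarCov_mem_covSpan (τ := τ) (κ := κ) (p := p) (e := e)
        (mem_scalarModel_der.2 (show 2 * a + ξ < 2 * r by omega))
      rwa [scalarCov, h1, h2] at h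

/-- A transverse tensor is the sum of its traceless symmetric part, its skewsymmetric part and its
trace. -/
lemma transProj_mul_mul (A : Matrix (Fin 26) (Fin 26) ℂ) :
    transProj r e * A * transProj r e = hatMat (F.symProj A).1 + hatMat (F.skewProj A).1 +
      ((26 - r : ℂ)⁻¹ * traceMul (transProj r e) A) • transProj r e := by
  change _ = hatMat (unhatMat _) + hatMat (unhatMat _) + _
  rw [F.hatMat_unhatMat_transProj, F.hatMat_unhatMat_transProj]
  conv_rhs => rw [← F.transProj_mul_self]
  simp only [Matrix.mul_sub, Matrix.mul_add, Matrix.mul_smul, Matrix.sub_mul, Matrix.add_mul,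
    Matrix.smul_mul, Matrix.mul_one, F.transProj_mul_self]
  module

/-- The letters commute, so `ξ ≤ η` is no loss; `reconstruct_two` needs no other case. -/
lemma quad_mem_covSpan {ξ η : ℕ} (hη : η < 2) (h : ξ ≤ η) (A : Matrix (Fin 26) (Fin 26) ℂ) :
    quad τ κ ξ η A ∈ covSpan τ κ p r e 2 := by
  have hdiv : ∀ a ξ : ℕ, ξ < 2 → (2 * a + ξ) / 2 = a ∧ (2 * a + ξ) % 2 = ξ := by omega
  have hv : ∀ ξ < 2, ∀ η < 2, ∀ a < r, ∀ u,
      quad τ κ ξ η (Matrix.vecMulVec (e a) (transProj r e *ᵥ u)) ∈ covSpan τ κ p r e 2 := by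
    intro ξ hξ η hη a ha u
    have h : vectorCov τ κ e (.quad (2 * a + ξ) η) (transProj r e *ᵥ u) ∈ covSpan τ κ p r e 2 :=
      F.vectorCov_mem_covSpan
        (mem_vectorModel.2 (Or.inr (Or.inr ⟨2 * a + ξ, by omega, η, hη, rfl⟩))) u
    rwa [vectorCov, LinearMap.comp_apply, outer_apply, (hdiv a ξ hξ).1, (hdiv a ξ hξ).2] at h
  have hs : ∀ ξ < 2, ∀ η < 2, ∀ a < r, ∀ b < r,
      quad τ κ ξ η (Matrix.vecMulVec (e a) (e b)) ∈ covSpan τ κ p r e 2 := by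
    intro ξ hξ η hη a ha b hb
    have hm : mkQuad (2 * a + ξ) (2 * b + η) ∈ (scalarModel r).labels := by
      rw [mkQuad]
      split <;> rw [mem_scalarModel_quad] <;> omega
    have h := scalarCov_mem_covSpan (τ := τ) (κ := κ) (p := p) (e := e) hm
    rw [scalarCov_mkQuad, (hdiv a ξ hξ).1, (hdiv a ξ hξ).2, (hdiv b η hη).1, (hdiv b η hη).2] at h
    rw [mkQuad] at h
    split at h <;> exact h
  have htr : ∀ u v : Fin 26 → ℂ, (Matrix.vecMulVec u v)ᵀ = Matrix.vecMulVec v u :=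
    fun u v => Matrix.transpose_vecMulVec u v
  have hi : ξ + η < 3 ∧ (ξ + η) / 2 = ξ ∧ (ξ + η + 1) / 2 = η := by omega
  -- The identity, written as transverse projection plus projections to the axes, is inserted on
  -- both sides of `A`; this gives four blocks.
  have hdec : A = transProj r e * A * transProj r e +
      (∑ a ∈ Finset.range r, Matrix.vecMulVec (e a) (transProj r e *ᵥ (e a ᵥ* A)) +
        (∑ a ∈ Finset.range r, Matrix.vecMulVec (transProj r e *ᵥ (A *ᵥ e a)) (e a) +
          ∑ a ∈ Finset.range r, ∑ b ∈ Finset.range r,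
            (e a ⬝ᵥ A *ᵥ e b) • Matrix.vecMulVec (e a) (e b))) := by
    have h1 : ∑ a ∈ Finset.range r, Matrix.vecMulVec (e a) (transProj r e *ᵥ (e a ᵥ* A)) =
        (∑ a ∈ Finset.range r, Matrix.vecMulVec (e a) (e a)) * A * transProj r e := by
      rw [Finset.sum_mul, Finset.sum_mul]
      refine Finset.sum_congr rfl fun a _ => ?_
      rw [Matrix.vecMulVec_mul, Matrix.vecMulVec_mul, ← Matrix.mulVec_transpose (transProj r e),
        transProj_transpose]
    have h2 : ∑ a ∈ Finset.range r, Matrix.vecMulVec (transProj r e *ᵥ (A *ᵥ e a)) (e a) =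
        transProj r e * A * ∑ a ∈ Finset.range r, Matrix.vecMulVec (e a) (e a) := by
      rw [Finset.mul_sum]
      refine Finset.sum_congr rfl fun a _ => ?_
      rw [Matrix.mul_vecMulVec, Matrix.mulVec_mulVec]
    have h3 : ∑ a ∈ Finset.range r, ∑ b ∈ Finset.range r,
          (e a ⬝ᵥ A *ᵥ e b) • Matrix.vecMulVec (e a) (e b) =
        (∑ a ∈ Finset.range r, Matrix.vecMulVec (e a) (e a)) * A *
          ∑ a ∈ Finset.range r, Matrix.vecMulVec (e a) (e a) := by
      rw [Finset.sum_mul, Finset.sum_mul]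
      refine Finset.sum_congr rfl fun a _ => ?_
      rw [Finset.mul_sum]
      refine Finset.sum_congr rfl fun b _ => ?_
      rw [Matrix.vecMulVec_mul, Matrix.vecMulVec_mul_vecMulVec, Matrix.dotProduct_mulVec]
      ext μ ν
      simp [Matrix.vecMulVec_apply]
      ring
    rw [h1, h2, h3]
    conv_lhs => rw [← Matrix.one_mul A, ← Matrix.mul_one (1 * A), one_eq_transProj_add_sum (r := r) (e := e)]
    simp only [Matrix.add_mul, Matrix.mul_add]
    abel
  rw [hdec, map_add, map_add, map_add, F.transProj_mul_mul, map_add, map_add]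
  refine Submodule.add_mem _ (Submodule.add_mem _ (Submodule.add_mem _ ?_ ?_) ?_)
    (Submodule.add_mem _ ?_ (Submodule.add_mem _ ?_ ?_))
  · refine Submodule.subset_span ⟨.sym, .tr (ξ + η), mem_symModel.2 ⟨_, hi.1, rfl⟩, rfl,
      F.symProj A, ?_⟩
    rw [covariant_sym, tensorCov, hi.2.1, hi.2.2]
  -- With letters of the same kind the skewsymmetric part contributes nothing, which is why the skew
  -- sector has a single label.
  · by_cases hξη : ξ = η
    · subst hξη
      have h0 : (hatMat (F.skewProj A).1)ᵀ = (-1 : ℂ) • hatMat (F.skewProj A).1 := by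
        rw [← hatMat_transpose, (F.skewProj A).2.1, ← map_smul, neg_one_smul]
      rw [quad_self_eq_zero ξ h0 rfl]
      exact Submodule.zero_mem _
    · obtain ⟨rfl, rfl⟩ : ξ = 0 ∧ η = 1 := by omega
      exact Submodule.subset_span ⟨.skew, .tr 1, mem_skewModel.2 rfl, rfl, F.skewProj A, by
        rw [covariant_skew, tensorCov]⟩
  · rw [map_smul]
    refine Submodule.smul_mem _ _ ?_
    have h := scalarCov_mem_covSpan (τ := τ) (κ := κ) (p := p) (r := r) (e := e)
      (mem_scalarModel_tr.2 hi.1)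
    rwa [scalarCov, hi.2.1, hi.2.2] at h
  · rw [map_sum]
    exact Submodule.sum_mem _ fun a ha =>
      hv ξ (by omega) η hη a (Finset.mem_range.1 ha) _
  · rw [map_sum]
    refine Submodule.sum_mem _ fun a ha => ?_
    rw [quad_comm, htr]
    exact hv η hη ξ (by omega) a (Finset.mem_range.1 ha) (A *ᵥ e a)
  · rw [map_sum]
    refine Submodule.sum_mem _ fun a ha => ?_
    rw [map_sum]
    refine Submodule.sum_mem _ fun b hb => ?_
    rw [map_smul]
    exact Submodule.smul_mem _ _
      (hs ξ (by omega) η hη a (Finset.mem_range.1 ha) b (Finset.mem_range.1 hb))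

lemma matterW_le_covSpan {w : ℕ} (hw : w ≤ 2) : matterW w ≤ covSpan τ κ p r e w := by
  have hκ := F.scale
  have ht : (τ : ℂ) ≠ 0 := Complex.ofReal_ne_zero.2 F.tension
  intro P hP
  interval_cases w
  · rw [reconstruct_zero hP]
    exact Submodule.smul_mem _ _ (scalarCov_mem_covSpan (x := .one) (by simp [scalarModel]))
  · rw [reconstruct_one ht hκ hP]
    exact Submodule.add_mem _ (F.lin_mem_covSpan (by norm_num) (by norm_num) _)
      (F.lin_mem_covSpan (by norm_num) (by norm_num) _)
  · rw [reconstruct_two ht hκ hP]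
    exact Submodule.add_mem _ (Submodule.add_mem _
      (F.lin_mem_covSpan (by norm_num) (by norm_num) _)
      (F.lin_mem_covSpan (by norm_num) (by norm_num) _))
      (Submodule.add_mem _ (Submodule.add_mem _
        (Submodule.smul_mem _ _ (F.quad_mem_covSpan (by norm_num) le_rfl _))
        (F.quad_mem_covSpan (by norm_num) (by norm_num) _))
        (Submodule.smul_mem _ _ (F.quad_mem_covSpan (by norm_num) le_rfl _)))

end IsFrame

end

/-! ### Ghost states of nonpositive weight -/

lemma sum_maskSet (f : GhostMode → ℤ) (s : ℕ) :
    ∑ g ∈ maskSet s, f g = maskSum (fun i => f (modeOf i)) s := by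
  rw [maskSet, Finset.sum_map, Finset.sum_filter, maskSum, ← List.sum_toFinset]
  · rfl
  · exact List.nodup_range

lemma maskSum_congr {f f' : ℕ → ℤ} (h : ∀ i < 18, f i = f' i) (s : ℕ) :
    maskSum f s = maskSum f' s := by
  rw [maskSum, maskSum]
  refine congrArg List.sum (List.map_congr_left fun i hi => ?_)
  rw [h i (List.mem_range.1 hi)]

lemma sum_ghostWeight_maskSet (s : ℕ) : ∑ g ∈ maskSet s, ghostWeight g = maskSum bitWeight s := by
  rw [sum_maskSet]
  exact maskSum_congr (by decide) s

lemma ghostNumber_maskSet (s : ℕ) : ghostNumber (maskSet s) = maskNumber s := by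
  rw [ghostNumber, sum_maskSet]
  exact maskSum_congr (by decide) s

lemma lowMasks_lt : ∀ s ∈ lowMasks, s < 2 ^ 18 := by decide +kernel

lemma maskSet_injOn {s t : ℕ} (hs : s ∈ lowMasks) (ht : t ∈ lowMasks) (h : maskSet s = maskSet t) :
    s = t := by
  refine Nat.eq_of_testBit_eq fun i => ?_
  by_cases hi : i < 18
  · have h' := modeOf_mem_maskSet (s := s) hi
    rw [h, modeOf_mem_maskSet hi] at h'
    exact Bool.eq_iff_iff.2 h'.symm
  · have hp : 2 ^ 18 ≤ 2 ^ i := Nat.pow_le_pow_right (by norm_num) (by omega)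
    rw [Nat.testBit_lt_two_pow ((lowMasks_lt s hs).trans_le hp),
      Nat.testBit_lt_two_pow ((lowMasks_lt t ht).trans_le hp)]

/-- `c_1` and `C_1` are the only modes of negative weight; each has weight `-1` and occurs at most
once. -/
lemma neg_two_le_sum_ghostWeight (S : Finset GhostMode) : -2 ≤ ∑ g ∈ S, ghostWeight g := by
  have h : ∀ g ∈ S, (if g ∈ ({toLex (0, 0), toLex (1, 0)} : Finset GhostMode) then -1 else 0) ≤
      ghostWeight g := by
    intro g _
    rw [ghostWeight]
    split_ifs <;> first | omega | skip
    rename_i h1 h2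
    have h3 : (ofLex g).2 ≠ 0 := by
      intro h3
      refine h1 ?_
      rw [Finset.mem_insert, Finset.mem_singleton]
      exact h2.imp (fun h => ofLex.injective (Prod.ext h h3))
        fun h => ofLex.injective (Prod.ext h h3)
    omega
  refine le_trans ?_ (Finset.sum_le_sum h)
  rw [← Finset.sum_filter, Finset.sum_const, Finset.filter_mem_eq_inter, smul_neg]
  have := Finset.card_le_card (Finset.inter_subset_right (s₁ := S)
    (s₂ := ({toLex (0, 0), toLex (1, 0)} : Finset GhostMode)))
  have h2 := Finset.card_le_two (a := (toLex (0, 0) : GhostMode)) (b := toLex (1, 0))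
  simp
  omega

/-- The other modes have total weight at least `-2`, so a single mode cannot have weight above `2`.
-/
lemma ghostWeight_le_of_mem {S : Finset GhostMode} (hS : ∑ g ∈ S, ghostWeight g ≤ 0)
    {g : GhostMode} (hg : g ∈ S) : ghostWeight g ≤ 2 := by
  rw [← Finset.add_sum_erase S _ hg] at hS
  linarith [neg_two_le_sum_ghostWeight (S.erase g)]

lemma exists_modeOf {g : GhostMode} (hg : ghostWeight g ≤ 2) :
    ∃ i ∈ [0, 1, 2, 3, 6, 7, 8, 9, 12, 15], modeOf i = g := by
  obtain ⟨⟨a, k⟩, rfl⟩ := toLex.surjective g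
  rw [ghostWeight] at hg
  simp only [ofLex_toLex] at hg
  have h : ∀ a : Fin 4, ∀ k : ℕ, k < 4 → (if a = 0 ∨ a = 1 then (k : ℤ) - 1 else k + 2) ≤ 2 →
      ∃ i ∈ [0, 1, 2, 3, 6, 7, 8, 9, 12, 15], modeOf i = toLex (a, k) := by decide
  refine h a k ?_ hg
  split_ifs at hg <;> omega

/-- Induction on the list of allowed modes: the bit `i` is set exactly if its mode lies in `S`, and
the rest of `S` is covered by the rest of the list. -/
lemma exists_mask (L : List ℕ) (hL : ∀ i ∈ L, i < 18) (S : Finset GhostMode)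
    (hS : ∀ g ∈ S, ∃ i ∈ L, modeOf i = g) : ∃ s ∈ masks L, maskSet s = S := by
  induction L generalizing S with
  | nil =>
    refine ⟨0, by simp [masks], ?_⟩
    ext g
    simp only [mem_maskSet, Nat.zero_testBit, Bool.false_eq_true, false_and, and_false, exists_false,
      false_iff]
    exact fun hg => by simpa using hS g hg
  | cons i L ih =>
    have hi := hL i (List.mem_cons_self ..)
    obtain ⟨s, hs, h⟩ := ih (fun j hj => hL j (List.mem_cons_of_mem _ hj)) (S.erase (modeOf i)) (by
      intro g hg
      obtain ⟨h1, h2⟩ := Finset.mem_erase.1 hg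
      obtain ⟨j, hj, rfl⟩ := hS g h2
      rcases List.mem_cons.1 hj with rfl | hj
      · exact absurd rfl h1
      · exact ⟨j, hj, rfl⟩)
    by_cases hm : modeOf i ∈ S
    · refine ⟨s ||| 2 ^ i, List.mem_append_right _ (List.mem_map_of_mem hs), ?_⟩
      rw [← Finset.insert_erase hm, ← h]
      ext g
      simp only [Finset.mem_insert, mem_maskSet, Nat.testBit_or, Nat.testBit_two_pow]
      constructor
      · rintro ⟨j, hj, h1, rfl⟩
        by_cases hij : i = j
        · exact Or.inl (hij ▸ rfl)
        · exact Or.inr ⟨j, hj, by simpa [hij] using h1, rfl⟩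
      · rintro (rfl | ⟨j, hj, h1, rfl⟩)
        · exact ⟨i, hi, by simp, rfl⟩
        · exact ⟨j, hj, by simp [h1], rfl⟩
    · exact ⟨s, List.mem_append_left _ hs, by rw [h, Finset.erase_eq_of_notMem hm]⟩

/-- A check over the `2 ^ 10` sets of the ten possible modes, which shows that the explicit list is
complete. -/
lemma mem_lowMasks_of_mem_masks : ∀ s ∈ masks [0, 1, 2, 3, 6, 7, 8, 9, 12, 15],
    maskSum bitWeight s ≤ 0 → s ∈ lowMasks := by
  have h : ((masks [0, 1, 2, 3, 6, 7, 8, 9, 12, 15]).all fun s =>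
      decide (0 < maskSum bitWeight s) || lowMasks.contains s) = true := by decide +kernel
  intro s hs hw
  have h' := List.all_eq_true.1 h s hs
  rw [Bool.or_eq_true, decide_eq_true_iff, List.contains_iff_mem] at h'
  exact h'.resolve_left (not_lt.2 hw)

lemma exists_lowMask {S : Finset GhostMode} (hS : ∑ g ∈ S, ghostWeight g ≤ 0) :
    ∃ s ∈ lowMasks, maskSet s = S := by
  obtain ⟨s, hs, rfl⟩ := exists_mask _ (by decide) S fun g hg =>
    exists_modeOf (ghostWeight_le_of_mem hS hg)
  rw [sum_ghostWeight_maskSet] at hS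
  exact ⟨s, mem_lowMasks_of_mem_masks s hs hS, rfl⟩

/-! ### The cochains as a sum of isotypic components -/

section

variable {τ : ℝ} {κ : ℂ} {p : Fin 26 → ℝ} {r : ℕ} {e : ℕ → Fin 26 → ℂ}

/-- The number of copies of a representation in the cochains of ghost number `n`. -/
abbrev Sector.dim (r : ℕ) (σ : Sector) (n : ℤ) : ℕ := (basis (σ.model r) n).length

/-- The cochain with given components. -/
def assemble (τ κ : ℂ) (p : Fin 26 → ℝ) (r : ℕ) (e : ℕ → Fin 26 → ℂ) (n : ℤ) :
    (∀ σ : Sector, Fin (σ.dim r n) → σ.Space p) →ₗ[ℂ] Fock :=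
  ∑ σ, ∑ i, sectorState τ κ p r e σ ((basis (σ.model r) n).get i) ∘ₗ LinearMap.proj i ∘ₗ
    LinearMap.proj σ

lemma assemble_apply (τ κ : ℂ) (n : ℤ) (f : ∀ σ : Sector, Fin (σ.dim r n) → σ.Space p) :
    assemble τ κ p r e n f =
      ∑ σ, ∑ i, sectorState τ κ p r e σ ((basis (σ.model r) n).get i) (f σ i) := by
  simp [assemble]

lemma sectorState_mem_cochains {σ : Sector} {n : ℤ} {x : ℕ × Label}
    (hx : x ∈ basis (σ.model r) n) (w : σ.Space p) :
    sectorState τ κ p r e σ x w ∈ cochains p n := by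
  obtain ⟨⟨h1, h2⟩, h3, h4⟩ := mem_basis.1 hx
  refine Submodule.smul_mem _ _ (state_mem_cochains p (w := x.2.weight) ?_ ?_ (covariant_mem _ _ _))
  · rw [sum_ghostWeight_maskSet, h4]
  · rw [ghostNumber_maskSet, h2]

lemma assemble_mem (n : ℤ) (f : ∀ σ : Sector, Fin (σ.dim r n) → σ.Space p) :
    assemble τ κ p r e n f ∈ cochains p n := by
  rw [assemble_apply]
  exact Submodule.sum_mem _ fun σ _ => Submodule.sum_mem _ fun i _ =>
    sectorState_mem_cochains (List.get_mem _ _) _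

namespace IsFrame

variable (F : IsFrame τ κ p r e)
include F

lemma extract_sectorState {σ σ' : Sector} {n : ℤ} {x y : ℕ × Label}
    (hx : x ∈ basis (σ.model r) n) (hy : y ∈ basis (σ'.model r) n) (w : σ'.Space p)
    (h : σ ≠ σ' ∨ x ≠ y) :
    F.extract σ x.2 (coeff (maskSet x.1) (sectorState τ κ p r e σ' y w)) = 0 := by
  obtain ⟨⟨h1, -⟩, h3, -⟩ := mem_basis.1 hx
  obtain ⟨⟨h1', -⟩, h3', -⟩ := mem_basis.1 hy
  rw [sectorState_apply, map_smul, map_smul, coeff_state]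
  split
  · rename_i hs
    have hs' := maskSet_injOn h1' h1 hs
    by_cases hσ : σ = σ'
    · subst hσ
      rw [F.extract_covariant_self h3 h3', if_neg, smul_zero]
      intro h2
      exact h.elim (fun h => h rfl) fun h => h (Prod.ext hs'.symm h2)
    · rw [F.extract_covariant_of_ne hσ h3 h3', smul_zero]
  · rw [map_zero, smul_zero]

lemma extract_sectorState_self {σ : Sector} {n : ℤ} {x : ℕ × Label}
    (hx : x ∈ basis (σ.model r) n) (w : σ.Space p) :
    F.extract σ x.2 (coeff (maskSet x.1) (sectorState τ κ p r e σ x w)) =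
      ((κ ^ 2) ^ (-maskScale x.1)) • w := by
  obtain ⟨⟨h1, -⟩, h3, -⟩ := mem_basis.1 hx
  rw [sectorState_apply, map_smul, map_smul, coeff_state, if_pos rfl,
    F.extract_covariant_self h3 h3, if_pos rfl]

/-- Each component of `f` can be recovered: the coefficient at a set of ghost modes singles out the
mask, and `extract` the sector and the label. -/
lemma assemble_injective {n : ℤ} (hn : ∀ σ : Sector, (basis (σ.model r) n).Nodup) :
    Function.Injective (assemble τ κ p r e n) := by
  rw [injective_iff_map_eq_zero]
  intro f hf
  funext σ i
  have h := congrArg (fun v => F.extract σ ((basis (σ.model r) n).get i).2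
    (coeff (maskSet ((basis (σ.model r) n).get i).1) v)) hf
  simp only [assemble_apply, map_sum, map_zero] at h
  rw [Finset.sum_eq_single σ, Finset.sum_eq_single i, F.extract_sectorState_self (List.get_mem _ _),
    smul_eq_zero_iff_right (zpow_ne_zero _ (pow_ne_zero 2 F.scale))] at h
  · exact h
  · intro j _ hj
    refine F.extract_sectorState (List.get_mem _ _) (List.get_mem _ _) _ (Or.inr fun h => ?_)
    exact hj ((hn σ).injective_get h).symm
  · exact fun h => absurd (Finset.mem_univ i) h
  · intro σ' _ hσ
    exact Finset.sum_eq_zero fun j _ =>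
      F.extract_sectorState (List.get_mem _ _) (List.get_mem _ _) _ (Or.inl hσ.symm)
  · exact fun h => absurd (Finset.mem_univ σ) h

/-- For a state of weight zero the ghost modes form one of the listed masks. The weight of that mask
is at least `-2`, so the matter polynomial has weight at most two and is a combination of
covariants. -/
lemma cochains_le_range (n : ℤ) :
    cochains p n ≤ LinearMap.range (assemble τ κ p r e n) := by
  refine (cochains_le_span p n).trans (Submodule.span_le.2 ?_)
  rintro _ ⟨S, w, P, h1, h2, hP, rfl⟩
  obtain ⟨s, hs, rfl⟩ := exists_lowMask (S := S) (by omega)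
  rw [sum_ghostWeight_maskSet] at h1
  rw [ghostNumber_maskSet] at h2
  have hw := lowMasks_weight s hs
  have hP' := F.matterW_le_covSpan (by omega) hP
  rw [SetLike.mem_coe, ← Submodule.mem_comap]
  refine Submodule.span_le.2 ?_ hP'
  rintro _ ⟨σ, x, hx, hxw, v, rfl⟩
  have hb : (s, x) ∈ basis (σ.model r) n := mem_basis.2 ⟨⟨hs, h2⟩, hx, by rw [hxw]; exact h1⟩
  obtain ⟨i, hi⟩ := List.get_of_mem hb
  -- The scalar undoes the scaling built into `sectorState`.
  refine ⟨Pi.single σ (Pi.single i (((κ ^ 2) ^ (maskScale s)) • v)), ?_⟩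
  rw [assemble_apply, Finset.sum_eq_single σ, Finset.sum_eq_single i, Pi.single_eq_same,
    Pi.single_eq_same, hi, sectorState_apply, map_smul, map_smul, smul_smul,
    ← zpow_add₀ (pow_ne_zero 2 F.scale), neg_add_cancel, zpow_zero, one_smul]
  · intro j _ hj
    rw [Pi.single_eq_same, Pi.single_eq_of_ne hj, map_zero]
  · exact fun h => absurd (Finset.mem_univ i) h
  · intro σ' _ hσ
    refine Finset.sum_eq_zero fun j _ => ?_
    rw [Pi.single_eq_of_ne hσ, Pi.zero_apply, map_zero]
  · exact fun h => absurd (Finset.mem_univ σ) h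

end IsFrame

end

/-! ### Rotations of the covariants -/

/-- The matrix of a rotation of the `26` directions. -/
def rotMat (R : SO25) : Matrix (Fin 26) (Fin 26) ℂ := Matrix.of (rotCoeff R)

lemma rotMat_apply (R : SO25) (μ ν : Fin 26) : rotMat R μ ν = rotCoeff R μ ν := rfl

lemma rotMat_mul_transpose (R : SO25) : rotMat R * (rotMat R)ᵀ = 1 := by
  ext μ ν
  rw [Matrix.mul_apply, Matrix.one_apply]
  exact rotCoeff_orth R μ ν

lemma rotMat_mulVec_hat (R : SO25) (v : Fin 25 → ℂ) : rotMat R *ᵥ hat v = hat (rotMatrix R *ᵥ v) := by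
  ext μ
  refine Fin.cases ?_ (fun i => ?_) μ <;>
  simp [Matrix.mulVec, dotProduct, Fin.sum_univ_succ, hat_zero, hat_succ, rotMat_apply, rotCoeff,
      spacetime_zero_succ, spacetime_succ_succ, rotMatrix, Matrix.map_apply]

lemma rotMat_mul_hatMat (R : SO25) (A : Matrix (Fin 25) (Fin 25) ℂ) :
    rotMat R * hatMat A * (rotMat R)ᵀ = hatMat (rotMatrix R * (A * (rotMatrix R)ᵀ)) := by
  have h : ∀ (R : SO25) (A : Matrix (Fin 25) (Fin 25) ℂ),
      rotMat R * hatMat A = hatMat (rotMatrix R * A) := by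
    intro R A
    ext μ ν
    refine Fin.cases ?_ (fun i => ?_) μ <;> refine Fin.cases ?_ (fun j => ?_) ν <;>
      simp [Matrix.mul_apply, Fin.sum_univ_succ, hatMat_zero_left, hatMat_zero_right, hatMat_succ,
        rotMat_apply, rotCoeff, spacetime_zero_succ, spacetime_succ_succ, rotMatrix]
  rw [h, ← Matrix.transpose_inj, Matrix.transpose_mul, Matrix.transpose_transpose,
    ← hatMat_transpose, h, ← hatMat_transpose, ← Matrix.mul_assoc,
    Matrix.transpose_mul (rotMatrix R * A), Matrix.transpose_transpose]

/-- The letters combine the time component and the transverse components of the modes with different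
constants, even with `x` and `π` exchanged. This is compatible with rotations because they do not
mix time with the other directions. -/
lemma rotPoly_letter {τ κ : ℂ} (R : SO25) (ξ : ℕ) (μ : Fin 26) (k : ℕ) :
    rotPoly R (letter τ κ ξ μ k) = ∑ ν, rotMat R ν μ • letter τ κ ξ ν k := by
  have h : ∀ i : Fin 25, rotCoeff R 0 i.succ = 0 ∧ rotCoeff R i.succ 0 = 0 := fun i => by
    simp [rotCoeff, spacetime_zero_succ, spacetime_succ_zero]
  by_cases hξ : ξ = 0 <;> refine Fin.cases ?_ (fun i => ?_) μ <;>
    simp [letter, hξ, rotMat_apply, Fin.sum_univ_succ, h, rotPoly_X, Fin.succ_ne_zero,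
      smul_smul, mul_comm, mul_left_comm]

section

variable {τ κ : ℂ}

lemma rotPoly_lin (R : SO25) (ξ k : ℕ) (u : Fin 26 → ℂ) :
    rotPoly R (lin τ κ ξ k u) = lin τ κ ξ k (rotMat R *ᵥ u) := by
  rw [lin_apply, lin_apply, map_sum]
  simp only [map_smul, rotPoly_letter, Finset.smul_sum, Matrix.mulVec, dotProduct, Finset.sum_smul]
  rw [Finset.sum_comm]
  refine Finset.sum_congr rfl fun ν _ => Finset.sum_congr rfl fun μ _ => ?_
  rw [smul_smul, mul_comm]

lemma rotPoly_quad (R : SO25) (ξ η : ℕ) (A : Matrix (Fin 26) (Fin 26) ℂ) :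
    rotPoly R (quad τ κ ξ η A) = quad τ κ ξ η (rotMat R * A * (rotMat R)ᵀ) := by
  -- By linearity it suffices to treat tensors of rank one, on which `quad` is a product of two
  -- linear terms and the substitution is multiplicative.
  have hA : A = ∑ μ, ∑ ν, A μ ν • Matrix.vecMulVec (Pi.single μ 1) (Pi.single ν 1) := by
    conv_lhs => rw [Matrix.matrix_eq_sum_single A]
    refine Finset.sum_congr rfl fun μ _ => Finset.sum_congr rfl fun ν _ => ?_
    ext i j
    simp [Matrix.single_apply, Matrix.vecMulVec_apply, Pi.single_apply, eq_comm, ite_and]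
    split_ifs <;> rfl
  have key : ∀ u v, rotPoly R (quad τ κ ξ η (Matrix.vecMulVec u v)) =
      quad τ κ ξ η (rotMat R * Matrix.vecMulVec u v * (rotMat R)ᵀ) := by
    intro u v
    rw [quad_vecMulVec, map_mul, rotPoly_lin, rotPoly_lin, Matrix.mul_vecMulVec,
      Matrix.vecMulVec_mul, ← Matrix.mulVec_transpose, Matrix.transpose_transpose, quad_vecMulVec]
  rw [hA]
  simp only [map_sum, map_smul, key, Finset.mul_sum, Finset.sum_mul, Matrix.mul_smul,
    Matrix.smul_mul]

end

section

variable {τ : ℝ} {κ : ℂ} {p : Fin 26 → ℝ} {r : ℕ} {e : ℕ → Fin 26 → ℂ}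

namespace IsFrame

variable (F : IsFrame τ κ p r e)
include F

lemma rotMat_mulVec_axis (R : stab p) {a : ℕ} (ha : a < r) : rotMat R.1 *ᵥ e a = e a :=
  funext fun ν => F.fixed R a ha ν

lemma rotMat_outer_axis (R : stab p) {a : ℕ} (ha : a < r) (v : Fin 26 → ℂ) :
    rotMat R.1 * Matrix.vecMulVec (e a) v * (rotMat R.1)ᵀ =
      Matrix.vecMulVec (e a) (rotMat R.1 *ᵥ v) := by
  rw [Matrix.mul_vecMulVec, F.rotMat_mulVec_axis R ha, Matrix.vecMulVec_mul,
    ← Matrix.mulVec_transpose, Matrix.transpose_transpose]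

lemma rotMat_transProj (R : stab p) :
    rotMat R.1 * transProj r e * (rotMat R.1)ᵀ = transProj r e := by
  rw [transProj, Matrix.mul_sub, Matrix.sub_mul, Matrix.mul_one, rotMat_mul_transpose,
    Matrix.mul_sum, Matrix.sum_mul]
  refine congrArg (1 - ·) (Finset.sum_congr rfl fun a ha => ?_)
  rw [F.rotMat_outer_axis R (Finset.mem_range.1 ha),
    F.rotMat_mulVec_axis R (Finset.mem_range.1 ha)]

lemma rotPoly_scalarCov (R : stab p) {x : Label} (hx : x ∈ (scalarModel r).labels) :
    rotPoly R.1 (scalarCov τ κ r e x) = scalarCov τ κ r e x := by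
  obtain rfl | ⟨i, hi, rfl⟩ | ⟨i, hi, rfl⟩ | ⟨j, hj, i, hi, rfl⟩ | ⟨i, hi, rfl⟩ :=
    mem_scalarModel.1 hx <;> rw [scalarCov]
  · exact map_one _
  · rw [rotPoly_lin, F.rotMat_mulVec_axis R (by omega)]
  · rw [rotPoly_lin, F.rotMat_mulVec_axis R (by omega)]
  · rw [rotPoly_quad, F.rotMat_outer_axis R (by omega), F.rotMat_mulVec_axis R (by omega)]
  · rw [rotPoly_quad, F.rotMat_transProj R]

lemma rotPoly_vectorCov (R : stab p) {x : Label} (hx : x ∈ (vectorModel r).labels)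
    (v : Fin 25 → ℂ) :
    rotPoly R.1 (vectorCov τ κ e x (hat v)) = vectorCov τ κ e x (hat (rotMatrix R.1 *ᵥ v)) := by
  obtain ⟨i, hi, rfl⟩ | ⟨i, hi, rfl⟩ | ⟨i, hi, j, hj, rfl⟩ := mem_vectorModel.1 hx <;>
    rw [vectorCov]
  · rw [rotPoly_lin, rotMat_mulVec_hat]
  · rw [rotPoly_lin, rotMat_mulVec_hat]
  · rw [LinearMap.comp_apply, LinearMap.comp_apply, outer_apply, outer_apply, rotPoly_quad,
      F.rotMat_outer_axis R (by omega), rotMat_mulVec_hat]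

omit F in
lemma rotPoly_tensorCov (R : stab p) (x : Label) (A : Matrix (Fin 25) (Fin 25) ℂ) :
    rotPoly R.1 (tensorCov τ κ x (hatMat A)) =
      tensorCov τ κ x (hatMat (rotMatrix R.1 * (A * (rotMatrix R.1)ᵀ))) := by
  cases x with
  | tr i => rw [tensorCov, rotPoly_quad, rotMat_mul_hatMat]
  | _ => exact map_zero _

lemma rotPoly_covariant (R : stab p) {σ : Sector} {x : Label} (hx : x ∈ (σ.model r).labels)
    (w : σ.Space p) : rotPoly R.1 (covariant τ κ p r e σ x w) =
      covariant τ κ p r e σ x (σ.rep p R w) := by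
  cases σ with
  | scalar =>
    refine (map_smul (rotPoly R.1) _ _).trans ?_
    rw [F.rotPoly_scalarCov R hx]
    rfl
  | vector => exact F.rotPoly_vectorCov R hx _
  | sym => exact rotPoly_tensorCov R x _
  | skew => exact rotPoly_tensorCov R x _

/-- The covariants are equivariant because the axes are fixed by the stabiliser, and the ghosts are
inert. So a rotation acts on each component separately and leaves the multiplicity index alone. -/
lemma stabRep_assemble (n : ℤ) (R : stab p) (f : ∀ σ : Sector, Fin (σ.dim r n) → σ.Space p) :
    stabRep p R (assemble τ κ p r e n f) =
      assemble τ κ p r e n (fun σ i => σ.rep p R (f σ i)) := by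
  rw [assemble_apply, assemble_apply, map_sum]
  refine Finset.sum_congr rfl fun σ _ => ?_
  rw [map_sum]
  refine Finset.sum_congr rfl fun i _ => ?_
  rw [sectorState_apply, sectorState_apply, map_smul]
  refine congrArg _ ((rotation_state _ _ _).trans ?_)
  exact congrArg _ (F.rotPoly_covariant R (mem_basis.1 (List.get_mem _ i)).2.1 _)

end IsFrame

end

/-! ### The matrices of the differential -/

/-- The matrix of twice the differential on a multiplicity space. -/
def diffMat (m : MatterModel) (n n' : ℤ) :
    Matrix (Fin (basis m n').length) (Fin (basis m n).length) ℤ :=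
  fun i j => listCoeff (key ((basis m n').get i))
    ((modelDiff m ((basis m n).get j)).map fun z => (z.1, key z.2))

/-- The matrix of the differential on a multiplicity space. -/
def diffC (m : MatterModel) (n n' : ℤ) :
    Matrix (Fin (basis m n').length) (Fin (basis m n).length) ℂ :=
  (1 / 2 : ℂ) • (diffMat m n n').map Int.cast

/-- The rank of the differential on a multiplicity space. -/
def diffRank (m : MatterModel) (n : ℤ) : ℕ := elimRank (basis m (n + 1)).length (diffRows m n)

lemma listCoeff_cons (k : ℕ) (x : ℤ × ℕ) (v : List (ℤ × ℕ)) :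
    listCoeff k (x :: v) = if k = x.2 then x.1 + listCoeff k v else listCoeff k v := by
  rw [listCoeff, List.foldr_cons, ← listCoeff]
  by_cases h : k = x.2
  · rw [if_pos h, h]
    simp
  · rw [if_neg h, Bool.eq_false_iff.2 fun h' => h (Nat.eq_of_beq_eq_true h')]
    rfl

/-- Distinct basis elements have distinct keys, so collecting the terms by key merges only equal
basis elements. -/
lemma sum_eq_sum_listCoeff {W : Type} [AddCommGroup W] [Module ℂ W] (b : List (ℕ × Label))
    (hb : (b.map key).Nodup) (f : ℕ × Label → W) (L : List (ℤ × ℕ × Label))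
    (hL : ∀ z ∈ L, z.2 ∈ b) :
    (L.map fun z => (z.1 : ℂ) • f z.2).sum =
      ∑ i, ((listCoeff (key (b.get i)) (L.map fun z => (z.1, key z.2)) : ℤ) : ℂ) • f (b.get i) := by
  induction L with
  | nil => simp [listCoeff]
  | cons z L ih =>
    obtain ⟨i, hi⟩ := List.get_of_mem (hL z (List.mem_cons_self ..))
    rw [List.map_cons, List.sum_cons, ih fun z hz => hL z (List.mem_cons_of_mem _ hz)]
    have hinj : ∀ j, key (b.get j) = key z.2 → j = i := by
      intro j hj
      rw [← hi] at hj
      have := (List.nodup_iff_injective_get.1 hb)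
        (a₁ := j.cast (List.length_map ..).symm) (a₂ := i.cast (List.length_map ..).symm)
        (by simpa using hj)
      exact Fin.cast_injective _ this
    have hz : (z.1 : ℂ) • f z.2 = ∑ j, if key (b.get j) = key z.2 then (z.1 : ℂ) • f (b.get j) else 0 := by
      rw [Finset.sum_eq_single i]
      · rw [hi, if_pos rfl]
      · intro j _ hj
        rw [if_neg fun h => hj (hinj j h)]
      · exact fun h => absurd (Finset.mem_univ i) h
    rw [hz, ← Finset.sum_add_distrib]
    refine Finset.sum_congr rfl fun j _ => ?_
    rw [List.map_cons, listCoeff_cons]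
    split
    · rw [Int.cast_add, add_smul]
    · rw [zero_add]

lemma ofFn_diffMat (m : MatterModel) (n : ℤ) :
    (List.ofFn fun j => List.ofFn fun i => (diffMat m n (n + 1))ᵀ j i) = diffRows m n := by
  rw [diffRows, ← List.ofFn_getElem_eq_map]
  refine congrArg _ (funext fun j => ?_)
  rw [← List.ofFn_getElem_eq_map]
  rfl

/-- The rank changes neither under the factor one half nor under transposition; `diffRows` lists the
rows of the transposed matrix. -/
lemma rank_diffC (m : MatterModel) (n : ℤ) : (diffC m n (n + 1)).rank = diffRank m n := by
  have h := rank_eq_elimRank (diffMat m n (n + 1))ᵀ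
  rw [ofFn_diffMat] at h
  have hdet : IsUnit ((1 / 2 : ℂ) • (1 : Matrix (Fin (basis m (n + 1)).length) _ ℂ)).det := by
    rw [Matrix.det_smul, Matrix.det_one, mul_one]
    exact (pow_ne_zero _ (by norm_num)).isUnit
  rw [diffRank, ← h, Matrix.transpose_map, Matrix.rank_transpose, diffC,
    ← Matrix.rank_mul_eq_right_of_isUnit_det _ ((diffMat m n (n + 1)).map Int.cast) hdet,
    Matrix.smul_mul, Matrix.one_mul]

lemma rowMul_ofFn {m n : ℕ} (v : Fin m → ℤ) (B : Matrix (Fin m) (Fin n) ℤ) :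
    rowMul n (List.ofFn v) (List.ofFn fun i => List.ofFn (B i)) = List.ofFn (v ᵥ* B) := by
  induction m with
  | zero =>
    simp only [rowMul, List.ofFn_zero, List.zip_nil_left, List.foldr_nil]
    rw [← List.ofFn_const]
    rfl
  | succ m ih =>
    have ih' := ih (fun i => v i.succ) (fun i => B i.succ)
    rw [rowMul] at ih' ⊢
    rw [List.ofFn_succ, List.ofFn_succ, List.zip_cons_cons, List.foldr_cons, ih']
    have hsum : v ᵥ* B = fun j => v 0 * B 0 j + ((fun i : Fin m => v i.succ) ᵥ* fun i : Fin m => B i.succ) j := by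
      funext j
      exact Fin.sum_univ_succ _
    rw [hsum]
    split
    · rename_i h
      simp only at h
      rw [h]
      simp
    · refine List.ext_getElem (by simp) fun k h1 h2 => ?_
      simp

/-- The composite of two differentials of a model vanishes. -/
def squareZero (m : MatterModel) (n : ℤ) : Bool :=
  (diffRows m n).all fun v =>
    (rowMul (basis m (n + 1 + 1)).length v (diffRows m (n + 1))).all (· == 0)

/-- `squareZero` works with transposed integer matrices, so there the factors stand in the opposite
order. -/
lemma diffC_mul_diffC {m : MatterModel} {n : ℤ} (h : squareZero m n = true) :
    diffC m (n + 1) (n + 1 + 1) * diffC m n (n + 1) = 0 := by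
  have h1 : (diffMat m n (n + 1))ᵀ * (diffMat m (n + 1) (n + 1 + 1))ᵀ = 0 := by
    ext j k
    rw [squareZero, ← ofFn_diffMat, ← ofFn_diffMat, List.all_eq_true] at h
    have h2 := h _ (List.mem_ofFn.2 ⟨j, rfl⟩)
    have h4 := rowMul_ofFn ((diffMat m n (n + 1))ᵀ j) (diffMat m (n + 1) (n + 1 + 1))ᵀ
    rw [h4, List.all_eq_true] at h2
    have h3 := h2 _ (List.mem_ofFn.2 ⟨k, rfl⟩)
    exact beq_iff_eq.1 h3
  rw [← Matrix.transpose_mul, Matrix.transpose_eq_zero] at h1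
  have h2 := (Matrix.map_mul (L := diffMat m (n + 1) (n + 1 + 1)) (M := diffMat m n (n + 1))
    (f := Int.castRingHom ℂ)).symm
  rw [h1, Matrix.map_zero _ (map_zero _)] at h2
  rw [diffC, diffC, Matrix.smul_mul, Matrix.mul_smul]
  exact (congrArg (fun A => (1 / 2 : ℂ) • (1 / 2 : ℂ) • A) h2).trans (by simp)

/-! ### Ranks and dimensions of the multiplicity spaces -/

lemma lowMasks_maskNumber : ∀ s ∈ lowMasks, 0 ≤ maskNumber s ∧ maskNumber s ≤ 6 := by
  decide +kernel

lemma basis_eq_nil {n : ℤ} (hn : n < 0 ∨ 6 < n) (m : MatterModel) : basis m n = [] := by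
  refine List.eq_nil_iff_forall_not_mem.2 fun x hx => ?_
  obtain ⟨⟨h1, h2⟩, -⟩ := mem_basis.1 hx
  have := lowMasks_maskNumber _ h1
  omega

/-- The facts about a model that are needed: the basis elements have different keys, the squared
differential vanishes, and the dimensions and ranks of the differentials are as given. -/
structure MatterModel.HasTable (m : MatterModel) (dims ranks : List ℕ) : Prop where
  keys : ∀ n ∈ List.range 7, ((basis m n).map key).Nodup
  square : ∀ n ∈ List.range 7, squareZero m n = true
  dim : (List.range 7).map (fun n : ℕ => (basis m n).length) = dims
  rank : (List.range 7).map (fun n : ℕ => diffRank m n) = ranks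

/-- This and the following computations produce all numbers in the tables. The first list contains
the multiplicities in the cochains of degrees `0, …, 6`; the second contains the ranks of the
outgoing differentials, which are the multiplicities in the coboundaries one degree higher. -/
lemma hasTable_scalar_two :
    (scalarModel 2).HasTable [1, 12, 42, 62, 42, 12, 1] [1, 10, 28, 28, 10, 1, 0] :=
  ⟨by decide +kernel, by decide +kernel, by decide +kernel, by decide +kernel⟩

lemma hasTable_vector_two :
    (vectorModel 2).HasTable [0, 4, 18, 28, 18, 4, 0] [0, 3, 11, 11, 3, 0, 0] :=
  ⟨by decide +kernel, by decide +kernel, by decide +kernel, by decide +kernel⟩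

lemma hasTable_scalar_one :
    (scalarModel 1).HasTable [1, 8, 25, 36, 25, 8, 1] [0, 6, 15, 15, 6, 0, 0] :=
  ⟨by decide +kernel, by decide +kernel, by decide +kernel, by decide +kernel⟩

lemma hasTable_vector_one :
    (vectorModel 1).HasTable [0, 4, 14, 20, 14, 4, 0] [0, 2, 8, 8, 2, 0, 0] :=
  ⟨by decide +kernel, by decide +kernel, by decide +kernel, by decide +kernel⟩

lemma hasTable_sym : symModel.HasTable [0, 0, 3, 6, 3, 0, 0] [0, 0, 2, 2, 0, 0, 0] :=
  ⟨by decide +kernel, by decide +kernel, by decide +kernel, by decide +kernel⟩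

lemma hasTable_skew : skewModel.HasTable [0, 0, 1, 2, 1, 0, 0] [0, 0, 0, 0, 0, 0, 0] :=
  ⟨by decide +kernel, by decide +kernel, by decide +kernel, by decide +kernel⟩

lemma Sector.hasTable {r : ℕ} (hr : r = 1 ∨ r = 2) (σ : Sector) :
    ∃ dims ranks, (σ.model r).HasTable dims ranks := by
  rcases hr with rfl | rfl <;> cases σ
  exacts [⟨_, _, hasTable_scalar_one⟩, ⟨_, _, hasTable_vector_one⟩, ⟨_, _, hasTable_sym⟩,
    ⟨_, _, hasTable_skew⟩, ⟨_, _, hasTable_scalar_two⟩, ⟨_, _, hasTable_vector_two⟩,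
    ⟨_, _, hasTable_sym⟩, ⟨_, _, hasTable_skew⟩]

namespace MatterModel.HasTable

variable {m : MatterModel} {dims ranks : List ℕ}

lemma nodup (h : m.HasTable dims ranks) (n : ℤ) : ((basis m n).map key).Nodup := by
  by_cases hn : n < 0 ∨ 6 < n
  · rw [basis_eq_nil hn]
    exact List.nodup_nil
  · lift n to ℕ using by omega
    exact h.keys n (List.mem_range.2 (by omega))

lemma mul_eq_zero (h : m.HasTable dims ranks) {n n' n'' : ℤ} (hn' : n + 1 = n')
    (hn'' : n' + 1 = n'') : diffC m n' n'' * diffC m n n' = 0 := by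
  subst hn' hn''
  refine diffC_mul_diffC ?_
  by_cases hn : n < 0 ∨ 6 < n
  · rw [squareZero, diffRows, basis_eq_nil hn]
    rfl
  · lift n to ℕ using by omega
    exact h.square n (List.mem_range.2 (by omega))

end MatterModel.HasTable

lemma diffRank_eq_zero {n : ℤ} (hn : n < 0 ∨ 6 < n) (m : MatterModel) : diffRank m n = 0 := by
  rw [← rank_diffC, ← Nat.le_zero]
  refine (Matrix.rank_le_width _).trans ?_
  rw [basis_eq_nil hn]
  rfl

lemma rank_diffC_of_eq {m : MatterModel} {n n' : ℤ} (h : n + 1 = n') :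
    (diffC m n n').rank = diffRank m n := by
  subst h
  exact rank_diffC m n

section

variable {τ : ℝ} {κ : ℂ} {p : Fin 26 → ℝ} {r : ℕ} {e : ℕ → Fin 26 → ℂ}

/-- The multiplicity spaces of the cochains, as representations. -/
abbrev Components (p : Fin 26 → ℝ) (a : Sector → ℕ) : Type := ∀ σ : Sector, Fin (a σ) → σ.Space p

/-- Matrices acting on all components. -/
def actAll {p : Fin 26 → ℝ} {a b : Sector → ℕ} (A : ∀ σ, Matrix (Fin (b σ)) (Fin (a σ)) ℂ) :
    Components p a →ₗ[ℂ] Components p b :=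
  LinearMap.pi fun σ => act (A σ) ∘ₗ LinearMap.proj σ

lemma actAll_apply {a b : Sector → ℕ} (A : ∀ σ, Matrix (Fin (b σ)) (Fin (a σ)) ℂ)
    (f : Components p a) (σ : Sector) : actAll A f σ = act (A σ) (f σ) := rfl

/-- The action of the stabiliser on components. -/
def rotAll {a : Sector → ℕ} (R : stab p) : Components p a →ₗ[ℂ] Components p a :=
  LinearMap.pi fun σ => LinearMap.pi fun i =>
    σ.rep p R ∘ₗ LinearMap.proj i ∘ₗ LinearMap.proj σ

lemma rotAll_apply {a : Sector → ℕ} (R : stab p) (f : Components p a) (σ : Sector)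
    (i : Fin (a σ)) : rotAll R f σ i = σ.rep p R (f σ i) := rfl

/-- Matrices act on the multiplicity index and rotations on the values. -/
lemma actAll_rotAll {a b : Sector → ℕ} (A : ∀ σ, Matrix (Fin (b σ)) (Fin (a σ)) ℂ) (R : stab p)
    (f : Components p a) : actAll A (rotAll R f) = rotAll R (actAll A f) := by
  funext σ i
  rw [actAll_apply, act_apply, rotAll_apply, actAll_apply, act_apply, map_sum]
  refine Finset.sum_congr rfl fun j _ => ?_
  rw [map_smul, rotAll_apply]

namespace IsFrame

variable (F : IsFrame τ κ p r e)
include F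

lemma injective_assemble (n : ℤ) : Function.Injective (assemble τ κ p r e n) :=
  F.assemble_injective fun σ =>
    let ⟨_, _, h⟩ := Sector.hasTable F.rank σ
    (h.nodup n).of_map _

/-- As `assemble` is injective with the cochains as image, all questions about kernel, image and
square of `d` become questions about these matrices. -/
lemma brst_assemble {n n' : ℤ} (hn : n + 1 = n') (f : Components p fun σ => σ.dim r n) :
    brst τ p (assemble τ κ p r e n f) =
      assemble τ κ p r e n' (actAll (fun σ => diffC (σ.model r) n n') f) := by
  subst hn
  rw [assemble_apply, assemble_apply, map_sum]
  refine Finset.sum_congr rfl fun σ _ => ?_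
  obtain ⟨_, _, h⟩ := Sector.hasTable F.rank σ
  have key : ∀ j, brst τ p (sectorState τ κ p r e σ ((basis (σ.model r) n).get j) (f σ j)) =
      ∑ i, diffC (σ.model r) n (n + 1) i j •
        sectorState τ κ p r e σ ((basis (σ.model r) (n + 1)).get i) (f σ j) := by
    intro j
    have hx := List.get_mem (basis (σ.model r) n) j
    have h1 := F.brst_sectorState σ hx (f σ j)
    rw [sectorSum, sum_eq_sum_listCoeff _ (h.nodup (n + 1))
      (fun y => sectorState τ κ p r e σ y (f σ j)) _
      fun z hz => modelDiff_mem_basis (Sector.graded F.rank σ) hx hz] at h1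
    rw [← one_smul ℂ (brst τ p _), show (1 : ℂ) = (1 / 2) * 2 by norm_num, mul_smul, h1,
      Finset.smul_sum]
    refine Finset.sum_congr rfl fun i _ => ?_
    rw [smul_smul]
    rfl
  rw [map_sum]
  simp only [key]
  rw [Finset.sum_comm]
  refine Finset.sum_congr rfl fun i _ => ?_
  rw [actAll_apply, act_apply, map_sum]
  exact Finset.sum_congr rfl fun j _ => (map_smul _ _ _).symm

lemma exists_assemble {n : ℤ} {v : Fock} (hv : v ∈ cochains p n) :
    ∃ f, assemble τ κ p r e n f = v := F.cochains_le_range n hv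

lemma actAll_diffC_diffC {n n' n'' : ℤ} (hn' : n + 1 = n') (hn'' : n' + 1 = n'')
    (f : Components p fun σ => σ.dim r n) :
    actAll (fun σ => diffC (σ.model r) n' n'') (actAll (fun σ => diffC (σ.model r) n n') f) = 0 := by
  funext σ
  obtain ⟨_, _, h⟩ := Sector.hasTable F.rank σ
  rw [actAll_apply, actAll_apply, ← act_mul, h.mul_eq_zero hn' hn'', act_zero]
  rfl

theorem isComplex (n : ℤ) {v : Fock} (hv : v ∈ cochains p n) :
    brst τ p v ∈ cochains p (n + 1) ∧ brst τ p (brst τ p v) = 0 := by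
  obtain ⟨f, rfl⟩ := F.exists_assemble hv
  rw [F.brst_assemble rfl, F.brst_assemble rfl, F.actAll_diffC_diffC rfl rfl, map_zero]
  exact ⟨assemble_mem _ _, rfl⟩

end IsFrame

end

/-! ### Isotypic decompositions -/

/-- The multiplicity of a sector. -/
def Multiplicity.count (m : Multiplicity) : Sector → ℕ
  | .scalar => m.scalar
  | .vector => m.vector
  | .sym => m.sym
  | .skew => m.skew

section

variable {τ : ℝ} {κ : ℂ} {p : Fin 26 → ℝ} {r : ℕ} {e : ℕ → Fin 26 → ℂ}

lemma finsupp_rep_apply {W : Type} [AddCommGroup W] [Module ℂ W]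
    (ρ : Representation ℂ (stab p) W) {k : ℕ} (R : stab p) (f : Fin k →₀ W) (i : Fin k) :
    ρ.finsupp (Fin k) R f i = ρ R (f i) := by
  induction f using Finsupp.induction_linear with
  | zero => simp
  | add f g hf hg => simp [hf, hg]
  | single j w =>
    rw [Representation.finsupp_single]
    by_cases h : j = i
    · subst h
      simp
    · simp [Finsupp.single_eq_of_ne' h]

/-- Vectors of an isotypic representation as families of components. -/
def isotypicEquiv (p : Fin 26 → ℝ) (m : Multiplicity) :
    ((Fin m.scalar →₀ ℂ) × (Fin m.vector →₀ perp p) ×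
      (Fin m.sym →₀ symPerp p) × (Fin m.skew →₀ skewPerp p)) ≃ₗ[ℂ] Components p m.count where
  toFun g
    | .scalar => g.1
    | .vector => g.2.1
    | .sym => g.2.2.1
    | .skew => g.2.2.2
  map_add' g g' := by
    funext σ
    cases σ <;> rfl
  map_smul' a g := by
    funext σ
    cases σ <;> rfl
  invFun f := ⟨Finsupp.equivFunOnFinite.symm (f .scalar), Finsupp.equivFunOnFinite.symm (f .vector),
    Finsupp.equivFunOnFinite.symm (f .sym), Finsupp.equivFunOnFinite.symm (f .skew)⟩
  left_inv g := by
    refine Prod.ext ?_ (Prod.ext ?_ (Prod.ext ?_ ?_)) <;> exact Finsupp.ext fun _ => rfl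
  right_inv f := by
    funext σ
    cases σ <;> rfl

lemma isotypicEquiv_isotypic (m : Multiplicity) (R : stab p) (g) :
    isotypicEquiv p m (isotypic p m R g) = rotAll R (isotypicEquiv p m g) := by
  funext σ i
  cases σ
  exacts [finsupp_rep_apply (Representation.trivial ℂ (stab p) ℂ) R g.1 i,
    finsupp_rep_apply (perpRep p) R g.2.1 i, finsupp_rep_apply (symPerpRep p) R g.2.2.1 i,
    finsupp_rep_apply (skewPerpRep p) R g.2.2.2 i]

lemma nonempty_equiv_isotypic {M : Type} [AddCommGroup M] [Module ℂ M]
    (ρ : Representation ℂ (stab p) M) (m : Multiplicity) (Ψ : Components p m.count →ₗ[ℂ] M)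
    (hinj : ∀ f, Ψ f = 0 → f = 0) (hsurj : ∀ v, ∃ f, Ψ f = v)
    (hΨ : ∀ R f, ρ R (Ψ f) = Ψ (rotAll R f)) : Nonempty (ρ.Equiv (isotypic p m)) := by
  let E := (isotypicEquiv p m).trans
    (LinearEquiv.ofBijective Ψ ⟨(injective_iff_map_eq_zero _).2 hinj, hsurj⟩)
  refine ⟨(Representation.Equiv.mk E fun R => LinearMap.ext fun g => ?_).symm⟩
  change Ψ (isotypicEquiv p m (isotypic p m R g)) = ρ R (Ψ (isotypicEquiv p m g))
  rw [hΨ, isotypicEquiv_isotypic]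

lemma actAll_actAll {a b c : Sector → ℕ} (A : ∀ σ, Matrix (Fin (c σ)) (Fin (b σ)) ℂ)
    (B : ∀ σ, Matrix (Fin (b σ)) (Fin (a σ)) ℂ) (f : Components p a) :
    actAll A (actAll B f) = actAll (fun σ => A σ * B σ) f :=
  funext fun σ => (act_mul (A σ) (B σ) (f σ)).symm

lemma actAll_eq_zero {a b : Sector → ℕ} {A : ∀ σ, Matrix (Fin (b σ)) (Fin (a σ)) ℂ}
    (h : ∀ σ, A σ = 0) (f : Components p a) : actAll A f = 0 :=
  funext fun σ => by rw [actAll_apply, h, act_zero]; rfl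

lemma actAll_eq_self {a : Sector → ℕ} {A : ∀ σ, Matrix (Fin (a σ)) (Fin (a σ)) ℂ}
    (h : ∀ σ, A σ = 1) (f : Components p a) : actAll A f = f :=
  funext fun σ => by rw [actAll_apply, h, act_one]

lemma actAll_add {a b : Sector → ℕ} (A B : ∀ σ, Matrix (Fin (b σ)) (Fin (a σ)) ℂ)
    (f : Components p a) : actAll (fun σ => A σ + B σ) f = actAll A f + actAll B f :=
  funext fun σ => by
    rw [actAll_apply, act_add]
    rfl

namespace IsFrame

variable (F : IsFrame τ κ p r e)
include F

lemma nonempty_cochainRep_equiv (n : ℤ) (m : Multiplicity)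
    (hm : ∀ σ : Sector, σ.dim r n = m.count σ) :
    Nonempty ((cochainRep p n).Equiv (isotypic p m)) := by
  have hs : ∀ σ : Sector, ∃ (Y : Matrix (Fin (m.count σ)) (Fin (σ.dim r n)) ℂ)
      (Y' : Matrix (Fin (σ.dim r n)) (Fin (m.count σ)) ℂ), Y * Y' = 1 ∧ Y' * Y = 1 := by
    intro σ
    rw [hm]
    exact ⟨1, 1, by simp, by simp⟩
  choose Y Y' h1 h2 using hs
  refine nonempty_equiv_isotypic _ m
    (LinearMap.codRestrict (cochains p n) (assemble τ κ p r e n ∘ₗ actAll Y') fun f =>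
      assemble_mem n _) ?_ ?_ ?_
  · intro f hf
    have h := F.injective_assemble n ((congrArg Subtype.val hf).trans (map_zero _).symm)
    rw [← actAll_eq_self h1 f, ← actAll_actAll, h, map_zero]
  · rintro ⟨v, hv⟩
    obtain ⟨f, rfl⟩ := F.exists_assemble hv
    refine ⟨actAll Y f, Subtype.ext ?_⟩
    change assemble τ κ p r e n (actAll Y' (actAll Y f)) = _
    rw [actAll_actAll, actAll_eq_self h2]
  · intro R f
    refine Subtype.ext ?_
    change stabRep p R (assemble τ κ p r e n (actAll Y' f)) =
      assemble τ κ p r e n (actAll Y' (rotAll R f))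
    rw [actAll_rotAll, F.stabRep_assemble]
    rfl

lemma brst_assemble_eq_zero {n n' : ℤ} (hn : n + 1 = n') (f : Components p fun σ => σ.dim r n) :
    brst τ p (assemble τ κ p r e n f) = 0 ↔
      actAll (fun σ => diffC (σ.model r) n n') f = 0 := by
  rw [F.brst_assemble hn]
  exact ⟨fun h => F.injective_assemble n' (h.trans (map_zero _).symm), fun h => by rw [h, map_zero]⟩

lemma nonempty_cocycleRep_equiv (n : ℤ) (m : Multiplicity)
    (hm : ∀ σ : Sector, diffRank (σ.model r) n + m.count σ = σ.dim r n) :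
    Nonempty ((cocycleRep τ p n).Equiv (isotypic p m)) := by
  have hs : ∀ σ : Sector, ∃ (Y : Matrix (Fin (m.count σ)) (Fin (σ.dim r n)) ℂ)
      (Y' : Matrix (Fin (σ.dim r n)) (Fin (m.count σ)) ℂ)
      (L : Matrix (Fin (σ.dim r n)) (Fin (σ.dim r (n + 1))) ℂ), Y * Y' = 1 ∧
        diffC (σ.model r) n (n + 1) * Y' = 0 ∧
        Y' * Y + L * diffC (σ.model r) n (n + 1) = 1 := by
    intro σ
    -- With an incoming matrix of width zero the splitting has no boundary part, and the columns of
    -- `Y'` form a basis of the kernel of the differential.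
    obtain ⟨X, X', Y, Y', S, L, -, -, -, h4, -, h6, -, h8⟩ := exists_splitting
      (0 : Matrix (Fin (σ.dim r n)) (Fin 0) ℂ) (diffC (σ.model r) n (n + 1)) (Matrix.mul_zero _) 0
      (m.count σ) Matrix.rank_zero (by rw [rank_diffC, add_zero, hm, Fintype.card_fin])
    refine ⟨Y, Y', L, h4, h6, ?_⟩
    have : X' * X = 0 := by
      ext i j
      simp [Matrix.mul_apply]
    rwa [this, zero_add] at h8
  choose Y Y' L h1 h2 h3 using hs
  refine nonempty_equiv_isotypic _ m
    (LinearMap.codRestrict (cocycles τ p n) (assemble τ κ p r e n ∘ₗ actAll Y') fun f =>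
      ⟨assemble_mem n _, (F.brst_assemble_eq_zero rfl _).2 ?_⟩) ?_ ?_ ?_
  · rw [actAll_actAll, actAll_eq_zero h2]
  · intro f hf
    have h := F.injective_assemble n ((congrArg Subtype.val hf).trans (map_zero _).symm)
    rw [← actAll_eq_self h1 f, ← actAll_actAll, h, map_zero]
  · rintro ⟨v, hv, hd⟩
    obtain ⟨f, rfl⟩ := F.exists_assemble hv
    refine ⟨actAll Y f, Subtype.ext ?_⟩
    change assemble τ κ p r e n (actAll Y' (actAll Y f)) = _
    have h4 := actAll_eq_self h3 f
    rw [actAll_add, ← actAll_actAll, ← actAll_actAll, (F.brst_assemble_eq_zero rfl f).1 hd, map_zero,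
      add_zero] at h4
    rw [h4]
  · intro R f
    refine Subtype.ext ?_
    change stabRep p R (assemble τ κ p r e n (actAll Y' f)) =
      assemble τ κ p r e n (actAll Y' (rotAll R f))
    rw [actAll_rotAll, F.stabRep_assemble]
    rfl

lemma mem_coboundaries {n : ℤ} {v : Fock} : v ∈ coboundaries τ p n ↔
    ∃ g, v = assemble τ κ p r e n (actAll (fun σ => diffC (σ.model r) (n - 1) n) g) := by
  have hn : n - 1 + 1 = n := sub_add_cancel n 1
  constructor
  · rintro ⟨w, hw, rfl⟩
    obtain ⟨g, rfl⟩ := F.exists_assemble hw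
    exact ⟨g, F.brst_assemble hn g⟩
  · rintro ⟨g, rfl⟩
    exact ⟨_, assemble_mem (n - 1) g, F.brst_assemble hn g⟩

lemma exists_splitting_diffC (n : ℤ) (b h : Multiplicity)
    (hb : ∀ σ : Sector, diffRank (σ.model r) (n - 1) = b.count σ)
    (hh : ∀ σ : Sector, diffRank (σ.model r) n + b.count σ + h.count σ = σ.dim r n) (σ : Sector) :
    ∃ (X : Matrix (Fin (b.count σ)) (Fin (σ.dim r n)) ℂ)
      (X' : Matrix (Fin (σ.dim r n)) (Fin (b.count σ)) ℂ)
      (Y : Matrix (Fin (h.count σ)) (Fin (σ.dim r n)) ℂ)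
      (Y' : Matrix (Fin (σ.dim r n)) (Fin (h.count σ)) ℂ)
      (S : Matrix (Fin (σ.dim r (n - 1))) (Fin (b.count σ)) ℂ)
      (L : Matrix (Fin (σ.dim r n)) (Fin (σ.dim r (n + 1))) ℂ),
      X * X' = 1 ∧ X * Y' = 0 ∧ Y * X' = 0 ∧ Y * Y' = 1 ∧
      diffC (σ.model r) (n - 1) n * S = X' ∧ diffC (σ.model r) n (n + 1) * Y' = 0 ∧
      Y * diffC (σ.model r) (n - 1) n = 0 ∧
      X' * X + Y' * Y + L * diffC (σ.model r) n (n + 1) = 1 := by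
  obtain ⟨_, _, ht⟩ := Sector.hasTable F.rank σ
  have hn : n - 1 + 1 = n := sub_add_cancel n 1
  exact exists_splitting _ _ (ht.mul_eq_zero hn rfl) _ _ ((rank_diffC_of_eq hn).trans (hb σ))
    (by rw [rank_diffC, hh, Fintype.card_fin])

lemma nonempty_coboundaryRep_equiv (n : ℤ) (b h : Multiplicity)
    (hb : ∀ σ : Sector, diffRank (σ.model r) (n - 1) = b.count σ)
    (hh : ∀ σ : Sector, diffRank (σ.model r) n + b.count σ + h.count σ = σ.dim r n) :
    Nonempty ((coboundaryRep τ p n).Equiv (isotypic p b)) := by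
  choose X X' Y Y' S L h1 _ _ _ h5 _ h7 h8 using F.exists_splitting_diffC n b h hb hh
  refine nonempty_equiv_isotypic _ b
    (LinearMap.codRestrict (coboundaries τ p n) (assemble τ κ p r e n ∘ₗ actAll X') fun f =>
      F.mem_coboundaries.2 ⟨actAll S f, ?_⟩) ?_ ?_ ?_
  · rw [actAll_actAll]
    simp only [h5]
    rfl
  · intro f hf
    have h := F.injective_assemble n ((congrArg Subtype.val hf).trans (map_zero _).symm)
    rw [← actAll_eq_self h1 f, ← actAll_actAll, h, map_zero]
  · rintro ⟨v, hv⟩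
    obtain ⟨g, rfl⟩ := F.mem_coboundaries.1 hv
    refine ⟨actAll X (actAll (fun σ => diffC (σ.model r) (n - 1) n) g), Subtype.ext ?_⟩
    change assemble τ κ p r e n (actAll X' (actAll X _)) = _
    -- On a coboundary both `Y` and the outgoing differential vanish, so the splitting identity says
    -- that `X' X` fixes it.
    have h9 := actAll_eq_self h8 (actAll (fun σ => diffC (σ.model r) (n - 1) n) g)
    rw [actAll_add, actAll_add, ← actAll_actAll, ← actAll_actAll Y', ← actAll_actAll L,
      actAll_actAll Y, actAll_eq_zero h7, map_zero,
      F.actAll_diffC_diffC (sub_add_cancel n 1) rfl, map_zero, add_zero, add_zero] at h9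
    rw [h9]
  · intro R f
    refine Subtype.ext ?_
    change stabRep p R (assemble τ κ p r e n (actAll X' f)) =
      assemble τ κ p r e n (actAll X' (rotAll R f))
    rw [actAll_rotAll, F.stabRep_assemble]
    rfl

/-- The columns of `Y'` represent the cohomology classes. They are independent modulo coboundaries
because `Y` kills coboundaries and `Y Y' = 1`. They exhaust the classes because a cocycle `f`
differs from `Y' Y f` by `X' X f`, which is the differential of `S X f`. -/
lemma nonempty_cohomologyRep_equiv (n : ℤ) (b h : Multiplicity)
    (hb : ∀ σ : Sector, diffRank (σ.model r) (n - 1) = b.count σ)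
    (hh : ∀ σ : Sector, diffRank (σ.model r) n + b.count σ + h.count σ = σ.dim r n) :
    Nonempty ((cohomologyRep τ p n).Equiv (isotypic p h)) := by
  choose X X' Y Y' S L h1 h2 h3 h4 h5 h6 h7 h8 using F.exists_splitting_diffC n b h hb hh
  let Ψ := LinearMap.codRestrict (cocycles τ p n) (assemble τ κ p r e n ∘ₗ actAll Y') fun f =>
      ⟨assemble_mem n _, (F.brst_assemble_eq_zero rfl _).2
        (by rw [actAll_actAll, actAll_eq_zero h6])⟩
  refine nonempty_equiv_isotypic _ h
    (((coboundaries τ p n).submoduleOf (cocycles τ p n)).mkQ ∘ₗ Ψ) ?_ ?_ ?_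
  · intro f hf
    have hf' := (Submodule.Quotient.mk_eq_zero _).1 hf
    obtain ⟨g, hg⟩ := F.mem_coboundaries.1 (Submodule.mem_comap.1 hf')
    have h9 := F.injective_assemble n hg
    rw [← actAll_eq_self h4 f, ← actAll_actAll, h9, actAll_actAll, actAll_eq_zero h7]
  · intro q
    obtain ⟨⟨v, hv, hd⟩, rfl⟩ := Submodule.Quotient.mk_surjective _ q
    obtain ⟨f, rfl⟩ := F.exists_assemble hv
    refine ⟨actAll Y f, ((Submodule.Quotient.eq _).2 (Submodule.mem_comap.2
      (F.mem_coboundaries.2 ⟨actAll S (actAll X f), ?_⟩))).symm⟩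
    change assemble τ κ p r e n f - assemble τ κ p r e n (actAll Y' (actAll Y f)) = _
    have h9 := actAll_eq_self h8 f
    rw [actAll_add, ← actAll_actAll L, (F.brst_assemble_eq_zero rfl f).1 hd, map_zero,
      add_zero, actAll_add, ← actAll_actAll, ← actAll_actAll] at h9
    rw [actAll_actAll _ S, ← map_sub, sub_eq_of_eq_add h9.symm]
    simp only [h5]
  · intro R f
    refine congrArg (Submodule.Quotient.mk (p := _)) (Subtype.ext ?_ :
      cocycleRep τ p n R (Ψ f) = Ψ (rotAll R f))
    change stabRep p R (assemble τ κ p r e n (actAll Y' f)) =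
      assemble τ κ p r e n (actAll Y' (rotAll R f))
    rw [actAll_rotAll, F.stabRep_assemble]
    rfl

end IsFrame

end

/-! ### Existence of frames -/

section

variable {τ : ℝ} {p : Fin 26 → ℝ}

lemma rotMat_mulVec_single_zero (R : SO25) :
    rotMat R *ᵥ Pi.single 0 1 = (Pi.single 0 1 : Fin 26 → ℂ) := by
  rw [Matrix.mulVec_single_one]
  funext ν
  refine Fin.cases ?_ (fun i => ?_) ν
  · simp [rotMat_apply, rotCoeff, spacetime_zero_zero]
  · simp [rotMat_apply, rotCoeff, spacetime_succ_zero, Fin.succ_ne_zero]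

lemma rotMat_mulVec_transverse (R : stab p) :
    rotMat R.1 *ᵥ hat (transverse p) = hat (transverse p) := by
  have h1 : rotMatrix R.1 * (rotMatrix R.1)ᵀ = 1 :=
    mul_eq_one_comm.1 (rotMatrix_transpose_mul R.1)
  rw [rotMat_mulVec_hat]
  conv_lhs => rw [← rotMatrix_transpose_transverse R, Matrix.mulVec_mulVec, h1, Matrix.one_mulVec]

lemma momentum_eq_smul_hat {κ : ℂ} (hp : p 0 = 0) :
    momentum τ κ p = (τ * κ : ℂ)⁻¹ • hat (transverse p) := by
  funext μ
  refine Fin.cases ?_ (fun i => ?_) μ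
  · rw [momentum, Pi.smul_apply, hat_zero, smul_zero, hp, Complex.ofReal_zero, zero_div]
  · rw [momentum, Pi.smul_apply, hat_succ, smul_eq_mul, CarrollString.transverse, div_eq_inv_mul]

/-- At zero momentum the time axis is the only one and its complement is all of `V`. There is no
length to normalise, so `κ` is taken to be one. -/
lemma isFrame_zero (hτ : τ ≠ 0) : IsFrame τ 1 0 1 fun _ => Pi.single 0 1 where
  tension := hτ
  scale := one_ne_zero
  energy := rfl
  rank := Or.inl rfl
  orth a ha b hb := by
    obtain rfl : a = b := by omega
    simp
  zero := rfl
  mem_perp v := by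
    have h : v ⬝ᵥ transverse 0 = 0 := by
      simp [transverse, dotProduct]
    refine ⟨fun _ a _ => ?_, fun _ => h⟩
    rw [single_dotProduct, one_mul, hat_zero]
  transverse := ⟨1, one_ne_zero, by
    rw [if_neg (by norm_num), show transverse 0 = 0 by funext i; simp [CarrollString.transverse],
      map_zero]⟩
  momentum := by
    rw [if_neg (by norm_num), momentum_eq_smul_hat rfl,
      show transverse 0 = 0 by funext i; simp [CarrollString.transverse], map_zero, smul_zero]
  fixed R a _ ν := congrFun (rotMat_mulVec_single_zero R.1) ν

/-- The choice `κ = |𝐩| / τ` makes the rescaled momentum the unit vector along `𝐩`, so that the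
length of `𝐩` drops out of the complex. This vector is the second axis; it is fixed by the
stabiliser because `𝐩` is. -/
lemma exists_isFrame (hτ : τ ≠ 0) (hp : p 0 = 0) (hp' : p ≠ 0) :
    ∃ κ e, IsFrame τ κ p 2 e := by
  have hpos : 0 < ∑ i : Fin 25, p i.succ ^ 2 := by
    obtain ⟨μ, hμ⟩ := Function.ne_iff.1 hp'
    obtain ⟨i, rfl⟩ := Fin.exists_succ_eq.2 (show μ ≠ 0 by rintro rfl; exact hμ hp)
    refine lt_of_lt_of_le ?_ (Finset.single_le_sum (fun j _ => sq_nonneg (p j.succ))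
      (Finset.mem_univ i))
    have : p i.succ ≠ 0 := hμ
    positivity
  set l : ℝ := √(∑ i : Fin 25, p i.succ ^ 2) with hl
  have hl0 : l ≠ 0 := (Real.sqrt_pos.2 hpos).ne'
  have hl0' : (l : ℂ) ≠ 0 := Complex.ofReal_ne_zero.2 hl0
  have hτ' : (τ : ℂ) ≠ 0 := Complex.ofReal_ne_zero.2 hτ
  have hsq : transverse p ⬝ᵥ transverse p = (l : ℂ) ^ 2 := by
    rw [← Complex.ofReal_pow, hl, Real.sq_sqrt hpos.le]
    simp [transverse, dotProduct, sq]
  let e : ℕ → Fin 26 → ℂ := fun a =>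
    if a = 0 then Pi.single 0 1 else (l : ℂ)⁻¹ • hat (transverse p)
  have h0 : e 0 = Pi.single 0 1 := rfl
  have h1 : e 1 = (l : ℂ)⁻¹ • hat (transverse p) := rfl
  have hcases : ∀ a < 2, a = 0 ∨ a = 1 := by omega
  have hdot : ∀ v, e 0 ⬝ᵥ hat v = 0 := fun v => by
    rw [h0, single_dotProduct, one_mul, hat_zero]
  have h01 : e 0 ⬝ᵥ e 1 = 0 := by rw [h1, dotProduct_smul, hdot, smul_zero]
  refine ⟨l / τ, e, hτ, div_ne_zero hl0' hτ', hp, Or.inr rfl, ?_, rfl, ?_, ?_, ?_, ?_⟩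
  · intro a ha b hb
    obtain rfl | rfl := hcases a ha <;> obtain rfl | rfl := hcases b hb
    · simp [h0]
    · exact h01
    · rw [dotProduct_comm]
      exact h01
    · rw [h1, smul_dotProduct, dotProduct_smul, hat_dotProduct_hat, hsq]
      simp only [if_true, smul_eq_mul]
      field_simp
  · intro v
    have h2 : e 1 ⬝ᵥ hat v = (l : ℂ)⁻¹ * (v ⬝ᵥ transverse p) := by
      rw [h1, smul_dotProduct, hat_dotProduct_hat, dotProduct_comm, smul_eq_mul]
    constructor
    · intro hv a ha
      obtain rfl | rfl := hcases a ha
      · exact hdot v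
      · rw [h2]
        exact mul_eq_zero_of_right _ hv
    · intro h
      have h3 := h 1 one_lt_two
      rw [h2] at h3
      exact (mul_eq_zero.1 h3).resolve_left (inv_ne_zero hl0')
  · refine ⟨l, hl0', ?_⟩
    rw [if_pos rfl, h1, smul_inv_smul₀ hl0']
  · rw [if_pos rfl, momentum_eq_smul_hat hp, h1, mul_div_cancel₀ _ hτ']
  · intro R a ha
    refine congrFun (?_ : rotMat R.1 *ᵥ e a = e a)
    obtain rfl | rfl := hcases a ha
    · exact rotMat_mulVec_single_zero R.1
    · rw [h1, Matrix.mulVec_smul, rotMat_mulVec_transverse]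

end

/-! ### The tables -/

lemma MatterModel.HasTable.length_eq {m : MatterModel} {dims ranks : List ℕ}
    (h : m.HasTable dims ranks) {n : ℕ} (hn : n < 7) : (basis m n).length = dims.getD n 0 := by
  rw [← h.dim, List.getD_eq_getElem _ _ (by simpa using hn)]
  simp

lemma MatterModel.HasTable.diffRank_eq {m : MatterModel} {dims ranks : List ℕ}
    (h : m.HasTable dims ranks) {n : ℕ} (hn : n < 7) : diffRank m n = ranks.getD n 0 := by
  rw [← h.rank, List.getD_eq_getElem _ _ (by simpa using hn)]
  simp

lemma int_induction_of_window {P : ℤ → Prop} (h : ∀ n : ℕ, n < 7 → P n)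
    (h' : ∀ n : ℤ, n < 0 ∨ 6 < n → P n) (n : ℤ) : P n := by
  by_cases hn : n < 0 ∨ 6 < n
  · exact h' n hn
  · lift n to ℕ using by omega
    exact h n (by omega)

lemma tableGeneric_eq_zero {n : ℤ} (hn : n < 0 ∨ 6 < n) :
    tableGeneric n = ⟨⟨0, 0, 0, 0⟩, ⟨0, 0, 0, 0⟩, ⟨0, 0, 0, 0⟩, ⟨0, 0, 0, 0⟩⟩ := by
  unfold tableGeneric
  split <;> first | omega | rfl

lemma tableZero_eq_zero {n : ℤ} (hn : n < 0 ∨ 6 < n) :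
    tableZero n = ⟨⟨0, 0, 0, 0⟩, ⟨0, 0, 0, 0⟩, ⟨0, 0, 0, 0⟩, ⟨0, 0, 0, 0⟩⟩ := by
  unfold tableZero
  split <;> first | omega | rfl

/-- A table that records the dimensions and ranks of the models of rank `r`. -/
structure IsTable (r : ℕ) (t : ℤ → Row) : Prop where
  dim : ∀ n σ, Sector.dim r σ n = (t n).C.count σ
  rank : ∀ n σ, diffRank (Sector.model r σ) n = (t (n + 1)).B.count σ
  cocycles : ∀ n σ, (t (n + 1)).B.count σ + (t n).Z.count σ = (t n).C.count σ
  cohomology : ∀ n σ,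
    (t (n + 1)).B.count σ + (t n).B.count σ + (t n).H.count σ = (t n).C.count σ
  duality : ∀ n, (t n).H = (t (6 - n)).H
  euler : ∀ σ, ∑ n ∈ Finset.range 7, (-1 : ℤ) ^ n * ((t n).H.count σ : ℤ) = 0

lemma isTable_of_window {r : ℕ} {t : ℤ → Row}
    (h0 : ∀ n : ℤ, n < 0 ∨ 6 < n →
      t n = ⟨⟨0, 0, 0, 0⟩, ⟨0, 0, 0, 0⟩, ⟨0, 0, 0, 0⟩, ⟨0, 0, 0, 0⟩⟩)
    (hB : (t 0).B = ⟨0, 0, 0, 0⟩)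
    (hdim : ∀ n : ℕ, n < 7 → ∀ σ, Sector.dim r σ n = (t n).C.count σ)
    (hrank : ∀ n : ℕ, n < 7 → ∀ σ, diffRank (Sector.model r σ) n = (t (n + 1)).B.count σ)
    (hcoc : ∀ n : ℕ, n < 7 → ∀ σ,
      (t (n + 1)).B.count σ + (t n).Z.count σ = (t n).C.count σ)
    (hcoh : ∀ n : ℕ, n < 7 → ∀ σ,
      (t (n + 1)).B.count σ + (t n).B.count σ + (t n).H.count σ = (t n).C.count σ)
    (hdual : ∀ n : ℕ, n < 7 → (t n).H = (t (6 - n)).H)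
    (heuler : ∀ σ, ∑ n ∈ Finset.range 7, (-1 : ℤ) ^ n * ((t n).H.count σ : ℤ) = 0) :
    IsTable r t := by
  have hB' : ∀ n : ℤ, n < 0 ∨ 6 < n → (t (n + 1)).B = ⟨0, 0, 0, 0⟩ := by
    intro n hn
    -- For `n = -1` the row concerned is row zero, which lies in the window; its coboundaries vanish
    -- by `hB`.
    by_cases h : n + 1 = 0
    · rw [h, hB]
    · rw [h0 _ (by omega)]
  refine ⟨int_induction_of_window hdim ?_, int_induction_of_window hrank ?_,
    int_induction_of_window hcoc ?_, int_induction_of_window hcoh ?_,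
    int_induction_of_window hdual ?_, heuler⟩
  · intro n hn σ
    rw [Sector.dim, basis_eq_nil hn, h0 n hn]
    cases σ <;> rfl
  · intro n hn σ
    rw [diffRank_eq_zero hn, hB' n hn]
    cases σ <;> rfl
  · intro n hn σ
    rw [hB' n hn, h0 n hn]
    cases σ <;> rfl
  · intro n hn σ
    rw [hB' n hn, h0 n hn]
    cases σ <;> rfl
  · intro n hn
    rw [h0 n hn, h0 (6 - n) (by omega)]

lemma isTable_tableGeneric : IsTable 2 tableGeneric := by
  refine isTable_of_window (fun n => tableGeneric_eq_zero) rfl ?_ ?_ ?_ ?_ ?_ ?_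
  · intro n hn σ
    cases σ
    · refine (hasTable_scalar_two.length_eq hn).trans ?_
      interval_cases n <;> rfl
    · refine (hasTable_vector_two.length_eq hn).trans ?_
      interval_cases n <;> rfl
    · refine (hasTable_sym.length_eq hn).trans ?_
      interval_cases n <;> rfl
    · refine (hasTable_skew.length_eq hn).trans ?_
      interval_cases n <;> rfl
  · intro n hn σ
    cases σ
    · refine (hasTable_scalar_two.diffRank_eq hn).trans ?_
      interval_cases n <;> rfl
    · refine (hasTable_vector_two.diffRank_eq hn).trans ?_
      interval_cases n <;> rfl
    · refine (hasTable_sym.diffRank_eq hn).trans ?_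
      interval_cases n <;> rfl
    · refine (hasTable_skew.diffRank_eq hn).trans ?_
      interval_cases n <;> rfl
  · intro n hn σ
    interval_cases n <;> cases σ <;> rfl
  · intro n hn σ
    interval_cases n <;> cases σ <;> rfl
  · intro n hn
    interval_cases n <;> rfl
  · intro σ
    cases σ <;> decide

lemma isTable_tableZero : IsTable 1 tableZero := by
  refine isTable_of_window (fun n => tableZero_eq_zero) rfl ?_ ?_ ?_ ?_ ?_ ?_
  · intro n hn σ
    cases σ
    · refine (hasTable_scalar_one.length_eq hn).trans ?_
      interval_cases n <;> rfl
    · refine (hasTable_vector_one.length_eq hn).trans ?_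
      interval_cases n <;> rfl
    · refine (hasTable_sym.length_eq hn).trans ?_
      interval_cases n <;> rfl
    · refine (hasTable_skew.length_eq hn).trans ?_
      interval_cases n <;> rfl
  · intro n hn σ
    cases σ
    · refine (hasTable_scalar_one.diffRank_eq hn).trans ?_
      interval_cases n <;> rfl
    · refine (hasTable_vector_one.diffRank_eq hn).trans ?_
      interval_cases n <;> rfl
    · refine (hasTable_sym.diffRank_eq hn).trans ?_
      interval_cases n <;> rfl
    · refine (hasTable_skew.diffRank_eq hn).trans ?_
      interval_cases n <;> rfl
  · intro n hn σ
    interval_cases n <;> cases σ <;> rfl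
  · intro n hn σ
    interval_cases n <;> cases σ <;> rfl
  · intro n hn
    interval_cases n <;> rfl
  · intro σ
    cases σ <;> decide

/-- The alternating sum vanishes for the multiplicities of each sector, hence for any quantity `f`
that is linear in them. It is applied with `d` the dimensions of the sectors and the dimensions of
the spaces of intertwiners into them. -/
lemma IsTable.euler_sum {r : ℕ} {t : ℤ → Row} (ht : IsTable r t) (d : Sector → ℕ) (f : ℕ → ℕ)
    (hf : ∀ n : ℕ, f n = ∑ σ, (t n).H.count σ * d σ) :
    ∑ n ∈ Finset.range 7, (-1 : ℤ) ^ n * (f n : ℤ) = 0 := by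
  simp only [hf, Nat.cast_sum, Nat.cast_mul, Finset.mul_sum]
  rw [Finset.sum_comm]
  refine Finset.sum_eq_zero fun σ _ => ?_
  simp only [← mul_assoc]
  rw [← Finset.sum_mul, ht.euler, zero_mul]

section

variable {τ : ℝ} {κ : ℂ} {p : Fin 26 → ℝ} {r : ℕ} {e : ℕ → Fin 26 → ℂ}

lemma IsFrame.decomposesAs (F : IsFrame τ κ p r e) {t : ℤ → Row} (ht : IsTable r t) (n : ℤ) :
    DecomposesAs τ p n (t n) := by
  have hb : ∀ σ, diffRank (σ.model r) (n - 1) = (t n).B.count σ := fun σ => by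
    rw [ht.rank, sub_add_cancel]
  have hh : ∀ σ, diffRank (σ.model r) n + (t n).B.count σ + (t n).H.count σ = σ.dim r n :=
    fun σ => by rw [ht.rank, ht.dim, ht.cohomology]
  exact ⟨F.nonempty_cochainRep_equiv n _ (ht.dim n),
    F.nonempty_cocycleRep_equiv n _ fun σ => by rw [ht.rank, ht.dim, ht.cocycles],
    F.nonempty_coboundaryRep_equiv n _ _ hb hh, F.nonempty_cohomologyRep_equiv n _ _ hb hh⟩

/-! ### Dimensions and intertwiners of isotypic representations -/

instance (p : Fin 26 → ℝ) : (s : Sector) → FiniteDimensional ℂ (s.Space p)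
  | .scalar => inferInstanceAs (FiniteDimensional ℂ ℂ)
  | .vector => inferInstanceAs (FiniteDimensional ℂ (perp p))
  | .sym => inferInstanceAs (FiniteDimensional ℂ (symPerp p))
  | .skew => inferInstanceAs (FiniteDimensional ℂ (skewPerp p))

section

variable {V : Type} [AddCommGroup V] [Module ℂ V] {ρ : Representation ℂ (stab p) V}
  {m : Multiplicity}

lemma finiteDimensional_of_equiv_isotypic (E : ρ.Equiv (isotypic p m)) :
    FiniteDimensional ℂ V :=
  (E.toLinearEquiv.trans (isotypicEquiv p m)).symm.finiteDimensional

lemma finrank_of_equiv_isotypic (E : ρ.Equiv (isotypic p m)) :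
    Module.finrank ℂ V = ∑ s : Sector, m.count s * Module.finrank ℂ (s.Space p) := by
  rw [(E.toLinearEquiv.trans (isotypicEquiv p m)).finrank_eq, Module.finrank_pi_fintype]
  simp [Module.finrank_pi_fintype]

variable {W : Type} [AddCommGroup W] [Module ℂ W] (σ : Representation ℂ (stab p) W)

instance [FiniteDimensional ℂ W] (s : Sector) :
    FiniteDimensional ℂ (Representation.IntertwiningMap σ (s.rep p)) :=
  FiniteDimensional.of_injective
    ({ toFun f := f.toLinearMap, map_add' _ _ := rfl, map_smul' _ _ := rfl } :
      Representation.IntertwiningMap σ (s.rep p) →ₗ[ℂ] W →ₗ[ℂ] s.Space p)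
    (Representation.IntertwiningMap.toLinearMap_injective _ _)

variable {σ} in
/-- Intertwiners into a sum of sectors, component by component. -/
def intertwiningEquiv {a : Sector → ℕ} (E : V ≃ₗ[ℂ] Components p a)
    (hE : ∀ R v, E (ρ R v) = rotAll R (E v)) :
    Representation.IntertwiningMap σ ρ ≃ₗ[ℂ]
      ∀ s : Sector, Fin (a s) → Representation.IntertwiningMap σ (s.rep p) where
  toFun f s i :=
    { toLinearMap := LinearMap.proj i ∘ₗ LinearMap.proj s ∘ₗ E.toLinearMap ∘ₗ f.toLinearMap
      isIntertwining' R := LinearMap.ext fun w => by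
        change E (f (σ R w)) s i = s.rep p R (E (f w) s i)
        rw [f.isIntertwining, hE]
        rfl }
  map_add' f g := by
    funext s i
    refine Representation.IntertwiningMap.ext (LinearMap.ext fun w => ?_)
    exact congrFun (congrFun (E.map_add (f w) (g w)) s) i
  map_smul' a f := by
    funext s i
    refine Representation.IntertwiningMap.ext (LinearMap.ext fun w => ?_)
    exact congrFun (congrFun (E.map_smul a (f w)) s) i
  invFun g :=
    { toLinearMap := E.symm.toLinearMap ∘ₗ
        LinearMap.pi fun s => LinearMap.pi fun i => (g s i).toLinearMap
      isIntertwining' R := LinearMap.ext fun w => by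
        change E.symm (fun s i => g s i (σ R w)) = ρ R (E.symm fun s i => g s i w)
        rw [LinearEquiv.symm_apply_eq, hE, LinearEquiv.apply_symm_apply]
        funext s i
        exact (g s i).isIntertwining _ _ R w }
  left_inv f := by
    refine Representation.IntertwiningMap.ext (LinearMap.ext fun w => ?_)
    exact E.symm_apply_apply (f w)
  right_inv g := by
    funext s i
    refine Representation.IntertwiningMap.ext (LinearMap.ext fun w => ?_)
    exact congrFun (congrFun (E.apply_symm_apply fun s i => g s i w) s) i

/-- `Hom(W, ·)` commutes with finite direct sums, so its dimension is linear in the multiplicities.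
Irreducibility plays no role, neither of `W` nor of the sectors. -/
lemma finrank_intertwiningMap [FiniteDimensional ℂ W] (E : ρ.Equiv (isotypic p m)) :
    Module.finrank ℂ (Representation.IntertwiningMap σ ρ) =
      ∑ s : Sector, m.count s * Module.finrank ℂ (Representation.IntertwiningMap σ (s.rep p)) := by
  have hE : ∀ R v, E.toLinearEquiv.trans (isotypicEquiv p m) (ρ R v) =
      rotAll R (E.toLinearEquiv.trans (isotypicEquiv p m) v) := fun R v => by
    refine (congrArg (isotypicEquiv p m) ?_).trans (isotypicEquiv_isotypic m R _)
    exact E.toIntertwiningMap.isIntertwining _ _ R v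
  rw [(intertwiningEquiv _ hE).finrank_eq, Module.finrank_pi_fintype]
  simp [Module.finrank_pi_fintype]

end

lemma exists_isFrame_isTable (hτ : τ ≠ 0) (hp : p 0 = 0) :
    ∃ κ r e t, IsFrame τ κ p r e ∧ IsTable r t := by
  by_cases h : p = 0
  · subst h
    exact ⟨_, _, _, _, isFrame_zero hτ, isTable_tableZero⟩
  · obtain ⟨κ, e, F⟩ := exists_isFrame hτ hp h
    exact ⟨_, _, _, _, F, isTable_tableGeneric⟩

end

end

end CarrollString

open CarrollString

theorem mainTheorem1 (τ : ℝ) (hτ : τ ≠ 0) (p : Fin 26 → ℝ) (hp : p 0 = 0) :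
    -- the cochains form a complex
    (∀ (n : ℤ), ∀ ψ ∈ cochains p n,
      brst τ p ψ ∈ cochains p (n + 1) ∧ brst τ p (brst τ p ψ) = 0) ∧
    -- the two tables
    (p ≠ 0 → ∀ n : ℤ, DecomposesAs τ p n (tableGeneric n)) ∧
    (p = 0 → ∀ n : ℤ, DecomposesAs τ p n (tableZero n)) ∧
    -- finite dimension and Poincaré duality
    (∀ n : ℤ, FiniteDimensional ℂ (Cohomology τ p n)) ∧
    (∀ n : ℤ, Nonempty ((cohomologyRep τ p n).Equiv (cohomologyRep τ p (6 - n)))) ∧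
    -- the alternating sum of multiplicities `dim Hom(W, H^n)`, and that of dimensions, vanish
    (∀ (W : Type) [AddCommGroup W] [Module ℂ W] [FiniteDimensional ℂ W]
      (σ : Representation ℂ (stab p) W),
      ∑ n ∈ Finset.range 7, (-1 : ℤ) ^ n *
        (Module.finrank ℂ (Representation.IntertwiningMap σ (cohomologyRep τ p n)) : ℤ) = 0) ∧
    ∑ n ∈ Finset.range 7, (-1 : ℤ) ^ n * (Module.finrank ℂ (Cohomology τ p n) : ℤ) = 0 := by
  obtain ⟨κ, r, e, t, F, ht⟩ := exists_isFrame_isTable hτ hp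
  have hE : ∀ n, Nonempty ((cohomologyRep τ p n).Equiv (isotypic p (t n).H)) :=
    fun n => (F.decomposesAs ht n).2.2.2
  refine ⟨fun n ψ hψ => F.isComplex n hψ, fun h n => ?_, fun h n => ?_, fun n => ?_, fun n => ?_,
    fun W _ _ _ σ => ?_, ?_⟩
  -- The table `t` above is not identified, so each explicit table is obtained from the frame of its
  -- own case.
  · obtain ⟨_, _, F'⟩ := exists_isFrame hτ hp h
    exact F'.decomposesAs isTable_tableGeneric n
  · subst h
    exact (isFrame_zero hτ).decomposesAs isTable_tableZero n
  · exact finiteDimensional_of_equiv_isotypic (hE n).some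
  · have h := hE (6 - n)
    -- The two cohomologies have the same multiplicities; the isomorphism comes from this and not
    -- from a pairing.
    rw [← ht.duality n] at h
    exact ⟨(hE n).some.trans h.some.symm⟩
  · exact ht.euler_sum _ _ fun n => finrank_intertwiningMap σ (hE n).some
  · exact ht.euler_sum _ _ fun n => finrank_of_equiv_isotypic (hE n).some
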